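/- Let $n\ge 2$, let $\beta\in(\tfrac12,\tfrac32)$ with $\beta\le\frac{n+1}{4}$, and let $\alpha\in[\beta,2\beta]$ with $\alpha<2$. Put $$p=\frac{2n+2}{n+1+4\beta},\qquad q=\frac{2n+2}{n+1-4(\alpha-\beta)},$$ where $q=\infty$ if the denominator is $0$. Write $\hat f(\xi)=\int_{\mathbb R^n}e^{-i\xi\cdot x}f(x)\,dx$, extended to $L^p(\mathbb R^n)$ in the sense of tempered distributions (since $1\le p<2$, $\hat f$ is a locally integrable function). Say that $\hat f$ vanishes on the unit sphere in the $L^2$-trace sense if there are Schwartz functions $f_k\to f$ in $L^p(\mathbb R^n)$ with $\hat f_k|_{\mathbb S^{n-1}}\to 0$ in $L^2(\mathbb S^{n-1})$. Let $S^{-\alpha}$ be the Bochner–Riesz operator $$\widehat{S^{-\alpha}f}(\xi)=(1-|\xi|^2)_+^{-\alpha}\hat f(\xi),$$ where the right-hand side is understood as the tempered distribution $\varphi\mapsto\lim_{\rho\to1^-}\int_{|\xi|<\rho}(1-|\xi|^2)^{-\alpha}\hat f(\xi)\varphi(\xi)\,d\xi$. Then there is a constant $C=C(n,\alpha,\beta)$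 such that for every $f\in L^p(\mathbb R^n)$ whose Fourier transform vanishes on the unit sphere in the $L^2$-trace sense, $S^{-\alpha}f$ is well defined (the limit exists for every Schwartz function $\varphi$), belongs to $L^q(\mathbb R^n)$, and $$\|S^{-\alpha}f\|_{L^q(\mathbb R^n)}\le C\,\|f\|_{L^p(\mathbb R^n)}.$$ -/

import Mathlib

open MeasureTheory Filter Topology
open scoped SchwartzMap ENNReal

namespace HelmholtzBR

/-- The Fourier transform with the convention `φ̂(ξ) = ∫ e^{-i ξ·x} φ(x) dx`. -/
noncomputable def fourier {n : ℕ} (φ : EuclideanSpace ℝ (Fin n) → ℂ)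
    (ξ : EuclideanSpace ℝ (Fin n)) : ℂ :=
  ∫ x, Complex.exp (-(Complex.I * ((inner ℝ ξ x : ℝ) : ℂ))) * φ x

/-- The locally integrable function `F` is the Fourier transform of `f` in the sense of
tempered distributions: `⟨F, φ⟩ = ⟨f, φ̂⟩` for all Schwartz `φ`. It is determined by `f`
up to a null set. -/
def IsFourierTransform {n : ℕ} (f F : EuclideanSpace ℝ (Fin n) → ℂ) : Prop :=
  LocallyIntegrable F volume ∧
    ∀ φ : 𝓢(EuclideanSpace ℝ (Fin n), ℂ),
      Integrable (fun ξ => F ξ * φ ξ) volume ∧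
        ∫ ξ, F ξ * φ ξ = ∫ x, f x * fourier φ x

/-- `g` is the restriction of `f̂` to the unit sphere in the `L²`-trace sense, for `f ∈ L^p`:
there are Schwartz functions tending to `f` in `L^p` whose (continuous) Fourier transforms,
restricted to the sphere, tend to `g` in `L²` of the surface measure. -/
def HasFourierSphereTrace {n : ℕ} (p : ℝ≥0∞) (f : EuclideanSpace ℝ (Fin n) → ℂ)
    (g : Metric.sphere (0 : EuclideanSpace ℝ (Fin n)) 1 → ℂ) : Prop :=
  ∃ s : ℕ → 𝓢(EuclideanSpace ℝ (Fin n), ℂ),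
    Tendsto (fun k => eLpNorm (fun x => s k x - f x) p volume) atTop (𝓝 0) ∧
    Tendsto (fun k => eLpNorm
        (fun ω : Metric.sphere (0 : EuclideanSpace ℝ (Fin n)) 1 =>
          fourier (s k) (ω : EuclideanSpace ℝ (Fin n)) - g ω)
        2 (volume : Measure (EuclideanSpace ℝ (Fin n))).toSphere) atTop (𝓝 0)

/-- The symbol `(1 - |ξ|²)_+^a`. -/
noncomputable def brSymbol {n : ℕ} (a : ℝ) (ξ : EuclideanSpace ℝ (Fin n)) : ℝ :=
  if ‖ξ‖ < 1 then (1 - ‖ξ‖ ^ 2) ^ a else 0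

/-- `u = S^a f`, i.e. `û(ξ) = (1 - |ξ|²)_+^a f̂(ξ)` as tempered distributions. Since the product
on the right need not be integrable up to the unit sphere when `a` is very negative, its pairing
with a Schwartz function `φ` is the limit, as `ρ → 1⁻`, of the integrals over `|ξ| < ρ`; this is
the ordinary integral whenever that converges. Such a `u` is unique up to null sets. -/
def IsBochnerRiesz {n : ℕ} (a : ℝ) (f u : EuclideanSpace ℝ (Fin n) → ℂ) : Prop :=
  ∃ F : EuclideanSpace ℝ (Fin n) → ℂ, IsFourierTransform f F ∧
    ∀ φ : 𝓢(EuclideanSpace ℝ (Fin n), ℂ),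
      Tendsto
        (fun ρ : ℝ => ∫ ξ in Metric.ball (0 : EuclideanSpace ℝ (Fin n)) ρ,
          (brSymbol a ξ : ℂ) * F ξ * φ ξ)
        (𝓝[<] 1) (𝓝 (∫ x, u x * fourier φ x))

end HelmholtzBR

open scoped FourierTransform ComplexConjugate

namespace HelmholtzBR

/-! Write s = |ξ|² - 1 and p_b = (2n+2)/(n+1+4b), which is `pExp n b`. Then p = p_β, and q is the
exponent conjugate to p_{α-β}. By duality (`exists_eq_integral_of_bound`) it suffices to bound the
pairing of (1-|ξ|²)_+^{-α} f̂(ξ) with ĝ(-ξ) by ‖f‖ in L^{p_β} times ‖g‖ in L^{p_{α-β}}, for Schwartz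
g.

Everything rests on one resolvent estimate, `norm_Gamma_mul_resForm_le_lpNorm`: for Re z = 2b the
form ∫ (w+is)^{-z} f̂(ξ) ĝ(-ξ) dξ is bounded on L^{p_b} × L^{p_b}, uniformly as w approaches the
imaginary axis near 0. It is a Stein interpolation between Plancherel at Re z = 0 and an L¹ × L¹
bound at Re z = (n+1)/2. For the latter the power is written as a Laplace transform, the explicit
kernel of e^{-it|ξ|²} is inserted, and the remaining t-integral is an oscillatory integral bounded
uniformly in |x-y| (`norm_integral_oscInt_le`).

The next step is a weighted L² bound (`exists_weighted_L2_bound`). For 1/2 < b < 3/2 the weight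
(s²+ε²)^{-b} is dominated by -Re (ε+is)^{-2b} where |s| is large compared with ε, because the
argument there is near πb in modulus and cos πb < 0. The region |s| ≲ ε is paid for by ε^{1-2b}(2P_ε
- P_{2ε}) with P_τ = τ/(s²+τ²). Integrals of P_τ against |f̂|² are fractional integrals in τ, of
order 2b-1 < 2, of a function that the resolvent estimate bounds. Hence the second difference of P
at the nodes 0, ε, 2ε contributes O(ε^{2b-1}), and the node 0 is the trace of f̂ on the sphere. When
the traces of the approximants tend to 0, a limit argument (`exists_weightedLimit`) represents f̂ by
a function F with |s|^{-β}F in L², bounded by ‖f‖_p.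

If α ≤ 1 then α-β < 1/2. For weights of order below 1/2 the real part of the symbol is already
positive, so |s|^{-(α-β)}ĝ is in L² with no condition on g, and Cauchy–Schwarz finishes
(`exists_bochnerRiesz_bound_of_le_one`).

If 1 < α < 2, the kernel is compared with the combination of (δ+is)^{-α} and (δ-is)^{-α} that tends
to s_-^{-α} off the origin; its denominator sin πα does not vanish. The corresponding forms with F
are bounded by Stein interpolation between Re z = β, where the weighted L² bound applies, and Re z =
2β, where the resolvent bound does (`exists_norm_signForm_limit_le`). It remains to show that the
truncated pairing converges and obeys the same bound. For a Schwartz approximant let H be the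
density of its transform times the test function with respect to s. The truncated integral minus
H(0)δ^{1-α}/(α-1) converges, and its difference from the regularised form tends to 0. Uniformity
comes from the forms of order α: their bounds force |H(s)-H(0)| ≲ |s|^{α-1}, which bounds the finite
parts uniformly in δ (`exists_norm_finPart_le`) by ‖f‖_p plus the trace norm. The approximants
therefore converge uniformly in δ, the subtracted term dies with the traces, and the limits may be
interchanged (`exists_tendsto_of_uniform`). -/

/-- Euclidean space. -/
abbrev Rn (n : ℕ) := EuclideanSpace ℝ (Fin n)

variable {n : ℕ}

/-! ### Fourier transform in the e^{-iξ·x} normalisation; Plancherel on L¹ ∩ L² -/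

lemma fourier_eq_vectorFourier (f : Rn n → ℂ) (ξ : Rn n) :
    fourier f ξ = VectorFourier.fourierIntegral Real.probChar volume (innerₗ (Rn n)) f ξ := by
  rw [VectorFourier.fourierIntegral_probChar, fourier]
  refine integral_congr_ae (ae_of_all _ fun x => ?_)
  simp only [innerₗ_apply_apply, smul_eq_mul, real_inner_comm x ξ]
  ring_nf

/-- `𝓕` is built on the character e^{-2πi⟨ξ,x⟩}, so a dilation separates the two. Schwartz
invariance, Plancherel and inversion are imported through it and pick up their powers of 2π here. -/
lemma fourier_eq_scaled (f : Rn n → ℂ) (ξ : Rn n) :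
    fourier f ξ = 𝓕 f ((2 * Real.pi)⁻¹ • ξ) := by
  rw [Real.fourier_eq', fourier]
  refine integral_congr_ae (ae_of_all _ fun x => ?_)
  simp only [smul_eq_mul, real_inner_comm x ξ, inner_smul_right]
  congr 2
  have : (Real.pi : ℂ) ≠ 0 := by exact_mod_cast Real.pi_ne_zero
  push_cast
  field_simp

lemma continuous_probChar_inner :
    Continuous fun p : Rn n × Rn n => (innerₗ (Rn n)) p.1 p.2 := by
  simpa using continuous_inner

lemma continuous_fourier {f : Rn n → ℂ} (hf : Integrable f) : Continuous (fourier f) := by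
  have : fourier f = VectorFourier.fourierIntegral Real.probChar volume (innerₗ (Rn n)) f :=
    funext (fourier_eq_vectorFourier f)
  rw [this]
  exact VectorFourier.fourierIntegral_continuous Real.continuous_probChar
    continuous_probChar_inner hf

lemma norm_fourier_le (f : Rn n → ℂ) (ξ : Rn n) : ‖fourier f ξ‖ ≤ ∫ x, ‖f x‖ := by
  rw [fourier_eq_vectorFourier]
  exact VectorFourier.norm_fourierIntegral_le_integral_norm _ _ _ _ _

lemma integrable_fourier_kernel {f : Rn n → ℂ} (hf : Integrable f) (ξ : Rn n) :
    Integrable fun x => Complex.exp (-(Complex.I * ((inner ℝ ξ x : ℝ) : ℂ))) * f x := by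
  refine hf.bdd_mul (c := 1) ?_ (ae_of_all _ fun x => ?_)
  · exact Continuous.aestronglyMeasurable (by fun_prop)
  · rw [Complex.norm_exp]; simp

lemma fourier_add {f g : Rn n → ℂ} (hf : Integrable f) (hg : Integrable g) :
    fourier (fun x => f x + g x) = fun ξ => fourier f ξ + fourier g ξ := by
  funext ξ
  simp only [fourier, mul_add]
  exact integral_add (integrable_fourier_kernel hf ξ) (integrable_fourier_kernel hg ξ)

lemma fourier_const_mul (c : ℂ) (f : Rn n → ℂ) :
    fourier (fun x => c * f x) = fun ξ => c * fourier f ξ := by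
  funext ξ
  simp only [fourier]
  rw [← integral_const_mul]
  exact integral_congr_ae (ae_of_all _ fun x => by ring)

lemma fourier_sub {f g : Rn n → ℂ} (hf : Integrable f) (hg : Integrable g) :
    fourier (fun x => f x - g x) = fun ξ => fourier f ξ - fourier g ξ := by
  funext ξ
  simp only [fourier, mul_sub]
  exact integral_sub (integrable_fourier_kernel hf ξ) (integrable_fourier_kernel hg ξ)

lemma fourier_conj (f : Rn n → ℂ) (ξ : Rn n) :
    fourier (fun x => conj (f x)) ξ = conj (fourier f (-ξ)) := by
  simp only [fourier]
  rw [← integral_conj]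
  refine integral_congr_ae (ae_of_all _ fun x => ?_)
  simp [← Complex.exp_conj]

lemma integral_fourier_mul_eq {f g : Rn n → ℂ} (hf : Integrable f) (hg : Integrable g) :
    ∫ ξ, fourier f ξ * g ξ = ∫ x, f x * fourier g x := by
  have := VectorFourier.integral_fourierIntegral_smul_eq_flip (L := innerₗ (Rn n))
    (μ := volume) (ν := volume) Real.continuous_probChar continuous_probChar_inner hf hg
  simp only [smul_eq_mul, flip_innerₗ] at this
  simpa only [fourier_eq_vectorFourier] using this

/-- Multiplication by a nonzero real number. -/
noncomputable def scaleEquiv (n : ℕ) (c : ℝ) (hc : c ≠ 0) : Rn n ≃L[ℝ] Rn n :=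
  ContinuousLinearEquiv.smulLeft (Units.mk0 c hc)

lemma scaleEquiv_apply (c : ℝ) (hc : c ≠ 0) (x : Rn n) : scaleEquiv n c hc x = c • x := rfl

lemma two_pi_inv_ne_zero : (2 * Real.pi)⁻¹ ≠ 0 := by positivity

/-- The Fourier transform of a Schwartz function, as a Schwartz function. -/
noncomputable def schwartzFourier (φ : 𝓢(Rn n, ℂ)) : 𝓢(Rn n, ℂ) :=
  SchwartzMap.compCLMOfContinuousLinearEquiv ℂ (scaleEquiv n _ two_pi_inv_ne_zero) (𝓕 φ)

lemma schwartzFourier_apply (φ : 𝓢(Rn n, ℂ)) (ξ : Rn n) : schwartzFourier φ ξ = fourier φ ξ := by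
  rw [fourier_eq_scaled]
  simp [schwartzFourier, scaleEquiv_apply, SchwartzMap.fourier_coe]

lemma coe_schwartzFourier (φ : 𝓢(Rn n, ℂ)) : ⇑(schwartzFourier φ) = fourier φ :=
  funext (schwartzFourier_apply φ)

/-- The functions that are both integrable and square integrable. -/
structure Nice (f : Rn n → ℂ) : Prop where
  one : MemLp f 1 volume
  two : MemLp f 2 volume

lemma Nice.integrable {f : Rn n → ℂ} (hf : Nice f) : Integrable f := memLp_one_iff_integrable.1 hf.one

lemma SchwartzMap_nice (f : 𝓢(Rn n, ℂ)) : Nice (f : Rn n → ℂ) := ⟨f.memLp 1, f.memLp 2⟩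

lemma Nice.conj {f : Rn n → ℂ} (hf : Nice f) : Nice (fun x => conj (f x)) :=
  ⟨hf.one.star, hf.two.star⟩

lemma Nice.sub {f g : Rn n → ℂ} (hf : Nice f) (hg : Nice g) : Nice (fun x => f x - g x) :=
  ⟨hf.one.sub hg.one, hf.two.sub hg.two⟩

lemma Nice.const_mul {f : Rn n → ℂ} (hf : Nice f) (c : ℂ) : Nice (fun x => c * f x) :=
  ⟨hf.one.const_mul c, hf.two.const_mul c⟩

/-- On `L¹ ∩ L²`, the integral Fourier transform represents the `L²` Fourier transform. -/
lemma fourierTransform_toLp_ae_eq {f : Rn n → ℂ} (hf : Nice f) :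
    (𝓕 (hf.two.toLp f) : Lp ℂ 2 (volume : Measure (Rn n))) =ᵐ[volume] 𝓕 f := by
  have hcont : Continuous (𝓕 f) := by
    have := continuous_fourier hf.integrable
    have h2 : 𝓕 f = fun ξ => fourier f ((2 * Real.pi) • ξ) := by
      funext ξ
      rw [fourier_eq_scaled, smul_smul, inv_mul_cancel₀ Real.two_pi_pos.ne', one_smul]
    rw [h2]
    exact this.comp (continuous_const_smul _)
  -- Locally integrable functions that agree against all test functions agree almost everywhere.
  -- Against a test function the L² transform moves across by its compatibility with tempered
  -- distributions, the integral transform by Fubini.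
  refine ae_eq_of_integral_contDiff_smul_eq
    ((Lp.memLp _).locallyIntegrable (by norm_num)) hcont.locallyIntegrable fun g hg hgs => ?_
  have hg' : ContDiff ℝ (⊤ : ℕ∞) (fun x => (g x : ℂ)) := Complex.ofRealCLM.contDiff.comp hg
  have hgs' : HasCompactSupport (fun x => (g x : ℂ)) := hgs.comp_left Complex.ofReal_zero
  set φ : 𝓢(Rn n, ℂ) := hgs'.toSchwartzMap hg'
  have hφ : ∀ x, φ x = (g x : ℂ) := fun x => rfl
  have h1 := congrArg (fun T => T φ) (Lp.fourier_toTemperedDistribution_eq (hf.two.toLp f))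
  simp only [TemperedDistribution.fourier_apply, Lp.toTemperedDistribution_apply] at h1
  have h2 : ∫ x, g x • 𝓕 f x = ∫ x, (𝓕 φ) x • f x := by
    have := VectorFourier.integral_fourierIntegral_smul_eq_flip (L := innerₗ (Rn n))
      (μ := volume) (ν := volume) Real.continuous_fourierChar continuous_probChar_inner
      hf.integrable φ.integrable
    simp only [smul_eq_mul, flip_innerₗ] at this
    have e : ∀ (h : Rn n → ℂ) (w : Rn n),
      VectorFourier.fourierIntegral Real.fourierChar volume (innerₗ (Rn n)) h w = 𝓕 h w :=
      fun _ _ => rfl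
    simp only [e] at this
    simp only [Complex.real_smul, ← hφ, smul_eq_mul]
    rw [SchwartzMap.fourier_coe]
    simp_rw [mul_comm (φ _), mul_comm (𝓕 (φ : Rn n → ℂ) _)]
    exact this
  rw [h2]
  simp only [← Complex.coe_smul, ← hφ]
  rw [← h1]
  refine integral_congr_ae ?_
  filter_upwards [hf.two.coeFn_toLp] with x hx
  rw [hx]

lemma Nice.memLp_fourierTransform {f : Rn n → ℂ} (hf : Nice f) : MemLp (𝓕 f) 2 volume :=
  (memLp_congr_ae (fourierTransform_toLp_ae_eq hf)).1 (Lp.memLp _)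

lemma Nice.lpNorm_fourierTransform {f : Rn n → ℂ} (hf : Nice f) :
    lpNorm (𝓕 f) 2 volume = lpNorm f 2 volume := by
  have h1 := Lp.norm_fourier_eq (hf.two.toLp f)
  rw [Lp.norm_toLp, Lp.norm_def, eLpNorm_congr_ae (fourierTransform_toLp_ae_eq hf)] at h1
  rwa [toReal_eLpNorm hf.memLp_fourierTransform.1, toReal_eLpNorm hf.two.1] at h1

/-- The constant in Plancherel's identity. -/
noncomputable def planch (n : ℕ) : ℝ := (2 * Real.pi) ^ ((n : ℝ) / 2)

lemma planch_pos (n : ℕ) : 0 < planch n := by unfold planch; positivity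

lemma eLpNorm_two_comp_smul (f : Rn n → ℂ) {c : ℝ} (hc : 0 < c) :
    eLpNorm (fun x => f (c • x)) 2 volume
      = ENNReal.ofReal (c ^ (-((n : ℝ) / 2))) * eLpNorm f 2 volume := by
  have h1 : eLpNorm (fun x => f (c • x)) 2 volume
      = eLpNorm f 2 (Measure.map (fun x : Rn n => c • x) volume) := by
    have := (Homeomorph.smulOfNeZero c hc.ne' : Rn n ≃ₜ Rn n).measurableEmbedding.eLpNorm_map_measure
      (g := f) (p := 2) (μ := volume)
    exact this.symm
  rw [h1, Measure.map_addHaar_smul volume hc.ne', eLpNorm_smul_measure_of_ne_top (by norm_num)]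
  congr 1
  simp only [finrank_euclideanSpace, Fintype.card_fin]
  rw [abs_of_pos (by positivity), ENNReal.ofReal_rpow_of_pos (by positivity)]
  congr 1
  rw [← Real.rpow_natCast, ← Real.rpow_neg hc.le, ← Real.rpow_mul hc.le]
  congr 1
  simp; ring

lemma Nice.memLp_fourier {f : Rn n → ℂ} (hf : Nice f) : MemLp (fourier f) 2 volume := by
  have : fourier f = fun ξ => 𝓕 f ((2 * Real.pi)⁻¹ • ξ) := funext (fourier_eq_scaled f)
  refine ⟨(continuous_fourier hf.integrable).aestronglyMeasurable, ?_⟩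
  rw [this, eLpNorm_two_comp_smul _ (by positivity)]
  exact ENNReal.mul_lt_top ENNReal.ofReal_lt_top hf.memLp_fourierTransform.2

lemma Nice.lpNorm_fourier {f : Rn n → ℂ} (hf : Nice f) :
    lpNorm (fourier f) 2 volume = planch n * lpNorm f 2 volume := by
  have : fourier f = fun ξ => 𝓕 f ((2 * Real.pi)⁻¹ • ξ) := funext (fourier_eq_scaled f)
  rw [← hf.lpNorm_fourierTransform, ← toReal_eLpNorm hf.memLp_fourier.1,
    ← toReal_eLpNorm hf.memLp_fourierTransform.1]
  nth_rw 1 [this]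
  rw [eLpNorm_two_comp_smul _ (by positivity), ENNReal.toReal_mul,
    ENNReal.toReal_ofReal (by positivity), planch]
  congr 1
  rw [Real.inv_rpow (by positivity), ← Real.rpow_neg (by positivity), neg_neg]

lemma Nice.memLp_fourier_neg {f : Rn n → ℂ} (hf : Nice f) :
    MemLp (fun ξ => fourier f (-ξ)) 2 volume :=
  hf.memLp_fourier.comp_measurePreserving (Measure.measurePreserving_neg _)

lemma lpNorm_comp_neg {f : Rn n → ℂ} {p : ℝ≥0∞} (hf : AEStronglyMeasurable f volume) :
    lpNorm (fun ξ => f (-ξ)) p volume = lpNorm f p volume := by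
  have hm := Measure.measurePreserving_neg (volume : Measure (Rn n))
  have h2 : AEStronglyMeasurable (fun ξ => f (-ξ)) volume := hf.comp_measurePreserving hm
  rw [← toReal_eLpNorm hf, ← toReal_eLpNorm h2]
  exact congrArg ENNReal.toReal (eLpNorm_comp_measurePreserving hf hm)

lemma Nice.lpNorm_fourier_neg {f : Rn n → ℂ} (hf : Nice f) :
    lpNorm (fun ξ => fourier f (-ξ)) 2 volume = planch n * lpNorm f 2 volume := by
  rw [lpNorm_comp_neg hf.memLp_fourier.1, hf.lpNorm_fourier]

section CauchySchwarz

variable {X : Type*} [MeasurableSpace X] {μ : Measure X}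

lemma integrable_mul_of_memLp_two {f g : X → ℂ} (hf : MemLp f 2 μ) (hg : MemLp g 2 μ) :
    Integrable (fun x => f x * g x) μ := hf.integrable_mul hg

lemma lpNorm_two_sq {f : X → ℂ} (hf : MemLp f 2 μ) : lpNorm f 2 μ ^ 2 = ∫ x, ‖f x‖ ^ 2 ∂μ := by
  rw [lpNorm_eq_integral_norm_rpow_toReal (by norm_num) (by norm_num) hf.1]
  simp only [ENNReal.toReal_ofNat, Real.rpow_two]
  rw [← Real.rpow_natCast, ← Real.rpow_mul (integral_nonneg fun _ => by positivity)]
  norm_num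

lemma integral_norm_mul_le_lpNorm {f g : X → ℂ} (hf : MemLp f 2 μ) (hg : MemLp g 2 μ) :
    ∫ x, ‖f x * g x‖ ∂μ ≤ lpNorm f 2 μ * lpNorm g 2 μ := by
  have h := integral_mul_norm_le_Lp_mul_Lq (μ := μ) (f := f) (g := g) Real.HolderConjugate.two_two
    (by simpa using hf) (by simpa using hg)
  rw [lpNorm_eq_integral_norm_rpow_toReal (by norm_num) (by norm_num) hf.1,
    lpNorm_eq_integral_norm_rpow_toReal (by norm_num) (by norm_num) hg.1]
  simp only [norm_mul]
  simpa using h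

lemma norm_integral_mul_le_of_bound {m f g : X → ℂ} {A : ℝ} (hA : 0 ≤ A) (hm : ∀ x, ‖m x‖ ≤ A)
    (hf : MemLp f 2 μ) (hg : MemLp g 2 μ) :
    ‖∫ x, m x * (f x * g x) ∂μ‖ ≤ A * (lpNorm f 2 μ * lpNorm g 2 μ) := by
  calc ‖∫ x, m x * (f x * g x) ∂μ‖ ≤ ∫ x, A * ‖f x * g x‖ ∂μ := by
        refine norm_integral_le_of_norm_le ((hf.integrable_mul hg).norm.const_mul A)
          (ae_of_all _ fun x => ?_)
        rw [norm_mul]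
        gcongr
        exact hm x
    _ = A * ∫ x, ‖f x * g x‖ ∂μ := integral_const_mul _ _
    _ ≤ _ := by gcongr; exact integral_norm_mul_le_lpNorm hf hg

end CauchySchwarz

end HelmholtzBR

namespace HelmholtzBR

/-- The symbol `(w + i s)^{-z}`. -/
noncomputable def sym (z w : ℂ) (s : ℝ) : ℂ := (w + s * Complex.I) ^ (-z)

/-! ### The symbol (w + is)^{-z} -/

section Symbol

variable {z w : ℂ} {s : ℝ}

lemma re_base : (w + s * Complex.I).re = w.re := by simp

lemma base_ne_zero (hw : 0 < w.re) : w + s * Complex.I ≠ 0 := by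
  intro h
  have := congrArg Complex.re h
  rw [re_base] at this
  simp at this
  linarith

lemma re_le_norm_base : w.re ≤ ‖w + s * Complex.I‖ := by
  rw [← re_base (w := w) (s := s)]
  exact (le_abs_self _).trans (Complex.abs_re_le_norm _)

lemma base_mem_slitPlane (hw : 0 < w.re) : w + s * Complex.I ∈ Complex.slitPlane :=
  Or.inl (by rw [re_base]; exact hw)

/-- The base lies in the right half-plane, so its argument is at most π/2 ≤ 2 in modulus and an
imaginary exponent costs at most e^{2|Im z|}. This is the growth rate 2 of all later interpolations.
-/
lemma norm_sym_le (hw : 0 < w.re) :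
    ‖sym z w s‖ ≤ ‖w + s * Complex.I‖ ^ (-z.re) * Real.exp (2 * |z.im|) := by
  rw [sym, Complex.norm_cpow_of_ne_zero (base_ne_zero hw), div_eq_mul_inv, ← Real.exp_neg,
    Complex.neg_re, Complex.neg_im]
  gcongr
  have h1 : |(w + s * Complex.I).arg| ≤ Real.pi / 2 :=
    Complex.abs_arg_le_pi_div_two_iff.2 (by rw [re_base]; exact hw.le)
  have h2 : Real.pi / 2 ≤ 2 := by linarith [Real.pi_le_four]
  calc -((w + s * Complex.I).arg * -z.im) = (w + s * Complex.I).arg * z.im := by ring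
    _ ≤ |(w + s * Complex.I).arg * z.im| := le_abs_self _
    _ = |(w + s * Complex.I).arg| * |z.im| := abs_mul _ _
    _ ≤ 2 * |z.im| := by gcongr; linarith

lemma norm_sym_ofReal (a : ℝ) (w : ℂ) : ‖sym a w s‖ = ‖w + s * Complex.I‖ ^ (-a) := by
  rw [sym, ← Complex.ofReal_neg, Complex.norm_cpow_real]

lemma norm_sym_le_of_re_nonneg (hw : 0 < w.re) (hz : 0 ≤ z.re) :
    ‖sym z w s‖ ≤ w.re ^ (-z.re) * Real.exp (2 * |z.im|) := by
  refine (norm_sym_le hw).trans (mul_le_mul_of_nonneg_right ?_ (Real.exp_pos _).le)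
  exact Real.rpow_le_rpow_of_nonpos hw re_le_norm_base (neg_nonpos.2 hz)

lemma continuous_sym (z : ℂ) (hw : 0 < w.re) : Continuous (sym z w) := by
  unfold sym
  exact Continuous.cpow (by fun_prop) continuous_const fun s => base_mem_slitPlane hw

/-- Conjugation flips the sign of s; the branch cut is never met because the argument stays inside
(-π/2, π/2). -/
lemma conj_sym (z : ℂ) (hw : 0 < w.re) (s : ℝ) : conj (sym z w s) = sym (conj z) (conj w) (-s) := by
  rw [sym, sym]
  have : conj w + ((-s : ℝ) : ℂ) * Complex.I = conj (w + s * Complex.I) := by simp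
  have harg := Complex.abs_arg_lt_pi_div_two_iff.2 (Or.inl (by rw [re_base (s := s)]; exact hw))
  rw [this, ← map_neg, Complex.conj_cpow, Complex.conj_conj]
  intro h
  rw [h, abs_of_pos Real.pi_pos] at harg
  linarith [Real.pi_pos]

end Symbol

/-! ### Powers as Laplace transforms; fractional integration in w -/

section Laplace

lemma integrableOn_laplace {a η : ℝ} (ha : 0 < a) (hη : 0 < η) :
    IntegrableOn (fun t : ℝ => t ^ (a - 1) * Real.exp (-(η * t))) (Set.Ioi 0) := by
  have := integrableOn_rpow_mul_exp_neg_mul_rpow (p := 1) (s := a - 1) (b := η) (by linarith)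
    (by norm_num) hη
  simpa using this

lemma norm_laplace_integrand {a w : ℂ} {t : ℝ} (ht : 0 < t) :
    ‖(t : ℂ) ^ (a - 1) * Complex.exp (-(w * t))‖ = t ^ (a.re - 1) * Real.exp (-(w.re * t)) := by
  rw [norm_mul, Complex.norm_cpow_eq_rpow_re_of_pos ht, Complex.norm_exp]
  simp

lemma continuousOn_laplace_integrand (a w : ℂ) :
    ContinuousOn (fun t : ℝ => (t : ℂ) ^ (a - 1) * Complex.exp (-(w * t))) (Set.Ioi 0) := by
  refine ContinuousOn.mul ?_ (by fun_prop)
  exact fun t ht => ((Complex.continuousAt_ofReal_cpow_const _ _ (Or.inr (ne_of_gt ht)))).continuousWithinAt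

lemma integrableOn_laplace_complex {a w : ℂ} (ha : 0 < a.re) (hw : 0 < w.re) :
    IntegrableOn (fun t : ℝ => (t : ℂ) ^ (a - 1) * Complex.exp (-(w * t))) (Set.Ioi 0) := by
  refine Integrable.mono' (integrableOn_laplace ha hw)
    ((continuousOn_laplace_integrand a w).aestronglyMeasurable measurableSet_Ioi) ?_
  filter_upwards [ae_restrict_mem measurableSet_Ioi] with t ht
  rw [norm_laplace_integrand ht]

/-- Holomorphy in w allows the Laplace formula to be continued from positive real w, where it is the
Gamma integral, to the whole half-plane. -/
lemma differentiableAt_laplace {a w : ℂ} (ha : 0 < a.re) (hw : 0 < w.re) :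
    DifferentiableAt ℂ
      (fun w : ℂ => ∫ t in Set.Ioi (0 : ℝ), (t : ℂ) ^ (a - 1) * Complex.exp (-(w * t))) w := by
  have key := hasDerivAt_integral_of_dominated_loc_of_deriv_le (𝕜 := ℂ)
    (μ := volume.restrict (Set.Ioi (0 : ℝ)))
    (F := fun w t => (t : ℂ) ^ (a - 1) * Complex.exp (-(w * t)))
    (F' := fun w t => (t : ℂ) ^ (a - 1) * (Complex.exp (-(w * t)) * (-t)))
    (x₀ := w) (s := Metric.ball w (w.re / 2))
    (bound := fun t => t ^ ((a.re + 1) - 1) * Real.exp (-((w.re / 2) * t)))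
    (Metric.ball_mem_nhds _ (by linarith)) ?_ (integrableOn_laplace_complex ha hw) ?_ ?_
    (integrableOn_laplace (by linarith) (by linarith)) ?_
  · exact key.2.differentiableAt
  · exact Eventually.of_forall fun v =>
      (continuousOn_laplace_integrand a v).aestronglyMeasurable measurableSet_Ioi
  · simp_rw [← mul_assoc]
    exact ((continuousOn_laplace_integrand a w).mul
      (by fun_prop)).aestronglyMeasurable measurableSet_Ioi
  · filter_upwards [ae_restrict_mem measurableSet_Ioi] with t ht v hv
    have ht' : (0 : ℝ) < t := ht
    rw [← mul_assoc, norm_mul, norm_laplace_integrand ht, norm_neg, Complex.norm_real,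
      Real.norm_of_nonneg ht'.le]
    have hre : w.re / 2 ≤ v.re := by
      have h1 := (Complex.abs_re_le_norm (v - w)).trans_lt (mem_ball_iff_norm.1 hv)
      rw [Complex.sub_re, abs_lt] at h1
      linarith
    have e1 : t ^ (a.re + 1 - 1) = t ^ (a.re - 1) * t := by
      rw [← Real.rpow_add_one ht'.ne']; congr 1; ring
    rw [e1]
    have : Real.exp (-(v.re * t)) ≤ Real.exp (-(w.re / 2 * t)) := by
      apply Real.exp_le_exp.2
      nlinarith
    calc t ^ (a.re - 1) * Real.exp (-(v.re * t)) * t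
        = t ^ (a.re - 1) * t * Real.exp (-(v.re * t)) := by ring
      _ ≤ _ := by gcongr
  · refine ae_of_all _ fun t v _ => ?_
    refine HasDerivAt.const_mul _ ?_
    have : HasDerivAt (fun v : ℂ => -(v * t)) (-t : ℂ) v := by
      simpa [Pi.neg_def] using ((hasDerivAt_id v).mul_const (t : ℂ)).neg
    exact this.cexp

/-- The Laplace transform of a power. -/
lemma integral_cpow_mul_cexp_neg_mul_Ioi {a w : ℂ} (ha : 0 < a.re) (hw : 0 < w.re) :
    ∫ t in Set.Ioi (0 : ℝ), (t : ℂ) ^ (a - 1) * Complex.exp (-(w * t))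
      = w ^ (-a) * Complex.Gamma a := by
  set U : Set ℂ := {w | 0 < w.re}
  have hU : IsOpen U := isOpen_lt continuous_const Complex.continuous_re
  have hconv : Convex ℝ U := convex_halfSpace_re_gt 0
  have hf : AnalyticOnNhd ℂ
      (fun w : ℂ => ∫ t in Set.Ioi (0 : ℝ), (t : ℂ) ^ (a - 1) * Complex.exp (-(w * t))) U :=
    DifferentiableOn.analyticOnNhd
      (fun v hv => (differentiableAt_laplace ha hv).differentiableWithinAt) hU
  have hg : AnalyticOnNhd ℂ (fun w : ℂ => w ^ (-a) * Complex.Gamma a) U := by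
    refine DifferentiableOn.analyticOnNhd (fun v hv => ?_) hU
    exact ((differentiableAt_id.cpow_const (Or.inl hv)).mul_const _).differentiableWithinAt
  have h1 : (1 : ℂ) ∈ U := by simp [U]
  refine AnalyticOnNhd.eqOn_of_preconnected_of_frequently_eq hf hg hconv.isPreconnected h1 ?_ hw
  have hreal : ∀ r : ℝ, 0 < r →
      ∫ t in Set.Ioi (0 : ℝ), (t : ℂ) ^ (a - 1) * Complex.exp (-((r : ℂ) * t))
        = (r : ℂ) ^ (-a) * Complex.Gamma a := by
    intro r hr
    rw [Complex.integral_cpow_mul_exp_neg_mul_Ioi ha hr, one_div, Complex.cpow_neg,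
      Complex.inv_cpow]
    rw [Complex.arg_ofReal_of_nonneg hr.le]
    exact Real.pi_pos.ne
  -- The identity theorem needs an accumulation point; these positive reals tend to 1 without
  -- meeting it.
  have ht : Tendsto (fun k : ℕ => ((1 + 1 / ((k : ℝ) + 1) : ℝ) : ℂ)) atTop (𝓝[≠] 1) := by
    refine tendsto_nhdsWithin_iff.2 ⟨?_, Eventually.of_forall fun k => ?_⟩
    · have := (tendsto_one_div_add_atTop_nhds_zero_nat (𝕜 := ℝ)).const_add 1
      rw [add_zero] at this
      have h2 := (Complex.continuous_ofReal.tendsto 1).comp this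
      simpa [Function.comp_def] using h2
    · have : (0 : ℝ) < 1 / ((k : ℝ) + 1) := by positivity
      simp only [Set.mem_compl_iff, Set.mem_singleton_iff]
      intro h
      have h3 : (1 + 1 / ((k : ℝ) + 1) : ℝ) = 1 := by exact_mod_cast h
      linarith
  refine ht.frequently (Eventually.frequently (Eventually.of_forall fun k => ?_))
  exact hreal _ (by positivity)

lemma gamma_mul_sym {z w : ℂ} (hz : 0 < z.re) (hw : 0 < w.re) (s : ℝ) :
    Complex.Gamma z * sym z w s
      = ∫ t in Set.Ioi (0 : ℝ), (t : ℂ) ^ (z - 1) * Complex.exp (-((w + s * Complex.I) * t)) := by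
  rw [integral_cpow_mul_cexp_neg_mul_Ioi hz (by rw [re_base]; exact hw), sym, mul_comm]

lemma integral_rpow_mul_exp {c t : ℝ} (hc : 0 < c) (ht : 0 < t) :
    ∫ τ in Set.Ioi (0 : ℝ), τ ^ (c - 1) * Real.exp (-(t * τ)) = t ^ (-c) * Real.Gamma c := by
  rw [Real.integral_rpow_mul_exp_neg_mul_Ioi hc ht, one_div, Real.inv_rpow ht.le,
    ← Real.rpow_neg ht.le]

/-- Fractional integration of powers on the right half plane. -/
lemma integral_rpow_mul_cpow_add {a c : ℝ} (ha : 0 < a) (hc : 0 < c) {w : ℂ} (hw : 0 < w.re) :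
    ∫ τ in Set.Ioi (0 : ℝ), (τ ^ (c - 1) : ℝ) * (w + τ) ^ (-((a + c : ℝ) : ℂ))
      = ((Real.Gamma a * Real.Gamma c / Real.Gamma (a + c) : ℝ) : ℂ) * w ^ (-(a : ℂ)) := by
  have hG : Real.Gamma (a + c) ≠ 0 := (Real.Gamma_pos_of_pos (by linarith)).ne'
  -- Expanding (w+τ)^{-(a+c)} as a Laplace integral in t makes the claim two evaluations of one
  -- double integral: t first gives Γ(a+c) times the left side, τ first gives Γ(c) times the Laplace
  -- integral of order a.
  set F : ℝ → ℝ → ℂ := fun τ t => ((τ ^ (c - 1) * t ^ (a + c - 1) : ℝ) : ℂ)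
    * Complex.exp (-((w + τ) * t))
  have hFcont : ContinuousOn (Function.uncurry F) (Set.Ioi 0 ×ˢ Set.Ioi 0) := by
    simp only [F, Function.uncurry_def]
    refine ContinuousOn.mul ?_ (by fun_prop)
    refine Complex.continuous_ofReal.comp_continuousOn (ContinuousOn.mul ?_ ?_)
    · exact ContinuousOn.rpow_const (by fun_prop) fun p hp => Or.inl (ne_of_gt hp.1)
    · exact ContinuousOn.rpow_const (by fun_prop) fun p hp => Or.inl (ne_of_gt hp.2)
  have hnorm : ∀ τ t : ℝ, 0 < τ → 0 < t → ‖F τ t‖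
      = t ^ (a + c - 1) * Real.exp (-(w.re * t)) * (τ ^ (c - 1) * Real.exp (-(t * τ))) := by
    intro τ t hτ ht
    simp only [F]
    rw [norm_mul, Complex.norm_real, Complex.norm_exp, Real.norm_of_nonneg (by positivity)]
    have : (-((w + τ) * t)).re = -(w.re * t) + -(t * τ) := by simp; ring
    rw [this, Real.exp_add]
    ring
  have hmeas : AEStronglyMeasurable (Function.uncurry F)
      ((volume.restrict (Set.Ioi 0)).prod (volume.restrict (Set.Ioi 0))) := by
    rw [Measure.prod_restrict]
    exact hFcont.aestronglyMeasurable (measurableSet_Ioi.prod measurableSet_Ioi)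
  have hint : Integrable (Function.uncurry F)
      ((volume.restrict (Set.Ioi 0)).prod (volume.restrict (Set.Ioi 0))) := by
    rw [integrable_prod_iff' hmeas]
    constructor
    · filter_upwards [ae_restrict_mem measurableSet_Ioi] with t ht
      have ht' : (0 : ℝ) < t := ht
      refine Integrable.mono' ((integrableOn_laplace hc ht').const_mul
        (t ^ (a + c - 1) * Real.exp (-(w.re * t)))) ?_ ?_
      · have : ContinuousOn (fun τ => F τ t) (Set.Ioi 0) :=
          hFcont.comp (f := fun τ : ℝ => (τ, t)) (by fun_prop) fun τ hτ => ⟨hτ, ht⟩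
        exact this.aestronglyMeasurable measurableSet_Ioi
      · filter_upwards [ae_restrict_mem measurableSet_Ioi] with τ hτ
        exact (hnorm τ t hτ ht).le
    · refine (integrable_congr ?_).2 ((integrableOn_laplace ha hw).const_mul (Real.Gamma c))
      filter_upwards [ae_restrict_mem measurableSet_Ioi] with t ht
      have ht' : (0 : ℝ) < t := ht
      have : ∫ τ in Set.Ioi (0 : ℝ), ‖Function.uncurry F (τ, t)‖
          = ∫ τ in Set.Ioi (0 : ℝ), t ^ (a + c - 1) * Real.exp (-(w.re * t))
            * (τ ^ (c - 1) * Real.exp (-(t * τ))) :=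
        setIntegral_congr_fun measurableSet_Ioi fun τ hτ => hnorm τ t hτ ht
      rw [this, integral_const_mul, integral_rpow_mul_exp hc ht']
      have e : t ^ (a - 1) = t ^ (a + c - 1) * t ^ (-c) := by
        rw [← Real.rpow_add ht']; congr 1; ring
      rw [e]; ring
  have h1 : ∀ τ : ℝ, 0 < τ → ∫ t in Set.Ioi (0 : ℝ), F τ t
      = (Real.Gamma (a + c) : ℂ) * ((τ ^ (c - 1) : ℝ) * (w + τ) ^ (-((a + c : ℝ) : ℂ))) := by
    intro τ hτ
    have h2 := integral_cpow_mul_cexp_neg_mul_Ioi (a := ((a + c : ℝ) : ℂ)) (w := w + τ)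
      (by rw [Complex.ofReal_re]; linarith) (by simp; linarith)
    rw [Complex.Gamma_ofReal] at h2
    calc ∫ t in Set.Ioi (0 : ℝ), F τ t
        = ∫ t in Set.Ioi (0 : ℝ), ((τ ^ (c - 1) : ℝ) : ℂ)
          * ((t : ℂ) ^ (((a + c : ℝ) : ℂ) - 1) * Complex.exp (-((w + τ) * t))) := by
          refine setIntegral_congr_fun measurableSet_Ioi fun t ht => ?_
          have ht' : (0 : ℝ) ≤ t := le_of_lt ht
          simp only [F]
          rw [Complex.ofReal_mul, Complex.ofReal_cpow ht']
          push_cast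
          ring
      _ = _ := by rw [integral_const_mul, h2]; ring
  have h3 : ∀ t : ℝ, 0 < t → ∫ τ in Set.Ioi (0 : ℝ), F τ t
      = (Real.Gamma c : ℂ) * ((t : ℂ) ^ ((a : ℂ) - 1) * Complex.exp (-(w * t))) := by
    intro t ht
    calc ∫ τ in Set.Ioi (0 : ℝ), F τ t
        = ∫ τ in Set.Ioi (0 : ℝ), ((t ^ (a + c - 1) : ℝ) : ℂ) * Complex.exp (-(w * t))
          * ((τ ^ (c - 1) * Real.exp (-(t * τ)) : ℝ) : ℂ) := by
          refine setIntegral_congr_fun measurableSet_Ioi fun τ hτ => ?_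
          simp only [F]
          have : -((w + τ) * t) = -(w * t) + -(t * τ) := by ring
          rw [this, Complex.exp_add]
          push_cast
          ring
      _ = _ := by
          rw [integral_const_mul, integral_complex_ofReal, integral_rpow_mul_exp hc ht]
          have e : (t : ℂ) ^ ((a : ℂ) - 1) = ((t ^ (a + c - 1) * t ^ (-c) : ℝ) : ℂ) := by
            rw [← Real.rpow_add ht, show a + c - 1 + -c = a - 1 by ring,
              Complex.ofReal_cpow ht.le]
            push_cast; rfl
          rw [e]; push_cast; ring
  have hswap := integral_integral_swap hint
  rw [setIntegral_congr_fun measurableSet_Ioi (fun τ hτ => h1 τ hτ),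
    setIntegral_congr_fun measurableSet_Ioi (fun t ht => h3 t ht),
    integral_const_mul, integral_const_mul,
    integral_cpow_mul_cexp_neg_mul_Ioi (by simpa using ha) hw, Complex.Gamma_ofReal] at hswap
  have hG' : (Real.Gamma (a + c) : ℂ) ≠ 0 := by exact_mod_cast hG
  rw [← mul_right_inj' hG', hswap]
  push_cast
  field_simp

end Laplace

end HelmholtzBR

namespace HelmholtzBR

/-! ### An oscillatory integral with phase a²u² + b²/u² -/

section Oscillatory

/-- An oscillatory integrand with phase `a² u² + b² / u²`. -/
noncomputable def oscInt (a b η y u : ℝ) : ℂ :=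
  Complex.exp (((-(η * u ^ 2) : ℝ) : ℂ)
    + ((2 * y * Real.log u + (a ^ 2 * u ^ 2 + b ^ 2 / u ^ 2) : ℝ) : ℂ) * Complex.I)

lemma norm_oscInt (a b η y u : ℝ) : ‖oscInt a b η y u‖ = Real.exp (-(η * u ^ 2)) := by
  rw [oscInt, Complex.norm_exp]
  simp [-Complex.ofReal_mul, -Complex.ofReal_add, -Complex.ofReal_pow, -Complex.ofReal_div,
    -Complex.ofReal_neg]

lemma norm_oscInt_le_one {a b η y u : ℝ} (hη : 0 ≤ η) : ‖oscInt a b η y u‖ ≤ 1 := by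
  rw [norm_oscInt]
  exact Real.exp_le_one_iff.2 (by nlinarith [sq_nonneg u, mul_nonneg hη (sq_nonneg u)])

lemma hasDerivAt_oscInt (a b η y : ℝ) {u : ℝ} (hu : 0 < u) :
    HasDerivAt (oscInt a b η y) (oscInt a b η y u *
      (((-(2 * η * u) : ℝ) : ℂ)
        + ((2 * y / u + 2 * (a ^ 2 * u - b ^ 2 / u ^ 3) : ℝ) : ℂ) * Complex.I)) u := by
  have h1 : HasDerivAt (fun u : ℝ => -(η * u ^ 2)) (-(2 * η * u)) u := by
    have := ((hasDerivAt_pow 2 u).const_mul η).neg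
    convert! this using 1
    simp; ring
  have h2 : HasDerivAt (fun u : ℝ => 2 * y * Real.log u + (a ^ 2 * u ^ 2 + b ^ 2 / u ^ 2))
      (2 * y / u + 2 * (a ^ 2 * u - b ^ 2 / u ^ 3)) u := by
    have e1 := (Real.hasDerivAt_log hu.ne').const_mul (2 * y)
    have e2 := (hasDerivAt_pow 2 u).const_mul (a ^ 2)
    have e3 := ((hasDerivAt_const u (b ^ 2)).div (hasDerivAt_pow 2 u) (by positivity))
    convert! e1.add (e2.add e3) using 1
    field_simp
    ring
  exact (h1.ofReal_comp.add (h2.ofReal_comp.mul_const Complex.I)).cexp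

lemma continuousOn_oscInt (a b η y : ℝ) : ContinuousOn (oscInt a b η y) (Set.Ioi 0) :=
  fun _ hu => (hasDerivAt_oscInt a b η y hu).continuousAt.continuousWithinAt

/-- Integration by parts as a comparison of derivatives: if `F'` misses the integrand by at most
`D'`, the integral differs from the increment of `F` by at most the increment of `D`. It pays off
when the errors are derivatives of explicit bounded functions. -/
lemma norm_integral_le_of_approx_primitive {I F F' : ℝ → ℂ} {D D' : ℝ → ℝ} {c d : ℝ}
    (hcd : c ≤ d) (hI : ContinuousOn I (Set.Icc c d))
    (hF : ∀ u ∈ Set.Icc c d, HasDerivAt F (F' u) u)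
    (hD : ∀ u ∈ Set.Icc c d, HasDerivAt D (D' u) u)
    (hbound : ∀ u ∈ Set.Icc c d, ‖I u - F' u‖ ≤ D' u) :
    ‖∫ u in c..d, I u‖ ≤ ‖F c‖ + ‖F d‖ + (D d - D c) := by
  set H : ℝ → ℂ := fun x => (∫ u in c..x, I u) - (F x - F c)
  have hHd : ∀ x ∈ Set.Ico c d, HasDerivWithinAt H (I x - F' x) (Set.Ici x) x := by
    intro x hx
    have hsub : Set.Icc c d ∈ 𝓝[≥] x := by
      refine mem_of_superset (Icc_mem_nhdsGE hx.2) (Set.Icc_subset_Icc_left hx.1)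
    have hint : IntervalIntegrable I volume c x :=
      (hI.mono (by rw [Set.uIcc_of_le hx.1]; exact Set.Icc_subset_Icc_right hx.2.le)).intervalIntegrable
    have h1 : HasDerivWithinAt (fun y => ∫ u in c..y, I u) (I x) (Set.Ici x) x := by
      refine intervalIntegral.integral_hasDerivWithinAt_right hint (t := Set.Ioi x) ?_ ?_
      · refine ⟨Set.Ioo x d, Ioo_mem_nhdsGT hx.2, ?_⟩
        exact (hI.mono fun y hy => ⟨hx.1.trans hy.1.le, hy.2.le⟩).aestronglyMeasurable
          measurableSet_Ioo
      · exact (hI x ⟨hx.1, hx.2.le⟩).mono_of_mem_nhdsWithin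
          (nhdsWithin_mono x Set.Ioi_subset_Ici_self hsub)
    exact h1.sub ((hF x ⟨hx.1, hx.2.le⟩).hasDerivWithinAt.sub_const _)
  have hHc : ContinuousOn H (Set.Icc c d) := by
    refine ContinuousOn.sub ?_ ?_
    · have := intervalIntegral.continuousOn_primitive_interval (f := I) (a := c) (b := d)
        (μ := volume) (by rw [Set.uIcc_of_le hcd]; exact hI.integrableOn_Icc)
      rwa [Set.uIcc_of_le hcd] at this
    · exact (ContinuousOn.sub (fun x hx => (hF x hx).continuousAt.continuousWithinAt)
        continuousOn_const)
  have key := image_norm_le_of_norm_deriv_right_le_deriv_boundary' (f := H) (f' := fun x => I x - F' x)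
    (a := c) (b := d) hHc hHd (B := fun x => D x - D c) (B' := D') (by simp [H])
    (fun x hx => ((hD x hx).continuousAt.continuousWithinAt).sub continuousWithinAt_const)
    (fun x hx => ((hD x ⟨hx.1, hx.2.le⟩).hasDerivWithinAt.sub_const _))
    (fun x hx => hbound x ⟨hx.1, hx.2.le⟩) (x := d) ⟨hcd, le_rfl⟩
  have e : ∫ u in c..d, I u = H d + (F d - F c) := by simp [H]
  rw [e]
  calc ‖H d + (F d - F c)‖ ≤ ‖H d‖ + ‖F d - F c‖ := norm_add_le _ _
    _ ≤ (D d - D c) + (‖F d‖ + ‖F c‖) := add_le_add key (norm_sub_le _ _)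
    _ = _ := by ring

/-- First derivative test. With v = au - b/u the derivative of a²u² + b²/u² is 2vv', and v' = a +
b/u² ≥ a, so |v| ≥ 1 makes it at least 2a in modulus. Integrating by parts against its reciprocal
leaves three errors, each dominated by the derivative of a bounded function; hence the bound does
not see b, η, c or d. -/
lemma norm_integral_oscInt_le_of_one_le_abs {a b η y c d : ℝ} (ha : 0 < a) (hb : 0 ≤ b)
    (hη : 0 ≤ η) (hc : 0 < c) (hcd : c ≤ d) (hv : ∀ u ∈ Set.Icc c d, 1 ≤ |a * u - b / u|) :
    ‖∫ u in c..d, oscInt a b η y u‖ ≤ (3 + 2 * |y|) / a := by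
  have hpos : ∀ u ∈ Set.Icc c d, 0 < u := fun u hu => hc.trans_le hu.1
  set v : ℝ → ℝ := fun u => a * u - b / u
  set v' : ℝ → ℝ := fun u => a + b / u ^ 2
  set q : ℝ → ℝ := fun u => a ^ 2 * u - b ^ 2 / u ^ 3
  have hq : ∀ u, 0 < u → q u = v u * v' u := by
    intro u hu; simp only [q, v, v']; field_simp; ring
  have hv'a : ∀ u, 0 < u → a ≤ v' u := by
    intro u hu; simp only [v']; linarith [div_nonneg hb (sq_nonneg u)]
  have hqa : ∀ u ∈ Set.Icc c d, a ≤ |q u| := by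
    intro u hu
    rw [hq u (hpos u hu), abs_mul, abs_of_pos (ha.trans_le (hv'a u (hpos u hu)))]
    nlinarith [hv u hu, hv'a u (hpos u hu)]
  have hq0 : ∀ u ∈ Set.Icc c d, q u ≠ 0 := fun u hu h => by
    have := hqa u hu; rw [h, abs_zero] at this; linarith
  have hv0 : ∀ u ∈ Set.Icc c d, v u ≠ 0 := fun u hu h => by
    have := hv u hu; simp only [v] at h; rw [h, abs_zero] at this; linarith
  have hqd : ∀ u, 0 < u → HasDerivAt q (a ^ 2 + 3 * b ^ 2 / u ^ 4) u := by
    intro u hu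
    have e3 := ((hasDerivAt_const u (b ^ 2)).div (hasDerivAt_pow 3 u) (by positivity))
    convert! ((hasDerivAt_id u).const_mul (a ^ 2)).sub e3 using 1
    field_simp
    ring
  have hvd : ∀ u, 0 < u → HasDerivAt v (v' u) u := by
    intro u hu
    have e3 := ((hasDerivAt_const u b).div (hasDerivAt_id u) hu.ne')
    convert! ((hasDerivAt_id u).const_mul a).sub e3 using 1
    simp [v', neg_div]
  set k : ℝ → ℝ := fun u => (2 * q u)⁻¹
  have hkd : ∀ u ∈ Set.Icc c d, HasDerivAt k (-(2 * (a ^ 2 + 3 * b ^ 2 / u ^ 4)) / (2 * q u) ^ 2) u :=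
    fun u hu => ((hqd u (hpos u hu)).const_mul 2).inv (mul_ne_zero two_ne_zero (hq0 u hu))
  have hk : ∀ u ∈ Set.Icc c d, |k u| ≤ 1 / (2 * a) := by
    intro u hu
    simp only [k]
    rw [abs_inv, abs_mul, abs_two, ← one_div]
    exact one_div_le_one_div_of_le (by linarith) (by linarith [hqa u hu])
  have hexpd : ∀ u, HasDerivAt (fun u : ℝ => Real.exp (-(η * u ^ 2)))
      (Real.exp (-(η * u ^ 2)) * (-(2 * η * u))) u := by
    intro u
    have h1 : HasDerivAt (fun u : ℝ => -(η * u ^ 2)) (-(2 * η * u)) u := by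
      have := ((hasDerivAt_pow 2 u).const_mul η).neg
      convert! this using 1
      simp; ring
    exact h1.exp
  have main := norm_integral_le_of_approx_primitive (I := oscInt a b η y) hcd
    ((continuousOn_oscInt a b η y).mono fun u hu => hpos u hu)
    -- `F` is the integrand divided by i times the main phase derivative 2q. In `D`, the term -k
    -- pays for differentiating 1/(2q), which is decreasing; the exponential pays for the damping η;
    -- and -1/v pays for the phase 2y log u.
    (F := fun u => -Complex.I * ((k u : ℂ) * oscInt a b η y u))
    (D := fun u => -k u - 1 / (2 * a) * Real.exp (-(η * u ^ 2)) - |y| / a * (v u)⁻¹)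
    (fun u hu => (((hkd u hu).ofReal_comp).mul
      (hasDerivAt_oscInt a b η y (hpos u hu))).const_mul (-Complex.I))
    (fun u hu => ((hkd u hu).neg.sub ((hexpd u).const_mul _)).sub
      (((hvd u (hpos u hu)).inv (hv0 u hu)).const_mul _)) ?_
  · refine main.trans ?_
    have hF : ∀ u ∈ Set.Icc c d, ‖-Complex.I * ((k u : ℂ) * oscInt a b η y u)‖ ≤ 1 / (2 * a) := by
      intro u hu
      rw [norm_mul, norm_mul, norm_neg, Complex.norm_I, one_mul, Complex.norm_real]
      calc |k u| * ‖oscInt a b η y u‖ ≤ 1 / (2 * a) * 1 := by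
            gcongr
            · exact hk u hu
            · exact norm_oscInt_le_one hη
        _ = _ := mul_one _
    have hvinv : ∀ u ∈ Set.Icc c d, |(v u)⁻¹| ≤ 1 := by
      intro u hu
      rw [abs_inv]
      exact inv_le_one_of_one_le₀ (hv u hu)
    have hcm : c ∈ Set.Icc c d := ⟨le_rfl, hcd⟩
    have hdm : d ∈ Set.Icc c d := ⟨hcd, le_rfl⟩
    have k1 := abs_le.1 (hk c hcm)
    have k2 := abs_le.1 (hk d hdm)
    have v1 := abs_le.1 (hvinv c hcm)
    have v2 := abs_le.1 (hvinv d hdm)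
    have e1 : Real.exp (-(η * c ^ 2)) ≤ 1 := Real.exp_le_one_iff.2 (by
      nlinarith [mul_nonneg hη (sq_nonneg c)])
    have e2 : 0 < Real.exp (-(η * d ^ 2)) := Real.exp_pos _
    have m1 : 1 / (2 * a) * Real.exp (-(η * c ^ 2)) ≤ 1 / (2 * a) * 1 := by gcongr
    have m2 : 0 ≤ 1 / (2 * a) * Real.exp (-(η * d ^ 2)) := by positivity
    have hya : 0 ≤ |y| / a := by positivity
    have m3 : |y| / a * (v c)⁻¹ ≤ |y| / a * 1 := by gcongr; exact v1.2
    have m4 : -(|y| / a * 1) ≤ |y| / a * (v d)⁻¹ := by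
      rw [← mul_neg]; gcongr; exact v2.1
    have f1 := hF c hcm
    have f2 := hF d hdm
    have : (3 + 2 * |y|) / a = 6 * (1 / (2 * a)) + 2 * (|y| / a) := by field_simp; ring
    rw [this]
    have : 0 < 1 / (2 * a) := by positivity
    linarith
  · intro u hu
    have hu0 := hpos u hu
    have hqu := hq0 u hu
    set e := oscInt a b η y u
    have e1 : e - -Complex.I * (((-(2 * (a ^ 2 + 3 * b ^ 2 / u ^ 4)) / (2 * q u) ^ 2 : ℝ) : ℂ) * e
        + (k u : ℂ) * (e * (((-(2 * η * u) : ℝ) : ℂ)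
        + ((2 * y / u + 2 * (a ^ 2 * u - b ^ 2 / u ^ 3) : ℝ) : ℂ) * Complex.I)))
        = Complex.I * (((-(2 * (a ^ 2 + 3 * b ^ 2 / u ^ 4)) / (2 * q u) ^ 2 : ℝ) : ℂ) * e
          + (k u : ℂ) * (((-(2 * η * u) : ℝ) : ℂ) * e)
          + (k u : ℂ) * (((2 * y / u : ℝ) : ℂ) * Complex.I * e)) := by
      have hkq : (k u : ℂ) * ((2 * (a ^ 2 * u - b ^ 2 / u ^ 3) : ℝ) : ℂ) = 1 := by
        rw [← Complex.ofReal_mul]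
        have : k u * (2 * (a ^ 2 * u - b ^ 2 / u ^ 3)) = 1 :=
          inv_mul_cancel₀ (mul_ne_zero two_ne_zero hqu)
        rw [this, Complex.ofReal_one]
      rw [Complex.ofReal_add (2 * y / u)]
      linear_combination (-e) * hkq + (e * (k u : ℂ) *
        ((2 * (a ^ 2 * u - b ^ 2 / u ^ 3) : ℝ) : ℂ)) * Complex.I_sq
    rw [e1, norm_mul, Complex.norm_I, one_mul]
    have he1 : ‖e‖ ≤ 1 := norm_oscInt_le_one hη
    have he : ‖e‖ = Real.exp (-(η * u ^ 2)) := norm_oscInt _ _ _ _ _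
    refine (norm_add₃_le).trans ?_
    simp only [norm_mul, Complex.norm_real, Complex.norm_I, mul_one, Real.norm_eq_abs]
    have b1 : |-(2 * (a ^ 2 + 3 * b ^ 2 / u ^ 4)) / (2 * q u) ^ 2| * ‖e‖
        ≤ -(-(2 * (a ^ 2 + 3 * b ^ 2 / u ^ 4)) / (2 * q u) ^ 2) := by
      rw [neg_div, neg_neg, abs_neg, abs_of_nonneg (by positivity)]
      exact mul_le_of_le_one_right (by positivity) he1
    have b2 : |k u| * (|-(2 * η * u)| * ‖e‖)
        ≤ -(1 / (2 * a) * (Real.exp (-(η * u ^ 2)) * (-(2 * η * u)))) := by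
      rw [he, abs_neg, abs_of_nonneg (show 0 ≤ 2 * η * u by positivity)]
      have : -(1 / (2 * a) * (Real.exp (-(η * u ^ 2)) * (-(2 * η * u))))
        = 1 / (2 * a) * (2 * η * u * Real.exp (-(η * u ^ 2))) := by ring
      rw [this]
      exact mul_le_mul_of_nonneg_right (hk u hu) (by positivity)
    have b3 : |k u| * (|2 * y / u| * ‖e‖) ≤ -(|y| / a * (-v' u / v u ^ 2)) := by
      have hvp : 0 < v' u := ha.trans_le (hv'a u hu0)
      have hva : 0 < |v u| := abs_pos.2 (hv0 u hu)
      -- The logarithmic phase leaves the error |y|/(u|v|v'). This inequality turns 1/(u|v|v') into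
      -- at most v'/(av²), the derivative of -1/(av).
      have h1 : a * |v u| ≤ u * v' u ^ 2 := by
        have : |v u| ≤ u * v' u := by
          have e : u * v' u = a * u + b / u := by simp only [v']; field_simp
          rw [e, abs_le]
          simp only [v]
          constructor <;> nlinarith [div_nonneg hb hu0.le, mul_pos ha hu0]
        calc a * |v u| ≤ v' u * (u * v' u) := by
              gcongr
              exact hv'a u hu0
          _ = _ := by ring
      have h2 : |k u| * |2 * y / u| = |y| / (u * |v u| * v' u) := by
        simp only [k]
        rw [hq u hu0, abs_inv, abs_mul, abs_mul, abs_div, abs_mul, abs_two, abs_of_pos hvp,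
          abs_of_pos hu0]
        field_simp
      calc |k u| * (|2 * y / u| * ‖e‖) = |k u| * |2 * y / u| * ‖e‖ := by ring
        _ ≤ |k u| * |2 * y / u| := mul_le_of_le_one_right (by positivity) he1
        _ = |y| / (u * |v u| * v' u) := h2
        _ ≤ |y| * (v' u / (a * |v u| ^ 2)) := by
            rw [div_eq_mul_one_div]
            refine mul_le_mul_of_nonneg_left ?_ (abs_nonneg y)
            rw [div_le_div_iff₀ (by positivity) (by positivity)]
            nlinarith [mul_le_mul_of_nonneg_left h1 hva.le]
        _ = _ := by rw [sq_abs]; field_simp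
    linarith

/-- The second derivative test for the phase `a² u² + b² / u²`, uniformly in `b` and `η`. -/
lemma norm_integral_oscInt_le {a b η y : ℝ} (ha : 0 < a) (hb : 0 ≤ b) (hη : 0 < η) :
    ‖∫ u in Set.Ioi (0 : ℝ), oscInt a b η y u‖ ≤ (7 + 4 * |y|) / a := by
  have hint : IntegrableOn (oscInt a b η y) (Set.Ioi 0) := by
    refine Integrable.mono' (integrable_exp_neg_mul_sq hη).integrableOn
      ((continuousOn_oscInt a b η y).aestronglyMeasurable measurableSet_Ioi)
      (ae_of_all _ fun u => ?_)
    rw [norm_oscInt]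
    simp
  -- For b > 0 the points p and q below solve au - b/u = -1 and au - b/u = 1. Outside (p, q) the
  -- first derivative test applies; between them the integrand is at most 1 on an interval of length
  -- 1/a.
  set r : ℝ := √(1 + 4 * (a * b))
  have hab : 0 ≤ a * b := mul_nonneg ha.le hb
  have hr2 : r ^ 2 = 1 + 4 * (a * b) := Real.sq_sqrt (by linarith)
  have hr1 : 1 ≤ r := Real.one_le_sqrt.2 (by linarith)
  set p : ℝ := (r - 1) / (2 * a)
  set q : ℝ := (r + 1) / (2 * a)
  have hp0 : 0 ≤ p := div_nonneg (by linarith) (by linarith)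
  have hq0 : 0 < q := div_pos (by linarith) (by linarith)
  have hpq : q = p + 1 / a := by simp only [p, q]; field_simp; ring
  have hpq' : p ≤ q := by rw [hpq]; linarith [one_div_pos.2 ha]
  have hpeq : 2 * a * p = r - 1 := by simp only [p]; field_simp
  have hqeq : 2 * a * q = r + 1 := by simp only [q]; field_simp
  have hvq : ∀ u, q ≤ u → 1 ≤ |a * u - b / u| := by
    intro u hu
    have hu0 : 0 < u := hq0.trans_le hu
    refine le_trans ?_ (le_abs_self _)
    rw [le_sub_iff_add_le, ← le_sub_iff_add_le', div_le_iff₀ hu0]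
    have h2 : r + 1 ≤ 2 * a * u := by rw [← hqeq]; gcongr
    nlinarith
  have hvp : ∀ u, 0 < u → u ≤ p → 1 ≤ |a * u - b / u| := by
    intro u hu0 hu
    refine le_trans ?_ (neg_le_abs _)
    rw [neg_sub, le_sub_iff_add_le, le_div_iff₀ hu0]
    have h2 : 2 * a * u ≤ r - 1 := by rw [← hpeq]; gcongr
    have h3 : 0 < 2 * a * u := by positivity
    nlinarith
  set M := (3 + 2 * |y|) / a
  have hM : 0 ≤ M := by positivity
  have hsplit : ∫ u in Set.Ioi (0 : ℝ), oscInt a b η y u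
      = (∫ u in Set.Ioc 0 p, oscInt a b η y u) + ((∫ u in Set.Ioc p q, oscInt a b η y u)
        + ∫ u in Set.Ioi q, oscInt a b η y u) := by
    rw [← setIntegral_union Set.Ioc_disjoint_Ioi_same measurableSet_Ioi
        (hint.mono_set fun u hu => hp0.trans_lt hu.1) (hint.mono_set fun u hu => hq0.trans hu),
      Set.Ioc_union_Ioi_eq_Ioi hpq',
      ← setIntegral_union Set.Ioc_disjoint_Ioi_same measurableSet_Ioi
        (hint.mono_set fun u hu => hu.1) (hint.mono_set fun u hu => hp0.trans_lt hu),
      Set.Ioc_union_Ioi_eq_Ioi hp0]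
  have b1 : ‖∫ u in Set.Ioc 0 p, oscInt a b η y u‖ ≤ M := by
    -- The first derivative test needs a positive lower limit; the piece (0, c] costs at most c ≤ ε.
    refine le_of_forall_pos_le_add fun ε hε => ?_
    rcases hp0.eq_or_lt with h0 | h0
    · rw [← h0]; simp; positivity
    set c := min ε p
    have hc0 : 0 < c := lt_min hε h0
    have hcp : c ≤ p := min_le_right _ _
    have : ∫ u in Set.Ioc 0 p, oscInt a b η y u
        = (∫ u in Set.Ioc 0 c, oscInt a b η y u) + ∫ u in Set.Ioc c p, oscInt a b η y u := by
      rw [← setIntegral_union (Set.Ioc_disjoint_Ioc_of_le le_rfl) measurableSet_Ioc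
        (hint.mono_set fun u hu => hu.1) (hint.mono_set fun u hu => hc0.trans hu.1),
        Set.Ioc_union_Ioc_eq_Ioc hc0.le hcp]
    rw [this]
    have h1 : ‖∫ u in Set.Ioc 0 c, oscInt a b η y u‖ ≤ ε := by
      refine (norm_setIntegral_le_of_norm_le_const (C := 1) (by simp)
        fun u _ => norm_oscInt_le_one hη.le).trans ?_
      have : (volume : Measure ℝ).real (Set.Ioc 0 c) = c := by simp [Measure.real, hc0.le]
      rw [this, one_mul]
      exact min_le_left _ _
    have h2 : ‖∫ u in Set.Ioc c p, oscInt a b η y u‖ ≤ M := by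
      rw [← intervalIntegral.integral_of_le hcp]
      exact norm_integral_oscInt_le_of_one_le_abs ha hb hη.le hc0 hcp
        fun u hu => hvp u (hc0.trans_le hu.1) hu.2
    exact (norm_add_le _ _).trans (by linarith)
  have b2 : ‖∫ u in Set.Ioc p q, oscInt a b η y u‖ ≤ 1 / a := by
    refine (norm_setIntegral_le_of_norm_le_const (C := 1) (by simp)
        fun u _ => norm_oscInt_le_one hη.le).trans ?_
    simp [Measure.real, hpq, ha.le]
  have b3 : ‖∫ u in Set.Ioi q, oscInt a b η y u‖ ≤ M := by
    have ht := intervalIntegral_tendsto_integral_Ioi q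
      (hint.mono_set fun u hu => hq0.trans hu) tendsto_id
    refine le_of_tendsto ht.norm ?_
    filter_upwards [eventually_ge_atTop q] with d hd
    exact norm_integral_oscInt_le_of_one_le_abs ha hb hη.le hq0 hd fun u hu => hvq u hu.1
  rw [hsplit]
  have : (7 + 4 * |y|) / a = M + (1 / a + M) := by simp only [M]; field_simp; ring
  rw [this]
  exact (norm_add_le _ _).trans (add_le_add b1 ((norm_add_le _ _).trans (add_le_add b2 b3)))

end Oscillatory

end HelmholtzBR

namespace HelmholtzBR

variable {n : ℕ}

/-- The bilinear form `⟨(w + i(|ξ|² - 1))^{-z} f̂, ĝ⟩`. -/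
noncomputable def resForm (z w : ℂ) (f g : Rn n → ℂ) : ℂ :=
  ∫ ξ, sym z w (‖ξ‖ ^ 2 - 1) * (fourier f ξ * fourier g (-ξ))

/-! ### Gaussian multipliers and the Schrödinger kernel -/

section Gaussian

lemma integrable_gaussian_mul {b : ℂ} (hb : 0 < b.re) (x : Rn n) :
    Integrable fun ξ : Rn n =>
      Complex.exp (-b * ‖ξ‖ ^ 2 + Complex.I * ((inner ℝ x ξ : ℝ) : ℂ)) :=
  GaussianFourier.integrable_cexp_neg_mul_sq_norm_add hb Complex.I x

lemma fourier_gaussian_modulated {b : ℂ} (hb : 0 < b.re) (x y : Rn n) :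
    fourier (fun ξ : Rn n => Complex.exp (-b * ‖ξ‖ ^ 2 + Complex.I * ((inner ℝ x ξ : ℝ) : ℂ))) y
      = (Real.pi / b) ^ ((n : ℂ) / 2) * Complex.exp (-(‖x - y‖ ^ 2 / (4 * b))) := by
  have h := GaussianFourier.integral_cexp_neg_mul_sq_norm_add hb Complex.I (x - y)
  rw [Complex.I_sq, neg_one_mul, neg_div, finrank_euclideanSpace, Fintype.card_fin] at h
  rw [← h, fourier]
  refine integral_congr_ae (ae_of_all _ fun ξ => ?_)
  simp only
  rw [← Complex.exp_add, inner_sub_left, Complex.ofReal_sub]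
  congr 1
  ring

/-- From multiplier to kernel: the multiplication formula moves the transform off f, and a modulated
Gaussian has an explicit transform. Re b > 0 keeps every integral absolutely convergent; the
Schrödinger case Re b = 0 is a limit of this one. -/
lemma gaussian_form_eq {b : ℂ} (hb : 0 < b.re) {f g : Rn n → ℂ} (hf : Integrable f)
    (hg : Integrable g) :
    ∫ ξ : Rn n, Complex.exp (-b * ‖ξ‖ ^ 2) * (fourier f ξ * fourier g (-ξ))
      = (Real.pi / b) ^ ((n : ℂ) / 2)
        * ∫ p : Rn n × Rn n, f p.1 * g p.2 * Complex.exp (-(‖p.1 - p.2‖ ^ 2 / (4 * b))) := by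
  have hgc : Continuous (fourier g) := continuous_fourier hg
  have hG0 : Integrable fun ξ : Rn n => Complex.exp (-b * ‖ξ‖ ^ 2) := by
    simpa using integrable_gaussian_mul hb (0 : Rn n)
  have hG : Integrable fun ξ : Rn n => Complex.exp (-b * ‖ξ‖ ^ 2) * fourier g (-ξ) := by
    refine hG0.mul_bdd (c := ∫ x, ‖g x‖) ?_ (ae_of_all _ fun ξ => norm_fourier_le g _)
    exact (hgc.comp continuous_neg).aestronglyMeasurable
  have h1 : ∀ x, fourier (fun ξ : Rn n => Complex.exp (-b * ‖ξ‖ ^ 2) * fourier g (-ξ)) x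
      = ∫ y, g y * ((Real.pi / b) ^ ((n : ℂ) / 2)
        * Complex.exp (-(‖x - y‖ ^ 2 / (4 * b)))) := by
    intro x
    calc fourier (fun ξ : Rn n => Complex.exp (-b * ‖ξ‖ ^ 2) * fourier g (-ξ)) x
        = ∫ ξ, fourier g (-ξ)
          * Complex.exp (-b * ‖-ξ‖ ^ 2 + Complex.I * ((inner ℝ x (-ξ) : ℝ) : ℂ)) := by
          rw [fourier]
          refine integral_congr_ae (ae_of_all _ fun ξ => ?_)
          simp only
          rw [← mul_assoc, ← Complex.exp_add, mul_comm, norm_neg, inner_neg_right]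
          congr 2
          push_cast
          ring
      _ = ∫ ξ, fourier g ξ
          * Complex.exp (-b * ‖ξ‖ ^ 2 + Complex.I * ((inner ℝ x ξ : ℝ) : ℂ)) :=
          integral_neg_eq_self (fun ξ : Rn n => fourier g ξ
            * Complex.exp (-b * ‖ξ‖ ^ 2 + Complex.I * ((inner ℝ x ξ : ℝ) : ℂ))) volume
      _ = ∫ y, g y * fourier (fun ξ : Rn n =>
            Complex.exp (-b * ‖ξ‖ ^ 2 + Complex.I * ((inner ℝ x ξ : ℝ) : ℂ))) y :=
          integral_fourier_mul_eq hg (integrable_gaussian_mul hb x)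
      _ = _ := by
          refine integral_congr_ae (ae_of_all _ fun y => ?_)
          simp only
          rw [fourier_gaussian_modulated hb]
  have hint : Integrable fun p : Rn n × Rn n =>
      f p.1 * g p.2 * Complex.exp (-(‖p.1 - p.2‖ ^ 2 / (4 * b))) := by
    refine (hf.mul_prod hg).mul_bdd (c := 1) (Continuous.aestronglyMeasurable (by fun_prop))
      (ae_of_all _ fun p => ?_)
    rw [Complex.norm_exp, Real.exp_le_one_iff, Complex.neg_re, neg_nonpos]
    have : ((‖p.1 - p.2‖ : ℂ) ^ 2 / (4 * b)) = ((‖p.1 - p.2‖ ^ 2 / 4 : ℝ) : ℂ) * b⁻¹ := by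
      push_cast; rw [div_eq_mul_inv, mul_inv]; ring
    rw [this, Complex.re_ofReal_mul, Complex.inv_re]
    have := Complex.normSq_nonneg b
    positivity
  calc ∫ ξ : Rn n, Complex.exp (-b * ‖ξ‖ ^ 2) * (fourier f ξ * fourier g (-ξ))
      = ∫ ξ, fourier f ξ * (Complex.exp (-b * ‖ξ‖ ^ 2) * fourier g (-ξ)) :=
        integral_congr_ae (ae_of_all _ fun ξ => by ring)
    _ = ∫ x, f x * ∫ y, g y * ((Real.pi / b) ^ ((n : ℂ) / 2)
        * Complex.exp (-(‖x - y‖ ^ 2 / (4 * b)))) := by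
        rw [integral_fourier_mul_eq hf hG]
        simp_rw [h1]
    _ = (Real.pi / b) ^ ((n : ℂ) / 2) * ∫ x, ∫ y, f x * g y
        * Complex.exp (-(‖x - y‖ ^ 2 / (4 * b))) := by
        rw [← integral_const_mul]
        refine integral_congr_ae (ae_of_all _ fun x => ?_)
        simp only
        rw [← integral_const_mul, ← integral_const_mul]
        exact integral_congr_ae (ae_of_all _ fun y => by ring)
    _ = _ := by
        rw [Measure.volume_eq_prod, ← integral_prod _ hint]

lemma norm_exp_neg_div_le_one {b : ℂ} (hb : 0 ≤ b.re) (r : ℝ) (hr : 0 ≤ r) :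
    ‖Complex.exp (-((r : ℂ) / (4 * b)))‖ ≤ 1 := by
  rw [Complex.norm_exp, Real.exp_le_one_iff, Complex.neg_re, neg_nonpos]
  have : ((r : ℂ) / (4 * b)) = ((r / 4 : ℝ) : ℂ) * b⁻¹ := by
    push_cast; rw [div_eq_mul_inv, mul_inv]; ring
  rw [this, Complex.re_ofReal_mul, Complex.inv_re]
  have := Complex.normSq_nonneg b
  positivity

lemma Nice.integrable_fourier_mul {f g : Rn n → ℂ} (hf : Nice f) (hg : Nice g) :
    Integrable fun ξ => fourier f ξ * fourier g (-ξ) :=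
  integrable_mul_of_memLp_two hf.memLp_fourier hg.memLp_fourier_neg

/-- The kernel of the Schrödinger group. -/
lemma schrodinger_form_eq {t : ℝ} (ht : 0 < t) {f g : Rn n → ℂ} (hf : Nice f) (hg : Nice g) :
    ∫ ξ : Rn n, Complex.exp (-(Complex.I * t) * ‖ξ‖ ^ 2) * (fourier f ξ * fourier g (-ξ))
      = (Real.pi / (Complex.I * t)) ^ ((n : ℂ) / 2)
        * ∫ p : Rn n × Rn n,
          f p.1 * g p.2 * Complex.exp (-(‖p.1 - p.2‖ ^ 2 / (4 * (Complex.I * t)))) := by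
  have htend : Tendsto (fun δ : ℝ => (δ : ℂ) + Complex.I * t) (𝓝[>] 0) (𝓝 (Complex.I * t)) := by
    have : Continuous fun δ : ℝ => (δ : ℂ) + Complex.I * t := by fun_prop
    have := this.tendsto 0
    rw [Complex.ofReal_zero, zero_add] at this
    exact this.mono_left nhdsWithin_le_nhds
  have hIt : Complex.I * t ≠ 0 := mul_ne_zero Complex.I_ne_zero (by exact_mod_cast ht.ne')
  have hre : ∀ δ : ℝ, ((δ : ℂ) + Complex.I * t).re = δ := by intro δ; simp
  have hL : Tendsto (fun δ : ℝ => ∫ ξ : Rn n, Complex.exp (-((δ : ℂ) + Complex.I * t) * ‖ξ‖ ^ 2)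
      * (fourier f ξ * fourier g (-ξ))) (𝓝[>] 0)
      (𝓝 (∫ ξ : Rn n, Complex.exp (-(Complex.I * t) * ‖ξ‖ ^ 2)
        * (fourier f ξ * fourier g (-ξ)))) := by
    refine tendsto_integral_filter_of_dominated_convergence
      (fun ξ => ‖fourier f ξ * fourier g (-ξ)‖) ?_ ?_ (hf.integrable_fourier_mul hg).norm ?_
    · exact Eventually.of_forall fun δ => AEStronglyMeasurable.mul
        (Continuous.aestronglyMeasurable (by fun_prop)) (hf.integrable_fourier_mul hg).1
    · filter_upwards [self_mem_nhdsWithin] with δ hδ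
      refine ae_of_all _ fun ξ => ?_
      rw [norm_mul]
      refine mul_le_of_le_one_left (norm_nonneg _) ?_
      rw [Complex.norm_exp, Real.exp_le_one_iff, ← Complex.ofReal_pow, Complex.re_mul_ofReal,
        Complex.neg_re, hre]
      have : (0 : ℝ) < δ := hδ
      have := mul_nonneg this.le (sq_nonneg ‖ξ‖)
      linarith
    · refine ae_of_all _ fun ξ => Tendsto.mul_const _ ?_
      exact (Complex.continuous_exp.tendsto _).comp ((htend.neg).mul_const _)
  have hR : Tendsto (fun δ : ℝ => (Real.pi / ((δ : ℂ) + Complex.I * t)) ^ ((n : ℂ) / 2)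
        * ∫ p : Rn n × Rn n, f p.1 * g p.2
          * Complex.exp (-(‖p.1 - p.2‖ ^ 2 / (4 * ((δ : ℂ) + Complex.I * t))))) (𝓝[>] 0)
      (𝓝 ((Real.pi / (Complex.I * t)) ^ ((n : ℂ) / 2)
        * ∫ p : Rn n × Rn n,
          f p.1 * g p.2 * Complex.exp (-(‖p.1 - p.2‖ ^ 2 / (4 * (Complex.I * t)))))) := by
    have hfg : Integrable fun p : Rn n × Rn n => f p.1 * g p.2 :=
      hf.integrable.mul_prod hg.integrable
    refine Tendsto.mul ?_ ?_
    -- π/(it) = -iπ/t is off the negative real axis, so the principal power is continuous there.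
    · refine ((tendsto_const_nhds.div htend hIt).cpow tendsto_const_nhds ?_)
      refine Or.inr ?_
      have : (Real.pi / (Complex.I * t) : ℂ) = ((-(Real.pi / t) : ℝ) : ℂ) * Complex.I := by
        have : (t : ℂ) ≠ 0 := by exact_mod_cast ht.ne'
        push_cast
        field_simp
        rw [Complex.I_sq]; ring
      rw [this]
      simp [ht.ne', Real.pi_ne_zero]
    · refine tendsto_integral_filter_of_dominated_convergence
        (fun p : Rn n × Rn n => ‖f p.1 * g p.2‖) ?_ ?_ hfg.norm ?_
      · exact Eventually.of_forall fun δ => AEStronglyMeasurable.mul hfg.1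
          (Continuous.aestronglyMeasurable (by fun_prop))
      · filter_upwards [self_mem_nhdsWithin] with δ hδ
        refine ae_of_all _ fun p => ?_
        rw [norm_mul]
        refine mul_le_of_le_one_right (norm_nonneg _) ?_
        have := norm_exp_neg_div_le_one (b := (δ : ℂ) + Complex.I * t)
          (by rw [hre]; exact le_of_lt hδ) (‖p.1 - p.2‖ ^ 2) (by positivity)
        simpa using this
      · refine ae_of_all _ fun p => Tendsto.const_mul _ ?_
        refine (Complex.continuous_exp.tendsto _).comp (Tendsto.neg ?_)
        exact tendsto_const_nhds.div (htend.const_mul 4) (mul_ne_zero (by norm_num) hIt)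
  refine tendsto_nhds_unique hL (hR.congr' ?_)
  filter_upwards [self_mem_nhdsWithin] with δ hδ
  exact (gaussian_form_eq (by rw [hre]; exact hδ) hf.integrable hg.integrable).symm

end Gaussian

end HelmholtzBR

namespace HelmholtzBR

variable {n : ℕ}

/-! ### The L¹ × L¹ bound on the line Re z = (n+1)/2 -/

section KernelBound

/-- The spectral parameters `w` for which the estimates are uniform. -/
def goodParam (w : ℂ) : Prop := 0 < w.re ∧ (|w.im| ≤ 1 / 2 ∨ 1 / 2 ≤ w.re)

/-- The integrand of the kernel of a complex power of the resolvent on the critical line. -/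
noncomputable def kerInt (y : ℝ) (w : ℂ) (r t : ℝ) : ℂ :=
  (t : ℂ) ^ (-(1 / 2 : ℂ) + y * Complex.I) * Complex.exp (-((w - Complex.I) * t))
    * Complex.exp (Complex.I * (r ^ 2 / (4 * t) : ℝ))

lemma norm_kerInt {y : ℝ} {w : ℂ} {r t : ℝ} (ht : 0 < t) :
    ‖kerInt y w r t‖ = t ^ ((1 / 2 : ℝ) - 1) * Real.exp (-(w.re * t)) := by
  rw [kerInt, norm_mul, norm_mul, Complex.norm_cpow_eq_rpow_re_of_pos ht, Complex.norm_exp,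
    Complex.norm_exp]
  have e1 : (-(1 / 2 : ℂ) + y * Complex.I).re = (1 / 2 : ℝ) - 1 := by
    simp; norm_num
  have e2 : (-((w - Complex.I) * t)).re = -(w.re * t) := by simp
  have e3 : (Complex.I * ((r ^ 2 / (4 * t) : ℝ) : ℂ)).re = 0 := by
    rw [Complex.re_mul_ofReal]; simp
  rw [e1, e2, e3, Real.exp_zero, mul_one]

/-- The substitution t = u² cancels the singularity t^{-1/2} against the Jacobian and produces the
phase with a² = 1 - Im w and b = r/2, the reason for requiring Im w ≤ 1. -/
lemma kerInt_sq {y : ℝ} {w : ℂ} {r u : ℝ} (hu : 0 < u) (hw : w.im ≤ 1) :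
    (2 * u) • kerInt y w r (u ^ 2) = 2 * oscInt (√(1 - w.im)) (r / 2) w.re y u := by
  have hu2 : (u : ℂ) ≠ 0 := by exact_mod_cast hu.ne'
  have e1 : ((u ^ 2 : ℝ) : ℂ) ^ (-(1 / 2 : ℂ) + y * Complex.I)
      = (u : ℂ)⁻¹ * Complex.exp (((2 * y * Real.log u : ℝ) : ℂ) * Complex.I) := by
    rw [Complex.cpow_def_of_ne_zero (by exact_mod_cast (by positivity : u ^ 2 ≠ 0)),
      ← Complex.ofReal_log (by positivity), Real.log_pow, mul_add, Complex.exp_add]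
    congr 1
    · have : ((((2 : ℕ) : ℝ) * Real.log u : ℝ) : ℂ) * -(1 / 2) = -(Real.log u : ℂ) := by
        push_cast; ring
      rw [this, Complex.exp_neg, ← Complex.ofReal_exp, Real.exp_log hu]
    · congr 1; push_cast; ring
  rw [kerInt, e1, oscInt, Complex.real_smul]
  have e2 : √(1 - w.im) ^ 2 = 1 - w.im := Real.sq_sqrt (by linarith)
  rw [e2]
  have e3 : (w : ℂ) = w.re + w.im * Complex.I := (Complex.re_add_im w).symm
  have e4 : -((w - Complex.I) * ((u ^ 2 : ℝ) : ℂ))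
      = ((-(w.re * u ^ 2) : ℝ) : ℂ) + (((1 - w.im) * u ^ 2 : ℝ) : ℂ) * Complex.I := by
    conv_lhs => rw [e3]
    push_cast; ring
  rw [e4]
  have e5 : Complex.I * ((r ^ 2 / (4 * u ^ 2) : ℝ) : ℂ)
      = (((r / 2) ^ 2 / u ^ 2 : ℝ) : ℂ) * Complex.I := by
    have : r ^ 2 / (4 * u ^ 2) = (r / 2) ^ 2 / u ^ 2 := by field_simp; ring
    rw [this, mul_comm]
  rw [e5]
  have e6 : ((2 * u : ℝ) : ℂ) * ((u : ℂ)⁻¹ * Complex.exp (((2 * y * Real.log u : ℝ) : ℂ) * Complex.I)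
      * Complex.exp (((-(w.re * u ^ 2) : ℝ) : ℂ) + (((1 - w.im) * u ^ 2 : ℝ) : ℂ) * Complex.I)
      * Complex.exp ((((r / 2) ^ 2 / u ^ 2 : ℝ) : ℂ) * Complex.I))
      = 2 * ((u : ℂ) * (u : ℂ)⁻¹) * (Complex.exp (((2 * y * Real.log u : ℝ) : ℂ) * Complex.I)
      * Complex.exp (((-(w.re * u ^ 2) : ℝ) : ℂ) + (((1 - w.im) * u ^ 2 : ℝ) : ℂ) * Complex.I)
      * Complex.exp ((((r / 2) ^ 2 / u ^ 2 : ℝ) : ℂ) * Complex.I)) := by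
    push_cast; ring
  rw [e6, mul_inv_cancel₀ hu2, mul_one, ← Complex.exp_add, ← Complex.exp_add]
  congr 2
  push_cast
  ring

/-- The two alternatives of `goodParam`: if |Im w| ≤ 1/2, the coefficient 1 - Im w is at least 1/2
and oscillation gives a bound independent of r and Re w; if Re w ≥ 1/2, the damping alone makes the
integral of t^{-1/2}e^{-t/2} suffice. -/
lemma norm_integral_kerInt_le {y : ℝ} {w : ℂ} {r : ℝ} (hw : goodParam w) (hr : 0 ≤ r) :
    ‖∫ t in Set.Ioi (0 : ℝ), kerInt y w r t‖ ≤ 28 * (1 + |y|) := by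
  obtain ⟨hη, h | h⟩ := hw
  · have him := abs_le.1 h
    have hcv := integral_comp_rpow_Ioi_of_pos (g := kerInt y w r) (p := 2) two_pos
    rw [← hcv]
    have : ∫ x in Set.Ioi (0 : ℝ), ((2 : ℝ) * x ^ ((2 : ℝ) - 1)) • kerInt y w r (x ^ (2 : ℝ))
        = ∫ x in Set.Ioi (0 : ℝ), 2 * oscInt (√(1 - w.im)) (r / 2) w.re y x := by
      refine setIntegral_congr_fun measurableSet_Ioi fun x hx => ?_
      rw [← kerInt_sq hx (by linarith), Real.rpow_two]
      norm_num
    rw [this, integral_const_mul, norm_mul]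
    have ha : (1 / 2 : ℝ) ≤ √(1 - w.im) := by
      apply Real.le_sqrt_of_sq_le; norm_num; linarith
    have key := norm_integral_oscInt_le (a := √(1 - w.im)) (b := r / 2) (η := w.re) (y := y)
      (by linarith) (by linarith) hη
    have h2 : (7 + 4 * |y|) / √(1 - w.im) ≤ (7 + 4 * |y|) / (1 / 2) := by gcongr
    have : ‖(2 : ℂ)‖ = 2 := by norm_num
    rw [this]
    have := abs_nonneg y
    linarith
  · have hi := integrableOn_laplace (a := 1 / 2) (η := 1 / 2) (by norm_num) (by norm_num)
    calc ‖∫ t in Set.Ioi (0 : ℝ), kerInt y w r t‖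
        ≤ ∫ t in Set.Ioi (0 : ℝ), t ^ ((1 / 2 : ℝ) - 1) * Real.exp (-((1 / 2) * t)) := by
          refine norm_integral_le_of_norm_le hi ?_
          filter_upwards [ae_restrict_mem measurableSet_Ioi] with t ht
          have ht' : (0 : ℝ) < t := ht
          rw [norm_kerInt ht]
          gcongr
      _ = (1 / 2) ^ (-(1 / 2 : ℝ)) * Real.Gamma (1 / 2) :=
          integral_rpow_mul_exp (by norm_num) (by norm_num)
      _ ≤ 2 * 2 := by
          gcongr
          · rw [Real.rpow_neg (by norm_num), ← Real.inv_rpow (by norm_num)]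
            norm_num
            calc (2 : ℝ) ^ (1 / 2 : ℝ) ≤ 2 ^ (1 : ℝ) :=
                  Real.rpow_le_rpow_of_exponent_le (by norm_num) (by norm_num)
              _ = 2 := Real.rpow_one 2
          · rw [Real.Gamma_one_half_eq]
            exact Real.sqrt_le_iff.2 ⟨by norm_num, by linarith [Real.pi_le_four]⟩
      _ ≤ 28 * (1 + |y|) := by linarith [abs_nonneg y]

/-- The power splits because the factor 1/t is a positive real. -/
lemma cpow_pi_div {t : ℝ} (ht : 0 < t) (a : ℂ) :
    (Real.pi / (Complex.I * t) : ℂ) ^ a = (Real.pi / Complex.I : ℂ) ^ a * (t : ℂ) ^ (-a) := by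
  have h0 : (Real.pi / Complex.I : ℂ) ≠ 0 :=
    div_ne_zero (by exact_mod_cast Real.pi_ne_zero) Complex.I_ne_zero
  have ht0 : (t : ℂ) ≠ 0 := by exact_mod_cast ht.ne'
  have h1 : (Real.pi / (Complex.I * t) : ℂ) = ((t⁻¹ : ℝ) : ℂ) * (Real.pi / Complex.I) := by
    push_cast; rw [div_mul_eq_div_div, div_eq_mul_inv _ (t : ℂ), mul_comm]
  have h2 : ((t⁻¹ : ℝ) : ℂ) * (Real.pi / Complex.I) ≠ 0 :=
    mul_ne_zero (by exact_mod_cast (inv_pos.2 ht).ne') h0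
  rw [h1, Complex.cpow_def_of_ne_zero h2, Complex.log_ofReal_mul (inv_pos.2 ht) h0,
    Complex.cpow_def_of_ne_zero h0, Complex.cpow_def_of_ne_zero ht0, ← Complex.exp_add,
    Real.log_inv, ← Complex.ofReal_log ht.le]
  congr 1
  push_cast
  ring

/-- Laplace representation of the symbol followed by Fubini: the form is a superposition over t > 0
of Schrödinger propagators, the constant -1 in |ξ|² - 1 becoming the factor e^{it}. -/
lemma gamma_mul_resForm_eq {z w : ℂ} (hz : 0 < z.re) (hw : 0 < w.re) {f g : Rn n → ℂ}
    (hf : Nice f) (hg : Nice g) :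
    Complex.Gamma z * resForm z w f g
      = ∫ t in Set.Ioi (0 : ℝ), (t : ℂ) ^ (z - 1) * Complex.exp (-((w - Complex.I) * t))
        * ∫ ξ : Rn n, Complex.exp (-(Complex.I * t) * ‖ξ‖ ^ 2)
          * (fourier f ξ * fourier g (-ξ)) := by
  set h : Rn n → ℂ := fun ξ => fourier f ξ * fourier g (-ξ)
  have hh : Integrable h := hf.integrable_fourier_mul hg
  have hint : Integrable (Function.uncurry fun (ξ : Rn n) (t : ℝ) =>
      (t : ℂ) ^ (z - 1) * Complex.exp (-((w + ((‖ξ‖ ^ 2 - 1 : ℝ) : ℂ) * Complex.I) * t)) * h ξ)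
      ((volume : Measure (Rn n)).prod (volume.restrict (Set.Ioi (0 : ℝ)))) := by
    have h1 := (hh.mul_prod (integrableOn_laplace_complex hz hw)).bdd_mul (c := 1)
      (f := fun p : Rn n × ℝ => Complex.exp (-(((‖p.1‖ ^ 2 - 1 : ℝ) : ℂ) * Complex.I * p.2)))
      (Continuous.aestronglyMeasurable (by fun_prop)) (ae_of_all _ fun p => by
        rw [Complex.norm_exp]
        simp [-Complex.ofReal_sub, -Complex.ofReal_pow])
    refine h1.congr (ae_of_all _ fun p => ?_)
    simp only [Function.uncurry_def]
    have : -((w + ((‖p.1‖ ^ 2 - 1 : ℝ) : ℂ) * Complex.I) * p.2)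
      = -(((‖p.1‖ ^ 2 - 1 : ℝ) : ℂ) * Complex.I * p.2) + -(w * p.2) := by ring
    rw [this, Complex.exp_add]
    ring
  calc Complex.Gamma z * resForm z w f g
      = ∫ ξ : Rn n, ∫ t in Set.Ioi (0 : ℝ), (t : ℂ) ^ (z - 1)
          * Complex.exp (-((w + ((‖ξ‖ ^ 2 - 1 : ℝ) : ℂ) * Complex.I) * t)) * h ξ := by
        rw [resForm, ← integral_const_mul]
        refine integral_congr_ae (ae_of_all _ fun ξ => ?_)
        simp only
        rw [integral_mul_const, ← gamma_mul_sym hz hw]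
        ring
    _ = ∫ t in Set.Ioi (0 : ℝ), ∫ ξ : Rn n, (t : ℂ) ^ (z - 1)
          * Complex.exp (-((w + ((‖ξ‖ ^ 2 - 1 : ℝ) : ℂ) * Complex.I) * t)) * h ξ :=
        integral_integral_swap hint
    _ = _ := by
        refine integral_congr_ae (ae_of_all _ fun t => ?_)
        simp only
        rw [← integral_const_mul]
        refine integral_congr_ae (ae_of_all _ fun ξ => ?_)
        simp only [h]
        have : -((w + ((‖ξ‖ ^ 2 - 1 : ℝ) : ℂ) * Complex.I) * t)
          = -((w - Complex.I) * t) + -(Complex.I * t) * ‖ξ‖ ^ 2 := by push_cast; ring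
        rw [this, Complex.exp_add]
        ring

/-- The constant in the dispersive endpoint estimate. -/
noncomputable def dispConst (n : ℕ) : ℝ := 28 * ‖(Real.pi / Complex.I : ℂ) ^ ((n : ℂ) / 2)‖

/-- The `L¹ → L^∞` estimate on the critical line. -/
lemma norm_gamma_mul_resForm_le {z w : ℂ} (hz : z.re = ((n : ℝ) + 1) / 2) (hw : goodParam w)
    {f g : Rn n → ℂ} (hf : Nice f) (hg : Nice g) :
    ‖Complex.Gamma z * resForm z w f g‖
      ≤ dispConst n * (1 + |z.im|) * (lpNorm f 1 volume * lpNorm g 1 volume) := by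
  have hz0 : 0 < z.re := by rw [hz]; positivity
  have hfg : Integrable fun p : Rn n × Rn n => f p.1 * g p.2 :=
    hf.integrable.mul_prod hg.integrable
  set c : ℂ := (Real.pi / Complex.I : ℂ) ^ ((n : ℂ) / 2)
  have hint : Integrable (Function.uncurry fun (t : ℝ) (p : Rn n × Rn n) =>
      f p.1 * g p.2 * kerInt z.im w ‖p.1 - p.2‖ t)
      ((volume.restrict (Set.Ioi (0 : ℝ))).prod (volume : Measure (Rn n × Rn n))) := by
    have hk : Integrable (fun t : ℝ => (t : ℂ) ^ (-(1 / 2 : ℂ) + z.im * Complex.I)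
        * Complex.exp (-((w - Complex.I) * t))) (volume.restrict (Set.Ioi (0 : ℝ))) := by
      have := integrableOn_laplace_complex (a := (1 / 2 : ℂ) + z.im * Complex.I)
        (w := w - Complex.I) (by simp) (by simpa using hw.1)
      refine this.congr (ae_of_all _ fun t => ?_)
      simp only
      congr 2
      ring
    have h1 := (hk.mul_prod hfg).bdd_mul (c := 1)
      (f := fun q : ℝ × (Rn n × Rn n) =>
        Complex.exp (Complex.I * ((‖q.2.1 - q.2.2‖ ^ 2 / (4 * q.1) : ℝ) : ℂ)))
      (Measurable.aestronglyMeasurable (by fun_prop)) (ae_of_all _ fun q => by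
        rw [Complex.norm_exp, Complex.re_mul_ofReal]
        simp)
    refine h1.congr (ae_of_all _ fun q => ?_)
    simp only [Function.uncurry_def, kerInt]
    ring
  have e1 : Complex.Gamma z * resForm z w f g
      = c * ∫ p : Rn n × Rn n, f p.1 * g p.2
        * ∫ t in Set.Ioi (0 : ℝ), kerInt z.im w ‖p.1 - p.2‖ t := by
    calc Complex.Gamma z * resForm z w f g
        = ∫ t in Set.Ioi (0 : ℝ), c * ∫ p : Rn n × Rn n,
            f p.1 * g p.2 * kerInt z.im w ‖p.1 - p.2‖ t := by
          rw [gamma_mul_resForm_eq hz0 hw.1 hf hg]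
          refine setIntegral_congr_fun measurableSet_Ioi fun t ht => ?_
          have ht' : (0 : ℝ) < t := ht
          have ht0 : (t : ℂ) ≠ 0 := by exact_mod_cast ht'.ne'
          rw [schrodinger_form_eq ht hf hg, cpow_pi_div ht, mul_assoc c, mul_left_comm _ c]
          congr 1
          rw [← mul_assoc, ← integral_const_mul]
          refine integral_congr_ae (ae_of_all _ fun p => ?_)
          simp only [kerInt]
          -- The propagator contributes t^{-n/2}, and on Re z = (n+1)/2 exactly the power t^{-1/2 +
          -- i Im z} of `kerInt` is left.
          have e2 : (t : ℂ) ^ (-(1 / 2 : ℂ) + z.im * Complex.I)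
              = (t : ℂ) ^ (z - 1) * (t : ℂ) ^ (-((n : ℂ) / 2)) := by
            rw [← Complex.cpow_add _ _ ht0]
            congr 1
            have : z = (((n : ℝ) + 1) / 2 : ℝ) + z.im * Complex.I := by
              rw [← hz]; exact (Complex.re_add_im z).symm
            conv_rhs => rw [this]
            push_cast
            ring
          have e3 : -((‖p.1 - p.2‖ : ℂ) ^ 2 / (4 * (Complex.I * t)))
              = Complex.I * ((‖p.1 - p.2‖ ^ 2 / (4 * t) : ℝ) : ℂ) := by
            push_cast
            field_simp
            rw [Complex.I_sq]
            ring
          rw [e2, e3]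
          ring
      _ = c * ∫ t in Set.Ioi (0 : ℝ), ∫ p : Rn n × Rn n,
            f p.1 * g p.2 * kerInt z.im w ‖p.1 - p.2‖ t := integral_const_mul _ _
      _ = c * ∫ p : Rn n × Rn n, ∫ t in Set.Ioi (0 : ℝ),
            f p.1 * g p.2 * kerInt z.im w ‖p.1 - p.2‖ t := by
          rw [integral_integral_swap hint]
      _ = _ := by
          congr 1
          exact integral_congr_ae (ae_of_all _ fun p => integral_const_mul _ _)
  have e2 : ∫ p : Rn n × Rn n, ‖f p.1 * g p.2‖ = lpNorm f 1 volume * lpNorm g 1 volume := by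
    rw [lpNorm_one_eq_integral_norm hf.one.1, lpNorm_one_eq_integral_norm hg.one.1]
    simp only [norm_mul]
    exact integral_prod_mul (fun x => ‖f x‖) fun y => ‖g y‖
  rw [e1, norm_mul]
  calc ‖c‖ * ‖∫ p : Rn n × Rn n, f p.1 * g p.2
        * ∫ t in Set.Ioi (0 : ℝ), kerInt z.im w ‖p.1 - p.2‖ t‖
      ≤ ‖c‖ * ∫ p : Rn n × Rn n, ‖f p.1 * g p.2‖ * (28 * (1 + |z.im|)) := by
        gcongr
        refine norm_integral_le_of_norm_le (hfg.norm.mul_const _) (ae_of_all _ fun p => ?_)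
        rw [norm_mul]
        gcongr
        exact norm_integral_kerInt_le hw (norm_nonneg _)
    _ = _ := by
        rw [integral_mul_const, e2, dispConst]
        ring

end KernelBound

end HelmholtzBR

namespace HelmholtzBR

variable {n : ℕ}

/-! ### Three lines theorem and holomorphic families on strips -/

section Strip

/-- Analytic functions of exponential growth on a closed vertical strip. -/
structure StripFun (a b k : ℝ) (Ψ : ℂ → ℂ) : Prop where
  diff : DiffContOnCl ℂ Ψ (Complex.re ⁻¹' Set.Ioo a b)
  growth : ∃ M, ∀ z : ℂ, a ≤ z.re → z.re ≤ b → ‖Ψ z‖ ≤ M * Real.exp (k * |z.im|)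

lemma StripFun.const (a b : ℝ) (c : ℂ) : StripFun a b 0 fun _ => c :=
  ⟨diffContOnCl_const, ‖c‖, fun z _ _ => by simp⟩

lemma closure_strip_subset (a b : ℝ) :
    closure (Complex.re ⁻¹' Set.Ioo a b) ⊆ Complex.re ⁻¹' Set.Icc a b :=
  closure_minimal (Set.preimage_mono Set.Ioo_subset_Icc_self)
    (isClosed_Icc.preimage Complex.continuous_re)

lemma StripFun.congr {a b k : ℝ} {Φ Ψ : ℂ → ℂ} (hΦ : StripFun a b k Φ)
    (h : ∀ z : ℂ, a ≤ z.re → z.re ≤ b → Ψ z = Φ z) : StripFun a b k Ψ := by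
  obtain ⟨M, hM⟩ := hΦ.growth
  refine ⟨⟨hΦ.diff.1.congr fun z hz => h z hz.1.le hz.2.le, hΦ.diff.2.congr fun z hz => ?_⟩, M,
    fun z h1 h2 => ?_⟩
  · have := closure_strip_subset a b hz
    exact h z this.1 this.2
  · rw [h z h1 h2]
    exact hM z h1 h2

lemma StripFun.add {a b k : ℝ} {Φ Ψ : ℂ → ℂ} (hΦ : StripFun a b k Φ) (hΨ : StripFun a b k Ψ) :
    StripFun a b k fun z => Φ z + Ψ z := by
  obtain ⟨M, hM⟩ := hΦ.growth
  obtain ⟨M', hM'⟩ := hΨ.growth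
  refine ⟨hΦ.diff.add hΨ.diff, M + M', fun z h1 h2 => ?_⟩
  rw [add_mul]
  exact (norm_add_le _ _).trans (add_le_add (hM z h1 h2) (hM' z h1 h2))

lemma StripFun.mul {a b k l : ℝ} {Φ Ψ : ℂ → ℂ} (hΦ : StripFun a b k Φ) (hΨ : StripFun a b l Ψ) :
    StripFun a b (k + l) fun z => Φ z * Ψ z := by
  obtain ⟨M, hM⟩ := hΦ.growth
  obtain ⟨M', hM'⟩ := hΨ.growth
  refine ⟨hΦ.diff.smul hΨ.diff, M * M', fun z h1 h2 => ?_⟩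
  rw [norm_mul, add_mul, Real.exp_add]
  calc ‖Φ z‖ * ‖Ψ z‖ ≤ (M * Real.exp (k * |z.im|)) * (M' * Real.exp (l * |z.im|)) :=
        mul_le_mul (hM z h1 h2) (hM' z h1 h2) (norm_nonneg _)
          ((norm_nonneg _).trans (hM z h1 h2))
    _ = _ := by ring

lemma StripFun.sum {a b k : ℝ} {ι : Type*} (t : Finset ι) {Φ : ι → ℂ → ℂ}
    (hΦ : ∀ i ∈ t, StripFun a b k (Φ i)) : StripFun a b k fun z => ∑ i ∈ t, Φ i z := by
  classical
  induction t using Finset.induction_on with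
  | empty =>
    refine ⟨by simpa using diffContOnCl_const, 0, fun z _ _ => by simp⟩
  | insert i t hi ih =>
    simp only [Finset.sum_insert hi]
    exact (hΦ i (Finset.mem_insert_self i t)).add
      (ih fun j hj => hΦ j (Finset.mem_insert_of_mem hj))

/-- The three lines theorem for functions of exponential growth. -/
lemma three_lines {a b k A : ℝ} (hk : 0 ≤ k) (hab : a < b) {Ψ : ℂ → ℂ} (hΨ : StripFun a b k Ψ)
    (hA : 0 ≤ A) (ha : ∀ z : ℂ, z.re = a → ‖Ψ z‖ ≤ A * Real.exp (k * |z.im|))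
    (hb : ∀ z : ℂ, z.re = b → ‖Ψ z‖ ≤ A * Real.exp (k * |z.im|)) {z₀ : ℂ} (h1 : a ≤ z₀.re)
    (h2 : z₀.re ≤ b) :
    ‖Ψ z₀‖ ≤ A * Real.exp ((b - a) ^ 2 + k ^ 2 / 4) * Real.exp (k * |z₀.im|) := by
  obtain ⟨M, hM⟩ := hΨ.growth
  -- The factor e^{(z-z₀)²} is 1 at z₀ and decays like e^{-(Im z - Im z₀)²} on vertical lines. It
  -- absorbs e^{k|Im z|} at the cost k²/4, found by completing the square.
  set G : ℂ → ℂ := fun z => Ψ z * Complex.exp ((z - z₀) ^ 2)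
  have hexp : ∀ z : ℂ, a ≤ z.re → z.re ≤ b → Real.exp (k * |z.im|) * ‖Complex.exp ((z - z₀) ^ 2)‖
      ≤ Real.exp ((b - a) ^ 2 + k ^ 2 / 4) * Real.exp (k * |z₀.im|) := by
    intro z hz1 hz2
    rw [Complex.norm_exp, ← Real.exp_add, ← Real.exp_add, Real.exp_le_exp]
    have e : ((z - z₀) ^ 2).re = (z.re - z₀.re) ^ 2 - (z.im - z₀.im) ^ 2 := by
      rw [sq, Complex.mul_re, Complex.sub_re, Complex.sub_im]; ring
    rw [e]
    have t1 : |z.im| ≤ |z₀.im| + |z.im - z₀.im| := by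
      have := abs_add_le z₀.im (z.im - z₀.im)
      rwa [add_sub_cancel] at this
    have t2 : (z.re - z₀.re) ^ 2 ≤ (b - a) ^ 2 := by
      apply sq_le_sq'  <;> linarith
    have t3 : k * |z.im - z₀.im| - (z.im - z₀.im) ^ 2 ≤ k ^ 2 / 4 := by
      rw [← sq_abs (z.im - z₀.im)]
      nlinarith [sq_nonneg (k / 2 - |z.im - z₀.im|)]
    nlinarith [mul_le_mul_of_nonneg_left t1 hk]
  have hGb : ∀ (B : ℝ) (z : ℂ), a ≤ z.re → z.re ≤ b → 0 ≤ B → ‖Ψ z‖ ≤ B * Real.exp (k * |z.im|) →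
      ‖G z‖ ≤ B * (Real.exp ((b - a) ^ 2 + k ^ 2 / 4) * Real.exp (k * |z₀.im|)) := by
    intro B z hz1 hz2 hB hle
    simp only [G]
    rw [norm_mul]
    calc ‖Ψ z‖ * ‖Complex.exp ((z - z₀) ^ 2)‖
        ≤ B * Real.exp (k * |z.im|) * ‖Complex.exp ((z - z₀) ^ 2)‖ := by gcongr
      _ = B * (Real.exp (k * |z.im|) * ‖Complex.exp ((z - z₀) ^ 2)‖) := by ring
      _ ≤ _ := mul_le_mul_of_nonneg_left (hexp z hz1 hz2) hB
  have hM0 : 0 ≤ M := by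
    have := (norm_nonneg _).trans (hM z₀ h1 h2)
    exact nonneg_of_mul_nonneg_left this (Real.exp_pos _)
  have hG : DiffContOnCl ℂ G (Complex.re ⁻¹' Set.Ioo a b) := by
    refine hΨ.diff.smul (Differentiable.diffContOnCl ?_)
    fun_prop
  have key := PhragmenLindelof.vertical_strip (f := G) (a := a) (b := b) (z := z₀)
    (C := A * (Real.exp ((b - a) ^ 2 + k ^ 2 / 4) * Real.exp (k * |z₀.im|))) hG ?_ ?_ ?_ h1 h2
  · have : G z₀ = Ψ z₀ := by simp [G]
    rw [this] at key
    linarith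
  · refine ⟨0, div_pos Real.pi_pos (by linarith), 0, ?_⟩
    refine Asymptotics.IsBigO.of_bound
      (M * (Real.exp ((b - a) ^ 2 + k ^ 2 / 4) * Real.exp (k * |z₀.im|))) ?_
    refine Filter.eventually_inf_principal.2 (Eventually.of_forall fun z hz => ?_)
    have hz' : a < z.re ∧ z.re < b := hz
    simpa using hGb M z hz'.1.le hz'.2.le hM0 (hM z hz'.1.le hz'.2.le)
  · exact fun z hz => hGb A z hz.ge (by linarith) hA (ha z hz)
  · exact fun z hz => hGb A z (by linarith) hz.le hA (hb z hz)

/-- Integrals of holomorphic families with a uniform integrable bound are holomorphic. -/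
lemma differentiableAt_integral_of_bound {X : Type*} [MeasurableSpace X] {μ : Measure X}
    {F : ℂ → X → ℂ} {z₀ : ℂ} {r : ℝ} (hr : 0 < r) {bound : X → ℝ} (hbound : Integrable bound μ)
    (hmeas : ∀ z ∈ Metric.ball z₀ (2 * r), AEStronglyMeasurable (F z) μ)
    (hd : ∀ᵐ x ∂μ, DifferentiableOn ℂ (fun z => F z x) (Metric.ball z₀ (2 * r)))
    (hle : ∀ᵐ x ∂μ, ∀ z ∈ Metric.ball z₀ (2 * r), ‖F z x‖ ≤ bound x) :
    DifferentiableAt ℂ (fun z => ∫ x, F z x ∂μ) z₀ := by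
  have hz₀ : z₀ ∈ Metric.ball z₀ (2 * r) := Metric.mem_ball_self (by linarith)
  have hderiv : ∀ᵐ x ∂μ, ∀ z ∈ Metric.ball z₀ r,
      HasDerivAt (fun z => F z x) (deriv (fun z => F z x) z) z := by
    filter_upwards [hd] with x hx z hz
    refine (hx.differentiableAt (Metric.isOpen_ball.mem_nhds ?_)).hasDerivAt
    exact Metric.ball_subset_ball (by linarith) hz
  -- The derivative is an almost everywhere limit of difference quotients along a sequence, hence
  -- measurable.
  have hmeas' : AEStronglyMeasurable (fun x => deriv (fun z => F z x) z₀) μ := by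
    have hseq : Tendsto (fun k : ℕ => z₀ + (r / ((k : ℝ) + 1) : ℝ)) atTop (𝓝[≠] z₀) := by
      refine tendsto_nhdsWithin_iff.2 ⟨?_, Eventually.of_forall fun k => ?_⟩
      · have h1 : Tendsto (fun k : ℕ => r / ((k : ℝ) + 1)) atTop (𝓝 0) := by
          have := (tendsto_one_div_add_atTop_nhds_zero_nat (𝕜 := ℝ)).const_mul r
          simpa [mul_one_div, div_eq_mul_inv] using this
        have h2 := ((Complex.continuous_ofReal.tendsto 0).comp h1).const_add z₀
        simpa [Function.comp_def] using h2
      · have : (0 : ℝ) < r / ((k : ℝ) + 1) := by positivity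
        simp only [Set.mem_compl_iff, Set.mem_singleton_iff, add_eq_left]
        exact_mod_cast this.ne'
    refine aestronglyMeasurable_of_tendsto_ae atTop
      (f := fun (k : ℕ) x => slope (fun z => F z x) z₀ (z₀ + (r / ((k : ℝ) + 1) : ℝ))) ?_ ?_
    · intro k
      simp only [slope_def_module, smul_eq_mul]
      refine AEStronglyMeasurable.const_mul ((hmeas _ ?_).sub (hmeas _ hz₀)) _
      rw [mem_ball_iff_norm, add_sub_cancel_left, Complex.norm_real, Real.norm_of_nonneg (by positivity)]
      calc r / ((k : ℝ) + 1) ≤ r := div_le_self hr.le (by linarith [Nat.cast_nonneg (α := ℝ) k])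
        _ < 2 * r := by linarith
    · filter_upwards [hderiv] with x hx
      exact (hasDerivAt_iff_tendsto_slope.1 (hx z₀ (Metric.mem_ball_self hr))).comp hseq
  refine (hasDerivAt_integral_of_dominated_loc_of_deriv_le (𝕜 := ℂ) (μ := μ) (F := F)
    (F' := fun z x => deriv (fun z => F z x) z) (x₀ := z₀) (s := Metric.ball z₀ r)
    (bound := fun x => bound x / (r / 2)) (Metric.ball_mem_nhds _ hr) ?_ ?_ hmeas' ?_
    (hbound.div_const _) hderiv).2.differentiableAt
  · filter_upwards [Metric.ball_mem_nhds z₀ (show 0 < 2 * r by linarith)] with z hz using hmeas z hz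
  · exact Integrable.mono' hbound (hmeas _ hz₀) (by filter_upwards [hle] with x hx using hx z₀ hz₀)
  · filter_upwards [hle, hd] with x hx hdx z hz
    -- Cauchy's estimate on circles of radius r/2 converts the bound on F into one on its
    -- derivative.
    have hsub : Metric.closedBall z (r / 2) ⊆ Metric.ball z₀ (2 * r) := by
      intro v hv
      rw [Metric.mem_closedBall] at hv
      rw [Metric.mem_ball] at hz ⊢
      linarith [dist_triangle v z z₀]
    refine Complex.norm_deriv_le_of_forall_mem_sphere_norm_le (by linarith) ?_ fun v hv =>
      hx v (hsub (Metric.sphere_subset_closedBall hv))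
    exact (hdx.mono hsub).diffContOnCl_ball subset_rfl

lemma differentiable_sym {w : ℂ} (hw : 0 < w.re) (s : ℝ) : Differentiable ℂ fun z => sym z w s := by
  intro z
  unfold sym
  exact (differentiableAt_id.neg).const_cpow (Or.inl (base_ne_zero hw))

lemma rpow_neg_le_of_mem {η x b : ℝ} (hη : 0 < η) (hx : 0 ≤ x) (hxb : x ≤ b) :
    η ^ (-x) ≤ 1 + η ^ (-b) := by
  rcases le_total 1 η with h | h
  · have := Real.rpow_le_one_of_one_le_of_nonpos h (neg_nonpos.2 hx)
    have := Real.rpow_pos_of_pos hη (-b)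
    linarith
  · have := Real.rpow_le_rpow_of_exponent_ge hη h (neg_le_neg hxb)
    linarith

/-- Integrals of the symbol against an integrable function, as functions of the exponent. -/
lemma stripFun_integral_sym {X : Type*} [MeasurableSpace X] {μ : Measure X} {b : ℝ} {w : ℂ}
    (hw : 0 < w.re) {s : X → ℝ} (hs : Measurable s) {h : X → ℂ} (hh : Integrable h μ) :
    StripFun 0 b 2 fun z => ∫ x, sym z w (s x) * h x ∂μ := by
  have hmeas : ∀ z, AEStronglyMeasurable (fun x => sym z w (s x) * h x) μ := fun z =>
    ((continuous_sym z hw).measurable.comp hs).aestronglyMeasurable.mul hh.1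
  have hle : ∀ (B : ℝ) (z : ℂ), 0 ≤ z.re → z.re ≤ B → ∀ x,
      ‖sym z w (s x) * h x‖ ≤ (1 + w.re ^ (-B)) * Real.exp (2 * |z.im|) * ‖h x‖ := by
    intro B z h0 h1 x
    rw [norm_mul]
    gcongr
    refine (norm_sym_le_of_re_nonneg hw h0).trans ?_
    gcongr
    exact rpow_neg_le_of_mem hw h0 h1
  refine ⟨⟨?_, ?_⟩, (1 + w.re ^ (-b)) * ∫ x, ‖h x‖ ∂μ, ?_⟩
  · intro z hz
    have hz' : 0 < z.re ∧ z.re < b := hz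
    refine (differentiableAt_integral_of_bound (r := z.re / 2) (by linarith)
      (bound := fun x => (1 + w.re ^ (-(2 * z.re))) * Real.exp (2 * (|z.im| + z.re)) * ‖h x‖)
      (hh.norm.const_mul _) (fun v _ => hmeas v) (ae_of_all _ fun x v _ =>
        ((differentiable_sym hw (s x)).mul_const _ v).differentiableWithinAt)
      (ae_of_all _ fun x v hv => ?_)).differentiableWithinAt
    have hv' : ‖v - z‖ < z.re := by
      have := mem_ball_iff_norm.1 hv; linarith
    have h1 := (Complex.abs_re_le_norm (v - z)).trans_lt hv'
    have h2 := (Complex.abs_im_le_norm (v - z)).trans_lt hv'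
    rw [Complex.sub_re, abs_lt] at h1
    rw [Complex.sub_im] at h2
    have h3 : |v.im| ≤ |z.im| + z.re := by
      have := abs_add_le z.im (v.im - z.im)
      rw [add_sub_cancel] at this
      linarith
    refine (hle (2 * z.re) v (by linarith) (by linarith) x).trans ?_
    gcongr
  · refine ContinuousOn.mono (fun z hz => ?_) (closure_strip_subset 0 b)
    refine continuousWithinAt_of_dominated
      (bound := fun x => (1 + w.re ^ (-b)) * Real.exp (2 * (|z.im| + 1)) * ‖h x‖)
      (Eventually.of_forall fun v => hmeas v) ?_ (hh.norm.const_mul _)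
      (ae_of_all _ fun x => ((differentiable_sym hw (s x)).mul_const _
        ).continuous.continuousWithinAt)
    filter_upwards [self_mem_nhdsWithin, mem_nhdsWithin_of_mem_nhds (Metric.ball_mem_nhds z one_pos)]
      with v hv hv1
    refine ae_of_all _ fun x => (hle b v hv.1 hv.2 x).trans ?_
    have h2 := (Complex.abs_im_le_norm (v - z)).trans_lt (mem_ball_iff_norm.1 hv1)
    rw [Complex.sub_im] at h2
    have h3 : |v.im| ≤ |z.im| + 1 := by
      have := abs_add_le z.im (v.im - z.im)
      rw [add_sub_cancel] at this
      linarith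
    gcongr
  · intro z h0 h1
    calc ‖∫ x, sym z w (s x) * h x ∂μ‖
        ≤ ∫ x, (1 + w.re ^ (-b)) * Real.exp (2 * |z.im|) * ‖h x‖ ∂μ :=
          norm_integral_le_of_norm_le (hh.norm.const_mul _) (ae_of_all _ (hle b z h0 h1))
      _ = _ := by rw [integral_const_mul]; ring

lemma norm_Gamma_le {z : ℂ} (hz : 0 < z.re) : ‖Complex.Gamma z‖ ≤ Real.Gamma z.re := by
  rw [Complex.Gamma_eq_integral hz, Complex.GammaIntegral, Real.Gamma_eq_integral hz]
  refine norm_integral_le_of_norm_le (Real.GammaIntegral_convergent hz) ?_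
  filter_upwards [ae_restrict_mem measurableSet_Ioi] with t ht
  rw [norm_mul, Complex.norm_cpow_eq_rpow_re_of_pos ht, Complex.norm_real,
    Real.norm_of_nonneg (Real.exp_pos _).le]
  simp

/-- Γ(z+1) replaces Γ(z) so that no pole lies on Re z = 0. Since |Γ(z+1)| ≤ Γ(Re z + 1), the factor
is bounded on the strip and costs no exponential growth. -/
lemma stripFun_Gamma_add_one {a b : ℝ} (ha : 0 ≤ a) :
    StripFun a b 0 fun z => Complex.Gamma (z + 1) := by
  have hd : ∀ z : ℂ, a ≤ z.re → DifferentiableAt ℂ (fun z => Complex.Gamma (z + 1)) z := by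
    intro z hz
    refine (Complex.differentiableAt_Gamma _ fun m hm => ?_).comp z (by fun_prop)
    have := congrArg Complex.re hm
    simp at this
    have : (0 : ℝ) ≤ m := Nat.cast_nonneg m
    linarith
  have hcomp : ContinuousOn (fun x : ℝ => Real.Gamma (x + 1)) (Set.Icc a b) := by
    intro x hx
    refine ContinuousAt.continuousWithinAt ?_
    refine ContinuousAt.comp (g := Real.Gamma) (f := fun x : ℝ => x + 1) ?_ (by fun_prop)
    refine (Real.differentiableAt_Gamma fun m hm => ?_).continuousAt
    have : (0 : ℝ) ≤ m := Nat.cast_nonneg m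
    linarith [hx.1]
  obtain ⟨M, hM⟩ := isCompact_Icc.exists_bound_of_continuousOn hcomp
  refine ⟨⟨fun z hz => (hd z (le_of_lt hz.1)).differentiableWithinAt, fun z hz =>
    (hd z (closure_strip_subset a b hz).1).continuousAt.continuousWithinAt⟩, M, fun z h1 h2 => ?_⟩
  have := hM z.re ⟨h1, h2⟩
  rw [zero_mul, Real.exp_zero, mul_one]
  have h3 := norm_Gamma_le (z := z + 1) (by simp; linarith)
  simp only [Complex.add_re, Complex.one_re] at h3
  exact h3.trans ((le_abs_self _).trans this)

end Strip

end HelmholtzBR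

namespace HelmholtzBR

variable {n : ℕ}

/-! ### Stein interpolation, first on simple functions -/

section Stein

/-- The power `|c|^e` carrying the phase of `c`. -/
noncomputable def phasePow (e c : ℂ) : ℂ := if c = 0 then 0 else c * (‖c‖ : ℂ) ^ (e - 1)

lemma phasePow_zero (e : ℂ) : phasePow e 0 = 0 := if_pos rfl

lemma phasePow_one (c : ℂ) : phasePow 1 c = c := by
  unfold phasePow
  split_ifs with h
  · exact h.symm
  · simp

lemma norm_phasePow {e c : ℂ} (he : 0 < e.re) : ‖phasePow e c‖ = ‖c‖ ^ e.re := by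
  unfold phasePow
  split_ifs with h
  · rw [h, norm_zero, Real.zero_rpow he.ne']
  · have hc : 0 < ‖c‖ := norm_pos_iff.2 h
    rw [norm_mul, Complex.norm_cpow_eq_rpow_re_of_pos hc, Complex.sub_re, Complex.one_re,
      Real.rpow_sub_one hc.ne', mul_div_cancel₀ _ hc.ne']

lemma stripFun_phasePow {a b m M : ℝ} {e : ℂ → ℂ} (he : Differentiable ℂ e) (hm : 0 < m)
    (h : ∀ z : ℂ, a ≤ z.re → z.re ≤ b → m ≤ (e z).re ∧ (e z).re ≤ M) (c : ℂ) :
    StripFun a b 0 fun z => phasePow (e z) c := by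
  by_cases hc : c = 0
  · subst hc
    simpa [phasePow_zero] using StripFun.const a b 0
  have hc' : 0 < ‖c‖ := norm_pos_iff.2 hc
  have hd : Differentiable ℂ fun z => phasePow (e z) c := by
    simp only [phasePow, if_neg hc]
    refine Differentiable.const_mul (fun z => ?_) _
    exact ((he z).sub_const 1).const_cpow (Or.inl (by exact_mod_cast hc'.ne'))
  refine ⟨hd.diffContOnCl, ‖c‖ ^ m + ‖c‖ ^ M, fun z h1 h2 => ?_⟩
  obtain ⟨h3, h4⟩ := h z h1 h2
  rw [norm_phasePow (hm.trans_le h3), zero_mul, Real.exp_zero, mul_one]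
  rcases le_total 1 ‖c‖ with h5 | h5
  · have := Real.rpow_le_rpow_of_exponent_le h5 h4
    have := Real.rpow_nonneg hc'.le m
    linarith
  · have := Real.rpow_le_rpow_of_exponent_ge hc' h5 h3
    have := Real.rpow_nonneg hc'.le M
    linarith

/-- Linearity on `L¹ ∩ L²`. -/
structure NiceLinear (ℓ : (Rn n → ℂ) → ℂ) : Prop where
  add : ∀ f g, Nice f → Nice g → ℓ (fun x => f x + g x) = ℓ f + ℓ g
  const_mul : ∀ c f, Nice f → ℓ (fun x => c * f x) = c * ℓ f

lemma Nice.zero : Nice (fun _ : Rn n => (0 : ℂ)) := ⟨MemLp.zero', MemLp.zero'⟩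

lemma Nice.sum {ι : Type*} (t : Finset ι) {f : ι → Rn n → ℂ} (hf : ∀ i ∈ t, Nice (f i)) :
    Nice fun x => ∑ i ∈ t, f i x :=
  ⟨memLp_finsetSum _ fun i hi => (hf i hi).one, memLp_finsetSum _ fun i hi => (hf i hi).two⟩

lemma NiceLinear.sum {ℓ : (Rn n → ℂ) → ℂ} (hℓ : NiceLinear ℓ) {ι : Type*} (t : Finset ι)
    (c : ι → ℂ) {f : ι → Rn n → ℂ} (hf : ∀ i ∈ t, Nice (f i)) :
    ℓ (fun x => ∑ i ∈ t, c i * f i x) = ∑ i ∈ t, c i * ℓ (f i) := by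
  classical
  induction t using Finset.induction_on with
  | empty => simpa using hℓ.const_mul 0 _ (Nice.zero (n := n))
  | insert i t hi ih =>
    have h1 := hf i (Finset.mem_insert_self i t)
    have h2 : ∀ j ∈ t, Nice (f j) := fun j hj => hf j (Finset.mem_insert_of_mem hj)
    simp only [Finset.sum_insert hi]
    rw [hℓ.add _ _ (h1.const_mul _) (Nice.sum t fun j hj => (h2 j hj).const_mul _),
      hℓ.const_mul _ _ h1, ih h2]

lemma NiceLinear.sub {ℓ : (Rn n → ℂ) → ℂ} (hℓ : NiceLinear ℓ) {f g : Rn n → ℂ} (hf : Nice f)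
    (hg : Nice g) : ℓ (fun x => f x - g x) = ℓ f - ℓ g := by
  have h1 := hℓ.add f _ hf (hg.const_mul (-1))
  rw [hℓ.const_mul _ _ hg] at h1
  simpa [sub_eq_add_neg] using h1

lemma SimpleFunc_memLp {g : SimpleFunc (Rn n) ℂ} (hg : Integrable g) (p : ℝ≥0∞) :
    MemLp g p volume := by
  refine SimpleFunc.memLp_of_finite_measure_preimage p fun y hy => ?_
  exact SimpleFunc.measure_preimage_lt_top_of_integrable g hg hy

lemma SimpleFunc_nice {g : SimpleFunc (Rn n) ℂ} (hg : Integrable g) : Nice g :=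
  ⟨SimpleFunc_memLp hg 1, SimpleFunc_memLp hg 2⟩

/-- The indicator functions of the level sets of a simple function. -/
noncomputable def levelInd (g : SimpleFunc (Rn n) ℂ) (y : ℂ) : Rn n → ℂ :=
  (g ⁻¹' {y}).indicator fun _ => 1

lemma levelInd_nice {g : SimpleFunc (Rn n) ℂ} (hg : Integrable g) {y : ℂ} (hy : y ≠ 0) :
    Nice (levelInd g y) := by
  have h := SimpleFunc.measure_preimage_lt_top_of_integrable g hg hy
  exact ⟨memLp_indicator_const _ (g.measurableSet_preimage _) _ (Or.inr h.ne),
    memLp_indicator_const _ (g.measurableSet_preimage _) _ (Or.inr h.ne)⟩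

/-- A simple function has finitely many values, so its complex power is a finite combination of
fixed indicators with coefficients holomorphic in the exponent. Holomorphy of the interpolated
function thus reduces to that of the family on fixed functions. -/
lemma phasePow_comp_eq_sum (g : SimpleFunc (Rn n) ℂ) (e : ℂ) :
    (fun x => phasePow e (g x))
      = fun x => ∑ y ∈ g.range.filter (· ≠ 0), phasePow e y * levelInd g y x := by
  funext x
  by_cases hx : g x = 0
  · rw [hx, phasePow_zero]
    refine (Finset.sum_eq_zero fun y hy => ?_).symm
    have : g x ≠ y := by rw [hx]; exact (Finset.mem_filter.1 hy).2.symm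
    simp [levelInd, this]
  · rw [Finset.sum_eq_single (g x)]
    · simp [levelInd]
    · intro y _ hy
      simp [levelInd, hy.symm]
    · intro h
      exact absurd (Finset.mem_filter.2 ⟨SimpleFunc.mem_range_self g x, hx⟩) h

lemma phasePow_comp_nice {g : SimpleFunc (Rn n) ℂ} (hg : Integrable g) (e : ℂ) :
    Nice fun x => phasePow e (g x) := by
  rw [phasePow_comp_eq_sum]
  exact Nice.sum _ fun y hy => (levelInd_nice hg (Finset.mem_filter.1 hy).2).const_mul _

/-- The power has modulus |g|^{r/r₀}, whose r₀-th power is |g|^r; the imaginary part of the exponent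
is invisible. -/
lemma lpNorm_phasePow_le_one {g : SimpleFunc (Rn n) ℂ} (hg : Integrable g) {e : ℂ} {r r₀ : ℝ}
    (hr : 0 < r) (hr₀ : 0 < r₀) (he : e.re = r / r₀)
    (hg1 : lpNorm g (ENNReal.ofReal r) volume ≤ 1) :
    lpNorm (fun x => phasePow e (g x)) (ENNReal.ofReal r₀) volume ≤ 1 := by
  have he0 : 0 < e.re := by rw [he]; positivity
  have hm := (phasePow_comp_nice hg e).one.1
  have hrm := SimpleFunc_memLp hg (ENNReal.ofReal r)
  rw [← toReal_eLpNorm hm]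
  have h1 : eLpNorm (fun x => phasePow e (g x)) (ENNReal.ofReal r₀) volume
      = eLpNorm (fun x => ‖g x‖ ^ e.re) (ENNReal.ofReal r₀) volume := by
    refine eLpNorm_congr_norm_ae (ae_of_all _ fun x => ?_)
    rw [norm_phasePow he0, Real.norm_of_nonneg (by positivity)]
  have h2 : ENNReal.ofReal r₀ * ENNReal.ofReal e.re = ENNReal.ofReal r := by
    rw [← ENNReal.ofReal_mul hr₀.le, he, mul_div_cancel₀ _ hr₀.ne']
  rw [h1, eLpNorm_norm_rpow _ he0, h2, ← ENNReal.toReal_rpow, toReal_eLpNorm hrm.1]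
  exact Real.rpow_le_one lpNorm_nonneg hg1 he0.le

/-- The exponent in Stein's interpolation theorem. -/
noncomputable def steinExp (a b r₀ r₁ r : ℝ) (z₀ z : ℂ) : ℂ :=
  r / r₀ + ((z - Complex.I * z₀.im - a) / ((b - a : ℝ) : ℂ)) * ((r / r₁ - r / r₀ : ℝ) : ℂ)

lemma steinExp_re (a b r₀ r₁ r : ℝ) (z₀ z : ℂ) :
    (steinExp a b r₀ r₁ r z₀ z).re
      = r / r₀ + (z.re - a) / (b - a) * (r / r₁ - r / r₀) := by
  rw [steinExp, Complex.add_re, Complex.re_mul_ofReal, Complex.div_ofReal_re, Complex.div_ofReal_re]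
  simp

/-- `steinExp` is shifted by i Im z₀ so that its value at z₀ is 1 itself and not merely of real part
1. -/
lemma steinExp_self {a b r₀ r₁ r : ℝ} {z₀ : ℂ} (hr : 0 < r)
    (h : 1 / r = (1 - (z₀.re - a) / (b - a)) / r₀ + (z₀.re - a) / (b - a) / r₁) :
    steinExp a b r₀ r₁ r z₀ z₀ = 1 := by
  have h0 : z₀ - Complex.I * z₀.im - a = ((z₀.re - a : ℝ) : ℂ) := by
    apply Complex.ext <;> simp
  rw [steinExp, h0]
  norm_cast
  set θ := (z₀.re - a) / (b - a)
  have : r * (1 / r) = 1 := by field_simp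
  rw [h] at this
  rw [← this]
  ring

lemma differentiable_steinExp (a b r₀ r₁ r : ℝ) (z₀ : ℂ) :
    Differentiable ℂ (steinExp a b r₀ r₁ r z₀) := by
  unfold steinExp
  fun_prop

lemma steinExp_re_mem {a b r₀ r₁ r : ℝ} (hab : a < b) (z₀ : ℂ) {z : ℂ} (h1 : a ≤ z.re)
    (h2 : z.re ≤ b) :
    min (r / r₀) (r / r₁) ≤ (steinExp a b r₀ r₁ r z₀ z).re ∧
      (steinExp a b r₀ r₁ r z₀ z).re ≤ max (r / r₀) (r / r₁) := by
  rw [steinExp_re]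
  set θ := (z.re - a) / (b - a)
  have hθ0 : 0 ≤ θ := div_nonneg (by linarith) (by linarith)
  have hθ1 : θ ≤ 1 := (div_le_one (by linarith)).2 (by linarith)
  have hmin := min_le_left (r / r₀) (r / r₁)
  have hmin' := min_le_right (r / r₀) (r / r₁)
  have hmax := le_max_left (r / r₀) (r / r₁)
  have hmax' := le_max_right (r / r₀) (r / r₁)
  constructor <;> nlinarith

/-- Complex interpolation of analytic families of functionals, on simple functions in the unit
ball. -/
lemma stein_unit {a b k r₀ r₁ r K : ℝ} (hk : 0 ≤ k) (hab : a < b) (hr₀ : 0 < r₀) (hr₁ : 0 < r₁)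
    (hr : 0 < r) (hK : 0 ≤ K) {L : ℂ → (Rn n → ℂ) → ℂ}
    (hlin : ∀ z : ℂ, a ≤ z.re → z.re ≤ b → NiceLinear (L z))
    (hstrip : ∀ f, Nice f → StripFun a b k fun z => L z f)
    {z₀ : ℂ} (h1 : a ≤ z₀.re) (h2 : z₀.re ≤ b)
    (hrel : 1 / r = (1 - (z₀.re - a) / (b - a)) / r₀ + (z₀.re - a) / (b - a) / r₁)
    (ha : ∀ z : ℂ, z.re = a → ∀ f, Nice f →
      ‖L z f‖ ≤ K * Real.exp (k * |z.im|) * lpNorm f (ENNReal.ofReal r₀) volume)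
    (hb : ∀ z : ℂ, z.re = b → ∀ f, Nice f →
      ‖L z f‖ ≤ K * Real.exp (k * |z.im|) * lpNorm f (ENNReal.ofReal r₁) volume)
    {g : SimpleFunc (Rn n) ℂ} (hg : Integrable g)
    (hg1 : lpNorm g (ENNReal.ofReal r) volume ≤ 1) :
    ‖L z₀ g‖ ≤ K * Real.exp ((b - a) ^ 2 + k ^ 2 / 4) * Real.exp (k * |z₀.im|) := by
  set e := steinExp a b r₀ r₁ r z₀
  have he : ∀ z : ℂ, a ≤ z.re → z.re ≤ b → L z (fun x => phasePow (e z) (g x))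
      = ∑ y ∈ g.range.filter (· ≠ 0), phasePow (e z) y * L z (levelInd g y) := by
    intro z hz1 hz2
    rw [phasePow_comp_eq_sum]
    exact (hlin z hz1 hz2).sum _ _ fun y hy => levelInd_nice hg (Finset.mem_filter.1 hy).2
  have hΨ : StripFun a b k fun z => L z (fun x => phasePow (e z) (g x)) := by
    refine StripFun.congr ?_ he
    refine StripFun.sum _ fun y hy => ?_
    have h3 := (stripFun_phasePow (differentiable_steinExp a b r₀ r₁ r z₀)
      (m := min (r / r₀) (r / r₁)) (by positivity)
      (fun z hz1 hz2 => steinExp_re_mem hab z₀ hz1 hz2) y).mul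
      (hstrip _ (levelInd_nice hg (Finset.mem_filter.1 hy).2))
    rwa [zero_add] at h3
  have hba : b - a ≠ 0 := by linarith
  have key := three_lines hk hab hΨ hK ?_ ?_ h1 h2
  · have h4 : e z₀ = 1 := steinExp_self hr hrel
    simpa only [h4, phasePow_one] using key
  · intro z hz
    refine (ha z hz _ (phasePow_comp_nice hg _)).trans ?_
    refine mul_le_of_le_one_right (by positivity) (lpNorm_phasePow_le_one hg hr hr₀ ?_ hg1)
    rw [steinExp_re, hz]; simp
  · intro z hz
    refine (hb z hz _ (phasePow_comp_nice hg _)).trans ?_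
    refine mul_le_of_le_one_right (by positivity) (lpNorm_phasePow_le_one hg hr hr₁ ?_ hg1)
    rw [steinExp_re, hz, div_self hba]; ring

/-- A homogeneous functional bounded on the unit ball of simple functions. -/
lemma norm_le_of_unit_ball {r B : ℝ} {ℓ : (Rn n → ℂ) → ℂ} (hℓ : NiceLinear ℓ)
    (h : ∀ g : SimpleFunc (Rn n) ℂ, Integrable g → lpNorm g (ENNReal.ofReal r) volume ≤ 1 →
      ‖ℓ g‖ ≤ B) {g : SimpleFunc (Rn n) ℂ} (hg : Integrable g) :
    ‖ℓ g‖ ≤ B * lpNorm g (ENNReal.ofReal r) volume := by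
  have hB : 0 ≤ B := by
    refine (norm_nonneg _).trans (h 0 ?_ ?_)
    · simp
    · simp
  -- Normalising by a number above the norm avoids dividing by a norm that may vanish.
  have key : ∀ N, lpNorm g (ENNReal.ofReal r) volume < N → ‖ℓ g‖ ≤ B * N := by
    intro N hN
    have hN0 : 0 < N := lpNorm_nonneg.trans_lt hN
    have e1 : ⇑(g.map fun y => ((N⁻¹ : ℝ) : ℂ) * y) = fun x => ((N⁻¹ : ℝ) : ℂ) * g x := by
      funext x; simp
    have h1 := h (g.map fun y => ((N⁻¹ : ℝ) : ℂ) * y) (by rw [e1]; exact hg.const_mul _) (by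
      rw [e1]
      have := lpNorm_const_smul (p := ENNReal.ofReal r) ((N⁻¹ : ℝ) : ℂ) (g : Rn n → ℂ) volume
      have e2 : (fun x => ((N⁻¹ : ℝ) : ℂ) * g x) = ((N⁻¹ : ℝ) : ℂ) • (g : Rn n → ℂ) := rfl
      rw [e2, this]
      simp only [coe_nnnorm, Complex.norm_real, Real.norm_eq_abs, abs_inv, abs_of_pos hN0]
      rw [inv_mul_le_one₀ hN0]
      exact hN.le)
    rw [e1, hℓ.const_mul _ _ (SimpleFunc_nice hg), norm_mul, Complex.norm_real, Real.norm_eq_abs,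
      abs_inv, abs_of_pos hN0, inv_mul_le_iff₀ hN0] at h1
    linarith
  refine le_of_forall_pos_lt_add fun δ hδ => ?_
  have := key (lpNorm g (ENNReal.ofReal r) volume + δ / (2 * (B + 1))) (by
    have : 0 < δ / (2 * (B + 1)) := by positivity
    linarith)
  have h2 : B * (δ / (2 * (B + 1))) < δ := by
    rw [mul_div_assoc', div_lt_iff₀ (by positivity)]
    nlinarith
  rw [mul_add] at this
  linarith

lemma memLp_of_one_two {f : Rn n → ℂ} (hf : Nice f) {r : ℝ} (h1 : 1 ≤ r) (h2 : r ≤ 2) :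
    MemLp f (ENNReal.ofReal r) volume := by
  rw [← integrable_norm_rpow_iff hf.one.1 (by simp; linarith) (by simp),
    ENNReal.toReal_ofReal (by linarith)]
  refine Integrable.mono' (hf.integrable.norm.add (hf.two.integrable_norm_pow two_ne_zero))
    (hf.one.1.norm.aemeasurable.pow_const _).aestronglyMeasurable (ae_of_all _ fun x => ?_)
  rw [Real.norm_of_nonneg (by positivity)]
  simp only [Pi.add_apply]
  rcases le_total 1 ‖f x‖ with h | h
  · have := Real.rpow_le_rpow_of_exponent_le h h2
    norm_num at this ⊢
    linarith [norm_nonneg (f x)]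
  · have := Real.rpow_le_rpow_of_exponent_ge' (norm_nonneg (f x)) h zero_le_one h1
    rw [Real.rpow_one] at this
    linarith [sq_nonneg ‖f x‖]

/-- Simultaneous approximation by simple functions. -/
lemma exists_simpleFunc_approx {f : Rn n → ℂ} (hf : Nice f) :
    ∃ s : ℕ → SimpleFunc (Rn n) ℂ, (∀ k, Integrable (s k)) ∧
      ∀ r : ℝ, 1 ≤ r → r ≤ 2 →
        Tendsto (fun k => lpNorm (fun x => f x - s k x) (ENNReal.ofReal r) volume) atTop (𝓝 0) := by
  set f' := hf.one.1.mk f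
  have hae : f =ᵐ[volume] f' := hf.one.1.ae_eq_mk
  have hmeas : Measurable f' := hf.one.1.stronglyMeasurable_mk.measurable
  have hf' : Nice f' := ⟨(memLp_congr_ae hae).1 hf.one, (memLp_congr_ae hae).1 hf.two⟩
  -- One sequence has to serve all r at once; this approximation does not depend on the exponent.
  have hint : ∀ k, Integrable (SimpleFunc.approxOn f' hmeas (Set.range f' ∪ {0}) 0 (by simp) k) :=
    fun k => SimpleFunc.integrable_approxOn_range hmeas hf'.integrable k
  refine ⟨_, hint, fun r h1 h2 => ?_⟩
  have hr := memLp_of_one_two hf' h1 h2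
  have := SimpleFunc.tendsto_approxOn_range_Lp_eLpNorm (p := ENNReal.ofReal r) (by simp) hmeas hr.2
  have h3 := (ENNReal.tendsto_toReal (by simp)).comp this
  refine h3.congr fun k => ?_
  simp only [Function.comp]
  rw [eLpNorm_sub_comm]
  refine Eq.trans ?_ (toReal_eLpNorm (hf.one.1.sub (SimpleFunc.aestronglyMeasurable _)))
  refine congrArg ENNReal.toReal (eLpNorm_congr_ae ?_)
  filter_upwards [hae] with x hx
  simp [hx]

/-- Extension of an estimate from simple functions to `L¹ ∩ L²`. -/
lemma norm_le_of_simple {r B M : ℝ} (hr1 : 1 ≤ r) (hr2 : r ≤ 2) {ℓ : (Rn n → ℂ) → ℂ}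
    (hℓ : NiceLinear ℓ) (hB : 0 ≤ B)
    (hM : ∀ f, Nice f → ‖ℓ f‖ ≤ M * (lpNorm f 1 volume + lpNorm f 2 volume))
    (h : ∀ g : SimpleFunc (Rn n) ℂ, Integrable g →
      ‖ℓ g‖ ≤ B * lpNorm g (ENNReal.ofReal r) volume) {f : Rn n → ℂ} (hf : Nice f) :
    ‖ℓ f‖ ≤ B * lpNorm f (ENNReal.ofReal r) volume := by
  obtain ⟨s, hs, hlim⟩ := exists_simpleFunc_approx hf
  have h1 := hlim 1 le_rfl one_le_two
  have h2 := hlim 2 one_le_two le_rfl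
  have h3 := hlim r hr1 hr2
  rw [ENNReal.ofReal_one] at h1
  rw [ENNReal.ofReal_ofNat] at h2
  -- `M` may be arbitrarily bad: it multiplies only the L¹ and L² errors, which tend to 0.
  have hle : ∀ k, ‖ℓ f‖ ≤ B * (lpNorm f (ENNReal.ofReal r) volume
      + lpNorm (fun x => f x - s k x) (ENNReal.ofReal r) volume)
      + M * (lpNorm (fun x => f x - s k x) 1 volume + lpNorm (fun x => f x - s k x) 2 volume) := by
    intro k
    have hsn := SimpleFunc_nice (hs k)
    have e := hℓ.sub hf hsn
    have e2 : ℓ f = ℓ (s k) + ℓ (fun x => f x - s k x) := by rw [e]; ring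
    rw [e2]
    refine (norm_add_le _ _).trans (add_le_add ((h _ (hs k)).trans ?_) (hM _ (hf.sub hsn)))
    gcongr
    have h4 := lpNorm_le_lpNorm_add_lpNorm_sub (f := (s k : Rn n → ℂ))
      (memLp_of_one_two hf hr1 hr2) (by simpa using hr1)
    exact h4
  have hT := ((h3.const_add (lpNorm f (ENNReal.ofReal r) volume)).const_mul B).add
    ((h1.add h2).const_mul M)
  simp only [add_zero, mul_zero] at hT
  exact ge_of_tendsto' hT hle

/-- Complex interpolation of analytic families of functionals. -/
lemma stein_interpolation {a b k r₀ r₁ r K M : ℝ} (hk : 0 ≤ k) (hab : a < b) (hr₀ : 0 < r₀)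
    (hr₁ : 0 < r₁) (hr1 : 1 ≤ r) (hr2 : r ≤ 2) (hK : 0 ≤ K) {L : ℂ → (Rn n → ℂ) → ℂ}
    (hlin : ∀ z : ℂ, a ≤ z.re → z.re ≤ b → NiceLinear (L z))
    (hstrip : ∀ f, Nice f → StripFun a b k fun z => L z f)
    {z₀ : ℂ} (h1 : a ≤ z₀.re) (h2 : z₀.re ≤ b)
    (hM : ∀ f, Nice f → ‖L z₀ f‖ ≤ M * (lpNorm f 1 volume + lpNorm f 2 volume))
    (hrel : 1 / r = (1 - (z₀.re - a) / (b - a)) / r₀ + (z₀.re - a) / (b - a) / r₁)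
    (ha : ∀ z : ℂ, z.re = a → ∀ f, Nice f →
      ‖L z f‖ ≤ K * Real.exp (k * |z.im|) * lpNorm f (ENNReal.ofReal r₀) volume)
    (hb : ∀ z : ℂ, z.re = b → ∀ f, Nice f →
      ‖L z f‖ ≤ K * Real.exp (k * |z.im|) * lpNorm f (ENNReal.ofReal r₁) volume)
    {f : Rn n → ℂ} (hf : Nice f) :
    ‖L z₀ f‖ ≤ K * Real.exp ((b - a) ^ 2 + k ^ 2 / 4) * Real.exp (k * |z₀.im|)
      * lpNorm f (ENNReal.ofReal r) volume :=
  norm_le_of_simple hr1 hr2 (hlin z₀ h1 h2) (by positivity) hM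
    (fun _ hg => norm_le_of_unit_ball (hlin z₀ h1 h2) (fun _ hg' hg1 => stein_unit hk hab hr₀ hr₁
      (by linarith) hK hlin hstrip h1 h2 hrel ha hb hg' hg1) hg) hf

end Stein

end HelmholtzBR

namespace HelmholtzBR

variable {n : ℕ}

/-! ### Uniform estimates for complex powers of the resolvent -/

section Resolvent

lemma integrable_resForm {z w : ℂ} (hz : 0 ≤ z.re) (hw : 0 < w.re) {f g : Rn n → ℂ} (hf : Nice f)
    (hg : Nice g) :
    Integrable fun ξ => sym z w (‖ξ‖ ^ 2 - 1) * (fourier f ξ * fourier g (-ξ)) := by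
  refine (hf.integrable_fourier_mul hg).bdd_mul (c := w.re ^ (-z.re) * Real.exp (2 * |z.im|)) ?_
    (ae_of_all _ fun ξ => norm_sym_le_of_re_nonneg hw hz)
  exact ((continuous_sym z hw).comp (by fun_prop)).aestronglyMeasurable

lemma resForm_linear_left {z w : ℂ} (hz : 0 ≤ z.re) (hw : 0 < w.re) {g : Rn n → ℂ} (hg : Nice g) :
    NiceLinear fun f => resForm z w f g := by
  refine ⟨fun f h hf hh => ?_, fun c f hf => ?_⟩
  · simp only [resForm]
    rw [← integral_add (integrable_resForm hz hw hf hg) (integrable_resForm hz hw hh hg)]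
    simp only [fourier_add hf.integrable hh.integrable]
    exact integral_congr_ae (ae_of_all _ fun ξ => by ring)
  · simp only [resForm]
    rw [← integral_const_mul]
    simp only [fourier_const_mul]
    exact integral_congr_ae (ae_of_all _ fun ξ => by ring)

lemma resForm_linear_right {z w : ℂ} (hz : 0 ≤ z.re) (hw : 0 < w.re) {f : Rn n → ℂ}
    (hf : Nice f) : NiceLinear fun g => resForm z w f g := by
  refine ⟨fun g h hg hh => ?_, fun c g hg => ?_⟩
  · simp only [resForm]
    rw [← integral_add (integrable_resForm hz hw hf hg) (integrable_resForm hz hw hf hh)]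
    simp only [fourier_add hg.integrable hh.integrable]
    exact integral_congr_ae (ae_of_all _ fun ξ => by ring)
  · simp only [resForm]
    rw [← integral_const_mul]
    simp only [fourier_const_mul]
    exact integral_congr_ae (ae_of_all _ fun ξ => by ring)

lemma NiceLinear.smul {ℓ : (Rn n → ℂ) → ℂ} (hℓ : NiceLinear ℓ) (c : ℂ) :
    NiceLinear fun f => c * ℓ f :=
  ⟨fun f g hf hg => by rw [hℓ.add f g hf hg]; ring,
    fun a f hf => by rw [hℓ.const_mul a f hf]; ring⟩

lemma norm_resForm_le {z w : ℂ} (hz : 0 ≤ z.re) (hw : 0 < w.re) {f g : Rn n → ℂ} (hf : Nice f)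
    (hg : Nice g) :
    ‖resForm z w f g‖ ≤ w.re ^ (-z.re) * Real.exp (2 * |z.im|) * planch n ^ 2
      * (lpNorm f 2 volume * lpNorm g 2 volume) := by
  have := norm_integral_mul_le_of_bound (m := fun ξ : Rn n => sym z w (‖ξ‖ ^ 2 - 1)) (by positivity)
    (fun ξ => norm_sym_le_of_re_nonneg hw hz) hf.memLp_fourier hg.memLp_fourier_neg
  rw [hf.lpNorm_fourier, hg.lpNorm_fourier_neg] at this
  refine this.trans (le_of_eq ?_)
  ring

/-- The exponent `(2n+2)/(n+1+4b)`. -/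
noncomputable def pExp (n : ℕ) (b : ℝ) : ℝ := (2 * (n : ℝ) + 2) / ((n : ℝ) + 1 + 4 * b)

lemma one_le_pExp {b : ℝ} (hb : 0 ≤ b) (hbn : b ≤ ((n : ℝ) + 1) / 4) : 1 ≤ pExp n b := by
  rw [pExp, one_le_div (by positivity)]
  linarith

lemma pExp_le_two {b : ℝ} (hb : 0 ≤ b) : pExp n b ≤ 2 := by
  rw [pExp, div_le_iff₀ (by positivity)]
  linarith

lemma stripFun_resForm {w : ℂ} (hw : 0 < w.re) (b : ℝ) {f g : Rn n → ℂ} (hf : Nice f)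
    (hg : Nice g) : StripFun 0 b 2 fun z => resForm z w f g :=
  stripFun_integral_sym hw (s := fun ξ : Rn n => ‖ξ‖ ^ 2 - 1)
    (by fun_prop) (hf.integrable_fourier_mul hg)

/-- Constant in the resolvent estimates. -/
noncomputable def resConst (n : ℕ) : ℝ :=
  (planch n ^ 2 + (1 + ((n : ℝ) + 1) / 2) * dispConst n)
    * Real.exp ((((n : ℝ) + 1) / 2 - 0) ^ 2 + 2 ^ 2 / 4)

lemma dispConst_nonneg (n : ℕ) : 0 ≤ dispConst n := by unfold dispConst; positivity

lemma resConst_pos (n : ℕ) : 0 < resConst n := by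
  have h1 := dispConst_nonneg n
  have h2 := planch_pos n
  unfold resConst
  positivity

/-- Uniform `L^p → L^{p'}` estimates for complex powers of the resolvent. -/
theorem norm_Gamma_mul_resForm_le_lpNorm {b : ℝ} (hb : 0 ≤ b) (hbn : b ≤ ((n : ℝ) + 1) / 4)
    {z w : ℂ} (hz : z.re = 2 * b) (hw : goodParam w) {f g : Rn n → ℂ} (hf : Nice f) (hg : Nice g) :
    ‖Complex.Gamma (z + 1) * resForm z w f g‖ ≤ resConst n * Real.exp (2 * |z.im|)
      * (lpNorm f (ENNReal.ofReal (pExp n b)) volume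
        * lpNorm g (ENNReal.ofReal (pExp n b)) volume) := by
  set σ : ℝ := ((n : ℝ) + 1) / 2 with hσ
  have hσ0 : 0 < σ := by positivity
  set r := pExp n b with hr
  have hr1 : 1 ≤ r := one_le_pExp hb hbn
  have hr2 : r ≤ 2 := pExp_le_two hb
  have hd := dispConst_nonneg n
  have hz0 : 0 ≤ z.re := by rw [hz]; linarith
  have hz1 : z.re ≤ σ := by rw [hz]; linarith
  -- Re z = 2b lies at the fraction 4b/(n+1) of the way from L² to L¹; this is what fixes `pExp`.
  have hrel : 1 / r = (1 - (z.re - 0) / (σ - 0)) / 2 + (z.re - 0) / (σ - 0) / 1 := by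
    rw [hr, hz, pExp, hσ]
    have : (n : ℝ) + 1 + 4 * b ≠ 0 := by positivity
    field_simp
    ring
  set K : ℝ := planch n ^ 2 + (1 + σ) * dispConst n with hK
  have hK0 : 0 ≤ K := by positivity
  have hM : ∀ f g : Rn n → ℂ, Nice f → Nice g →
      ‖Complex.Gamma (z + 1) * resForm z w f g‖
        ≤ ‖Complex.Gamma (z + 1)‖ * (w.re ^ (-z.re) * Real.exp (2 * |z.im|) * planch n ^ 2)
          * lpNorm f 2 volume * lpNorm g 2 volume := by
    intro f g hf hg
    rw [norm_mul]
    refine (mul_le_mul_of_nonneg_left (norm_resForm_le hz0 hw.1 hf hg) (norm_nonneg _)).trans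
      (le_of_eq (by ring))
  have hunit : ∀ g : SimpleFunc (Rn n) ℂ, Integrable g → lpNorm g (ENNReal.ofReal r) volume ≤ 1 →
      ∀ f, Nice f → ‖Complex.Gamma (z + 1) * resForm z w f g‖
        ≤ resConst n * Real.exp (2 * |z.im|) * lpNorm f (ENNReal.ofReal r) volume := by
    intro g hg hg1 f hf
    set e := steinExp 0 σ 2 1 r z
    have hez : e z = 1 := steinExp_self (by linarith) hrel
    -- Both arguments must move: the powers of g are built into the family, and
    -- `stein_interpolation` supplies those of f. At v = z the exponent is 1 and g itself returns.
    set L : ℂ → (Rn n → ℂ) → ℂ := fun v f =>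
      Complex.Gamma (v + 1) * resForm v w f (fun x => phasePow (e v) (g x)) with hL
    have hLz : ∀ f, L z f = Complex.Gamma (z + 1) * resForm z w f g := by
      intro f
      simp only [hL, hez, phasePow_one]
    have key := stein_interpolation (a := 0) (b := σ) (k := 2) (r₀ := 2) (r₁ := 1) (r := r)
      (K := K) (M := ‖Complex.Gamma (z + 1)‖ * (w.re ^ (-z.re) * Real.exp (2 * |z.im|)
        * planch n ^ 2) * lpNorm g 2 volume) (by norm_num) hσ0 (by norm_num) one_pos hr1 hr2 hK0
      (L := L) ?_ ?_ hz0 hz1 ?_ hrel ?_ ?_ hf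
    · rw [hLz] at key
      exact key
    · intro v hv1 hv2
      exact (resForm_linear_left hv1 hw.1 (phasePow_comp_nice hg _)).smul _
    · intro f hf
      have h1 : StripFun 0 σ 2 fun v => resForm v w f (fun x => phasePow (e v) (g x)) := by
        refine StripFun.congr (Φ := fun v => ∑ y ∈ g.range.filter (· ≠ 0),
          phasePow (e v) y * resForm v w f (levelInd g y)) ?_ fun v hv1 hv2 => ?_
        · refine StripFun.sum _ fun y hy => ?_
          have h3 := (stripFun_phasePow (differentiable_steinExp 0 σ 2 1 r z)
            (m := min (r / 2) (r / 1)) (by positivity)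
            (fun v hv1 hv2 => steinExp_re_mem hσ0 z hv1 hv2) y).mul
            (stripFun_resForm hw.1 σ hf (levelInd_nice hg (Finset.mem_filter.1 hy).2))
          rwa [zero_add] at h3
        · rw [phasePow_comp_eq_sum]
          exact (resForm_linear_right hv1 hw.1 hf).sum _ _
            fun y hy => levelInd_nice hg (Finset.mem_filter.1 hy).2
      have h2 := (stripFun_Gamma_add_one (b := σ) le_rfl).mul h1
      rwa [zero_add] at h2
    · intro f hf
      rw [hLz]
      refine (hM f g hf (SimpleFunc_nice hg)).trans ?_
      have hw0 := hw.1
      have hg2 : 0 ≤ lpNorm g 2 volume := lpNorm_nonneg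
      rw [mul_right_comm]
      gcongr
      linarith [lpNorm_nonneg (f := f) (p := 1) (μ := volume)]
    · intro v hv f hf
      have hv0 : 0 ≤ v.re := hv.ge
      rw [ENNReal.ofReal_ofNat]
      have h1 := lpNorm_phasePow_le_one hg (e := e v) (r := r) (r₀ := 2) (by linarith) two_pos
        (by rw [steinExp_re, hv]; simp) hg1
      rw [ENNReal.ofReal_ofNat] at h1
      have h2 : ‖Complex.Gamma (v + 1)‖ ≤ 1 := by
        have := norm_Gamma_le (z := v + 1) (by simp [hv])
        simpa [hv] using this
      have h3 := norm_resForm_le hv0 hw.1 hf (phasePow_comp_nice hg (e v))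
      rw [hv, neg_zero, Real.rpow_zero, one_mul] at h3
      simp only [hL]
      rw [norm_mul]
      have hf2 : 0 ≤ lpNorm f 2 volume := lpNorm_nonneg
      calc ‖Complex.Gamma (v + 1)‖ * ‖resForm v w f (fun x => phasePow (e v) (g x))‖
          ≤ 1 * (Real.exp (2 * |v.im|) * planch n ^ 2 * (lpNorm f 2 volume * 1)) := by
            refine mul_le_mul h2 (h3.trans ?_) (norm_nonneg _) zero_le_one
            gcongr
        _ = planch n ^ 2 * Real.exp (2 * |v.im|) * lpNorm f 2 volume := by ring
        _ ≤ _ := by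
            gcongr
            have : 0 ≤ (1 + σ) * dispConst n := by positivity
            linarith
    · intro v hv f hf
      rw [ENNReal.ofReal_one]
      have hv0 : 0 < v.re := by rw [hv]; exact hσ0
      have h1 := lpNorm_phasePow_le_one hg (e := e v) (r := r) (r₀ := 1) (by linarith) one_pos
        (by rw [steinExp_re, hv, sub_zero, div_self hσ0.ne']; ring) hg1
      rw [ENNReal.ofReal_one] at h1
      have h3 := norm_gamma_mul_resForm_le hv hw hf (phasePow_comp_nice hg (e v))
      have hv00 : v ≠ 0 := by rintro rfl; simp at hv0
      simp only [hL]
      -- The kernel bound controls Γ(v) times the form. Passing to Γ(v+1) costs |v|, and the two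
      -- resulting factors 1 + |Im v| are absorbed by e^{2|Im v|}.
      rw [Complex.Gamma_add_one _ hv00, mul_assoc, norm_mul]
      have h4 : ‖v‖ ≤ (1 + σ) * (1 + |v.im|) := by
        refine (Complex.norm_le_abs_re_add_abs_im v).trans ?_
        rw [abs_of_pos hv0, hv]
        nlinarith [mul_nonneg hσ0.le (abs_nonneg v.im)]
      have h5 : (1 + |v.im|) ^ 2 ≤ Real.exp (2 * |v.im|) := by
        have := Real.add_one_le_exp |v.im|
        rw [two_mul, Real.exp_add, ← sq]
        have h0 := abs_nonneg v.im
        gcongr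
        linarith
      have hf1 : 0 ≤ lpNorm f 1 volume := lpNorm_nonneg
      calc ‖v‖ * ‖Complex.Gamma v * resForm v w f (fun x => phasePow (e v) (g x))‖
          ≤ ((1 + σ) * (1 + |v.im|)) * (dispConst n * (1 + |v.im|) * (lpNorm f 1 volume * 1)) := by
            refine mul_le_mul h4 (h3.trans ?_) (norm_nonneg _) (by positivity)
            gcongr
        _ = (1 + σ) * dispConst n * (1 + |v.im|) ^ 2 * lpNorm f 1 volume := by ring
        _ ≤ _ := by
            gcongr
            have := sq_nonneg (planch n)
            linarith
  have hsimple : ∀ g : SimpleFunc (Rn n) ℂ, Integrable g →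
      ‖Complex.Gamma (z + 1) * resForm z w f g‖
        ≤ resConst n * Real.exp (2 * |z.im|) * lpNorm f (ENNReal.ofReal r) volume
          * lpNorm g (ENNReal.ofReal r) volume := fun g hg =>
    norm_le_of_unit_ball (((resForm_linear_right hz0 hw.1 hf).smul (Complex.Gamma (z + 1))))
      (fun g' hg' hg1 => hunit g' hg' hg1 f hf) hg
  have hC := resConst_pos n
  have hw0 := hw.1
  have hf2 : 0 ≤ lpNorm f 2 volume := lpNorm_nonneg
  have hfr : 0 ≤ lpNorm f (ENNReal.ofReal r) volume := lpNorm_nonneg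
  have := norm_le_of_simple (B := resConst n * Real.exp (2 * |z.im|)
    * lpNorm f (ENNReal.ofReal r) volume) hr1 hr2
    ((resForm_linear_right hz0 hw.1 hf).smul (Complex.Gamma (z + 1))) (by positivity)
    (M := ‖Complex.Gamma (z + 1)‖ * (w.re ^ (-z.re) * Real.exp (2 * |z.im|) * planch n ^ 2)
          * lpNorm f 2 volume) (fun g hg => (hM f g hf hg).trans ?_) hsimple hg
  · linarith
  · gcongr
    linarith [lpNorm_nonneg (f := g) (p := 1) (μ := volume)]

end Resolvent

end HelmholtzBR

namespace HelmholtzBR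

variable {n : ℕ}

/-! ### Polar coordinates and the density with respect to s = |ξ|² - 1 -/

section Polar

/-- The surface measure on the unit sphere. -/
noncomputable abbrev sphereMeasure (n : ℕ) : Measure (Metric.sphere (0 : Rn n) 1) :=
  (volume : Measure (Rn n)).toSphere

/-- Integral of a function over the sphere of radius `r`, in angular coordinates. -/
noncomputable def sphInt (h : Rn n → ℂ) (r : ℝ) : ℂ :=
  ∫ ω : Metric.sphere (0 : Rn n) 1, h (r • (ω : Rn n)) ∂sphereMeasure n

lemma nontrivial_Rn (hn : 2 ≤ n) : Nontrivial (Rn n) := by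
  have : Nonempty (Fin n) := ⟨⟨0, by omega⟩⟩
  infer_instance

/-- Nonzero vectors are homeomorphic to sphere × (0, ∞), Lebesgue measure going over to surface
measure times r^{n-1}dr, and the origin is null because the space is nontrivial. -/
lemma integral_polar (hn : 2 ≤ n) {F : Rn n → ℂ} (hF : Integrable F) :
    IntegrableOn (fun r : ℝ => r ^ (n - 1) • sphInt F r) (Set.Ioi 0) ∧
      ∫ x, F x = ∫ r in Set.Ioi (0 : ℝ), r ^ (n - 1) • sphInt F r := by
  have := nontrivial_Rn hn
  have hfr : Module.finrank ℝ (Rn n) = n := by simp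
  set μ : Measure (Rn n) := volume
  have hmp := μ.measurePreserving_homeomorphUnitSphereProd
  have hemb := (homeomorphUnitSphereProd (Rn n)).measurableEmbedding
  set G : Metric.sphere (0 : Rn n) 1 × Set.Ioi (0 : ℝ) → ℂ := fun p => F (p.2.1 • (p.1 : Rn n))
  have hGcomp : (fun x : ({0}ᶜ : Set (Rn n)) => G (homeomorphUnitSphereProd (Rn n) x))
      = fun x : ({0}ᶜ : Set (Rn n)) => F (x : Rn n) := by
    funext x
    have hx : ‖(x : Rn n)‖ ≠ 0 := norm_ne_zero_iff.2 x.2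
    simp [G, homeomorphUnitSphereProd_apply_snd_coe, homeomorphUnitSphereProd_apply_fst_coe,
      smul_smul, hx]
  have hint : Integrable G (μ.toSphere.prod (Measure.volumeIoiPow (Module.finrank ℝ (Rn n) - 1))) := by
    rw [← hmp.integrable_comp_emb hemb]
    have h1 : IntegrableOn F ({0}ᶜ : Set (Rn n)) μ := hF.integrableOn
    rw [integrableOn_iff_comap_subtypeVal (measurableSet_singleton _).compl] at h1
    rw [show G ∘ homeomorphUnitSphereProd (Rn n) = _ from hGcomp]
    exact h1
  have heq : ∫ x, F x ∂μ
      = ∫ p, G p ∂(μ.toSphere.prod (Measure.volumeIoiPow (Module.finrank ℝ (Rn n) - 1))) := by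
    have e : ∫ x, F x ∂μ = ∫ x : ({0}ᶜ : Set (Rn n)), F x ∂(μ.comap Subtype.val) := by
      rw [integral_subtype_comap (measurableSet_singleton _).compl, restrict_compl_singleton]
    rw [← hmp.integral_comp hemb, e]
    exact integral_congr_ae (ae_of_all _ fun x => (congrFun hGcomp x).symm)
  have hmeas : Measurable fun r : Set.Ioi (0 : ℝ) => Real.toNNReal (r.1 ^ (n - 1)) :=
    (measurable_subtype_coe.pow_const _).real_toNNReal
  have hr : ∀ r ∈ Set.Ioi (0 : ℝ), Real.toNNReal (r ^ (n - 1)) • sphInt F r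
      = r ^ (n - 1) • sphInt F r := by
    intro r hr
    rw [NNReal.smul_def, Real.coe_toNNReal _ (pow_nonneg (le_of_lt hr) _)]
  have h2 := hint.integral_prod_right
  rw [hfr] at h2 heq
  constructor
  · rw [Measure.volumeIoiPow] at h2
    have h3 := (integrable_withDensity_iff_integrable_smul hmeas).1 h2
    have h4 : Integrable (fun r : Set.Ioi (0 : ℝ) => (fun r : ℝ =>
        Real.toNNReal (r ^ (n - 1)) • sphInt F r) r) (Measure.comap Subtype.val volume) := h3
    have h5 : IntegrableOn (fun r : ℝ => Real.toNNReal (r ^ (n - 1)) • sphInt F r) (Set.Ioi 0) := by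
      rw [integrableOn_iff_comap_subtypeVal measurableSet_Ioi]
      exact h4
    exact h5.congr_fun hr measurableSet_Ioi
  · have hint' := hint
    rw [hfr] at hint'
    rw [heq, integral_prod_symm _ hint', Measure.volumeIoiPow]
    have h6 := integral_withDensity_eq_integral_smul (μ := Measure.comap Subtype.val volume) hmeas
      (fun r : Set.Ioi (0 : ℝ) => sphInt F r.1)
    refine Eq.trans h6 ?_
    rw [integral_subtype_comap measurableSet_Ioi
      fun r : ℝ => Real.toNNReal (r ^ (n - 1)) • sphInt F r]
    exact setIntegral_congr_fun measurableSet_Ioi hr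

/-- The density of a function with respect to `s = |ξ|² - 1`. -/
noncomputable def shell (h : Rn n → ℂ) (s : ℝ) : ℂ :=
  ((1 / 2 * (1 + s) ^ (((n : ℝ) - 2) / 2) : ℝ) : ℂ) * sphInt h (√(1 + s))

lemma shell_zero (h : Rn n → ℂ) :
    shell h 0 = (1 / 2 : ℂ) * ∫ ω : Metric.sphere (0 : Rn n) 1, h ω ∂sphereMeasure n := by
  simp [shell, sphInt]

lemma image_sqrt : (fun s : ℝ => √(1 + s)) '' Set.Ioi (-1) = Set.Ioi 0 := by
  ext r
  constructor
  · rintro ⟨s, hs, rfl⟩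
    have : -1 < s := hs
    exact Real.sqrt_pos.2 (by linarith)
  · intro hr
    have hr : 0 < r := hr
    refine ⟨r ^ 2 - 1, ?_, ?_⟩
    · have : 0 < r ^ 2 := by positivity
      simp only [Set.mem_Ioi]; linarith
    · simp only [add_sub_cancel]
      exact Real.sqrt_sq hr.le

/-- Substituting r = √(1+s) gives r^{n-1}dr = ½(1+s)^{(n-2)/2}ds. Pairings with functions of |ξ|² -
1 become one-dimensional. -/
lemma integral_eq_integral_shell (hn : 2 ≤ n) {F : Rn n → ℂ} (hF : Integrable F) :
    IntegrableOn (shell F) (Set.Ioi (-1)) ∧ ∫ x, F x = ∫ s in Set.Ioi (-1 : ℝ), shell F s := by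
  obtain ⟨h1, h2⟩ := integral_polar hn hF
  have hd : ∀ s ∈ Set.Ioi (-1 : ℝ),
      HasDerivWithinAt (fun s : ℝ => √(1 + s)) (1 / (2 * √(1 + s))) (Set.Ioi (-1)) s := by
    intro s hs
    have hs : -1 < s := hs
    have : HasDerivAt (fun s : ℝ => 1 + s) 1 s := (hasDerivAt_id s).const_add 1
    exact (this.sqrt (by linarith)).hasDerivWithinAt
  have hinj : Set.InjOn (fun s : ℝ => √(1 + s)) (Set.Ioi (-1)) := by
    intro s hs t ht h
    have hs : -1 < s := hs
    have ht : -1 < t := ht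
    have := (Real.sqrt_inj (by linarith) (by linarith)).1 h
    linarith
  have hcongr : ∀ s ∈ Set.Ioi (-1 : ℝ), |1 / (2 * √(1 + s))| • (√(1 + s) ^ (n - 1)
      • sphInt F (√(1 + s))) = shell F s := by
    intro s hs
    have hs : -1 < s := hs
    have h0 : 0 < 1 + s := by linarith
    have h0' : 0 < √(1 + s) := Real.sqrt_pos.2 h0
    rw [smul_smul, Complex.real_smul, shell]
    congr 2
    rw [abs_of_pos (by positivity)]
    have e1 : √(1 + s) ^ (n - 1) = √(1 + s) * (1 + s) ^ (((n : ℝ) - 2) / 2) := by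
      obtain ⟨m, rfl⟩ : ∃ m, n = m + 2 := ⟨n - 2, by omega⟩
      have : m + 2 - 1 = m + 1 := by omega
      rw [this, pow_succ', Real.sqrt_eq_rpow, ← Real.rpow_natCast, ← Real.rpow_mul h0.le]
      congr 2
      push_cast
      ring
    rw [e1]
    field_simp
  have h3 := (integrableOn_image_iff_integrableOn_abs_deriv_smul measurableSet_Ioi hd hinj
    (fun r : ℝ => r ^ (n - 1) • sphInt F r))
  have h4 := integral_image_eq_integral_abs_deriv_smul measurableSet_Ioi hd hinj
    (fun r : ℝ => r ^ (n - 1) • sphInt F r)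
  rw [image_sqrt] at h3 h4
  refine ⟨(h3.1 h1).congr_fun hcongr measurableSet_Ioi, ?_⟩
  rw [h2, h4]
  exact setIntegral_congr_fun measurableSet_Ioi hcongr

lemma shell_radial_mul (k : ℝ → ℂ) (h : Rn n → ℂ) {s : ℝ} (hs : -1 < s) :
    shell (fun ξ => k (‖ξ‖ ^ 2 - 1) * h ξ) s = k s * shell h s := by
  have : ∀ ω : Metric.sphere (0 : Rn n) 1, ‖√(1 + s) • (ω : Rn n)‖ ^ 2 - 1 = s := by
    intro ω
    rw [norm_smul, norm_eq_of_mem_sphere, mul_one, Real.norm_of_nonneg (Real.sqrt_nonneg _),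
      Real.sq_sqrt (by linarith)]
    ring
  simp only [shell, sphInt, this, integral_const_mul]
  ring

lemma integral_radial_mul (hn : 2 ≤ n) {k : ℝ → ℂ} {h : Rn n → ℂ}
    (hF : Integrable fun ξ => k (‖ξ‖ ^ 2 - 1) * h ξ) :
    IntegrableOn (fun s => k s * shell h s) (Set.Ioi (-1)) ∧
      ∫ ξ, k (‖ξ‖ ^ 2 - 1) * h ξ = ∫ s in Set.Ioi (-1 : ℝ), k s * shell h s := by
  obtain ⟨h1, h2⟩ := integral_eq_integral_shell hn hF
  have : ∀ s ∈ Set.Ioi (-1 : ℝ), shell (fun ξ => k (‖ξ‖ ^ 2 - 1) * h ξ) s = k s * shell h s :=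
    fun s hs => shell_radial_mul k h hs
  exact ⟨h1.congr_fun this measurableSet_Ioi, h2.trans (setIntegral_congr_fun measurableSet_Ioi this)⟩

lemma continuous_sphInt {h : Rn n → ℂ} (hh : Continuous h) : Continuous (sphInt h) := by
  have h1 : Continuous (Function.uncurry fun (r : ℝ) (ω : Metric.sphere (0 : Rn n) 1) =>
      h (r • (ω : Rn n))) := hh.comp (by fun_prop)
  have := continuous_parametric_integral_of_continuous (μ := sphereMeasure n) h1
    (isCompact_univ (X := Metric.sphere (0 : Rn n) 1))
  simp only [Measure.restrict_univ] at this
  exact this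

lemma continuousOn_shell {h : Rn n → ℂ} (hh : Continuous h) :
    ContinuousOn (shell h) (Set.Ioi (-1)) := by
  intro s hs
  have hs : -1 < s := hs
  refine ContinuousAt.continuousWithinAt ?_
  unfold shell
  refine ContinuousAt.mul ?_ ((continuous_sphInt hh).comp (by fun_prop)).continuousAt
  refine Complex.continuous_ofReal.continuousAt.comp ?_
  refine ContinuousAt.const_mul ?_ _
  exact ContinuousAt.rpow_const (by fun_prop) (Or.inl (by linarith))

end Polar

/-! ### Poisson integrals on the line -/

section Peak

lemma integral_cauchy_kernel : ∫ x : ℝ, Real.pi⁻¹ * (1 + x ^ 2)⁻¹ = 1 := by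
  rw [integral_const_mul, integral_univ_inv_one_add_sq, inv_mul_cancel₀ Real.pi_ne_zero]

/-- Poisson integrals converge to boundary values. -/
lemma tendsto_poisson {H : ℝ → ℂ} {a x₀ : ℝ} (ha : a < x₀) (hH : IntegrableOn H (Set.Ioi a))
    (hc : ContinuousAt H x₀) :
    Tendsto (fun δ : ℝ => ∫ s in Set.Ioi a, ((δ / ((s - x₀) ^ 2 + δ ^ 2) : ℝ) : ℂ) * H s)
      (𝓝[>] 0) (𝓝 (Real.pi * H x₀)) := by
  set g : ℝ → ℂ := (Set.Ioi a).indicator H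
  have hg : Integrable g := (integrable_indicator_iff measurableSet_Ioi).2 hH
  have hgc : ContinuousAt g x₀ := by
    refine hc.congr ?_
    filter_upwards [Ioi_mem_nhds ha] with s hs
    exact (Set.indicator_of_mem hs H).symm
  have hg0 : g x₀ = H x₀ := Set.indicator_of_mem (by simpa using ha) H
  -- Dilated by 1/δ, the Cauchy density is the Poisson kernel divided by π. The side condition that
  -- |x|φ(x) → 0 at infinity is what an approximate identity needs when g is only integrable.
  have key := tendsto_integral_comp_smul_smul_of_integrable' (μ := (volume : Measure ℝ))
    (φ := fun x : ℝ => Real.pi⁻¹ * (1 + x ^ 2)⁻¹) (fun x => by positivity) integral_cauchy_kernel ?_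
    hg hgc
  · have h2 := (key.comp tendsto_inv_nhdsGT_zero).const_mul (Real.pi : ℂ)
    rw [hg0] at h2
    refine h2.congr' ?_
    filter_upwards [self_mem_nhdsWithin] with δ hδ
    have hδ : 0 < δ := hδ
    simp only [Function.comp]
    rw [← integral_indicator measurableSet_Ioi, ← integral_const_mul]
    refine integral_congr_ae (ae_of_all _ fun s => ?_)
    simp only [g, Module.finrank_self, pow_one, smul_eq_mul]
    by_cases hs : s ∈ Set.Ioi a
    · rw [Set.indicator_of_mem hs, Set.indicator_of_mem hs, Complex.real_smul, ← mul_assoc]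
      congr 1
      norm_cast
      have := Real.pi_pos
      have h3 : 0 < (s - x₀) ^ 2 + δ ^ 2 := by positivity
      have h4 : 1 + (δ⁻¹ * (x₀ - s)) ^ 2 = ((s - x₀) ^ 2 + δ ^ 2) / δ ^ 2 := by
        field_simp; ring
      rw [h4]
      field_simp
    · rw [Set.indicator_of_notMem hs, Set.indicator_of_notMem hs, smul_zero, mul_zero]
  · simp only [Module.finrank_self, pow_one]
    refine squeeze_zero' (Eventually.of_forall fun x => by positivity) (g := fun x : ℝ => ‖x‖⁻¹) ?_
      (tendsto_inv_atTop_zero.comp tendsto_norm_cobounded_atTop)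
    filter_upwards [Bornology.eventually_ne_cobounded (0 : ℝ)] with x hx
    have hx' : 0 < ‖x‖ := norm_pos_iff.2 hx
    have e : x ^ 2 = ‖x‖ ^ 2 := by simp
    rw [e, ← mul_inv, mul_inv_le_iff₀ (by positivity)]
    have h3 : (1 : ℝ) ≤ Real.pi := by linarith [Real.pi_gt_three]
    rw [inv_mul_eq_div, le_div_iff₀ hx']
    nlinarith [sq_nonneg ‖x‖]

end Peak

end HelmholtzBR

namespace HelmholtzBR

variable {n : ℕ}

/-! ### Fractional integration of averages of the symbol -/

section Fractional

/-- The constant in the fractional integration identity. -/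
noncomputable def fracConst (a c : ℝ) : ℝ := Real.Gamma a * Real.Gamma c / Real.Gamma (a + c)

lemma fracConst_pos {a c : ℝ} (ha : 0 < a) (hc : 0 < c) : 0 < fracConst a c := by
  have h1 := Real.Gamma_pos_of_pos ha
  have h2 := Real.Gamma_pos_of_pos hc
  have h3 := Real.Gamma_pos_of_pos (add_pos ha hc)
  unfold fracConst
  positivity

/-- The complex integral at w = η has a known nonzero value, while the integral of a non-integrable
function is 0 by convention; so the integrand is integrable, and so is its modulus. -/
lemma integrableOn_rpow_mul_add_rpow {a c η : ℝ} (ha : 0 < a) (hc : 0 < c) (hη : 0 < η) :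
    IntegrableOn (fun τ : ℝ => τ ^ (c - 1) * (η + τ) ^ (-(a + c))) (Set.Ioi 0) := by
  have h := integral_rpow_mul_cpow_add ha hc (w := (η : ℂ)) (by simpa using hη)
  have hne : ((Real.Gamma a * Real.Gamma c / Real.Gamma (a + c) : ℝ) : ℂ) * (η : ℂ) ^ (-(a : ℂ))
      ≠ 0 := by
    refine mul_ne_zero ?_ ?_
    · exact_mod_cast (fracConst_pos ha hc).ne'
    · rw [Ne, Complex.cpow_eq_zero_iff]
      have : (η : ℂ) ≠ 0 := by exact_mod_cast hη.ne'
      tauto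
  have hint : IntegrableOn (fun τ : ℝ => ((τ ^ (c - 1) : ℝ) : ℂ)
      * ((η : ℂ) + τ) ^ (-((a + c : ℝ) : ℂ))) (Set.Ioi 0) := by
    by_contra hcon
    exact hne (h.symm.trans (integral_undef hcon))
  refine IntegrableOn.congr_fun (f := fun τ : ℝ => ‖((τ ^ (c - 1) : ℝ) : ℂ)
      * ((η : ℂ) + τ) ^ (-((a + c : ℝ) : ℂ))‖) hint.norm (fun τ hτ => ?_) measurableSet_Ioi
  have hτ : 0 < τ := hτ
  simp only
  rw [norm_mul, Complex.norm_real, Real.norm_of_nonneg (by positivity), ← Complex.ofReal_add,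
    ← Complex.ofReal_neg, Complex.norm_cpow_eq_rpow_re_of_pos (by positivity), Complex.ofReal_re]

variable {X : Type*} [MeasurableSpace X] {μ : Measure X}

lemma norm_sym_add_le {a : ℝ} (ha : 0 ≤ a) {w : ℂ} (hw : 0 < w.re) {τ : ℝ} (hτ : 0 < τ) (s : ℝ) :
    ‖sym a (w + τ) s‖ ≤ (w.re + τ) ^ (-a) := by
  rw [norm_sym_ofReal]
  have : (w + (τ : ℂ)).re = w.re + τ := by simp
  rw [← this]
  exact Real.rpow_le_rpow_of_nonpos (by rw [this]; linarith) re_le_norm_base (neg_nonpos.2 ha)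

lemma integrable_fractional {a c : ℝ} (ha : 0 < a) (hc : 0 < c) {w : ℂ} (hw : 0 < w.re)
    {s : X → ℝ} (hs : Measurable s) {h : X → ℂ} (hh : Integrable h μ) :
    Integrable (fun p : ℝ × X => ((p.1 ^ (c - 1) : ℝ) : ℂ)
      * (sym ((a + c : ℝ) : ℂ) (w + p.1) (s p.2) * h p.2))
      ((volume.restrict (Set.Ioi 0)).prod μ) := by
  have h1 := (integrableOn_rpow_mul_add_rpow ha hc hw).mul_prod hh.norm
  refine Integrable.mono' h1 ?_ ?_
  · refine AEStronglyMeasurable.mul ?_ (AEStronglyMeasurable.mul ?_ hh.1.comp_snd)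
    · exact (Complex.measurable_ofReal.comp
        (measurable_fst.pow_const (c - 1))).aestronglyMeasurable
    · refine Measurable.aestronglyMeasurable ?_
      unfold sym
      refine Measurable.pow_const ?_ _
      fun_prop
  · have hae : ∀ᵐ p : ℝ × X ∂((volume.restrict (Set.Ioi 0)).prod μ), 0 < p.1 :=
      Measure.quasiMeasurePreserving_fst.ae (ae_restrict_mem measurableSet_Ioi)
    filter_upwards [hae] with p hp
    rw [norm_mul, norm_mul, Complex.norm_real, Real.norm_of_nonneg (by positivity), ← mul_assoc]
    gcongr
    exact norm_sym_add_le (by linarith) hw hp _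

/-- Fractional integration of averages of powers. -/
lemma integral_fractional [SFinite μ] {a c : ℝ} (ha : 0 < a) (hc : 0 < c) {w : ℂ} (hw : 0 < w.re)
    {s : X → ℝ} (hs : Measurable s) {h : X → ℂ} (hh : Integrable h μ) :
    IntegrableOn (fun τ : ℝ => ((τ ^ (c - 1) : ℝ) : ℂ)
        * ∫ x, sym ((a + c : ℝ) : ℂ) (w + τ) (s x) * h x ∂μ) (Set.Ioi 0) ∧
      ∫ τ in Set.Ioi (0 : ℝ), ((τ ^ (c - 1) : ℝ) : ℂ)
        * ∫ x, sym ((a + c : ℝ) : ℂ) (w + τ) (s x) * h x ∂μ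
        = (fracConst a c : ℂ) * ∫ x, sym a w (s x) * h x ∂μ := by
  have hint := integrable_fractional ha hc hw hs hh
  constructor
  · have := hint.integral_prod_left
    simp only [integral_const_mul] at this
    exact this
  · have h1 := integral_integral_swap (f := fun (τ : ℝ) (x : X) => ((τ ^ (c - 1) : ℝ) : ℂ)
      * (sym ((a + c : ℝ) : ℂ) (w + τ) (s x) * h x)) hint
    simp only [integral_const_mul] at h1
    rw [h1, ← integral_const_mul]
    refine integral_congr_ae (ae_of_all _ fun x => ?_)
    simp only
    have h2 := integral_rpow_mul_cpow_add ha hc (w := w + s x * Complex.I)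
      (by rw [re_base]; exact hw)
    calc ∫ τ in Set.Ioi (0 : ℝ), ((τ ^ (c - 1) : ℝ) : ℂ)
          * (sym ((a + c : ℝ) : ℂ) (w + τ) (s x) * h x)
        = ∫ τ in Set.Ioi (0 : ℝ), ((τ ^ (c - 1) : ℝ) : ℂ)
          * (w + s x * Complex.I + τ) ^ (-((a + c : ℝ) : ℂ)) * h x := by
          refine integral_congr_ae (ae_of_all _ fun τ => ?_)
          simp only [sym]
          rw [add_right_comm, mul_assoc]
      _ = _ := by
          rw [integral_mul_const, h2, fracConst, sym, mul_assoc]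

end Fractional

/-! ### Second differences of fractional integrals -/

section SecondDifference

/-- Mean value theorem twice: for x ↦ (x+1)^e - x^e, then for x ↦ x^{e-1}. As e < 1, the power e - 2
at the intermediate point is at most its value at u. -/
lemma abs_second_difference_le {e u : ℝ} (he : e < 1) (hu : 0 < u) :
    |2 * (u + 1) ^ e - u ^ e - (u + 2) ^ e| ≤ |e| * |e - 1| * u ^ (e - 2) := by
  have hd : ∀ (e x : ℝ), 0 < x → HasDerivAt (fun x : ℝ => x ^ e) (e * x ^ (e - 1)) x :=
    fun e x hx => Real.hasDerivAt_rpow_const (Or.inl hx.ne')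
  have hd1 : ∀ (e x : ℝ), 0 < x → HasDerivAt (fun x : ℝ => (x + 1) ^ e) (e * (x + 1) ^ (e - 1)) x :=
    fun e x hx => HasDerivAt.comp_add_const x 1 (hd e (x + 1) (by linarith))
  have hdg : ∀ x : ℝ, 0 < x → HasDerivAt (fun x : ℝ => (x + 1) ^ e - x ^ e)
      (e * (x + 1) ^ (e - 1) - e * x ^ (e - 1)) x := fun x hx => (hd1 e x hx).sub (hd e x hx)
  obtain ⟨ξ, hξ, h1⟩ := exists_hasDerivAt_eq_slope (fun x : ℝ => (x + 1) ^ e - x ^ e)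
    (fun x => e * (x + 1) ^ (e - 1) - e * x ^ (e - 1)) (show u < u + 1 by linarith)
    (fun x hx => (hdg x (by linarith [hx.1])).continuousAt.continuousWithinAt)
    (fun x hx => hdg x (by linarith [hx.1]))
  have hξ0 : 0 < ξ := by linarith [hξ.1]
  obtain ⟨η, hη, h2⟩ := exists_hasDerivAt_eq_slope (fun x : ℝ => x ^ (e - 1))
    (fun x => (e - 1) * x ^ (e - 1 - 1)) (show ξ < ξ + 1 by linarith)
    (fun x hx => (hd _ x (by linarith [hx.1])).continuousAt.continuousWithinAt)
    (fun x hx => hd _ x (by linarith [hx.1]))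
  have e1 : u + 1 - u = 1 := by ring
  have e2 : ξ + 1 - ξ = 1 := by ring
  have e3 : u + 1 + 1 = u + 2 := by ring
  simp only [e1, div_one, e3] at h1
  simp only [e2, div_one] at h2
  have h3 : 2 * (u + 1) ^ e - u ^ e - (u + 2) ^ e = -(e * ((e - 1) * η ^ (e - 1 - 1))) := by
    rw [h2]; linarith
  have hη0 : 0 < η := by linarith [hη.1]
  rw [h3, abs_neg, abs_mul, abs_mul, abs_of_pos (Real.rpow_pos_of_pos hη0 _), mul_assoc]
  have e4 : e - 1 - 1 = e - 2 := by ring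
  rw [e4]
  gcongr ?_ * (?_ * ?_)
  exact Real.rpow_le_rpow_of_nonpos hu (by linarith [hη.1, hξ.1]) (by linarith)

/-- At 0 the term u^e is integrable because e > -1; at infinity two powers are gained and e - 2 <
-1. A first difference gains one power only and would require e < 0. -/
lemma integrableOn_second_difference {e : ℝ} (he : -1 < e) (he1 : e < 1) :
    IntegrableOn (fun u : ℝ => 2 * (u + 1) ^ e - u ^ e - (u + 2) ^ e) (Set.Ioi 0) := by
  have hmeas : Measurable fun u : ℝ => 2 * (u + 1) ^ e - u ^ e - (u + 2) ^ e := by fun_prop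
  rw [← Set.Ioc_union_Ioi_eq_Ioi zero_le_one]
  refine IntegrableOn.union ?_ ?_
  · have hcont : ∀ c : ℝ, 0 < c → IntegrableOn (fun u : ℝ => (u + c) ^ e) (Set.Ioc 0 1) := by
      intro c hc
      refine (ContinuousOn.integrableOn_Icc ?_).mono_set Set.Ioc_subset_Icc_self
      exact ContinuousOn.rpow_const (by fun_prop) fun x hx => Or.inl (by linarith [hx.1])
    have h0 : IntegrableOn (fun u : ℝ => u ^ e) (Set.Ioc 0 1) := by
      rw [← intervalIntegrable_iff_integrableOn_Ioc_of_le zero_le_one]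
      exact intervalIntegral.intervalIntegrable_rpow' he
    exact (((hcont 1 one_pos).const_mul 2).sub h0).sub (hcont 2 two_pos)
  · refine Integrable.mono' ((integrableOn_Ioi_rpow_of_lt (show e - 2 < -1 by linarith)
      one_pos).const_mul (|e| * |e - 1|)) hmeas.aestronglyMeasurable ?_
    filter_upwards [ae_restrict_mem measurableSet_Ioi] with u hu
    have hu : 1 < u := hu
    exact abs_second_difference_le he1 (by linarith)

lemma setIntegral_Ioi_add (g : ℝ → ℂ) (k : ℝ) :
    ∫ u in Set.Ioi (0 : ℝ), g (u + k) = ∫ v in Set.Ioi k, g v := by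
  have := (measurePreserving_add_right (volume : Measure ℝ) k).setIntegral_preimage_emb
    (measurableEmbedding_addRight k) g (Set.Ioi k)
  rw [← this]
  congr 2
  ext u
  simp

lemma integrableOn_Ioi_add {g : ℝ → ℂ} {k : ℝ} (hk : 0 ≤ k) (hg : IntegrableOn g (Set.Ioi 0)) :
    IntegrableOn (fun u => g (u + k)) (Set.Ioi 0) := by
  have := (measurePreserving_add_right (volume : Measure ℝ) k).integrableOn_comp_preimage
    (measurableEmbedding_addRight k) (f := g) (s := Set.Ioi k)
  have e : (fun x : ℝ => x + k) ⁻¹' Set.Ioi k = Set.Ioi 0 := by ext u; simp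
  rw [e] at this
  exact this.2 (hg.mono_set (Set.Ioi_subset_Ioi hk))

/-- Second differences of fractional integrals of bounded functions. -/
lemma exists_second_difference_bound {e : ℝ} (he : -1 < e) (he1 : e < 1) :
    ∃ C : ℝ, 0 ≤ C ∧ ∀ (ψ : ℝ → ℂ) (A : ℝ), 0 ≤ A → (∀ v, 0 < v → ‖ψ v‖ ≤ A) →
      (∀ k : ℝ, 0 ≤ k → IntegrableOn (fun v : ℝ => ((v ^ e : ℝ) : ℂ) * ψ (v + k)) (Set.Ioi 0)) →
      ‖2 * (∫ v in Set.Ioi (0 : ℝ), ((v ^ e : ℝ) : ℂ) * ψ (v + 1))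
        - (∫ v in Set.Ioi (0 : ℝ), ((v ^ e : ℝ) : ℂ) * ψ (v + 2))
        - ∫ v in Set.Ioi (0 : ℝ), ((v ^ e : ℝ) : ℂ) * ψ v‖ ≤ C * A := by
  set K : ℝ → ℝ := fun u => 2 * (u + 1) ^ e - u ^ e - (u + 2) ^ e with hK
  have hKint := integrableOn_second_difference he he1
  have hpow : ∀ c : ℝ, 0 ≤ c → IntegrableOn (fun u : ℝ => u ^ e) (Set.Ioc 0 c) := by
    intro c hc
    rw [← intervalIntegrable_iff_integrableOn_Ioc_of_le hc]
    exact intervalIntegral.intervalIntegrable_rpow' he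
  set I1 := ∫ u in Set.Ioc (0 : ℝ) 1, u ^ e
  set I2 := ∫ u in Set.Ioc (0 : ℝ) 2, u ^ e
  set I3 := ∫ u in Set.Ioi (0 : ℝ), |K u|
  have hI1 : 0 ≤ I1 := setIntegral_nonneg measurableSet_Ioc fun u hu => Real.rpow_nonneg hu.1.le _
  have hI2 : 0 ≤ I2 := setIntegral_nonneg measurableSet_Ioc fun u hu => Real.rpow_nonneg hu.1.le _
  have hI3 : 0 ≤ I3 := setIntegral_nonneg measurableSet_Ioi fun u _ => abs_nonneg _
  refine ⟨2 * I1 + I2 + I3, by positivity, fun ψ A hA hψ hint => ?_⟩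
  -- The three integrals are translated until ψ is evaluated at u + 2. The kernels then combine to
  -- `K`, and only pieces on (0, 1] and (0, 2], where v^e is integrable, are left over.
  have hsplit : ∀ (k c : ℝ), 0 ≤ k → 0 ≤ c → k + c = 2 →
      ∫ v in Set.Ioi (0 : ℝ), ((v ^ e : ℝ) : ℂ) * ψ (v + k)
        = (∫ v in Set.Ioc 0 c, ((v ^ e : ℝ) : ℂ) * ψ (v + k))
          + ∫ u in Set.Ioi (0 : ℝ), (((u + c) ^ e : ℝ) : ℂ) * ψ (u + 2) := by
    intro k c hk hc hkc
    have h1 := hint k hk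
    rw [← Set.Ioc_union_Ioi_eq_Ioi hc, setIntegral_union (Set.Ioc_disjoint_Ioi le_rfl)
      measurableSet_Ioi (h1.mono_set Set.Ioc_subset_Ioi_self)
      (h1.mono_set (Set.Ioi_subset_Ioi hc)), ← setIntegral_Ioi_add,
      Set.Ioc_union_Ioi_eq_Ioi hc]
    congr 1
    refine integral_congr_ae (ae_of_all _ fun u => ?_)
    simp only
    rw [add_assoc u, add_comm c, hkc]
  have hint' : ∀ (k c : ℝ), 0 ≤ k → 0 ≤ c → k + c = 2 →
      IntegrableOn (fun u : ℝ => (((u + c) ^ e : ℝ) : ℂ) * ψ (u + 2)) (Set.Ioi 0) := by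
    intro k c hk hc hkc
    refine (integrableOn_Ioi_add hc (hint k hk)).congr_fun (fun u _ => ?_) measurableSet_Ioi
    simp only
    rw [add_assoc u, add_comm c, hkc]
  have s1 := hsplit 1 1 zero_le_one zero_le_one (by norm_num)
  have s3 := hsplit 0 2 le_rfl zero_le_two (by norm_num)
  have t1 := hint' 1 1 zero_le_one zero_le_one (by norm_num)
  have t2 := hint' 2 0 zero_le_two le_rfl (by norm_num)
  have t3 := hint' 0 2 le_rfl zero_le_two (by norm_num)
  simp only [add_zero] at s3 t2
  have hcomb : ∫ u in Set.Ioi (0 : ℝ), (K u : ℂ) * ψ (u + 2)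
      = 2 * (∫ u in Set.Ioi (0 : ℝ), (((u + 1) ^ e : ℝ) : ℂ) * ψ (u + 2))
        - (∫ u in Set.Ioi (0 : ℝ), ((u ^ e : ℝ) : ℂ) * ψ (u + 2))
        - ∫ u in Set.Ioi (0 : ℝ), (((u + 2) ^ e : ℝ) : ℂ) * ψ (u + 2) := by
    rw [← integral_const_mul, ← integral_sub (t1.const_mul 2) t2,
      ← integral_sub (f := fun u => 2 * ((((u + 1) ^ e : ℝ) : ℂ) * ψ (u + 2))
        - ((u ^ e : ℝ) : ℂ) * ψ (u + 2)) ((t1.const_mul 2).sub t2) t3]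
    refine integral_congr_ae (ae_of_all _ fun u => ?_)
    simp only [hK]
    push_cast
    ring
  have b1 : ‖∫ v in Set.Ioc (0 : ℝ) 1, ((v ^ e : ℝ) : ℂ) * ψ (v + 1)‖ ≤ I1 * A := by
    rw [← integral_mul_const]
    refine norm_integral_le_of_norm_le ((hpow 1 zero_le_one).mul_const A) ?_
    filter_upwards [ae_restrict_mem measurableSet_Ioc] with v hv
    rw [norm_mul, Complex.norm_real, Real.norm_of_nonneg (Real.rpow_nonneg hv.1.le _)]
    exact mul_le_mul_of_nonneg_left (hψ _ (by linarith [hv.1])) (Real.rpow_nonneg hv.1.le _)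
  have b2 : ‖∫ v in Set.Ioc (0 : ℝ) 2, ((v ^ e : ℝ) : ℂ) * ψ v‖ ≤ I2 * A := by
    rw [← integral_mul_const]
    refine norm_integral_le_of_norm_le ((hpow 2 zero_le_two).mul_const A) ?_
    filter_upwards [ae_restrict_mem measurableSet_Ioc] with v hv
    rw [norm_mul, Complex.norm_real, Real.norm_of_nonneg (Real.rpow_nonneg hv.1.le _)]
    exact mul_le_mul_of_nonneg_left (hψ _ hv.1) (Real.rpow_nonneg hv.1.le _)
  have b3 : ‖∫ u in Set.Ioi (0 : ℝ), (K u : ℂ) * ψ (u + 2)‖ ≤ I3 * A := by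
    rw [← integral_mul_const]
    refine norm_integral_le_of_norm_le (hKint.abs.mul_const A) ?_
    filter_upwards [ae_restrict_mem measurableSet_Ioi] with u hu
    have hu : 0 < u := hu
    rw [norm_mul, Complex.norm_real, Real.norm_eq_abs]
    exact mul_le_mul_of_nonneg_left (hψ _ (by linarith)) (abs_nonneg _)
  have hfin : 2 * (∫ v in Set.Ioi (0 : ℝ), ((v ^ e : ℝ) : ℂ) * ψ (v + 1))
        - (∫ v in Set.Ioi (0 : ℝ), ((v ^ e : ℝ) : ℂ) * ψ (v + 2))
        - ∫ v in Set.Ioi (0 : ℝ), ((v ^ e : ℝ) : ℂ) * ψ v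
      = 2 * (∫ v in Set.Ioc (0 : ℝ) 1, ((v ^ e : ℝ) : ℂ) * ψ (v + 1))
        - (∫ v in Set.Ioc (0 : ℝ) 2, ((v ^ e : ℝ) : ℂ) * ψ v)
        + ∫ u in Set.Ioi (0 : ℝ), (K u : ℂ) * ψ (u + 2) := by
    rw [s1, s3, hcomb]
    ring
  rw [hfin]
  refine (norm_add_le _ _).trans ?_
  have := norm_sub_le (2 * ∫ v in Set.Ioc (0 : ℝ) 1, ((v ^ e : ℝ) : ℂ) * ψ (v + 1))
    (∫ v in Set.Ioc (0 : ℝ) 2, ((v ^ e : ℝ) : ℂ) * ψ v)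
  rw [norm_mul, Complex.norm_ofNat] at this
  linarith

end SecondDifference

/-! ### Pointwise comparison of (s²+ε²)^{-b} with the real part of the symbol -/

section Pointwise

/-- At |θ| = π/2 the angle is πb, strictly between π/2 and 3π/2, where the cosine is negative. The
margin κ is half the distance from πb to the nearer endpoint, and θ₀ is chosen with 2bθ₀ = π/2 + κ.
-/
lemma exists_neg_cos_ge {b : ℝ} (hb : 1 / 2 < b) (hb' : b < 3 / 2) :
    ∃ c θ₀ : ℝ, 0 < c ∧ 0 ≤ θ₀ ∧ θ₀ < Real.pi / 2 ∧
      ∀ θ, θ₀ ≤ |θ| → |θ| ≤ Real.pi / 2 → c ≤ -Real.cos (θ * (2 * b)) := by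
  have hπ := Real.pi_pos
  set κ := min (b * Real.pi - Real.pi / 2) (3 * Real.pi / 2 - b * Real.pi) / 2
  have h1 : 0 < κ := by
    have : 0 < min (b * Real.pi - Real.pi / 2) (3 * Real.pi / 2 - b * Real.pi) := by
      refine lt_min ?_ ?_ <;> nlinarith
    positivity
  have h2 : 2 * κ ≤ b * Real.pi - Real.pi / 2 := by
    have := min_le_left (b * Real.pi - Real.pi / 2) (3 * Real.pi / 2 - b * Real.pi)
    simp only [κ]; linarith
  have h3 : 2 * κ ≤ 3 * Real.pi / 2 - b * Real.pi := by
    have := min_le_right (b * Real.pi - Real.pi / 2) (3 * Real.pi / 2 - b * Real.pi)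
    simp only [κ]; linarith
  have hκ : κ < Real.pi / 2 := by linarith
  refine ⟨Real.sin κ, (Real.pi / 2 + κ) / (2 * b), Real.sin_pos_of_pos_of_lt_pi h1 (by linarith),
    by positivity, ?_, fun θ hθ hθ' => ?_⟩
  · rw [div_lt_iff₀ (by linarith)]
    linarith
  · rw [div_le_iff₀ (by linarith)] at hθ
    have e1 : Real.cos (θ * (2 * b)) = Real.cos (|θ| * (2 * b)) := by
      rcases abs_choice θ with h | h <;> rw [h]
      rw [neg_mul, Real.cos_neg]
    rw [e1]
    set x := |θ| * (2 * b)
    have hx : x ≤ b * Real.pi := by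
      simp only [x]; nlinarith
    have e2 : -Real.cos x = Real.cos (Real.pi - x) := by rw [Real.cos_pi_sub]
    have e3 : Real.sin κ = Real.cos (Real.pi / 2 - κ) := (Real.cos_pi_div_two_sub κ).symm
    rw [e2, e3, ← Real.cos_abs (Real.pi - x)]
    refine Real.cos_le_cos_of_nonneg_of_le_pi (abs_nonneg _) (by linarith) ?_
    rw [abs_le]
    constructor <;> linarith

lemma norm_base_ofReal (ε s : ℝ) : ‖(ε : ℂ) + s * Complex.I‖ = √(s ^ 2 + ε ^ 2) := by
  rw [Complex.norm_add_mul_I, add_comm]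

/-- The pointwise inequality behind the weighted `L²` estimate. -/
lemma exists_pointwise_bound {b : ℝ} (hb : 1 / 2 < b) (hb' : b < 3 / 2) :
    ∃ c C : ℝ, 0 < c ∧ 0 ≤ C ∧ ∀ ε s : ℝ, 0 < ε →
      c * (s ^ 2 + ε ^ 2) ^ (-b) ≤ -(sym ((2 * b : ℝ) : ℂ) ε s).re
        + C * ε ^ (4 - 2 * b) / ((s ^ 2 + ε ^ 2) * (s ^ 2 + 4 * ε ^ 2)) := by
  obtain ⟨c, θ₀, hc, hθ0, hθ1, hcos⟩ := exists_neg_cos_ge hb hb'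
  have hcθ : 0 < Real.cos θ₀ := Real.cos_pos_of_mem_Ioo ⟨by linarith, hθ1⟩
  refine ⟨c, 4 * (c + 1) * (Real.cos θ₀) ^ (-(4 - 2 * b)), hc, by positivity, fun ε s hε => ?_⟩
  set r := √(s ^ 2 + ε ^ 2)
  have hr2 : r ^ 2 = s ^ 2 + ε ^ 2 := Real.sq_sqrt (by positivity)
  have hr : 0 < r := Real.sqrt_pos.2 (by positivity)
  set x : ℂ := (ε : ℂ) + s * Complex.I
  have hnorm : ‖x‖ = r := norm_base_ofReal ε s
  have hxre : x.re = ε := by simp [x]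
  have hre : (sym ((2 * b : ℝ) : ℂ) ε s).re = r ^ (-(2 * b)) * Real.cos (x.arg * (2 * b)) := by
    rw [sym, ← Complex.ofReal_neg, Complex.cpow_ofReal_re, hnorm, mul_neg, Real.cos_neg]
  have hpow : (s ^ 2 + ε ^ 2) ^ (-b) = r ^ (-(2 * b)) := by
    rw [← hr2, ← Real.rpow_natCast, ← Real.rpow_mul hr.le]
    congr 1
    push_cast; ring
  rw [hre, hpow]
  have hrp : 0 < r ^ (-(2 * b)) := Real.rpow_pos_of_pos hr _
  have harg : |x.arg| ≤ Real.pi / 2 := (Complex.abs_arg_lt_pi_div_two_iff.2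
    (Or.inl (by rw [hxre]; exact hε))).le
  -- If the argument of ε + is is near ±π/2, the real part already has the right sign and size.
  -- Otherwise ε ≥ r cos θ₀, and the correction term is at least a multiple of r^{-2b}.
  rcases le_total θ₀ |x.arg| with h | h
  · have h1 := hcos x.arg h harg
    have h2 : 0 ≤ 4 * (c + 1) * Real.cos θ₀ ^ (-(4 - 2 * b)) * ε ^ (4 - 2 * b)
      / ((s ^ 2 + ε ^ 2) * (s ^ 2 + 4 * ε ^ 2)) := by positivity
    nlinarith
  · have h1 : Real.cos θ₀ * r ≤ ε := by
      have h2 : Real.cos x.arg = ε / r := by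
        rw [Complex.cos_arg (by rw [← norm_pos_iff, hnorm]; exact hr), hnorm, hxre]
      have h3 : Real.cos θ₀ ≤ Real.cos x.arg := by
        rw [← Real.cos_abs x.arg]
        exact Real.cos_le_cos_of_nonneg_of_le_pi (abs_nonneg _) (by linarith) h
      rw [h2, le_div_iff₀ hr] at h3
      exact h3
    have h4 : Real.cos θ₀ ^ (4 - 2 * b) * r ^ (4 - 2 * b) ≤ ε ^ (4 - 2 * b) := by
      rw [← Real.mul_rpow hcθ.le hr.le]
      exact Real.rpow_le_rpow (by positivity) h1 (by linarith)
    have h5 : (c + 1) * r ^ (-(2 * b)) ≤ 4 * (c + 1) * Real.cos θ₀ ^ (-(4 - 2 * b)) * ε ^ (4 - 2 * b)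
        / ((s ^ 2 + ε ^ 2) * (s ^ 2 + 4 * ε ^ 2)) := by
      rw [le_div_iff₀ (by positivity)]
      have h6 : (s ^ 2 + ε ^ 2) * (s ^ 2 + 4 * ε ^ 2) ≤ 4 * r ^ (4 : ℝ) := by
        have : r ^ (4 : ℝ) = (s ^ 2 + ε ^ 2) ^ 2 := by
          rw [← hr2, ← pow_mul]; norm_cast
        rw [this]
        nlinarith [sq_nonneg s, sq_nonneg ε]
      have h7 : r ^ (-(2 * b)) * r ^ (4 : ℝ) = r ^ (4 - 2 * b) := by
        rw [← Real.rpow_add hr]; congr 1; ring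
      have h8 : Real.cos θ₀ ^ (-(4 - 2 * b)) * Real.cos θ₀ ^ (4 - 2 * b) = 1 := by
        rw [← Real.rpow_add hcθ]; simp
      have h9 : r ^ (4 - 2 * b) ≤ Real.cos θ₀ ^ (-(4 - 2 * b)) * ε ^ (4 - 2 * b) := by
        calc r ^ (4 - 2 * b)
            = Real.cos θ₀ ^ (-(4 - 2 * b)) * (Real.cos θ₀ ^ (4 - 2 * b) * r ^ (4 - 2 * b)) := by
              rw [← mul_assoc, h8, one_mul]
          _ ≤ _ := by gcongr
      calc (c + 1) * r ^ (-(2 * b)) * ((s ^ 2 + ε ^ 2) * (s ^ 2 + 4 * ε ^ 2))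
          ≤ (c + 1) * r ^ (-(2 * b)) * (4 * r ^ (4 : ℝ)) := by gcongr
        _ = 4 * (c + 1) * (r ^ (-(2 * b)) * r ^ (4 : ℝ)) := by ring
        _ ≤ 4 * (c + 1) * (Real.cos θ₀ ^ (-(4 - 2 * b)) * ε ^ (4 - 2 * b)) := by
            rw [h7]; gcongr
        _ = _ := by ring
    have h10 := Real.cos_le_one (x.arg * (2 * b))
    nlinarith

end Pointwise

end HelmholtzBR

namespace HelmholtzBR

variable {n : ℕ}

/-! ### The weighted L² estimate with a trace term -/

section WeightedL2

/-- The constant in the estimate for real powers of the resolvent. -/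
noncomputable def powConst (n : ℕ) (b : ℝ) : ℝ := resConst n / Real.Gamma (2 * b + 1)

lemma powConst_pos {b : ℝ} (hb : 0 ≤ b) : 0 < powConst n b :=
  div_pos (resConst_pos n) (Real.Gamma_pos_of_pos (by linarith))

lemma norm_resForm_le_lpNorm {b : ℝ} (hb : 0 ≤ b) (hbn : b ≤ ((n : ℝ) + 1) / 4) {w : ℂ}
    (hw : goodParam w) {f g : Rn n → ℂ} (hf : Nice f) (hg : Nice g) :
    ‖resForm ((2 * b : ℝ) : ℂ) w f g‖ ≤ powConst n b
      * (lpNorm f (ENNReal.ofReal (pExp n b)) volume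
        * lpNorm g (ENNReal.ofReal (pExp n b)) volume) := by
  have h := norm_Gamma_mul_resForm_le_lpNorm hb hbn (z := ((2 * b : ℝ) : ℂ))
    (Complex.ofReal_re _) hw hf hg
  have hG : 0 < Real.Gamma (2 * b + 1) := Real.Gamma_pos_of_pos (by linarith)
  have e : Complex.Gamma (((2 * b : ℝ) : ℂ) + 1) = (Real.Gamma (2 * b + 1) : ℂ) := by
    rw [← Complex.Gamma_ofReal]; push_cast; rfl
  rw [e, norm_mul, Complex.norm_real, Real.norm_of_nonneg hG.le, Complex.ofReal_im, abs_zero,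
    mul_zero, Real.exp_zero, mul_one] at h
  rw [powConst, div_mul_eq_mul_div, le_div_iff₀ hG, mul_comm]
  exact h

/-- The `L²` norm squared of the restriction of the Fourier transform to the unit sphere. -/
noncomputable def traceSq (f : Rn n → ℂ) : ℝ :=
  ∫ ω : Metric.sphere (0 : Rn n) 1, ‖fourier f ω‖ ^ 2 ∂sphereMeasure n

lemma traceSq_nonneg (f : Rn n → ℂ) : 0 ≤ traceSq f := integral_nonneg fun _ => by positivity

/-- Choosing the second argument as the conjugate of f makes the bilinear form quadratic, so that
resolvent bounds become bounds for averages of |f̂|². -/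
lemma sq_norm_fourier_eq (f : Rn n → ℂ) (ξ : Rn n) :
    ((‖fourier f ξ‖ ^ 2 : ℝ) : ℂ) = fourier f ξ * fourier (fun x => conj (f x)) (-ξ) := by
  rw [fourier_conj, neg_neg, Complex.mul_conj, Complex.normSq_eq_norm_sq]

lemma Nice.integrable_sq_fourier {f : Rn n → ℂ} (hf : Nice f) :
    Integrable fun ξ => ((‖fourier f ξ‖ ^ 2 : ℝ) : ℂ) := by
  simp only [sq_norm_fourier_eq]
  exact hf.integrable_fourier_mul hf.conj

lemma lpNorm_conj_fun (f : Rn n → ℂ) (p : ℝ≥0∞) :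
    lpNorm (fun x => conj (f x)) p volume = lpNorm f p volume := lpNorm_conj f p volume

lemma norm_integral_sym_sq_le {b : ℝ} (hb : 0 ≤ b) (hbn : b ≤ ((n : ℝ) + 1) / 4) {w : ℂ}
    (hw : goodParam w) {f : Rn n → ℂ} (hf : Nice f) :
    ‖∫ ξ : Rn n, sym ((2 * b : ℝ) : ℂ) w (‖ξ‖ ^ 2 - 1) * ((‖fourier f ξ‖ ^ 2 : ℝ) : ℂ)‖
      ≤ powConst n b * lpNorm f (ENNReal.ofReal (pExp n b)) volume ^ 2 := by
  have h := norm_resForm_le_lpNorm hb hbn hw hf hf.conj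
  rw [lpNorm_conj_fun, ← sq] at h
  simpa only [resForm, sq_norm_fourier_eq] using h

lemma goodParam_ofReal {ε : ℝ} (hε : 0 < ε) : goodParam (ε : ℂ) :=
  ⟨by simpa using hε, Or.inl (by simp)⟩

lemma sym_one_re {τ : ℝ} (s : ℝ) : (sym 1 (τ : ℂ) s).re = τ / (s ^ 2 + τ ^ 2) := by
  rw [sym, Complex.cpow_neg_one, Complex.inv_re, Complex.normSq_add_mul_I]
  simp [add_comm]

/-- Second differences of Poisson integrals of `|f̂|²`. -/
lemma exists_poisson_second_difference {b : ℝ} (hb : 1 / 2 < b) (hb' : b < 3 / 2)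
    (hbn : b ≤ ((n : ℝ) + 1) / 4) :
    ∃ C : ℝ, 0 ≤ C ∧ ∀ f : Rn n → ℂ, Nice f → ∀ ε δ : ℝ, 0 < ε → 0 < δ →
      ‖2 * (∫ ξ : Rn n, sym 1 ((δ + ε : ℝ) : ℂ) (‖ξ‖ ^ 2 - 1) * ((‖fourier f ξ‖ ^ 2 : ℝ) : ℂ))
        - (∫ ξ : Rn n, sym 1 ((δ + 2 * ε : ℝ) : ℂ) (‖ξ‖ ^ 2 - 1) * ((‖fourier f ξ‖ ^ 2 : ℝ) : ℂ))
        - ∫ ξ : Rn n, sym 1 (δ : ℂ) (‖ξ‖ ^ 2 - 1) * ((‖fourier f ξ‖ ^ 2 : ℝ) : ℂ)‖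
      ≤ C * ε ^ (2 * b - 1) * lpNorm f (ENNReal.ofReal (pExp n b)) volume ^ 2 := by
  obtain ⟨C, hC, hdiff⟩ := exists_second_difference_bound (e := 2 * b - 2) (by linarith)
    (by linarith)
  have hκ := fracConst_pos one_pos (show 0 < 2 * b - 1 by linarith)
  set κ := fracConst 1 (2 * b - 1)
  have hpc := powConst_pos (n := n) (show 0 ≤ b by linarith)
  refine ⟨κ⁻¹ * C * powConst n b, by positivity, fun f hf ε δ hε hδ => ?_⟩
  -- φ is bounded by the resolvent estimate at order 2b, and up to the constant κ the Poisson
  -- integrals of |f̂|² are its fractional integrals of order 2b - 1.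
  set φ : ℝ → ℂ := fun v =>
    ∫ ξ : Rn n, sym ((2 * b : ℝ) : ℂ) (v : ℂ) (‖ξ‖ ^ 2 - 1) * ((‖fourier f ξ‖ ^ 2 : ℝ) : ℂ)
  set N := lpNorm f (ENNReal.ofReal (pExp n b)) volume
  have hφ : ∀ v, 0 < v → ‖φ v‖ ≤ powConst n b * N ^ 2 := fun v hv =>
    norm_integral_sym_sq_le (by linarith) hbn (goodParam_ofReal hv) hf
  have hsm : Measurable fun ξ : Rn n => ‖ξ‖ ^ 2 - 1 := by fun_prop
  have hfr : ∀ τ : ℝ, 0 < τ →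
      IntegrableOn (fun u : ℝ => ((u ^ (2 * b - 2) : ℝ) : ℂ) * φ (τ + u)) (Set.Ioi 0) ∧
      ∫ u in Set.Ioi (0 : ℝ), ((u ^ (2 * b - 2) : ℝ) : ℂ) * φ (τ + u)
        = κ * ∫ ξ : Rn n, sym 1 (τ : ℂ) (‖ξ‖ ^ 2 - 1) * ((‖fourier f ξ‖ ^ 2 : ℝ) : ℂ) := by
    intro τ hτ
    have h := integral_fractional one_pos (show 0 < 2 * b - 1 by linarith) (w := (τ : ℂ))
      (by simpa using hτ) hsm hf.integrable_sq_fourier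
    have e1 : (1 : ℝ) + (2 * b - 1) = 2 * b := by ring
    have e2 : 2 * b - 1 - 1 = 2 * b - 2 := by ring
    simp only [e1, e2, Complex.ofReal_one, ← Complex.ofReal_add] at h
    exact h
  -- Rescaling the step ε to 1 extracts ε^{2b-1} from u^{2b-2}du.
  set ψ : ℝ → ℂ := fun v => φ (δ + ε * v)
  have hscale : ∀ k : ℝ, 0 ≤ k → ∀ v : ℝ, 0 < v →
      (((ε * v) ^ (2 * b - 2) : ℝ) : ℂ) * φ (δ + ε * k + ε * v)
        = ((ε ^ (2 * b - 2) : ℝ) : ℂ) * (((v ^ (2 * b - 2) : ℝ) : ℂ) * ψ (v + k)) := by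
    intro k hk v hv
    rw [Real.mul_rpow hε.le hv.le]
    simp only [ψ]
    have : δ + ε * k + ε * v = δ + ε * (v + k) := by ring
    rw [this]
    push_cast
    ring
  have hne : ((ε ^ (2 * b - 2) : ℝ) : ℂ) ≠ 0 := by
    exact_mod_cast (Real.rpow_pos_of_pos hε _).ne'
  have hψint : ∀ k : ℝ, 0 ≤ k →
      IntegrableOn (fun v : ℝ => ((v ^ (2 * b - 2) : ℝ) : ℂ) * ψ (v + k)) (Set.Ioi 0) := by
    intro k hk
    have h1 := (hfr (δ + ε * k) (by positivity)).1
    have h2 := (integrableOn_Ioi_comp_mul_left_iff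
      (fun u : ℝ => ((u ^ (2 * b - 2) : ℝ) : ℂ) * φ (δ + ε * k + u)) 0 hε).2 (by simpa using h1)
    have h3 : IntegrableOn (fun v : ℝ => ((ε ^ (2 * b - 2) : ℝ) : ℂ)
        * (((v ^ (2 * b - 2) : ℝ) : ℂ) * ψ (v + k))) (Set.Ioi 0) :=
      h2.congr_fun (fun v hv => hscale k hk v hv) measurableSet_Ioi
    have h4 := h3.const_mul (((ε ^ (2 * b - 2) : ℝ) : ℂ)⁻¹)
    simp only [inv_mul_cancel_left₀ hne] at h4
    exact h4
  have hψeq : ∀ k : ℝ, 0 ≤ k → κ * ∫ ξ : Rn n, sym 1 ((δ + ε * k : ℝ) : ℂ) (‖ξ‖ ^ 2 - 1)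
        * ((‖fourier f ξ‖ ^ 2 : ℝ) : ℂ)
      = ((ε ^ (2 * b - 1) : ℝ) : ℂ)
        * ∫ v in Set.Ioi (0 : ℝ), ((v ^ (2 * b - 2) : ℝ) : ℂ) * ψ (v + k) := by
    intro k hk
    rw [← (hfr (δ + ε * k) (by positivity)).2]
    have h2 := integral_comp_mul_left_Ioi
      (fun u : ℝ => ((u ^ (2 * b - 2) : ℝ) : ℂ) * φ (δ + ε * k + u)) 0 hε
    rw [mul_zero, setIntegral_congr_fun measurableSet_Ioi (fun v hv => hscale k hk v hv),
      integral_const_mul] at h2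
    have h3 : ((ε ^ (2 * b - 1) : ℝ) : ℂ) = (ε : ℂ) * ((ε ^ (2 * b - 2) : ℝ) : ℂ) := by
      rw [← Complex.ofReal_mul, ← Real.rpow_one_add' hε.le (by linarith)]
      congr 2; ring
    rw [h3, mul_assoc, h2, Complex.real_smul, ← mul_assoc, Complex.ofReal_inv,
      mul_inv_cancel₀ (by exact_mod_cast hε.ne'), one_mul]
  have key := hdiff ψ (powConst n b * N ^ 2) (by positivity)
    (fun v hv => hφ _ (by positivity)) hψint
  have q0 := hψeq 0 le_rfl
  have q1 := hψeq 1 zero_le_one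
  have q2 := hψeq 2 zero_le_two
  simp only [mul_zero, add_zero, mul_one] at q0 q1
  rw [mul_comm ε 2] at q2
  have hκ' : (κ : ℂ) ≠ 0 := by exact_mod_cast hκ.ne'
  rw [← eq_inv_mul_iff_mul_eq₀ hκ'] at q0 q1 q2
  rw [q0, q1, q2]
  have hfac : ∀ A B D : ℂ, 2 * ((κ : ℂ)⁻¹ * (((ε ^ (2 * b - 1) : ℝ) : ℂ) * A))
      - (κ : ℂ)⁻¹ * (((ε ^ (2 * b - 1) : ℝ) : ℂ) * B)
      - (κ : ℂ)⁻¹ * (((ε ^ (2 * b - 1) : ℝ) : ℂ) * D)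
      = ((κ⁻¹ * ε ^ (2 * b - 1) : ℝ) : ℂ) * (2 * A - B - D) := by
    intro A B D; push_cast; ring
  rw [hfac, norm_mul, Complex.norm_real, Real.norm_of_nonneg (by positivity)]
  calc κ⁻¹ * ε ^ (2 * b - 1) * _ ≤ κ⁻¹ * ε ^ (2 * b - 1) * (C * (powConst n b * N ^ 2)) := by
        gcongr
    _ = _ := by ring

lemma integrable_sym_mul {X : Type*} [MeasurableSpace X] {μ : Measure X} {z w : ℂ}
    (hz : 0 ≤ z.re) (hw : 0 < w.re) {s : X → ℝ} (hs : Measurable s) {h : X → ℂ}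
    (hh : Integrable h μ) : Integrable (fun x => sym z w (s x) * h x) μ := by
  refine hh.bdd_mul (c := w.re ^ (-z.re) * Real.exp (2 * |z.im|)) ?_
    (ae_of_all _ fun ξ => norm_sym_le_of_re_nonneg hw hz)
  exact ((continuous_sym z hw).measurable.comp hs).aestronglyMeasurable

/-- Boundary values of the resolvent on the spectrum. -/
lemma tendsto_poisson_fourier (hn : 2 ≤ n) {f : Rn n → ℂ} (hf : Nice f) :
    Tendsto (fun δ : ℝ => (∫ ξ : Rn n, sym 1 (δ : ℂ) (‖ξ‖ ^ 2 - 1)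
      * ((‖fourier f ξ‖ ^ 2 : ℝ) : ℂ)).re) (𝓝[>] 0) (𝓝 (Real.pi / 2 * traceSq f)) := by
  have hcont : Continuous fun ξ => ((‖fourier f ξ‖ ^ 2 : ℝ) : ℂ) :=
    Complex.continuous_ofReal.comp ((continuous_fourier hf.integrable).norm.pow 2)
  have h1 := integral_eq_integral_shell hn hf.integrable_sq_fourier
  have h2 := tendsto_poisson (x₀ := 0) (by norm_num) h1.1 ((continuousOn_shell hcont).continuousAt
    (Ioi_mem_nhds (by norm_num)))
  simp only [sub_zero] at h2
  have h3 := (Complex.continuous_re.tendsto _).comp h2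
  have e0 : (Real.pi * shell (fun ξ => ((‖fourier f ξ‖ ^ 2 : ℝ) : ℂ)) 0).re
      = Real.pi / 2 * traceSq f := by
    rw [shell_zero, integral_complex_ofReal]
    rw [Complex.re_ofReal_mul, show (1 / 2 : ℂ) = ((1 / 2 : ℝ) : ℂ) by push_cast; rfl,
      Complex.re_ofReal_mul, Complex.ofReal_re, traceSq]
    ring
  rw [e0] at h3
  refine h3.congr' ?_
  filter_upwards [self_mem_nhdsWithin] with δ hδ
  have hδ : 0 < δ := hδ
  have hsm : Measurable fun ξ : Rn n => ‖ξ‖ ^ 2 - 1 := by fun_prop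
  simp only [Function.comp]
  have hi : Integrable fun ξ : Rn n => ((δ / ((‖ξ‖ ^ 2 - 1) ^ 2 + δ ^ 2) : ℝ) : ℂ)
      * ((‖fourier f ξ‖ ^ 2 : ℝ) : ℂ) := by
    refine hf.integrable_sq_fourier.bdd_mul (c := δ⁻¹) ?_ (ae_of_all _ fun ξ => ?_)
    · refine Measurable.aestronglyMeasurable ?_
      fun_prop
    · rw [Complex.norm_real, Real.norm_of_nonneg (by positivity), div_le_iff₀ (by positivity),
        mul_add, sq δ, inv_mul_cancel_left₀ hδ.ne']
      have : 0 ≤ δ⁻¹ * (‖ξ‖ ^ 2 - 1) ^ 2 := by positivity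
      linarith
  have h4 := (integral_radial_mul hn (k := fun s => ((δ / (s ^ 2 + δ ^ 2) : ℝ) : ℂ)) hi).2
  rw [← h4, ← RCLike.re_eq_complex_re, ← integral_re hi,
    ← integral_re (integrable_sym_mul (by simp) (by simpa using hδ) hsm hf.integrable_sq_fourier)]
  refine integral_congr_ae (ae_of_all _ fun ξ => ?_)
  simp only [RCLike.re_eq_complex_re, Complex.re_mul_ofReal, sym_one_re, Complex.ofReal_re]

lemma tendsto_integral_sym_one {f : Rn n → ℂ} (hf : Nice f) {τ : ℝ} (hτ : 0 < τ) :
    Tendsto (fun δ : ℝ => ∫ ξ : Rn n, sym 1 ((δ + τ : ℝ) : ℂ) (‖ξ‖ ^ 2 - 1)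
      * ((‖fourier f ξ‖ ^ 2 : ℝ) : ℂ)) (𝓝[>] 0)
      (𝓝 (∫ ξ : Rn n, sym 1 (τ : ℂ) (‖ξ‖ ^ 2 - 1) * ((‖fourier f ξ‖ ^ 2 : ℝ) : ℂ))) := by
  have hsm : Measurable fun ξ : Rn n => ‖ξ‖ ^ 2 - 1 := by fun_prop
  refine tendsto_integral_filter_of_dominated_convergence
    (fun ξ => τ⁻¹ * ‖((‖fourier f ξ‖ ^ 2 : ℝ) : ℂ)‖) ?_ ?_
    (hf.integrable_sq_fourier.norm.const_mul _) (ae_of_all _ fun ξ => ?_)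
  · filter_upwards [self_mem_nhdsWithin] with δ hδ
    have hδ : 0 < δ := hδ
    exact (integrable_sym_mul (by simp) (by simp; linarith) hsm hf.integrable_sq_fourier).1
  · filter_upwards [self_mem_nhdsWithin] with δ hδ
    have hδ : 0 < δ := hδ
    refine ae_of_all _ fun ξ => ?_
    rw [norm_mul]
    gcongr
    have h1 := norm_sym_le_of_re_nonneg (z := 1) (w := ((δ + τ : ℝ) : ℂ)) (s := ‖ξ‖ ^ 2 - 1)
      (by simp; linarith) (by simp)
    simp only [Complex.one_re, Complex.one_im, Complex.ofReal_re, abs_zero, mul_zero, Real.exp_zero,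
      mul_one, Real.rpow_neg_one] at h1
    refine h1.trans ?_
    gcongr
    linarith
  · refine Tendsto.mul_const _ ?_
    simp only [sym, Complex.cpow_neg_one]
    refine Tendsto.inv₀ (Tendsto.add_const _ ?_) (base_ne_zero (by simpa using hτ))
    refine (Complex.continuous_ofReal.tendsto _).comp ?_
    refine tendsto_nhdsWithin_of_tendsto_nhds ?_
    have : Continuous fun δ : ℝ => δ + τ := by fun_prop
    simpa using this.tendsto 0

/-- The first node δ of the second difference is sent to 0, where the Poisson integral has the
boundary value π/2 times `traceSq`. Real parts and one side of the inequality suffice for the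
application. -/
lemma exists_poisson_bound (hn : 2 ≤ n) {b : ℝ} (hb : 1 / 2 < b) (hb' : b < 3 / 2)
    (hbn : b ≤ ((n : ℝ) + 1) / 4) :
    ∃ C : ℝ, 0 ≤ C ∧ ∀ f : Rn n → ℂ, Nice f → ∀ ε : ℝ, 0 < ε →
      2 * (∫ ξ : Rn n, sym 1 (ε : ℂ) (‖ξ‖ ^ 2 - 1) * ((‖fourier f ξ‖ ^ 2 : ℝ) : ℂ)).re
        - (∫ ξ : Rn n, sym 1 ((2 * ε : ℝ) : ℂ) (‖ξ‖ ^ 2 - 1) * ((‖fourier f ξ‖ ^ 2 : ℝ) : ℂ)).re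
      ≤ C * ε ^ (2 * b - 1) * lpNorm f (ENNReal.ofReal (pExp n b)) volume ^ 2
        + Real.pi / 2 * traceSq f := by
  obtain ⟨C, hC, hbd⟩ := exists_poisson_second_difference (n := n) hb hb' hbn
  refine ⟨C, hC, fun f hf ε hε => ?_⟩
  have t1 := (Complex.continuous_re.tendsto _).comp (tendsto_integral_sym_one hf hε)
  have t2 := (Complex.continuous_re.tendsto _).comp (tendsto_integral_sym_one hf
    (show 0 < 2 * ε by linarith))
  have t3 := tendsto_poisson_fourier hn hf
  have t4 := ((t1.const_mul 2).sub t2).sub t3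
  have h5 := le_of_tendsto t4 (b := C * ε ^ (2 * b - 1)
    * lpNorm f (ENNReal.ofReal (pExp n b)) volume ^ 2) ?_
  · linarith
  · filter_upwards [self_mem_nhdsWithin] with δ hδ
    refine le_trans (le_of_eq ?_) ((Complex.re_le_norm _).trans (hbd f hf ε δ hε hδ))
    simp only [Function.comp, Complex.sub_re, Complex.mul_re, Complex.re_ofNat, Complex.im_ofNat,
      zero_mul, sub_zero]

lemma integral_neg_add_mul_sub {X : Type*} [MeasurableSpace X] {μ : Measure X} {u v w : X → ℝ}
    (hu : Integrable u μ) (hv : Integrable v μ) (hw : Integrable w μ) {K : ℝ} :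
    ∫ x, (-u x + K * (2 * v x - w x)) ∂μ
      = -(∫ x, u x ∂μ) + K * (2 * (∫ x, v x ∂μ) - ∫ x, w x ∂μ) := by
  have e1 : Integrable (fun x => -u x) μ := hu.neg
  have e3 : Integrable (fun x => 2 * v x) μ := hv.const_mul 2
  have e2 : Integrable (fun x => K * (2 * v x - w x)) μ := (e3.sub hw).const_mul K
  rw [integral_add e1 e2, integral_neg, integral_const_mul, integral_sub e3 hw, integral_const_mul]

/-- The weighted `L²` estimate for the Fourier transform, with a trace term. -/
theorem exists_weighted_L2_bound (hn : 2 ≤ n) {b : ℝ} (hb : 1 / 2 < b) (hb' : b < 3 / 2)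
    (hbn : b ≤ ((n : ℝ) + 1) / 4) :
    ∃ C : ℝ, 0 < C ∧ ∀ f : Rn n → ℂ, Nice f → ∀ ε : ℝ, 0 < ε →
      ∫ ξ : Rn n, ((‖ξ‖ ^ 2 - 1) ^ 2 + ε ^ 2) ^ (-b) * ‖fourier f ξ‖ ^ 2
        ≤ C * (lpNorm f (ENNReal.ofReal (pExp n b)) volume ^ 2 + ε ^ (1 - 2 * b) * traceSq f) := by
  obtain ⟨c, C₁, hc, hC₁, hpt⟩ := exists_pointwise_bound hb hb'
  obtain ⟨C₂, hC₂, hpo⟩ := exists_poisson_bound hn hb hb' hbn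
  have hpc := powConst_pos (n := n) (show 0 ≤ b by linarith)
  refine ⟨c⁻¹ * (powConst n b + C₁ / 6 * C₂ + C₁ / 6 * (Real.pi / 2)), by positivity,
    fun f hf ε hε => ?_⟩
  set N := lpNorm f (ENNReal.ofReal (pExp n b)) volume
  set T := traceSq f
  have hT : 0 ≤ T := traceSq_nonneg f
  have hsm : Measurable fun ξ : Rn n => ‖ξ‖ ^ 2 - 1 := by fun_prop
  have hG := hf.integrable_sq_fourier
  have i1 := integrable_sym_mul (z := ((2 * b : ℝ) : ℂ)) (w := (ε : ℂ)) (by simp; linarith)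
    (by simpa using hε) hsm hG
  have i2 := integrable_sym_mul (z := 1) (w := (ε : ℂ)) (by simp) (by simpa using hε) hsm hG
  have i3 := integrable_sym_mul (z := 1) (w := ((2 * ε : ℝ) : ℂ)) (by simp) (by simpa using hε)
    hsm hG
  -- The correction term is a combination of Poisson kernels: 2ε/(s²+ε²) - 2ε/(s²+4ε²) =
  -- 6ε³/((s²+ε²)(s²+4ε²)), whence C₁/6.
  have hpt2 : ∀ ξ : Rn n, c * (((‖ξ‖ ^ 2 - 1) ^ 2 + ε ^ 2) ^ (-b) * ‖fourier f ξ‖ ^ 2)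
      ≤ -(sym ((2 * b : ℝ) : ℂ) ε (‖ξ‖ ^ 2 - 1) * ((‖fourier f ξ‖ ^ 2 : ℝ) : ℂ)).re
        + C₁ / 6 * ε ^ (1 - 2 * b) * (2 * (sym 1 (ε : ℂ) (‖ξ‖ ^ 2 - 1)
          * ((‖fourier f ξ‖ ^ 2 : ℝ) : ℂ)).re - (sym 1 ((2 * ε : ℝ) : ℂ) (‖ξ‖ ^ 2 - 1)
          * ((‖fourier f ξ‖ ^ 2 : ℝ) : ℂ)).re) := by
    intro ξ
    have h := mul_le_mul_of_nonneg_right (hpt ε (‖ξ‖ ^ 2 - 1) hε) (sq_nonneg ‖fourier f ξ‖)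
    simp only [Complex.re_mul_ofReal, sym_one_re]
    rw [mul_assoc] at h
    refine h.trans (le_of_eq ?_)
    have e1 : ε ^ (4 - 2 * b) = ε ^ (1 - 2 * b) * ε ^ 3 := by
      rw [← Real.rpow_natCast, ← Real.rpow_add hε]; congr 1; push_cast; ring
    rw [e1]
    set s := ‖ξ‖ ^ 2 - 1
    have h1 : s ^ 2 + ε ^ 2 ≠ 0 := by positivity
    have h2 : s ^ 2 + 4 * ε ^ 2 ≠ 0 := by positivity
    have h3 : s ^ 2 + (2 * ε) ^ 2 = s ^ 2 + 4 * ε ^ 2 := by ring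
    rw [h3]
    field_simp
    ring
  have i1' := i1.re
  have i2' := i2.re
  have i3' := i3.re
  simp only [RCLike.re_eq_complex_re] at i1' i2' i3'
  have hle := integral_mono_of_nonneg (μ := volume) (ae_of_all _ fun ξ => by positivity)
    (i1'.neg.add (((i2'.const_mul 2).sub i3').const_mul (C₁ / 6 * ε ^ (1 - 2 * b))))
    (ae_of_all _ hpt2)
  have hR : ∫ ξ : Rn n, (-(sym ((2 * b : ℝ) : ℂ) ε (‖ξ‖ ^ 2 - 1)
        * ((‖fourier f ξ‖ ^ 2 : ℝ) : ℂ)).re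
        + C₁ / 6 * ε ^ (1 - 2 * b) * (2 * (sym 1 (ε : ℂ) (‖ξ‖ ^ 2 - 1)
          * ((‖fourier f ξ‖ ^ 2 : ℝ) : ℂ)).re - (sym 1 ((2 * ε : ℝ) : ℂ) (‖ξ‖ ^ 2 - 1)
          * ((‖fourier f ξ‖ ^ 2 : ℝ) : ℂ)).re))
      = -(∫ ξ : Rn n, sym ((2 * b : ℝ) : ℂ) ε (‖ξ‖ ^ 2 - 1) * ((‖fourier f ξ‖ ^ 2 : ℝ) : ℂ)).re
        + C₁ / 6 * ε ^ (1 - 2 * b) * (2 * (∫ ξ : Rn n, sym 1 (ε : ℂ) (‖ξ‖ ^ 2 - 1)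
          * ((‖fourier f ξ‖ ^ 2 : ℝ) : ℂ)).re - (∫ ξ : Rn n, sym 1 ((2 * ε : ℝ) : ℂ) (‖ξ‖ ^ 2 - 1)
          * ((‖fourier f ξ‖ ^ 2 : ℝ) : ℂ)).re) := by
    have r1 := integral_re i1
    have r2 := integral_re i2
    have r3 := integral_re i3
    simp only [RCLike.re_eq_complex_re] at r1 r2 r3
    rw [integral_neg_add_mul_sub i1' i2' i3', r1, r2, r3]
  have hle2 := hle.trans_eq hR
  rw [integral_const_mul] at hle2
  have b1 := norm_integral_sym_sq_le (show 0 ≤ b by linarith) hbn (goodParam_ofReal hε) hf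
  have b2 := hpo f hf ε hε
  have b3 := (Complex.abs_re_le_norm _).trans b1
  have b4 := (abs_le.1 b3).1
  have hE : 0 < ε ^ (1 - 2 * b) := Real.rpow_pos_of_pos hε _
  have e2 : ε ^ (1 - 2 * b) * ε ^ (2 * b - 1) = 1 := by
    rw [← Real.rpow_add hε]; simp
  have b5 := mul_le_mul_of_nonneg_left b2 (show 0 ≤ C₁ / 6 * ε ^ (1 - 2 * b) by positivity)
  have e3 : C₁ / 6 * ε ^ (1 - 2 * b) * (C₂ * ε ^ (2 * b - 1) * N ^ 2 + Real.pi / 2 * T)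
      = C₁ / 6 * C₂ * N ^ 2 + C₁ / 6 * (Real.pi / 2) * (ε ^ (1 - 2 * b) * T) := by
    linear_combination C₁ / 6 * C₂ * N ^ 2 * e2
  rw [e3] at b5
  rw [mul_assoc, ← inv_mul_le_iff₀ (by positivity), inv_inv]
  have hπ := Real.pi_pos
  have hET : 0 ≤ ε ^ (1 - 2 * b) * T := by positivity
  have hN : 0 ≤ N ^ 2 := by positivity
  have c1 : 0 ≤ powConst n b * (ε ^ (1 - 2 * b) * T) := by positivity
  have c2 : 0 ≤ C₁ / 6 * C₂ * (ε ^ (1 - 2 * b) * T) := by positivity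
  have c3 : 0 ≤ C₁ / 6 * (Real.pi / 2) * N ^ 2 := by positivity
  nlinarith

end WeightedL2

end HelmholtzBR

namespace HelmholtzBR

variable {n : ℕ}

/-! ### Bounded averages of order a force Hölder regularity of order a - 1 -/

section HoelderRegularity

/-- Averages of the powers `(w + iσs)^{-a}`. -/
noncomputable def symAvg (a σ : ℝ) (w : ℂ) (H : ℝ → ℂ) : ℂ :=
  ∫ s in Set.Ioi (-1 : ℝ), sym a w (σ * s) * H s

lemma differentiableAt_symAvg {a σ : ℝ} (ha : 0 ≤ a) {H : ℝ → ℂ} (hH : IntegrableOn H (Set.Ioi (-1)))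
    {w₀ : ℂ} (hw₀ : 0 < w₀.re) : DifferentiableAt ℂ (fun w => symAvg a σ w H) w₀ := by
  have hre : ∀ w ∈ Metric.ball w₀ (2 * (w₀.re / 4)), w₀.re / 2 < w.re := by
    intro w hw
    have h1 := (Complex.abs_re_le_norm (w - w₀)).trans_lt (mem_ball_iff_norm.1 hw)
    rw [Complex.sub_re, abs_lt] at h1
    linarith [h1.1]
  refine differentiableAt_integral_of_bound (r := w₀.re / 4) (by linarith)
    (bound := fun s => (w₀.re / 2) ^ (-a) * ‖H s‖) (hH.norm.const_mul _) ?_ ?_ ?_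
  · intro w hw
    have hw0 : 0 < w.re := by linarith [hre w hw]
    exact ((continuous_sym _ hw0).comp (by fun_prop)).aestronglyMeasurable.mul hH.1
  · refine ae_of_all _ fun s w hw => ?_
    have hw0 : 0 < w.re := by linarith [hre w hw]
    refine DifferentiableAt.differentiableWithinAt ?_
    refine DifferentiableAt.mul_const ?_ _
    unfold sym
    exact DifferentiableAt.cpow (by fun_prop) (by fun_prop) (base_mem_slitPlane hw0)
  · refine ae_of_all _ fun s w hw => ?_
    have hw1 := hre w hw
    rw [norm_mul, norm_sym_ofReal]
    have hpos : 0 < w₀.re / 2 := by linarith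
    exact mul_le_mul_of_nonneg_right (Real.rpow_le_rpow_of_nonpos hpos
      (hw1.le.trans re_le_norm_base) (neg_nonpos.2 ha)) (norm_nonneg _)

/-- For x ≤ 1 the disc has |Im w| < 1/2, for x ≥ 1 it has Re w > 1/2. The second alternative of
`goodParam` exists so that these discs, of radius proportional to x, fit for every x. -/
lemma goodParam_ball {x : ℝ} (hx : 0 < x) {w : ℂ} (hw : w ∈ Metric.ball (x : ℂ) (x / 2)) :
    goodParam w := by
  have h0 := mem_ball_iff_norm.1 hw
  have h1 := (Complex.abs_re_le_norm (w - x)).trans_lt h0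
  have h2 := (Complex.abs_im_le_norm (w - x)).trans_lt h0
  rw [Complex.sub_re, Complex.ofReal_re, abs_lt] at h1
  rw [Complex.sub_im, Complex.ofReal_im, sub_zero] at h2
  refine ⟨by linarith [h1.1], ?_⟩
  rcases le_total x 1 with h | h
  · left; linarith
  · right; linarith [h1.1]

lemma goodParam_of_abs_im {w : ℂ} (h : 0 < w.re) (h' : |w.im| ≤ 1 / 4) : goodParam w :=
  ⟨h, Or.inl (by linarith)⟩

/-- Both values are at most M, and the Schwarz lemma on the disc of radius x/2 about x gives the
constant 2M/(x/2). If |m| ≥ x/2 the second bound follows from the first. -/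
lemma norm_symAvg_sub_le {a σ M : ℝ} (ha : 0 ≤ a) (hM0 : 0 ≤ M) {H : ℝ → ℂ}
    (hH : IntegrableOn H (Set.Ioi (-1))) (hM : ∀ w, goodParam w → ‖symAvg a σ w H‖ ≤ M)
    {x m : ℝ} (hx : 0 < x) (hm : |m| ≤ 1 / 4) :
    ‖symAvg a σ (x + m * Complex.I) H - symAvg a σ x H‖ ≤ 2 * M ∧
      ‖symAvg a σ (x + m * Complex.I) H - symAvg a σ x H‖ ≤ 4 * M * |m| / x := by
  have h1 := hM (x + m * Complex.I) (goodParam_of_abs_im (by simpa using hx) (by simpa using hm))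
  have h2 := hM x (goodParam_ofReal hx)
  have h3 : ‖symAvg a σ (x + m * Complex.I) H - symAvg a σ x H‖ ≤ 2 * M :=
    (norm_sub_le _ _).trans (by linarith)
  refine ⟨h3, ?_⟩
  by_cases h : |m| < x / 2
  · have hd : DifferentiableOn ℂ (fun w => symAvg a σ w H) (Metric.ball (x : ℂ) (x / 2)) :=
      fun w hw => (differentiableAt_symAvg ha hH (goodParam_ball hx hw).1).differentiableWithinAt
    have hmem : (x + m * Complex.I : ℂ) ∈ Metric.ball (x : ℂ) (x / 2) := by
      rw [mem_ball_iff_norm, add_sub_cancel_left, norm_mul, Complex.norm_I, mul_one,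
        Complex.norm_real]
      exact h
    have h4 := Complex.dist_le_div_mul_dist_of_mapsTo_ball (R₂ := 2 * M) hd (fun w hw => ?_) hmem
    · rw [dist_eq_norm, dist_eq_norm, add_sub_cancel_left, norm_mul, Complex.norm_I, mul_one,
        Complex.norm_real, Real.norm_eq_abs] at h4
      refine h4.trans (le_of_eq ?_)
      field_simp
      ring
    · rw [Metric.mem_closedBall, dist_eq_norm]
      exact (norm_sub_le _ _).trans (by linarith [hM w (goodParam_ball hx hw)])
  · refine h3.trans ?_
    rw [le_div_iff₀ hx]
    push Not at h
    nlinarith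

/-- The average of order 1 is, up to a constant, a fractional integral of order a - 1 of those of
order a. The difference is at most 2M for τ ≤ |m| and 4M|m|/τ beyond; since 1 < a < 2, both
integrals converge and scale as |m|^{a-1}, uniformly in x. -/
lemma norm_symAvg_one_sub_le {a σ M : ℝ} (ha : 1 < a) (ha2 : a < 2) (hM0 : 0 ≤ M) {H : ℝ → ℂ}
    (hH : IntegrableOn H (Set.Ioi (-1))) (hM : ∀ w, goodParam w → ‖symAvg a σ w H‖ ≤ M)
    {x m : ℝ} (hx : 0 < x) (hm : |m| ≤ 1 / 4) :
    ‖symAvg 1 σ (x + m * Complex.I) H - symAvg 1 σ x H‖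
      ≤ (fracConst 1 (a - 1))⁻¹ * (2 / (a - 1) + 4 / (2 - a)) * M * |m| ^ (a - 1) := by
  rcases eq_or_ne m 0 with rfl | hm0
  · simp [Real.zero_rpow (show a - 1 ≠ 0 by linarith)]
  have hma : 0 < |m| := abs_pos.2 hm0
  have hκ := fracConst_pos one_pos (show 0 < a - 1 by linarith)
  set κ := fracConst 1 (a - 1)
  have hfr : ∀ w : ℂ, 0 < w.re →
      IntegrableOn (fun τ : ℝ => ((τ ^ (a - 2) : ℝ) : ℂ) * symAvg a σ (w + τ) H) (Set.Ioi 0) ∧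
      ∫ τ in Set.Ioi (0 : ℝ), ((τ ^ (a - 2) : ℝ) : ℂ) * symAvg a σ (w + τ) H
        = κ * symAvg 1 σ w H := by
    intro w hw
    have h := integral_fractional one_pos (show 0 < a - 1 by linarith) hw
      (s := fun s : ℝ => σ * s) (by fun_prop) hH
    have e1 : (1 : ℝ) + (a - 1) = a := by ring
    have e2 : a - 1 - 1 = a - 2 := by ring
    simp only [e1, e2] at h
    exact h
  obtain ⟨i1, q1⟩ := hfr (x + m * Complex.I) (by simpa using hx)
  obtain ⟨i2, q2⟩ := hfr x (by simpa using hx)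
  set f : ℝ → ℂ := fun τ => ((τ ^ (a - 2) : ℝ) : ℂ)
    * (symAvg a σ (x + m * Complex.I + τ) H - symAvg a σ (x + τ) H) with hf
  have hfi : IntegrableOn f (Set.Ioi 0) := by
    refine (i1.sub i2).congr_fun (fun τ _ => ?_) measurableSet_Ioi
    simp only [hf, Pi.sub_apply, mul_sub]
  have hq : κ * (symAvg 1 σ (x + m * Complex.I) H - symAvg 1 σ x H)
      = ∫ τ in Set.Ioi (0 : ℝ), f τ := by
    rw [mul_sub, ← q1, ← q2, ← integral_sub i1 i2]
    refine integral_congr_ae (ae_of_all _ fun τ => ?_)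
    simp only [hf, mul_sub]
  have hdiff : ∀ τ : ℝ, 0 < τ →
      ‖symAvg a σ (x + m * Complex.I + τ) H - symAvg a σ (x + τ) H‖ ≤ 2 * M ∧
      ‖symAvg a σ (x + m * Complex.I + τ) H - symAvg a σ (x + τ) H‖ ≤ 4 * M * |m| / τ := by
    intro τ hτ
    have h := norm_symAvg_sub_le (show 0 ≤ a by linarith) hM0 hH hM (show 0 < x + τ by linarith) hm
    have e : (x + m * Complex.I + τ : ℂ) = ((x + τ : ℝ) : ℂ) + m * Complex.I := by
      push_cast; ring
    rw [e, ← Complex.ofReal_add]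
    refine ⟨h.1, h.2.trans ?_⟩
    gcongr
    linarith
  have b1 : ‖∫ τ in Set.Ioc 0 |m|, f τ‖ ≤ 2 * M * (|m| ^ (a - 1) / (a - 1)) := by
    have hi : IntegrableOn (fun τ : ℝ => τ ^ (a - 2)) (Set.Ioc 0 |m|) := by
      rw [← intervalIntegrable_iff_integrableOn_Ioc_of_le hma.le]
      exact intervalIntegral.intervalIntegrable_rpow' (by linarith)
    have hv : ∫ τ in Set.Ioc 0 |m|, τ ^ (a - 2) = |m| ^ (a - 1) / (a - 1) := by
      rw [← intervalIntegral.integral_of_le hma.le, integral_rpow (Or.inl (by linarith))]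
      have : a - 2 + 1 = a - 1 := by ring
      rw [this, Real.zero_rpow (by linarith), sub_zero]
    rw [← hv, ← integral_const_mul]
    refine norm_integral_le_of_norm_le (hi.const_mul _) ?_
    filter_upwards [ae_restrict_mem measurableSet_Ioc] with τ hτ
    rw [hf, norm_mul, Complex.norm_real, Real.norm_of_nonneg (Real.rpow_nonneg hτ.1.le _), mul_comm]
    exact mul_le_mul_of_nonneg_right (hdiff τ hτ.1).1 (Real.rpow_nonneg hτ.1.le _)
  have b2 : ‖∫ τ in Set.Ioi |m|, f τ‖ ≤ 4 * M * (|m| ^ (a - 1) / (2 - a)) := by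
    have hi := integrableOn_Ioi_rpow_of_lt (show a - 3 < -1 by linarith) hma
    have hv : |m| * ∫ τ in Set.Ioi |m|, τ ^ (a - 3) = |m| ^ (a - 1) / (2 - a) := by
      rw [integral_Ioi_rpow_of_lt (by linarith) hma]
      have e1 : a - 3 + 1 = a - 2 := by ring
      have e2 : |m| ^ (a - 1) = |m| * |m| ^ (a - 2) := by
        rw [← Real.rpow_one_add' hma.le (by linarith)]; congr 1; ring
      have e3 : a - 2 ≠ 0 := by linarith
      have e4 : 2 - a ≠ 0 := by linarith
      rw [e1, e2]
      field_simp
      ring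
    rw [← hv, ← mul_assoc, ← integral_const_mul]
    refine norm_integral_le_of_norm_le (hi.const_mul _) ?_
    filter_upwards [ae_restrict_mem measurableSet_Ioi] with τ hτ
    have hτ0 : 0 < τ := hma.trans hτ
    rw [hf, norm_mul, Complex.norm_real, Real.norm_of_nonneg (Real.rpow_nonneg hτ0.le _)]
    calc τ ^ (a - 2) * _ ≤ τ ^ (a - 2) * (4 * M * |m| / τ) := by
          gcongr; exact (hdiff τ hτ0).2
      _ = 4 * M * |m| * (τ ^ (a - 2) / τ) := by ring
      _ = _ := by
          rw [← Real.rpow_sub_one hτ0.ne']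
          congr 2; ring
  have hsum : ‖∫ τ in Set.Ioi (0 : ℝ), f τ‖ ≤ (2 / (a - 1) + 4 / (2 - a)) * M * |m| ^ (a - 1) := by
    rw [← Set.Ioc_union_Ioi_eq_Ioi hma.le, setIntegral_union (Set.Ioc_disjoint_Ioi le_rfl)
      measurableSet_Ioi (hfi.mono_set Set.Ioc_subset_Ioi_self)
      (hfi.mono_set (Set.Ioi_subset_Ioi hma.le))]
    refine (norm_add_le _ _).trans ((add_le_add b1 b2).trans (le_of_eq ?_))
    ring
  rw [← hq, norm_mul, Complex.norm_real, Real.norm_of_nonneg hκ.le] at hsum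
  rw [mul_assoc, mul_assoc, ← div_eq_inv_mul, le_div_iff₀ hκ]
  linarith

/-- The summands are complex conjugates, so the sum is twice the Poisson kernel centred at l:
combining both signs recovers the density itself. -/
lemma sym_one_add_sym_one {η : ℝ} (hη : 0 < η) (l s : ℝ) :
    sym 1 (η + ((-l : ℝ) : ℂ) * Complex.I) s + sym 1 (η + (l : ℂ) * Complex.I) (-s)
      = 2 * ((η / ((s - l) ^ 2 + η ^ 2) : ℝ) : ℂ) := by
  have h1 : (η + ((-l : ℝ) : ℂ) * Complex.I + s * Complex.I) = η + ((s - l : ℝ) : ℂ) * Complex.I := by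
    push_cast; ring
  have h2 : (η + (l : ℂ) * Complex.I + ((-s : ℝ) : ℂ) * Complex.I)
      = η - ((s - l : ℝ) : ℂ) * Complex.I := by
    push_cast; ring
  simp only [sym, Complex.cpow_neg_one, h1, h2]
  set t := s - l
  have h3 : (η + (t : ℂ) * Complex.I) ≠ 0 := by
    intro h
    have := congrArg Complex.re h
    simp at this
    linarith
  have h4 : (η - (t : ℂ) * Complex.I) ≠ 0 := by
    intro h
    have := congrArg Complex.re h
    simp at this
    linarith
  have h5 : ((t : ℂ) ^ 2 + (η : ℂ) ^ 2) = (η + (t : ℂ) * Complex.I) * (η - (t : ℂ) * Complex.I) := by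
    ring_nf
    rw [Complex.I_sq]
    ring
  push_cast
  rw [h5]
  field_simp
  ring

lemma integrableOn_symAvg {a σ : ℝ} (ha : 0 ≤ a) {H : ℝ → ℂ} (hH : IntegrableOn H (Set.Ioi (-1)))
    {w : ℂ} (hw : 0 < w.re) : IntegrableOn (fun s => sym a w (σ * s) * H s) (Set.Ioi (-1)) :=
  integrable_sym_mul (s := fun s : ℝ => σ * s) (by simpa using ha) hw (by fun_prop) hH

/-- Uniform bounds for the averages force Hölder regularity. -/
lemma exists_hoelder_of_symAvg_bound {a : ℝ} (ha : 1 < a) (ha2 : a < 2) :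
    ∃ C : ℝ, 0 ≤ C ∧ ∀ (H : ℝ → ℂ) (M : ℝ), 0 ≤ M → IntegrableOn H (Set.Ioi (-1)) →
      ContinuousOn H (Set.Ioi (-1)) →
      (∀ σ : ℝ, σ = 1 ∨ σ = -1 → ∀ w, goodParam w → ‖symAvg a σ w H‖ ≤ M) →
      ∀ l : ℝ, |l| ≤ 1 / 4 → ‖H l - H 0‖ ≤ C * M * |l| ^ (a - 1) := by
  have hκ := fracConst_pos one_pos (show 0 < a - 1 by linarith)
  set K := (fracConst 1 (a - 1))⁻¹ * (2 / (a - 1) + 4 / (2 - a))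
  have h1 : 0 < a - 1 := by linarith
  have h2 : 0 < 2 - a := by linarith
  refine ⟨K / Real.pi, by positivity, fun H M hM0 hH hc hM l hl => ?_⟩
  -- As η → 0 the combination tends to 2πH(l), so continuity of the averages in the imaginary shift
  -- becomes continuity of H.
  have hlim : ∀ l : ℝ, |l| ≤ 1 / 4 →
      Tendsto (fun η : ℝ => symAvg 1 1 (η + ((-l : ℝ) : ℂ) * Complex.I) H
        + symAvg 1 (-1) (η + (l : ℂ) * Complex.I) H) (𝓝[>] 0) (𝓝 (2 * (Real.pi * H l))) := by
    intro l hl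
    have hl1 : -1 < l := by linarith [(abs_le.1 hl).1]
    have h := (tendsto_poisson hl1 hH (hc.continuousAt (Ioi_mem_nhds hl1))).const_mul 2
    refine h.congr' ?_
    filter_upwards [self_mem_nhdsWithin] with η hη
    have hη : 0 < η := hη
    unfold symAvg
    rw [← integral_add (integrableOn_symAvg zero_le_one hH (by simpa using hη))
      (integrableOn_symAvg zero_le_one hH (by simpa using hη)), ← integral_const_mul]
    refine integral_congr_ae (ae_of_all _ fun s => ?_)
    simp only [one_mul, neg_mul, Complex.ofReal_one]
    rw [← add_mul, sym_one_add_sym_one hη]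
    ring
  have hsub := (hlim l hl).sub (hlim 0 (by norm_num))
  have hle : ‖2 * (Real.pi * H l) - 2 * (Real.pi * H 0)‖ ≤ 2 * (K * M * |l| ^ (a - 1)) := by
    refine le_of_tendsto hsub.norm ?_
    filter_upwards [self_mem_nhdsWithin] with η hη
    have hη : 0 < η := hη
    have t1 := norm_symAvg_one_sub_le (m := -l) ha ha2 hM0 hH (hM 1 (Or.inl rfl)) hη
      (by rwa [abs_neg])
    have t2 := norm_symAvg_one_sub_le (m := l) ha ha2 hM0 hH (hM (-1) (Or.inr rfl)) hη hl
    rw [abs_neg] at t1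
    simp only [neg_zero, Complex.ofReal_zero, zero_mul, add_zero]
    have e : ∀ A B C D : ℂ, A + B - (C + D) = (A - C) + (B - D) := by intros; ring
    rw [e]
    refine (norm_add_le _ _).trans ?_
    simp only [K]
    linarith
  have e : 2 * (Real.pi * H l) - 2 * (Real.pi * H 0) = ((2 * Real.pi : ℝ) : ℂ) * (H l - H 0) := by
    push_cast; ring
  have hπ := Real.pi_pos
  rw [e, norm_mul, Complex.norm_real, Real.norm_of_nonneg (by positivity)] at hle
  rw [div_mul_eq_mul_div, div_mul_eq_mul_div, le_div_iff₀ hπ]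
  linarith

end HoelderRegularity

end HelmholtzBR

namespace HelmholtzBR

/-! ### Truncated kernel, regularisation and finite parts -/

section TruncatedKernel

/-- The kernel `s_-^{-a}` cut off at distance `δ` from the origin. -/
noncomputable def dKer (a δ s : ℝ) : ℝ := if s < -δ then (-s) ^ (-a) else 0

/-- The regularisation of `s_-^{-a}` as a combination of `(δ ± i s)^{-a}`. -/
noncomputable def mReg (a δ s : ℝ) : ℂ :=
  (Complex.exp (Complex.I * (Real.pi * a / 2 : ℝ)) * sym a δ s
    - Complex.exp (-(Complex.I * (Real.pi * a / 2 : ℝ))) * sym a δ (-s))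
      / (2 * Complex.I * (Real.sin (Real.pi * a) : ℝ))

lemma sin_pi_mul_ne_zero {a : ℝ} (ha : 1 < a) (ha2 : a < 2) : Real.sin (Real.pi * a) ≠ 0 := by
  have hp := Real.pi_pos
  have h : Real.sin (Real.pi * a - Real.pi) = - Real.sin (Real.pi * a) := Real.sin_sub_pi _
  have : 0 < Real.sin (Real.pi * a - Real.pi) :=
    Real.sin_pos_of_pos_of_lt_pi (by nlinarith) (by nlinarith)
  intro h0
  rw [h, h0] at this
  simp at this

lemma sym_scale (a : ℝ) {δ : ℝ} (hδ : 0 < δ) (s : ℝ) :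
    sym a δ s = ((δ ^ (-a) : ℝ) : ℂ) * sym a 1 (s / δ) := by
  have hδ' : (δ : ℂ) ≠ 0 := by exact_mod_cast hδ.ne'
  have h : (δ : ℂ) + s * Complex.I = (δ : ℂ) * (1 + ((s / δ : ℝ) : ℂ) * Complex.I) := by
    push_cast; field_simp
  have h1 : (1 + ((s / δ : ℝ) : ℂ) * Complex.I) ≠ 0 := base_ne_zero (w := 1) (by simp)
  rw [sym, sym, h, Complex.cpow_def_of_ne_zero (mul_ne_zero hδ' h1), Complex.log_ofReal_mul hδ h1,
    Complex.cpow_def_of_ne_zero h1, Real.rpow_def_of_pos hδ, add_mul, Complex.exp_add]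
  push_cast
  rfl

lemma dKer_scale (a : ℝ) {δ : ℝ} (hδ : 0 < δ) (s : ℝ) :
    dKer a δ s = δ ^ (-a) * dKer a 1 (s / δ) := by
  unfold dKer
  by_cases h : s < -δ
  · rw [if_pos h, if_pos ((div_lt_iff₀ hδ).2 (by linarith)), ← Real.mul_rpow hδ.le]
    · congr 1; field_simp
    · rw [← neg_div]; exact div_nonneg (by linarith) hδ.le
  · rw [if_neg h, if_neg, mul_zero]
    rw [div_lt_iff₀ hδ]; linarith

/-- The error kernel at scale one. -/
noncomputable def xKer (a t : ℝ) : ℂ := dKer a 1 t - mReg a 1 t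

/-- Both kernels are homogeneous of degree -a in (s, δ), so the error is one fixed profile at scale
δ. -/
lemma dKer_sub_mReg (a : ℝ) {δ : ℝ} (hδ : 0 < δ) (s : ℝ) :
    (dKer a δ s : ℂ) - mReg a δ s = ((δ ^ (-a) : ℝ) : ℂ) * xKer a (s / δ) := by
  rw [xKer, dKer_scale a hδ, mReg, mReg, sym_scale a hδ s, sym_scale a hδ (-s), neg_div,
    Complex.ofReal_one]
  push_cast
  ring

/-- Rotating `1 + i t` by a quarter turn. -/
lemma exp_mul_sym_one (a : ℝ) {t : ℝ} (ht : 0 < t) :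
    Complex.exp (Complex.I * (Real.pi * a / 2 : ℝ)) * sym a (1 : ℝ) t
      = ((t : ℂ) - Complex.I) ^ (-(a : ℂ)) := by
  have h0 : ((t : ℂ) - Complex.I) ≠ 0 := by
    intro h
    have := congrArg Complex.re h
    simp at this
    linarith
  have harg : |Complex.arg ((t : ℂ) - Complex.I)| < Real.pi / 2 := by
    rw [Complex.abs_arg_lt_pi_div_two_iff]
    left
    simpa using ht
  have hp := Real.pi_pos
  have hI : (((1 : ℝ) : ℂ) + t * Complex.I) = Complex.I * ((t : ℂ) - Complex.I) := by
    rw [mul_sub, Complex.I_mul_I]; push_cast; ring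
  rw [sym, hI, Complex.cpow_def_of_ne_zero (mul_ne_zero Complex.I_ne_zero h0),
    Complex.log_mul Complex.I_ne_zero h0, Complex.cpow_def_of_ne_zero h0, Complex.log_I,
    ← Complex.exp_add]
  · congr 1; push_cast; ring
  · rw [Complex.arg_I]
    have := abs_lt.1 harg
    constructor <;> linarith

lemma exp_mul_sym_one_neg (a : ℝ) {t : ℝ} (ht : 0 < t) :
    Complex.exp (-(Complex.I * (Real.pi * a / 2 : ℝ))) * sym a (1 : ℝ) (-t)
      = ((t : ℂ) + Complex.I) ^ (-(a : ℂ)) := by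
  have h0 : ((t : ℂ) + Complex.I) ≠ 0 := by
    intro h
    have := congrArg Complex.re h
    simp at this
    linarith
  have harg : |Complex.arg ((t : ℂ) + Complex.I)| < Real.pi / 2 := by
    rw [Complex.abs_arg_lt_pi_div_two_iff]
    left
    simpa using ht
  have hp := Real.pi_pos
  have hI : (((1 : ℝ) : ℂ) + ((-t : ℝ) : ℂ) * Complex.I) = -Complex.I * ((t : ℂ) + Complex.I) := by
    rw [mul_add, neg_mul, neg_mul, Complex.I_mul_I]; push_cast; ring
  rw [sym, hI, Complex.cpow_def_of_ne_zero (mul_ne_zero (neg_ne_zero.2 Complex.I_ne_zero) h0),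
    Complex.log_mul (neg_ne_zero.2 Complex.I_ne_zero) h0, Complex.cpow_def_of_ne_zero h0,
    Complex.log_neg_I, ← Complex.exp_add]
  · congr 1; push_cast; ring
  · rw [Complex.arg_neg_I]
    have := abs_lt.1 harg
    constructor <;> linarith

/-- Mean value inequality on the half-plane Re x ≥ t, where the derivative of x^{-a} is at most
at^{-a-1} in modulus and which contains the displacement c = ±i. -/
lemma norm_add_I_cpow_sub_le {a : ℝ} (ha : 0 < a) {t : ℝ} (ht : 0 < t) {c : ℂ} (hc : c.re = 0)
    (hc1 : ‖c‖ = 1) :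
    ‖((t : ℂ) + c) ^ (-(a : ℂ)) - ((t ^ (-a) : ℝ) : ℂ)‖ ≤ a * t ^ (-a - 1) := by
  have hb : ∀ x ∈ {x : ℂ | t ≤ x.re}, HasDerivWithinAt (fun x : ℂ => x ^ (-(a : ℂ)))
      (-(a : ℂ) * x ^ (-(a : ℂ) - 1)) {x : ℂ | t ≤ x.re} x := by
    intro x hx
    have := (hasDerivAt_id x).cpow_const (c := -(a : ℂ)) (Or.inl (ht.trans_le hx))
    simpa using this.hasDerivWithinAt
  have hbd : ∀ x ∈ {x : ℂ | t ≤ x.re}, ‖-(a : ℂ) * x ^ (-(a : ℂ) - 1)‖ ≤ a * t ^ (-a - 1) := by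
    intro x hx
    have hx : t ≤ x.re := hx
    have e : (-(a : ℂ) - 1) = ((-a - 1 : ℝ) : ℂ) := by push_cast; ring
    rw [norm_mul, norm_neg, Complex.norm_real, Real.norm_of_nonneg ha.le, e, Complex.norm_cpow_real]
    exact mul_le_mul_of_nonneg_left
      (Real.rpow_le_rpow_of_nonpos ht (hx.trans (Complex.re_le_norm x)) (by linarith)) ha.le
  have hconv : Convex ℝ {x : ℂ | t ≤ x.re} := convex_halfSpace_re_ge t
  have := hconv.norm_image_sub_le_of_norm_hasDerivWithin_le hb hbd
    (x := (t : ℂ)) (y := (t : ℂ) + c) (by simp) (by simp [hc])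
  rw [add_sub_cancel_left, hc1, mul_one] at this
  rwa [Complex.ofReal_cpow ht.le, Complex.ofReal_neg]


/-- On this side the truncated kernel vanishes; inserting t^{-a} twice exhibits the cancellation of
the leading terms of the two powers. -/
lemma xKer_of_pos {a : ℝ} {t : ℝ} (ht : 0 < t) :
    xKer a t = ((((t : ℂ) + Complex.I) ^ (-(a : ℂ)) - ((t ^ (-a) : ℝ) : ℂ))
      - (((t : ℂ) - Complex.I) ^ (-(a : ℂ)) - ((t ^ (-a) : ℝ) : ℂ)))
        / (2 * Complex.I * (Real.sin (Real.pi * a) : ℝ)) := by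
  have h : dKer a 1 t = 0 := if_neg (by linarith)
  rw [xKer, h, mReg, exp_mul_sym_one a ht, exp_mul_sym_one_neg a ht]
  push_cast
  ring

/-- Here the leading terms carry the phases e^{iπa} and e^{-iπa}, whose difference is 2i sin(πa).
Dividing by it reproduces |t|^{-a} exactly, and only the errors of the two powers remain. -/
lemma xKer_of_neg {a : ℝ} (ha : 1 < a) (ha2 : a < 2) {t : ℝ} (ht : t < -1) :
    xKer a t = (Complex.exp (-(Complex.I * (Real.pi * a : ℝ)))
        * ((((-t : ℝ) : ℂ) - Complex.I) ^ (-(a : ℂ)) - (((-t) ^ (-a) : ℝ) : ℂ))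
      - Complex.exp (Complex.I * (Real.pi * a : ℝ))
        * ((((-t : ℝ) : ℂ) + Complex.I) ^ (-(a : ℂ)) - (((-t) ^ (-a) : ℝ) : ℂ)))
        / (2 * Complex.I * (Real.sin (Real.pi * a) : ℝ)) := by
  have h : dKer a 1 t = (-t) ^ (-a) := if_pos ht
  have ht' : 0 < -t := by linarith
  have hs : ((Real.sin (Real.pi * a) : ℝ) : ℂ) ≠ 0 := by exact_mod_cast sin_pi_mul_ne_zero ha ha2
  have hD : (2 * Complex.I * (Real.sin (Real.pi * a) : ℝ)) ≠ 0 :=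
    mul_ne_zero (mul_ne_zero two_ne_zero Complex.I_ne_zero) hs
  have h1 := exp_mul_sym_one a ht'
  have h2 := exp_mul_sym_one_neg a ht'
  rw [neg_neg] at h2
  rw [xKer, h, mReg, ← h1, ← h2]
  have e1 : Complex.exp (Complex.I * (Real.pi * a : ℝ))
      = Complex.exp (Complex.I * (Real.pi * a / 2 : ℝ)) * Complex.exp (Complex.I * (Real.pi * a / 2 : ℝ)) := by
    rw [← Complex.exp_add]; congr 1; push_cast; ring
  have e2 : Complex.exp (-(Complex.I * (Real.pi * a : ℝ)))
      = Complex.exp (-(Complex.I * (Real.pi * a / 2 : ℝ))) * Complex.exp (-(Complex.I * (Real.pi * a / 2 : ℝ))) := by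
    rw [← Complex.exp_add]; congr 1; push_cast; ring
  have e3 : Complex.exp (Complex.I * (Real.pi * a / 2 : ℝ))
      * Complex.exp (-(Complex.I * (Real.pi * a / 2 : ℝ))) = 1 := by
    rw [← Complex.exp_add, add_neg_cancel, Complex.exp_zero]
  have e4 : Complex.exp (Complex.I * (Real.pi * a : ℝ)) - Complex.exp (-(Complex.I * (Real.pi * a : ℝ)))
      = 2 * Complex.I * (Real.sin (Real.pi * a) : ℝ) := by
    have := Complex.two_sin (Real.pi * a : ℝ)
    rw [Complex.ofReal_sin]
    have e : ∀ x : ℂ, 2 * Complex.I * x = Complex.I * (2 * x) := by intros; ring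
    rw [e, this]
    have e' : ∀ A B : ℂ, Complex.I * ((A - B) * Complex.I) = (B - A) * (-(Complex.I * Complex.I)) := by
      intros; ring
    rw [e', Complex.I_mul_I, neg_neg, mul_one]
    congr 2 <;> ring
  rw [eq_div_iff hD, sub_mul, div_mul_cancel₀ _ hD, ← e4, e1, e2]
  set A := Complex.exp (Complex.I * (Real.pi * a / 2 : ℝ))
  set B := Complex.exp (-(Complex.I * (Real.pi * a / 2 : ℝ)))
  simp only [Complex.ofReal_one]
  linear_combination (sym a 1 t * A - sym a 1 (-t) * B) * e3

lemma norm_exp_I_mul (x : ℝ) : ‖Complex.exp (Complex.I * x)‖ = 1 := by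
  rw [mul_comm]; exact Complex.norm_exp_ofReal_mul_I x

lemma norm_exp_neg_I_mul (x : ℝ) : ‖Complex.exp (-(Complex.I * x))‖ = 1 := by
  rw [← norm_exp_I_mul (-x)]; congr 2; push_cast; ring

lemma norm_xKer_denominator (a : ℝ) :
    ‖(2 * Complex.I * (Real.sin (Real.pi * a) : ℝ))‖ = 2 * |Real.sin (Real.pi * a)| := by
  rw [norm_mul, norm_mul, Complex.norm_I, Complex.norm_real]
  simp

lemma norm_mReg_le (a δ s : ℝ) :
    ‖mReg a δ s‖ ≤ (‖sym a δ s‖ + ‖sym a δ (-s)‖) / (2 * |Real.sin (Real.pi * a)|) := by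
  rw [mReg, norm_div, norm_xKer_denominator]
  gcongr
  refine (norm_sub_le _ _).trans ?_
  rw [norm_mul, norm_mul, norm_exp_I_mul, norm_exp_neg_I_mul, one_mul, one_mul]

/-- Decay of the error kernel. -/
lemma exists_norm_xKer_le {a : ℝ} (ha : 1 < a) (ha2 : a < 2) :
    ∃ C : ℝ, 0 < C ∧ ∀ t, ‖xKer a t‖ ≤ C * (1 + t ^ 2) ^ (-(a + 1) / 2) := by
  have hs := abs_pos.2 (sin_pi_mul_ne_zero ha ha2)
  set S := |Real.sin (Real.pi * a)|
  have hbig : ∀ t : ℝ, 1 ≤ |t| → ‖xKer a t‖ ≤ 2 * (a * |t| ^ (-a - 1)) / (2 * S) → 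
      ‖xKer a t‖ ≤ (2 / S * 2 ^ ((a + 1) / 2)) * (1 + t ^ 2) ^ (-(a + 1) / 2) := by
    intro t ht h
    have h1 : |t| ^ (-a - 1) = (t ^ 2) ^ (-(a + 1) / 2) := by
      rw [← sq_abs, ← Real.rpow_natCast, ← Real.rpow_mul (abs_nonneg t)]
      congr 1; push_cast; ring
    have h2 : (t ^ 2) ^ (-(a + 1) / 2) ≤ ((1 + t ^ 2) / 2) ^ (-(a + 1) / 2) := by
      refine Real.rpow_le_rpow_of_nonpos (by positivity) ?_ (by linarith)
      have : 1 ≤ t ^ 2 := by rw [← sq_abs]; nlinarith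
      linarith
    have h3 : ((1 + t ^ 2) / 2) ^ (-(a + 1) / 2)
        = 2 ^ ((a + 1) / 2) * (1 + t ^ 2) ^ (-(a + 1) / 2) := by
      rw [Real.div_rpow (by positivity) (by norm_num), neg_div, Real.rpow_neg (x := 2) (by norm_num)]
      field_simp
    rw [h3] at h2
    refine h.trans ?_
    rw [h1, mul_div_mul_left _ _ two_ne_zero, mul_assoc, div_mul_eq_mul_div]
    gcongr
  have h5 : (0 : ℝ) < 2 ^ ((a + 1) / 2) := by positivity
  refine ⟨2 / S * 2 ^ ((a + 1) / 2), by positivity, fun t => ?_⟩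
  rcases lt_or_ge t (-1) with h | h
  · refine hbig t (by rw [abs_of_neg (by linarith)]; linarith) ?_
    have ht : 0 < -t := by linarith
    have n1 := norm_add_I_cpow_sub_le (a := a) (c := Complex.I) (by linarith) ht (by simp) (by simp)
    have n2 := norm_add_I_cpow_sub_le (a := a) (c := -Complex.I) (by linarith) ht (by simp) (by simp)
    rw [← sub_eq_add_neg] at n2
    rw [xKer_of_neg ha ha2 h, norm_div, norm_xKer_denominator]
    gcongr
    refine (norm_sub_le _ _).trans ?_
    rw [norm_mul, norm_mul, norm_exp_I_mul, norm_exp_neg_I_mul, one_mul, one_mul, two_mul,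
      abs_of_neg (show t < 0 by linarith)]
    exact add_le_add n2 n1
  rcases le_or_gt t 1 with h' | h'
  · have h0 : dKer a 1 t = 0 := if_neg (by linarith)
    have hsym : ∀ s : ℝ, ‖sym a (1 : ℝ) s‖ ≤ 1 := by
      intro s
      have := norm_sym_le_of_re_nonneg (s := s) (w := ((1 : ℝ) : ℂ)) (z := (a : ℂ)) (by simp)
        (by simp; linarith)
      simpa using this
    have h1 : ‖xKer a t‖ ≤ (1 + 1) / (2 * S) := by
      rw [xKer, h0, Complex.ofReal_zero, zero_sub, norm_neg]
      refine (norm_mReg_le a 1 t).trans ?_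
      gcongr <;> exact hsym _
    have h2 : (2 : ℝ) ^ (-(a + 1) / 2) ≤ (1 + t ^ 2) ^ (-(a + 1) / 2) :=
      Real.rpow_le_rpow_of_nonpos (by positivity) (by nlinarith) (by linarith)
    calc ‖xKer a t‖ ≤ 1 / S := h1.trans (le_of_eq (by field_simp; norm_num))
      _ ≤ 2 / S := by gcongr; norm_num
      _ = 2 / S * 2 ^ ((a + 1) / 2) * 2 ^ (-(a + 1) / 2) := by
          rw [mul_assoc, ← Real.rpow_add two_pos, neg_div, add_neg_cancel, Real.rpow_zero, mul_one]
      _ ≤ _ := by gcongr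
  · refine hbig t (by rw [abs_of_pos (by linarith)]; linarith) ?_
    have ht : 0 < t := by linarith
    rw [xKer_of_pos ht, norm_div, norm_xKer_denominator]
    gcongr
    refine (norm_sub_le _ _).trans ?_
    rw [two_mul, abs_of_pos ht]
    refine add_le_add (norm_add_I_cpow_sub_le (by linarith) ht (by simp) (by simp)) ?_
    rw [sub_eq_add_neg (t : ℂ)]
    exact norm_add_I_cpow_sub_le (by linarith) ht (by simp) (by simp)


lemma integrable_japanese {r : ℝ} (hr : 1 < r) : Integrable fun t : ℝ => (1 + t ^ 2) ^ (-r / 2) := by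
  have := integrable_rpow_neg_one_add_norm_sq (E := ℝ) (μ := volume) (r := r) (by simpa using hr)
  simpa using this

lemma integrable_sym_one {a : ℝ} (ha : 1 < a) : Integrable fun t : ℝ => sym a (1 : ℝ) t := by
  refine (integrable_japanese ha).mono' (continuous_sym _ (by simp)).aestronglyMeasurable ?_
  refine ae_of_all _ fun t => le_of_eq ?_
  rw [norm_sym_ofReal, norm_base_ofReal, Real.sqrt_eq_rpow, ← Real.rpow_mul (by positivity)]
  congr 1 <;> ring

/-- The primitive (1+it)^{1-a}/(i(1-a)) vanishes at both ends of the line because a > 1. -/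
lemma integral_sym_one {a : ℝ} (ha : 1 < a) : ∫ t : ℝ, sym a (1 : ℝ) t = 0 := by
  have hne : (1 - (a : ℂ)) ≠ 0 := by
    intro h
    have := congrArg Complex.re h
    simp at this
    linarith
  have hder : ∀ t : ℝ, HasDerivAt
      (fun t : ℝ => (((1 : ℝ) : ℂ) + t * Complex.I) ^ (1 - (a : ℂ)) / (Complex.I * (1 - a)))
      (sym a (1 : ℝ) t) t := by
    intro t
    have h0 := ((hasDerivAt_id (t : ℂ)).mul_const Complex.I).const_add ((1 : ℝ) : ℂ)
    have h := ((h0.cpow_const (c := 1 - (a : ℂ))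
      (base_mem_slitPlane (by simp))).div_const (Complex.I * (1 - a))).comp_ofReal
    refine h.congr_deriv ?_
    rw [sym, div_eq_iff (mul_ne_zero Complex.I_ne_zero hne)]
    have : (1 - (a : ℂ) - 1) = -a := by ring
    simp only [this, id]
    ring
  have hn : ∀ l : Filter ℝ, Tendsto (fun t : ℝ => |t|) l atTop → Tendsto
      (fun t : ℝ => (((1 : ℝ) : ℂ) + t * Complex.I) ^ (1 - (a : ℂ)) / (Complex.I * (1 - a)))
      l (𝓝 0) := by
    intro l hl
    rw [← zero_div (Complex.I * (1 - (a : ℂ)))]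
    refine Tendsto.div_const ?_ _
    refine squeeze_zero_norm' (a := fun t => |t| ^ (-(a - 1))) ?_
      ((tendsto_rpow_neg_atTop (by linarith)).comp hl)
    filter_upwards [hl.eventually_gt_atTop 0] with t ht
    have e : 1 - (a : ℂ) = ((-(a - 1) : ℝ) : ℂ) := by push_cast; ring
    rw [e, Complex.norm_cpow_real, norm_base_ofReal]
    refine Real.rpow_le_rpow_of_nonpos ht ?_ (by linarith)
    exact Real.abs_le_sqrt (by linarith)
  rw [integral_of_hasDerivAt_of_tendsto hder (integrable_sym_one ha) (hn _ tendsto_abs_atBot_atTop)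
    (hn _ tendsto_abs_atTop_atTop), sub_zero]

lemma integrable_mReg_one {a : ℝ} (ha : 1 < a) : Integrable (mReg a 1) := by
  have h := integrable_sym_one ha
  exact ((h.const_mul _).sub (h.comp_neg.const_mul _)).div_const _

lemma integral_mReg_one {a : ℝ} (ha : 1 < a) : ∫ t, mReg a 1 t = 0 := by
  have h := integrable_sym_one ha
  unfold mReg
  rw [integral_div, integral_sub (h.const_mul _) (h.comp_neg.const_mul _), integral_const_mul,
    integral_const_mul, integral_neg_eq_self (fun t => sym a (1 : ℝ) t), integral_sym_one ha]
  simp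

lemma dKer_one_eq (a : ℝ) : (fun t => dKer a 1 t) = fun t => (Set.Ioi 1).indicator (fun u => u ^ (-a)) (-t) := by
  funext t
  simp only [dKer, Set.indicator_apply, Set.mem_Ioi]
  congr 1
  exact propext ⟨fun h => by linarith, fun h => by linarith⟩

lemma integrable_dKer_one {a : ℝ} (ha : 1 < a) : Integrable (dKer a 1) := by
  have h : Integrable ((Set.Ioi 1).indicator fun u : ℝ => u ^ (-a)) :=
    (integrable_indicator_iff measurableSet_Ioi).2 (integrableOn_Ioi_rpow_of_lt (by linarith) one_pos)
  have := h.comp_neg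
  rwa [← dKer_one_eq] at this

lemma integral_dKer_one {a : ℝ} (ha : 1 < a) : ∫ t, dKer a 1 t = (a - 1)⁻¹ := by
  rw [dKer_one_eq, integral_neg_eq_self (fun t => (Set.Ioi (1 : ℝ)).indicator (fun u => u ^ (-a)) t),
    integral_indicator measurableSet_Ioi, integral_Ioi_rpow_of_lt (by linarith) one_pos,
    Real.one_rpow, neg_div, ← div_neg, one_div]
  congr 1; ring

lemma integrable_xKer {a : ℝ} (ha : 1 < a) : Integrable (xKer a) :=
  (integrable_dKer_one ha).ofReal.sub (integrable_mReg_one ha)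

/-- The regularisation has mean zero, so the whole mass is that of u^{-a} on u > 1. At scale δ it
becomes the divergent coefficient δ^{1-a}/(a-1). -/
lemma integral_xKer {a : ℝ} (ha : 1 < a) : ∫ t, xKer a t = ((a - 1)⁻¹ : ℝ) := by
  have h : Integrable fun t => (dKer a 1 t : ℂ) := (integrable_dKer_one ha).ofReal
  unfold xKer
  rw [integral_sub h (integrable_mReg_one ha), integral_mReg_one ha,
    sub_zero, integral_complex_ofReal, integral_dKer_one ha]

lemma integral_comp_div_pos (g : ℝ → ℂ) {δ : ℝ} (hδ : 0 < δ) : ∫ s, g (s / δ) = δ * ∫ t, g t := by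
  rw [Measure.integral_comp_div, abs_of_pos hδ]; simp

/-- The error made by replacing the truncated kernel by its regularisation. -/
lemma exists_norm_kernel_error_le {a κ : ℝ} (ha : 1 < a) (ha2 : a < 2) (hκ0 : 0 ≤ κ) (hκ : κ < a) :
    ∃ C : ℝ, 0 ≤ C ∧ ∀ (H : ℝ → ℂ) (L δ : ℝ), 0 ≤ L → 0 < δ → IntegrableOn H (Set.Ioi (-1)) →
      (∀ s, |s| ≤ 1 / 4 → ‖H s - H 0‖ ≤ L * |s| ^ κ) →
      ‖(∫ s in Set.Ioi (-1), ((dKer a δ s : ℂ) - mReg a δ s) * H s)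
          - H 0 * ((δ ^ (1 - a) / (a - 1) : ℝ) : ℂ)‖
        ≤ C * (L * δ ^ (κ + 1 - a) + δ * ((∫ s in Set.Ioi (-1), ‖H s‖) + ‖H 0‖)) := by
  obtain ⟨C, hC, hX⟩ := exists_norm_xKer_le ha ha2
  -- For |s| > 1/4 one has 1 + s² ≤ 17s²; this is the origin of 17.
  set D : ℝ := 17 ^ ((a + 1) / 2) with hD
  have hD0 : 0 < D := by positivity
  set K₁ := ∫ t : ℝ, (1 + t ^ 2) ^ (-(a + 1 - κ) / 2)
  set K₂ := ∫ t : ℝ, (1 + t ^ 2) ^ (-(a + 1) / 2)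
  have hK₁ : 0 ≤ K₁ := integral_nonneg fun t => by positivity
  have hK₂ : 0 ≤ K₂ := integral_nonneg fun t => by positivity
  have hi₁ := integrable_japanese (r := a + 1 - κ) (by linarith)
  have hi₂ := integrable_japanese (r := a + 1) (by linarith)
  refine ⟨C * K₁ + C * D * (1 + K₂), by positivity, fun H L δ hL hδ hH hHol => ?_⟩
  set G := (Set.Ioi (-1 : ℝ)).indicator H
  have hG : Integrable G := (integrable_indicator_iff measurableSet_Ioi).2 hH
  have hGn : ∫ s, ‖G s‖ = ∫ s in Set.Ioi (-1), ‖H s‖ := by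
    rw [← integral_indicator measurableSet_Ioi]
    exact integral_congr_ae (ae_of_all _ fun s => norm_indicator_eq_indicator_norm _ _)
  have hXm : AEStronglyMeasurable (fun s : ℝ => ((δ ^ (-a) : ℝ) : ℂ) * xKer a (s / δ)) volume :=
    (((integrable_xKer ha).comp_div hδ.ne').const_mul _).aestronglyMeasurable
  have hXi : Integrable (fun s : ℝ => ((δ ^ (-a) : ℝ) : ℂ) * xKer a (s / δ)) :=
    ((integrable_xKer ha).comp_div hδ.ne').const_mul _
  have hXb : ∀ s, ‖((δ ^ (-a) : ℝ) : ℂ) * xKer a (s / δ)‖ ≤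
      δ ^ (-a) * (C * (1 + (s / δ) ^ 2) ^ (-(a + 1) / 2)) := by
    intro s
    rw [norm_mul, Complex.norm_real, Real.norm_of_nonneg (by positivity)]
    gcongr
    exact hX _
  have hXG : Integrable (fun s : ℝ => ((δ ^ (-a) : ℝ) : ℂ) * xKer a (s / δ) * G s) := by
    refine hG.bdd_mul (c := δ ^ (-a) * (C * 1)) hXm (ae_of_all _ fun s => (hXb s).trans ?_)
    gcongr
    exact Real.rpow_le_one_of_one_le_of_nonpos (by nlinarith [sq_nonneg (s / δ)]) (by linarith)
  -- The divergent term is H(0) times the mass of the error kernel, so it turns H(s) into H(s) -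
  -- H(0), with H extended by zero to the whole line.
  have e1 : (∫ s in Set.Ioi (-1), ((dKer a δ s : ℂ) - mReg a δ s) * H s)
      - H 0 * ((δ ^ (1 - a) / (a - 1) : ℝ) : ℂ)
      = ∫ s, ((δ ^ (-a) : ℝ) : ℂ) * xKer a (s / δ) * (G s - H 0) := by
    simp_rw [mul_sub]
    rw [integral_sub hXG (hXi.mul_const _), integral_mul_const, integral_const_mul,
      integral_comp_div_pos _ hδ, integral_xKer ha]
    congr 1
    · rw [← integral_indicator measurableSet_Ioi]
      refine integral_congr_ae (ae_of_all _ fun s => ?_)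
      simp only [G, Set.indicator_apply]
      split_ifs
      · rw [dKer_sub_mReg a hδ]
      · simp
    · have : δ ^ (1 - a) = δ ^ (-a) * δ := by
        rw [← Real.rpow_add_one hδ.ne']; congr 1; ring
      rw [this]
      push_cast
      ring
  rw [e1]
  -- Near 0 the Hölder bound leaves a kernel decaying to the order a + 1 - κ > 1; for |s| > 1/4 the
  -- rescaled kernel itself is O(δ).
  have hpt : ∀ s, ‖((δ ^ (-a) : ℝ) : ℂ) * xKer a (s / δ) * (G s - H 0)‖ ≤
      C * (L * δ ^ (κ - a)) * (1 + (s / δ) ^ 2) ^ (-(a + 1 - κ) / 2)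
        + C * D * δ * (‖G s‖ + ‖H 0‖ * (1 + s ^ 2) ^ (-(a + 1) / 2)) := by
    intro s
    rw [norm_mul]
    rcases le_or_gt |s| (1 / 4) with hs | hs
    · have hGs : G s = H s := Set.indicator_of_mem (show -1 < s by linarith [(abs_le.1 hs).1]) _
      have hk : |s| ^ κ ≤ δ ^ κ * (1 + (s / δ) ^ 2) ^ (κ / 2) := by
        have : |s| ≤ δ * √(1 + (s / δ) ^ 2) := by
          have h1 : |s / δ| ≤ √(1 + (s / δ) ^ 2) := Real.abs_le_sqrt (by linarith)
          rw [abs_div, abs_of_pos hδ, div_le_iff₀ hδ] at h1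
          linarith
        refine (Real.rpow_le_rpow (abs_nonneg _) this hκ0).trans (le_of_eq ?_)
        rw [Real.mul_rpow hδ.le (Real.sqrt_nonneg _), Real.sqrt_eq_rpow,
          ← Real.rpow_mul (by positivity)]
        congr 2; ring
      have h2 : 0 ≤ C * D * δ * (‖G s‖ + ‖H 0‖ * (1 + s ^ 2) ^ (-(a + 1) / 2)) := by positivity
      refine le_trans ?_ (le_add_of_nonneg_right h2)
      rw [hGs]
      calc _ ≤ δ ^ (-a) * (C * (1 + (s / δ) ^ 2) ^ (-(a + 1) / 2))
            * (L * (δ ^ κ * (1 + (s / δ) ^ 2) ^ (κ / 2))) := by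
            gcongr
            · exact hXb s
            · exact (hHol s hs).trans (by gcongr)
        _ = C * (L * (δ ^ κ * δ ^ (-a))) * ((1 + (s / δ) ^ 2) ^ (-(a + 1) / 2)
            * (1 + (s / δ) ^ 2) ^ (κ / 2)) := by ring
        _ = _ := by
            rw [← Real.rpow_add hδ, ← Real.rpow_add (by positivity)]
            congr 2
            ring
    · have hs2 : 1 / 16 < s ^ 2 := by rw [← sq_abs]; nlinarith
      have h2 : 0 ≤ C * (L * δ ^ (κ - a)) * (1 + (s / δ) ^ 2) ^ (-(a + 1 - κ) / 2) := by positivity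
      refine le_trans ?_ (le_add_of_nonneg_left h2)
      have h3 : (1 + (s / δ) ^ 2) ^ (-(a + 1) / 2)
          ≤ δ ^ (a + 1) * (D * (1 + s ^ 2) ^ (-(a + 1) / 2)) := by
        have h4 : (1 + s ^ 2) / 17 / δ ^ 2 ≤ 1 + (s / δ) ^ 2 := by
          rw [div_pow]
          have : (1 + s ^ 2) / 17 ≤ s ^ 2 := by linarith
          have := div_le_div_of_nonneg_right this (sq_nonneg δ)
          linarith
        refine (Real.rpow_le_rpow_of_nonpos (by positivity) h4 (by linarith)).trans (le_of_eq ?_)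
        rw [Real.div_rpow (by positivity) (by positivity), Real.div_rpow (by positivity) (by norm_num),
          neg_div, Real.rpow_neg (x := 17) (by norm_num), Real.rpow_neg (x := δ ^ 2) (by positivity),
          ← hD]
        have : (δ ^ 2) ^ ((a + 1) / 2) = δ ^ (a + 1) := by
          rw [← Real.rpow_natCast, ← Real.rpow_mul hδ.le]
          congr 1; push_cast; ring
        rw [this]
        field_simp
      have h5 : (1 + s ^ 2) ^ (-(a + 1) / 2) ≤ 1 :=
        Real.rpow_le_one_of_one_le_of_nonpos (by nlinarith) (by linarith)
      have h6 : δ ^ (-a) * δ ^ (a + 1) = δ := by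
        rw [← Real.rpow_add hδ]; simp
      set J := (1 + s ^ 2) ^ (-(a + 1) / 2)
      have hJ : 0 ≤ J := by positivity
      calc _ ≤ δ ^ (-a) * (C * (δ ^ (a + 1) * (D * J))) * (‖G s‖ + ‖H 0‖) := by
            gcongr
            · exact (hXb s).trans (by gcongr)
            · exact norm_sub_le _ _
        _ = C * D * (δ ^ (-a) * δ ^ (a + 1)) * (J * ‖G s‖ + ‖H 0‖ * J) := by ring
        _ ≤ _ := by
            rw [h6]
            gcongr
            exact mul_le_of_le_one_left (norm_nonneg _) h5
  have j₁ : Integrable fun s : ℝ =>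
      C * (L * δ ^ (κ - a)) * (1 + (s / δ) ^ 2) ^ (-(a + 1 - κ) / 2) :=
    (hi₁.comp_div hδ.ne').const_mul _
  have j₂ : Integrable fun s : ℝ => ‖H 0‖ * (1 + s ^ 2) ^ (-(a + 1) / 2) := hi₂.const_mul _
  have j₃ : Integrable fun s : ℝ => C * D * δ * (‖G s‖ + ‖H 0‖ * (1 + s ^ 2) ^ (-(a + 1) / 2)) :=
    (hG.norm.add j₂).const_mul _
  refine (norm_integral_le_of_norm_le (j₁.add j₃) (ae_of_all _ hpt)).trans ?_
  simp only [Pi.add_apply]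
  rw [integral_add j₁ j₃, integral_const_mul, integral_const_mul, integral_add hG.norm j₂,
    integral_const_mul, hGn,
    Measure.integral_comp_div (fun t : ℝ => (1 + t ^ 2) ^ (-(a + 1 - κ) / 2)), abs_of_pos hδ, smul_eq_mul]
  have e2 : δ ^ (κ + 1 - a) = δ ^ (κ - a) * δ := by
    rw [← Real.rpow_add_one hδ.ne']; congr 1; ring
  rw [e2]
  set N := ∫ s in Set.Ioi (-1), ‖H s‖
  have hN : 0 ≤ N := integral_nonneg fun _ => norm_nonneg _
  have hP : 0 ≤ δ ^ (κ - a) := by positivity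
  have hH0 := norm_nonneg (H 0)
  have f1 : 0 ≤ C * K₁ * (δ * (N + ‖H 0‖)) := by positivity
  have f2 : 0 ≤ C * D * (1 + K₂) * (L * (δ ^ (κ - a) * δ)) := by positivity
  have f3 : 0 ≤ C * D * δ * (K₂ * N + ‖H 0‖) := by positivity
  linear_combination f1 + f2 + f3


/-- The truncated integral against `s_-^{-a}` with its divergent part removed. -/
noncomputable def finPart (a δ : ℝ) (H : ℝ → ℂ) : ℂ :=
  (∫ s in Set.Ioi (-1), (dKer a δ s : ℂ) * H s) - H 0 * ((δ ^ (1 - a) / (a - 1) : ℝ) : ℂ)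

lemma measurable_dKer (a δ : ℝ) : Measurable (dKer a δ) :=
  Measurable.ite (measurableSet_lt measurable_id measurable_const)
    (measurable_id.neg.pow_const _) measurable_const

lemma abs_dKer_le {a δ : ℝ} (ha : 0 ≤ a) (hδ : 0 < δ) (s : ℝ) : |dKer a δ s| ≤ δ ^ (-a) := by
  unfold dKer
  split_ifs with h
  · rw [abs_of_nonneg (Real.rpow_nonneg (by linarith) _)]
    exact Real.rpow_le_rpow_of_nonpos hδ (by linarith) (by linarith)
  · rw [abs_zero]; positivity

lemma integrableOn_dKer_mul {a δ : ℝ} (ha : 0 ≤ a) (hδ : 0 < δ) {H : ℝ → ℂ}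
    (hH : IntegrableOn H (Set.Ioi (-1))) :
    IntegrableOn (fun s => (dKer a δ s : ℂ) * H s) (Set.Ioi (-1)) := by
  refine hH.bdd_mul (c := δ ^ (-a)) 
    (Complex.measurable_ofReal.comp (measurable_dKer a δ)).aestronglyMeasurable
    (ae_of_all _ fun s => ?_)
  rw [Complex.norm_real]
  exact abs_dKer_le ha hδ s

lemma mReg_mul (a δ s : ℝ) (x : ℂ) : mReg a δ s * x
    = (Complex.exp (Complex.I * (Real.pi * a / 2 : ℝ)) * (sym a δ ((1 : ℝ) * s) * x)
    - Complex.exp (-(Complex.I * (Real.pi * a / 2 : ℝ))) * (sym a δ ((-1 : ℝ) * s) * x))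
      / (2 * Complex.I * (Real.sin (Real.pi * a) : ℝ)) := by
  rw [mReg, one_mul, neg_one_mul]
  ring

lemma integrableOn_mReg_mul {a δ : ℝ} (ha : 0 ≤ a) (hδ : 0 < δ) {H : ℝ → ℂ}
    (hH : IntegrableOn H (Set.Ioi (-1))) :
    IntegrableOn (fun s => mReg a δ s * H s) (Set.Ioi (-1)) := by
  simp_rw [mReg_mul]
  have hδ' : 0 < (δ : ℂ).re := by simpa using hδ
  exact (((integrableOn_symAvg ha hH hδ').const_mul _).sub
    ((integrableOn_symAvg ha hH hδ').const_mul _)).div_const _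

lemma integral_mReg_mul {a δ : ℝ} (ha : 0 ≤ a) (hδ : 0 < δ) {H : ℝ → ℂ}
    (hH : IntegrableOn H (Set.Ioi (-1))) :
    ∫ s in Set.Ioi (-1), mReg a δ s * H s
      = (Complex.exp (Complex.I * (Real.pi * a / 2 : ℝ)) * symAvg a 1 δ H
    - Complex.exp (-(Complex.I * (Real.pi * a / 2 : ℝ))) * symAvg a (-1) δ H)
      / (2 * Complex.I * (Real.sin (Real.pi * a) : ℝ)) := by
  simp_rw [mReg_mul]
  have hδ' : 0 < (δ : ℂ).re := by simpa using hδ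
  rw [integral_div, integral_sub ((integrableOn_symAvg ha hH hδ').const_mul _)
    ((integrableOn_symAvg ha hH hδ').const_mul _), integral_const_mul, integral_const_mul]
  rfl

lemma finPart_sub_integral_mReg {a δ : ℝ} (ha : 0 ≤ a) (hδ : 0 < δ) {H : ℝ → ℂ}
    (hH : IntegrableOn H (Set.Ioi (-1))) :
    finPart a δ H - ∫ s in Set.Ioi (-1), mReg a δ s * H s
      = (∫ s in Set.Ioi (-1), ((dKer a δ s : ℂ) - mReg a δ s) * H s)
          - H 0 * ((δ ^ (1 - a) / (a - 1) : ℝ) : ℂ) := by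
  simp_rw [sub_mul]
  rw [integral_sub (integrableOn_dKer_mul ha hδ hH) (integrableOn_mReg_mul ha hδ hH), finPart]
  ring

/-- Uniform bounds for the averages bound the finite parts uniformly. -/
lemma exists_norm_finPart_le {a : ℝ} (ha : 1 < a) (ha2 : a < 2) :
    ∃ C : ℝ, 0 ≤ C ∧ ∀ (H : ℝ → ℂ) (M : ℝ), 0 ≤ M → IntegrableOn H (Set.Ioi (-1)) →
      ContinuousOn H (Set.Ioi (-1)) →
      (∀ σ : ℝ, σ = 1 ∨ σ = -1 → ∀ w, goodParam w → ‖symAvg a σ w H‖ ≤ M) →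
      ∀ δ : ℝ, 0 < δ → δ ≤ 1 →
        ‖finPart a δ H‖ ≤ C * (M + (∫ s in Set.Ioi (-1), ‖H s‖) + ‖H 0‖) := by
  obtain ⟨C₁, hC₁, h₁⟩ := exists_hoelder_of_symAvg_bound ha ha2
  -- For the exponent κ = a - 1 the power δ^{κ+1-a} is δ⁰: bounded, though not small.
  obtain ⟨C₂, hC₂, h₂⟩ := exists_norm_kernel_error_le ha ha2 (κ := a - 1) (by linarith) (by linarith)
  have hs := abs_pos.2 (sin_pi_mul_ne_zero ha ha2)
  set S := |Real.sin (Real.pi * a)|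
  refine ⟨S⁻¹ + C₂ * (C₁ + 1), by positivity, fun H M hM0 hH hc hM δ hδ hδ1 => ?_⟩
  have hR : ‖∫ s in Set.Ioi (-1), mReg a δ s * H s‖ ≤ S⁻¹ * M := by
    rw [integral_mReg_mul (by linarith) hδ hH, norm_div, norm_xKer_denominator]
    have hg := goodParam_ofReal hδ
    have : ‖Complex.exp (Complex.I * (Real.pi * a / 2 : ℝ)) * symAvg a 1 δ H
        - Complex.exp (-(Complex.I * (Real.pi * a / 2 : ℝ))) * symAvg a (-1) δ H‖ ≤ M + M := by
      refine (norm_sub_le _ _).trans ?_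
      rw [norm_mul, norm_mul, norm_exp_I_mul, norm_exp_neg_I_mul, one_mul, one_mul]
      exact add_le_add (hM 1 (Or.inl rfl) _ hg) (hM (-1) (Or.inr rfl) _ hg)
    calc _ ≤ (M + M) / (2 * S) := by gcongr
      _ = _ := by field_simp; ring
  have hY := h₂ H (C₁ * M) δ (by positivity) hδ hH (fun s hs => h₁ H M hM0 hH hc hM s hs)
  rw [← finPart_sub_integral_mReg (by linarith) hδ hH, show a - 1 + 1 - a = 0 by ring,
    Real.rpow_zero, mul_one] at hY
  set N := ∫ s in Set.Ioi (-1), ‖H s‖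
  have hN : 0 ≤ N := integral_nonneg fun _ => norm_nonneg _
  have hN' : 0 ≤ N + ‖H 0‖ := by positivity
  have hY' : C₂ * (C₁ * M + δ * (N + ‖H 0‖)) ≤ C₂ * (C₁ * M + (N + ‖H 0‖)) := by
    gcongr
    exact mul_le_of_le_one_left hN' hδ1
  have := norm_le_norm_add_norm_sub (∫ s in Set.Ioi (-1), mReg a δ s * H s) (finPart a δ H)
  rw [norm_sub_rev] at this
  have f1 : 0 ≤ S⁻¹ * (N + ‖H 0‖) := by positivity
  have f2 : 0 ≤ C₂ * (M + C₁ * (N + ‖H 0‖)) := by positivity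
  linear_combination this + hR + hY + hY' + f1 + f2

/-- For a Lipschitz density the finite parts and the regularised integrals agree in the limit. -/
lemma tendsto_finPart_sub {a L : ℝ} (ha : 1 < a) (ha2 : a < 2) {H : ℝ → ℂ}
    (hH : IntegrableOn H (Set.Ioi (-1))) (hL0 : 0 ≤ L) (hL : ∀ s, |s| ≤ 1 / 4 → ‖H s - H 0‖ ≤ L * |s|) :
    Tendsto (fun δ => finPart a δ H - ∫ s in Set.Ioi (-1), mReg a δ s * H s) (𝓝[>] 0) (𝓝 0) := by
  -- A Lipschitz density, κ = 1, gives δ^{2-a}, which tends to 0.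
  obtain ⟨C, hC, h⟩ := exists_norm_kernel_error_le ha ha2 (κ := 1) (by linarith) (by linarith)
  set N := (∫ s in Set.Ioi (-1), ‖H s‖) + ‖H 0‖
  refine squeeze_zero_norm' (a := fun δ => C * (L * δ ^ (1 + 1 - a) + δ * N)) ?_ ?_
  · filter_upwards [self_mem_nhdsWithin] with δ hδ
    rw [finPart_sub_integral_mReg (by linarith) hδ hH]
    exact h H L δ hL0 hδ hH (fun s hs => by rw [Real.rpow_one]; exact hL s hs)
  · have h1 : ContinuousAt (fun δ : ℝ => C * (L * δ ^ (1 + 1 - a) + δ * N)) 0 := by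
      have : ContinuousAt (fun δ : ℝ => δ ^ (1 + 1 - a)) 0 :=
        Real.continuousAt_rpow_const 0 _ (Or.inr (by linarith))
      fun_prop
    have h2 := h1.tendsto.mono_left (nhdsWithin_le_nhds (s := Set.Ioi 0))
    simpa [Real.zero_rpow (show 1 + 1 - a ≠ 0 by linarith)] using h2

lemma integral_dKer_Ioo {a δ : ℝ} (ha : 1 < a) (hδ : 0 < δ) (hδ1 : δ < 1) :
    ∫ s in Set.Ioo (-1) 0, dKer a δ s = (δ ^ (1 - a) - 1) / (a - 1) := by
  have h1 : Set.EqOn (dKer a δ) ((Set.Ioo (-1) (-δ)).indicator fun s => (-s) ^ (-a)) (Set.Ioo (-1) 0) := by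
    intro s hs
    simp only [dKer, Set.indicator_apply, Set.mem_Ioo, hs.1, true_and]
  rw [setIntegral_congr_fun measurableSet_Ioo h1, setIntegral_indicator measurableSet_Ioo,
    Set.inter_eq_self_of_subset_right (Set.Ioo_subset_Ioo_right (by linarith)),
    ← integral_Ioc_eq_integral_Ioo, ← intervalIntegral.integral_of_le (by linarith),
    intervalIntegral.integral_comp_neg (fun x => x ^ (-a)), neg_neg, neg_neg,
    integral_rpow (Or.inr ⟨by linarith, Set.notMem_uIcc_of_lt hδ one_pos⟩), Real.one_rpow]
  have e : -a + 1 = 1 - a := by ring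
  have e1 : a - 1 ≠ 0 := by linarith
  have e2 : 1 - a ≠ 0 := by linarith
  rw [e, div_eq_div_iff e2 e1]
  ring

/-- The finite part converges for a Lipschitz density. -/
lemma exists_tendsto_finPart {a L : ℝ} (ha : 1 < a) (ha2 : a < 2) {H : ℝ → ℂ}
    (hH : IntegrableOn H (Set.Ioi (-1))) (hL0 : 0 ≤ L) (hL : ∀ s, |s| ≤ 1 / 4 → ‖H s - H 0‖ ≤ L * |s|) :
    ∃ l, Tendsto (fun δ => finPart a δ H) (𝓝[>] 0) (𝓝 l) := by
  have hsub : Set.Ioo (-1 : ℝ) 0 ⊆ Set.Ioi (-1) := fun s hs => hs.1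
  have hH' : IntegrableOn H (Set.Ioo (-1) 0) := hH.mono_set hsub
  have hc : IntegrableOn (fun _ => H 0) (Set.Ioo (-1 : ℝ) 0) := by simp
  have hbound : IntegrableOn (fun s => L * (-s) ^ (1 - a) + 4 ^ a * (‖H s‖ + ‖H 0‖)) (Set.Ioo (-1) 0) := by
    refine Integrable.add (Integrable.const_mul ?_ _) ((hH'.norm.add hc.norm).const_mul _)
    have h1 : IntegrableOn (fun u : ℝ => u ^ (1 - a)) (Set.Ioc 0 1) := by
      have := intervalIntegral.intervalIntegrable_rpow' (a := 0) (b := 1) (r := 1 - a) (by linarith)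
      rwa [intervalIntegrable_iff_integrableOn_Ioc_of_le zero_le_one] at this
    have h2 := ((integrable_indicator_iff measurableSet_Ioo).2 (h1.mono_set Set.Ioo_subset_Ioc_self)).comp_neg
    change IntegrableOn (fun s : ℝ => (-s) ^ (1 - a)) (Set.Ioo (-1) 0) volume
    rw [← integrable_indicator_iff measurableSet_Ioo]
    refine h2.congr (ae_of_all _ fun s => ?_)
    simp only [Set.indicator_apply, Set.mem_Ioo]
    congr 1
    exact propext ⟨fun h => ⟨by linarith, by linarith⟩, fun h => ⟨by linarith, by linarith⟩⟩
  -- With H(0) subtracted the integrand is of size (-s)^{1-a} near 0, integrable since a < 2. The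
  -- subtracted part is explicit: δ^{1-a}/(a-1) cancels and the constant -H(0)/(a-1) survives.
  have hlim : Tendsto (fun δ => ∫ s in Set.Ioo (-1) 0, (dKer a δ s : ℂ) * (H s - H 0)) (𝓝[>] 0)
      (𝓝 (∫ s in Set.Ioo (-1) 0, (((-s) ^ (-a) : ℝ) : ℂ) * (H s - H 0))) := by
    refine tendsto_integral_filter_of_dominated_convergence _ ?_ ?_ hbound ?_
    · filter_upwards with δ
      exact (Complex.measurable_ofReal.comp (measurable_dKer a δ)).aestronglyMeasurable.mul
        (hH'.sub hc).aestronglyMeasurable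
    · filter_upwards [self_mem_nhdsWithin] with δ hδ
      filter_upwards [ae_restrict_mem measurableSet_Ioo] with s hs
      have hδ : 0 < δ := hδ
      have hs0 : 0 < -s := by linarith [hs.2]
      have hd : ‖(dKer a δ s : ℂ)‖ ≤ (-s) ^ (-a) := by
        rw [Complex.norm_real]
        unfold dKer
        split_ifs
        · rw [Real.norm_of_nonneg (by positivity)]
        · rw [norm_zero]; positivity
      rw [norm_mul]
      refine (mul_le_mul_of_nonneg_right hd (norm_nonneg _)).trans ?_
      rcases le_or_gt (-s) (1 / 4) with h | h
      · have h3 : 0 ≤ (4 : ℝ) ^ a * (‖H s‖ + ‖H 0‖) := by positivity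
        refine le_trans ?_ (le_add_of_nonneg_right h3)
        have h4 := hL s (by rw [abs_of_neg (by linarith)]; exact h)
        rw [abs_of_neg (by linarith)] at h4
        calc (-s) ^ (-a) * ‖H s - H 0‖ ≤ (-s) ^ (-a) * (L * (-s)) := by gcongr
          _ = L * ((-s) ^ (-a) * (-s)) := by ring
          _ = _ := by rw [← Real.rpow_add_one hs0.ne', neg_add_eq_sub]
      · have h3 : 0 ≤ L * (-s) ^ (1 - a) := by positivity
        refine le_trans ?_ (le_add_of_nonneg_left h3)
        gcongr
        · have := Real.rpow_le_rpow_of_nonpos (by norm_num) h.le (show -a ≤ 0 by linarith)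
          refine this.trans (le_of_eq ?_)
          rw [one_div, Real.inv_rpow (by norm_num), Real.rpow_neg (by norm_num), inv_inv]
        · exact norm_sub_le _ _
    · filter_upwards [ae_restrict_mem measurableSet_Ioo] with s hs
      refine tendsto_const_nhds.congr' ?_
      have : Set.Iio (-s) ∈ 𝓝[>] (0 : ℝ) := nhdsWithin_le_nhds (Iio_mem_nhds (by linarith [hs.2]))
      filter_upwards [this] with δ hδ
      have hδ : δ < -s := hδ
      rw [dKer, if_pos (by linarith)]
  refine ⟨_, (hlim.sub_const (H 0 * (((a - 1)⁻¹ : ℝ) : ℂ))).congr' ?_⟩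
  have hev : Set.Ioo 0 1 ∈ 𝓝[>] (0 : ℝ) := Ioo_mem_nhdsGT one_pos
  filter_upwards [hev] with δ hδ
  have hd : IntegrableOn (fun s => (dKer a δ s : ℂ) * H s) (Set.Ioo (-1) 0) :=
    (integrableOn_dKer_mul (by linarith) hδ.1 hH).mono_set hsub
  have hd' : IntegrableOn (fun s => (dKer a δ s : ℂ) * H 0) (Set.Ioo (-1) 0) := by
    refine hc.bdd_mul (c := δ ^ (-a)) 
      (Complex.measurable_ofReal.comp (measurable_dKer a δ)).aestronglyMeasurable
      (ae_of_all _ fun s => ?_)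
    rw [Complex.norm_real]
    exact abs_dKer_le (by linarith) hδ.1 s
  have e : ∫ s in Set.Ioi (-1), (dKer a δ s : ℂ) * H s = ∫ s in Set.Ioo (-1) 0, (dKer a δ s : ℂ) * H s := by
    refine setIntegral_eq_of_subset_of_forall_sdiff_eq_zero measurableSet_Ioi hsub fun s hs => ?_
    have : ¬ s < -δ := fun h => hs.2 ⟨hs.1, by linarith [hδ.1]⟩
    rw [dKer, if_neg this]
    simp
  simp_rw [mul_sub]
  rw [finPart, e, integral_sub hd hd', integral_mul_const, integral_complex_ofReal,
    integral_dKer_Ioo ha hδ.1 hδ.2]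
  push_cast
  ring

end TruncatedKernel

end HelmholtzBR

namespace HelmholtzBR

variable {n : ℕ}

/-! ### Passage to the limit in the weighted L² space -/

section WeightedLimit

/-- The smooth weight `((|ξ|² - 1)² + ε²)^{-b/2}`. -/
noncomputable def wt (b ε : ℝ) (ξ : Rn n) : ℝ := ((‖ξ‖ ^ 2 - 1) ^ 2 + ε ^ 2) ^ (-b / 2)

/-- The singular weight `||ξ|² - 1|^{-b}`. -/
noncomputable def wtSing (b : ℝ) (ξ : Rn n) : ℝ := |‖ξ‖ ^ 2 - 1| ^ (-b)

lemma wt_pos (b : ℝ) {ε : ℝ} (hε : 0 < ε) (ξ : Rn n) : 0 < wt b ε ξ :=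
  Real.rpow_pos_of_pos (by positivity) _

lemma continuous_wt (b : ℝ) {ε : ℝ} (hε : 0 < ε) : Continuous (wt b ε : Rn n → ℝ) := by
  have h : ∀ ξ : Rn n, (‖ξ‖ ^ 2 - 1) ^ 2 + ε ^ 2 ≠ 0 := fun ξ => by positivity
  exact Continuous.rpow_const (by fun_prop) fun ξ => Or.inl (h ξ)

lemma wt_le {b ε : ℝ} (hb : 0 ≤ b) (hε : 0 < ε) (ξ : Rn n) : wt b ε ξ ≤ ε ^ (-b) := by
  have h1 : (‖ξ‖ ^ 2 - 1) ^ 2 + ε ^ 2 ≥ ε ^ 2 := by nlinarith [sq_nonneg (‖ξ‖ ^ 2 - 1)]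
  refine (Real.rpow_le_rpow_of_nonpos (by positivity) h1 (by linarith)).trans (le_of_eq ?_)
  rw [← Real.rpow_natCast, ← Real.rpow_mul hε.le]
  congr 1; push_cast; ring

/-- A bound by a multiple of the weight at scale 1 means that convergence in that single L² space
serves every ε. -/
lemma wt_le_wt_one {b ε : ℝ} (hb : 0 ≤ b) (hε : 0 < ε) (hε1 : ε ≤ 1) (ξ : Rn n) :
    wt b ε ξ ≤ ε ^ (-b) * wt b 1 ξ := by
  have h1 : ε ^ 2 * ((‖ξ‖ ^ 2 - 1) ^ 2 + 1 ^ 2) ≤ (‖ξ‖ ^ 2 - 1) ^ 2 + ε ^ 2 := by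
    have : ε ^ 2 ≤ 1 := by nlinarith
    nlinarith [mul_le_mul_of_nonneg_right this (sq_nonneg (‖ξ‖ ^ 2 - 1))]
  refine (Real.rpow_le_rpow_of_nonpos (by positivity) h1 (by linarith)).trans (le_of_eq ?_)
  rw [Real.mul_rpow (by positivity) (by positivity), ← Real.rpow_natCast, ← Real.rpow_mul hε.le, wt]
  congr 2; push_cast; ring

lemma wt_sq {b ε : ℝ} (hε : 0 < ε) (ξ : Rn n) : wt b ε ξ ^ 2 = ((‖ξ‖ ^ 2 - 1) ^ 2 + ε ^ 2) ^ (-b) := by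
  rw [wt, ← Real.rpow_natCast, ← Real.rpow_mul (by positivity)]
  congr 1; push_cast; ring

/-- The `L²` norm of the restriction of the Fourier transform to the unit sphere. -/
noncomputable def traceNorm (f : Rn n → ℂ) : ℝ :=
  lpNorm (fun ω : Metric.sphere (0 : Rn n) 1 => fourier f (ω : Rn n)) 2 (sphereMeasure n)

lemma traceNorm_nonneg (f : Rn n → ℂ) : 0 ≤ traceNorm f := lpNorm_nonneg

lemma Nice.memLp_trace {f : Rn n → ℂ} (hf : Nice f) :
    MemLp (fun ω : Metric.sphere (0 : Rn n) 1 => fourier f (ω : Rn n)) 2 (sphereMeasure n) :=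
  MemLp.of_bound ((continuous_fourier hf.integrable).comp continuous_subtype_val).aestronglyMeasurable
    (∫ x, ‖f x‖) (ae_of_all _ fun _ => norm_fourier_le f _)

lemma Nice.traceNorm_sq {f : Rn n → ℂ} (hf : Nice f) : traceNorm f ^ 2 = traceSq f :=
  lpNorm_two_sq hf.memLp_trace

lemma Nice.traceNorm_sub_le {f g : Rn n → ℂ} (hf : Nice f) (hg : Nice g) :
    traceNorm (fun x => f x - g x) ≤ traceNorm f + traceNorm g := by
  unfold traceNorm
  rw [fourier_sub hf.integrable hg.integrable]
  exact lpNorm_sub_le hf.memLp_trace (by norm_num)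

lemma Nice.memLp_wt_fourier {f : Rn n → ℂ} (hf : Nice f) {b ε : ℝ} (hb : 0 ≤ b) (hε : 0 < ε) :
    MemLp (fun ξ => (wt b ε ξ : ℂ) * fourier f ξ) 2 volume := by
  refine MemLp.of_le_mul (c := ε ^ (-b)) hf.memLp_fourier
    (((Complex.continuous_ofReal.comp (continuous_wt b hε)).mul
      (continuous_fourier hf.integrable)).aestronglyMeasurable) (ae_of_all _ fun ξ => ?_)
  rw [norm_mul, Complex.norm_real, Real.norm_of_nonneg (wt_pos b hε ξ).le]
  gcongr
  exact wt_le hb hε ξ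

/-- Square root of the weighted estimate, in terms of norms so that the triangle inequality is
available for approximating sequences. -/
theorem exists_lpNorm_wt_fourier_le (hn : 2 ≤ n) {b : ℝ} (hb : 1 / 2 < b) (hb' : b < 3 / 2)
    (hbn : b ≤ ((n : ℝ) + 1) / 4) :
    ∃ C : ℝ, 0 < C ∧ ∀ f : Rn n → ℂ, Nice f → ∀ ε : ℝ, 0 < ε →
      lpNorm (fun ξ => (wt b ε ξ : ℂ) * fourier f ξ) 2 volume
        ≤ C * (lpNorm f (ENNReal.ofReal (pExp n b)) volume + ε ^ ((1 - 2 * b) / 2) * traceNorm f) := by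
  obtain ⟨C, hC, h⟩ := exists_weighted_L2_bound hn hb hb' hbn
  refine ⟨√C, Real.sqrt_pos.2 hC, fun f hf ε hε => ?_⟩
  have h1 := h f hf ε hε
  have h2 := lpNorm_two_sq (hf.memLp_wt_fourier (show 0 ≤ b by linarith) hε)
  have e : ∀ ξ, ‖(wt b ε ξ : ℂ) * fourier f ξ‖ ^ 2
      = ((‖ξ‖ ^ 2 - 1) ^ 2 + ε ^ 2) ^ (-b) * ‖fourier f ξ‖ ^ 2 := by
    intro ξ
    rw [norm_mul, Complex.norm_real, Real.norm_of_nonneg (wt_pos b hε ξ).le, mul_pow, wt_sq hε]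
  simp_rw [e] at h2
  rw [← h2, ← hf.traceNorm_sq] at h1
  have hp : 0 ≤ lpNorm f (ENNReal.ofReal (pExp n b)) volume := lpNorm_nonneg
  have ht := traceNorm_nonneg f
  have hE : 0 ≤ ε ^ ((1 - 2 * b) / 2) := by positivity
  have e2 : ε ^ (1 - 2 * b) = (ε ^ ((1 - 2 * b) / 2)) ^ 2 := by
    rw [← Real.rpow_natCast, ← Real.rpow_mul hε.le]; congr 1; push_cast; ring
  rw [e2] at h1
  refine abs_le_of_sq_le_sq' ?_ (by positivity) |>.2
  rw [mul_pow, Real.sq_sqrt hC.le]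
  refine h1.trans ?_
  gcongr
  nlinarith [mul_nonneg hp (mul_nonneg hE ht)]

section Hoelder

variable {X : Type*} [MeasurableSpace X] {μ : Measure X}

lemma integrable_mul_of_memLp {p q : ℝ≥0∞} [p.HolderConjugate q] {f g : X → ℂ} (hf : MemLp f p μ)
    (hg : MemLp g q μ) : Integrable (fun x => f x * g x) μ := hf.integrable_mul hg

lemma integral_norm_mul_le_lpNorm_mul {p q : ℝ≥0∞} [p.HolderConjugate q] {f g : X → ℂ}
    (hf : MemLp f p μ) (hg : MemLp g q μ) :
    ∫ x, ‖f x * g x‖ ∂μ ≤ lpNorm f p μ * lpNorm g q μ := by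
  have h1 : lpNorm (fun x => f x * g x) 1 μ ≤ lpNorm f p μ * lpNorm g q μ := by
    have h := eLpNorm_smul_le_mul_eLpNorm (p := p) (q := q) (r := 1) hg.1 hf.1
    have hm : AEStronglyMeasurable (fun x => f x * g x) μ := hf.1.mul hg.1
    rw [← toReal_eLpNorm hm, ← toReal_eLpNorm hf.1, ← toReal_eLpNorm hg.1,
      ← ENNReal.toReal_mul]
    exact ENNReal.toReal_mono (ENNReal.mul_ne_top hf.2.ne hg.2.ne) h
  have hm : AEStronglyMeasurable (fun x => f x * g x) μ := hf.1.mul hg.1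
  rwa [lpNorm_one_eq_integral_norm hm] at h1

end Hoelder

/-- The inverse weight times a Schwartz function is square integrable. -/
lemma memLp_wt_inv_mul {b : ℝ} (hb' : b ≤ 2) (φ : 𝓢(Rn n, ℂ)) :
    MemLp (fun ξ => ((wt b 1 ξ)⁻¹ : ℂ) * φ ξ) 2 volume := by
  have hg : Function.HasTemperateGrowth (fun ξ : Rn n => (‖ξ‖ ^ 2 - 1) ^ 2 + 1) := by fun_prop
  have h := (SchwartzMap.smulLeftCLM ℂ (fun ξ : Rn n => (‖ξ‖ ^ 2 - 1) ^ 2 + 1) φ).memLp 2 volume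
  refine h.mono ?_ (ae_of_all _ fun ξ => ?_)
  · exact (((Complex.continuous_ofReal.comp (continuous_wt b one_pos)).inv₀ fun ξ =>
      Complex.ofReal_ne_zero.2 (wt_pos b one_pos ξ).ne').mul φ.continuous).aestronglyMeasurable
  · rw [SchwartzMap.smulLeftCLM_apply_apply hg, norm_mul, norm_smul, norm_inv, Complex.norm_real,
      Real.norm_of_nonneg (wt_pos b one_pos ξ).le, Real.norm_of_nonneg (by positivity)]
    gcongr
    rw [wt, ← Real.rpow_neg (by positivity), one_pow]
    calc ((‖ξ‖ ^ 2 - 1) ^ 2 + 1) ^ (-(-b / 2)) ≤ ((‖ξ‖ ^ 2 - 1) ^ 2 + 1) ^ (1 : ℝ) :=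
          Real.rpow_le_rpow_of_exponent_le (by nlinarith [sq_nonneg (‖ξ‖ ^ 2 - 1)]) (by linarith)
      _ = _ := Real.rpow_one _

/-- `F` is the limit of the Fourier transforms of `s k` in a weighted `L²` space, where
`s k → f` in `L^p` and the traces of the Fourier transforms on the sphere tend to zero. -/
structure WeightedLimit (b C : ℝ) (f F : Rn n → ℂ) (s : ℕ → 𝓢(Rn n, ℂ)) : Prop where
  memLp : MemLp f (ENNReal.ofReal (pExp n b)) volume
  tendsto_lpNorm : Tendsto (fun k => lpNorm (fun x => s k x - f x) (ENNReal.ofReal (pExp n b)) volume)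
    atTop (𝓝 0)
  tendsto_trace : Tendsto (fun k => traceNorm (s k)) atTop (𝓝 0)
  memLp_wt : MemLp (fun ξ => (wt b 1 ξ : ℂ) * F ξ) 2 volume
  tendsto_wt : Tendsto (fun k => lpNorm (fun ξ => (wt b 1 ξ : ℂ) * (F ξ - fourier (s k) ξ)) 2 volume)
    atTop (𝓝 0)
  memLp_sing : MemLp (fun ξ => (wtSing b ξ : ℂ) * F ξ) 2 volume
  lpNorm_sing_le : lpNorm (fun ξ => (wtSing b ξ : ℂ) * F ξ) 2 volume
    ≤ C * lpNorm f (ENNReal.ofReal (pExp n b)) volume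

lemma ae_norm_sq_ne_one : ∀ᵐ ξ : Rn n, ‖ξ‖ ^ 2 - 1 ≠ 0 := by
  have : volume (Metric.sphere (0 : Rn n) 1) = 0 := Measure.addHaar_sphere_of_ne_zero _ _ one_ne_zero
  filter_upwards [measure_eq_zero_iff_ae_notMem.1 this] with ξ hξ h
  refine hξ ?_
  rw [mem_sphere_zero_iff_norm]
  have := norm_nonneg ξ
  nlinarith

lemma tendsto_wt_zero (b : ℝ) {ξ : Rn n} (hξ : ‖ξ‖ ^ 2 - 1 ≠ 0) :
    Tendsto (fun k : ℕ => wt b (1 / ((k : ℝ) + 1)) ξ) atTop (𝓝 (wtSing b ξ)) := by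
  have h0 : (‖ξ‖ ^ 2 - 1) ^ 2 + (0 : ℝ) ^ 2 ≠ 0 := by positivity
  have h1 : ContinuousAt (fun ε : ℝ => wt b ε ξ) 0 := by
    unfold wt
    exact ContinuousAt.rpow_const (by fun_prop) (Or.inl h0)
  have h2 : wt b 0 ξ = wtSing b ξ := by
    rw [wt, wtSing, zero_pow two_ne_zero, add_zero, ← sq_abs, ← Real.rpow_natCast,
      ← Real.rpow_mul (abs_nonneg _)]
    congr 1; push_cast; ring
  have h3 := h1.tendsto.comp (tendsto_one_div_add_atTop_nhds_zero_nat (𝕜 := ℝ))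
  rwa [h2] at h3

lemma norm_wt_mul (b : ℝ) {ε : ℝ} (hε : 0 < ε) (ξ : Rn n) (x : ℂ) :
    ‖(wt b ε ξ : ℂ) * x‖ = wt b ε ξ * ‖x‖ := by
  rw [norm_mul, Complex.norm_real, Real.norm_of_nonneg (wt_pos b hε ξ).le]

/-- At ε = 1 the weighted estimate makes the transforms of `s k` a Cauchy sequence, and its limit
defines F. For fixed ε the trace term, whose coefficient ε^{(1-2b)/2} blows up as ε → 0, disappears
as k → ∞. Only afterwards is ε sent to 0, by Fatou, to reach the singular weight. -/
theorem exists_weightedLimit (hn : 2 ≤ n) {b : ℝ} (hb : 1 / 2 < b) (hb' : b < 3 / 2)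
    (hbn : b ≤ ((n : ℝ) + 1) / 4) :
    ∃ C : ℝ, 0 < C ∧ (∀ f : Rn n → ℂ, Nice f →
      lpNorm (fun ξ => (wt b 1 ξ : ℂ) * fourier f ξ) 2 volume
        ≤ C * (lpNorm f (ENNReal.ofReal (pExp n b)) volume + traceNorm f)) ∧
      ∀ (f : Rn n → ℂ) (s : ℕ → 𝓢(Rn n, ℂ)), MemLp f (ENNReal.ofReal (pExp n b)) volume →
      Tendsto (fun k => lpNorm (fun x => s k x - f x) (ENNReal.ofReal (pExp n b)) volume)
        atTop (𝓝 0) → Tendsto (fun k => traceNorm (s k)) atTop (𝓝 0) →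
      ∃ F, WeightedLimit b C f F s := by
  obtain ⟨C, hC, hW⟩ := exists_lpNorm_wt_fourier_le hn hb hb' hbn
  have hW1 : ∀ f : Rn n → ℂ, Nice f → lpNorm (fun ξ => (wt b 1 ξ : ℂ) * fourier f ξ) 2 volume
        ≤ C * (lpNorm f (ENNReal.ofReal (pExp n b)) volume + traceNorm f) := by
    intro f hf
    simpa using hW f hf 1 one_pos
  refine ⟨C, hC, hW1, fun f s hf hs hT => ?_⟩
  have hb0 : 0 ≤ b := by linarith
  set p := ENNReal.ofReal (pExp n b) with hp
  have hp1 : 1 ≤ p := by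
    rw [hp, ENNReal.one_le_ofReal]; exact one_le_pExp hb0 hbn
  have hsN : ∀ k, Nice (s k : Rn n → ℂ) := fun k => SchwartzMap_nice (s k)
  have hsp : ∀ k, MemLp (s k : Rn n → ℂ) p volume := fun k => (s k).memLp p
  set N : ℕ → ℝ := fun k => lpNorm (fun x => s k x - f x) p volume + traceNorm (s k)
  have hN : Tendsto N atTop (𝓝 0) := by simpa using hs.add hT
  have hU : ∀ k, MemLp (fun ξ => (wt b 1 ξ : ℂ) * fourier (s k) ξ) 2 volume :=
    fun k => (hsN k).memLp_wt_fourier hb0 one_pos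
  set u : ℕ → Lp ℂ 2 (volume : Measure (Rn n)) := fun k => (hU k).toLp
  have hdist : ∀ k l, dist (u k) (u l) ≤ C * (N k + N l) := by
    intro k l
    have e : (fun ξ => (wt b 1 ξ : ℂ) * fourier (s k) ξ) - (fun ξ => (wt b 1 ξ : ℂ) * fourier (s l) ξ)
        = fun ξ => (wt b 1 ξ : ℂ) * fourier (fun x => s k x - s l x) ξ := by
      rw [fourier_sub (hsN k).integrable (hsN l).integrable]
      funext ξ
      simp only [Pi.sub_apply]
      ring
    rw [dist_eq_norm, ← MemLp.toLp_sub, Lp.norm_toLp, toReal_eLpNorm ((hU k).sub (hU l)).1, e]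
    refine (hW1 _ ((hsN k).sub (hsN l))).trans ?_
    refine mul_le_mul_of_nonneg_left ?_ hC.le
    have t1 : lpNorm (fun x => s k x - s l x) p volume
        ≤ lpNorm (fun x => s k x - f x) p volume + lpNorm (fun x => s l x - f x) p volume := by
      have := lpNorm_sub_le (g := fun x => s l x - f x) ((hsp k).sub hf) hp1
      refine le_trans (le_of_eq ?_) this
      congr 1
      funext x
      simp
    have t2 := (hsN k).traceNorm_sub_le (hsN l)
    simp only [N]
    linarith
  have hcau : CauchySeq u := by
    rw [Metric.cauchySeq_iff']
    intro ε hε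
    have h1 : ∀ᶠ k in atTop, N k < ε / (2 * C) := hN.eventually_lt_const (by positivity)
    obtain ⟨K, hK⟩ := h1.exists_forall_of_atTop
    refine ⟨K, fun k hk => (hdist k K).trans_lt ?_⟩
    have a1 := hK k hk
    have a2 := hK K le_rfl
    rw [lt_div_iff₀ (by positivity)] at a1 a2
    nlinarith
  obtain ⟨U, hUlim⟩ := cauchySeq_tendsto_of_complete hcau
  set F : Rn n → ℂ := fun ξ => ((wt b 1 ξ)⁻¹ : ℂ) * U ξ with hF
  have hwne : ∀ ξ : Rn n, (wt b 1 ξ : ℂ) ≠ 0 := fun ξ => by exact_mod_cast (wt_pos b one_pos ξ).ne'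
  have hWF : (fun ξ => (wt b 1 ξ : ℂ) * F ξ) = U := by
    funext ξ
    rw [hF, mul_inv_cancel_left₀ (hwne ξ)]
  have hWFm : MemLp (fun ξ => (wt b 1 ξ : ℂ) * F ξ) 2 volume := by rw [hWF]; exact Lp.memLp U
  have hFm : AEStronglyMeasurable F volume :=
    ((Complex.continuous_ofReal.comp (continuous_wt b one_pos)).inv₀ hwne).aestronglyMeasurable.mul
      (Lp.memLp U).1
  have hdiff : ∀ k, MemLp (fun ξ => (wt b 1 ξ : ℂ) * (F ξ - fourier (s k) ξ)) 2 volume := by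
    intro k
    have := hWFm.sub (hU k)
    refine this.congr_norm ?_ (ae_of_all _ fun ξ => ?_)
    · exact (Complex.continuous_ofReal.comp (continuous_wt b one_pos)).aestronglyMeasurable.mul
        (hFm.sub (continuous_fourier (hsN k).integrable).aestronglyMeasurable)
    · simp only [Pi.sub_apply, mul_sub]
  have hconv : Tendsto (fun k => lpNorm (fun ξ => (wt b 1 ξ : ℂ) * (F ξ - fourier (s k) ξ)) 2 volume)
      atTop (𝓝 0) := by
    have := tendsto_iff_dist_tendsto_zero.1 hUlim
    refine this.congr fun k => ?_
    rw [dist_comm, dist_eq_norm, ← Lp.toLp_coeFn U (Lp.memLp U), ← MemLp.toLp_sub, Lp.norm_toLp,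
      toReal_eLpNorm ((Lp.memLp U).sub (hU k)).1, ← hWF]
    congr 1
    funext ξ
    simp only [Pi.sub_apply, mul_sub]
  have hεm : ∀ ε : ℝ, 0 < ε → ε ≤ 1 → MemLp (fun ξ => (wt b ε ξ : ℂ) * F ξ) 2 volume := by
    intro ε hε hε1
    refine hWFm.of_le_mul (c := ε ^ (-b)) ((Complex.continuous_ofReal.comp
      (continuous_wt b hε)).aestronglyMeasurable.mul hFm) (ae_of_all _ fun ξ => ?_)
    rw [norm_wt_mul b hε, norm_wt_mul b one_pos, ← mul_assoc]
    gcongr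
    exact wt_le_wt_one hb0 hε hε1 ξ
  have hεb : ∀ ε : ℝ, 0 < ε → ε ≤ 1 →
      lpNorm (fun ξ => (wt b ε ξ : ℂ) * F ξ) 2 volume ≤ C * lpNorm f p volume := by
    intro ε hε hε1
    have hk : ∀ k, lpNorm (fun ξ => (wt b ε ξ : ℂ) * F ξ) 2 volume ≤
        C * ((lpNorm f p volume + lpNorm (fun x => s k x - f x) p volume)
            + ε ^ ((1 - 2 * b) / 2) * traceNorm (s k))
          + ε ^ (-b) * lpNorm (fun ξ => (wt b 1 ξ : ℂ) * (F ξ - fourier (s k) ξ)) 2 volume := by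
      intro k
      have hA := (hsN k).memLp_wt_fourier hb0 hε
      have hB : MemLp (fun ξ => (wt b ε ξ : ℂ) * (F ξ - fourier (s k) ξ)) 2 volume := by
        refine ((hεm ε hε hε1).sub hA).congr_norm ?_ (ae_of_all _ fun ξ => ?_)
        · exact (Complex.continuous_ofReal.comp (continuous_wt b hε)).aestronglyMeasurable.mul
            (hFm.sub (continuous_fourier (hsN k).integrable).aestronglyMeasurable)
        · simp only [Pi.sub_apply, mul_sub]
      have e : (fun ξ => (wt b ε ξ : ℂ) * F ξ) = (fun ξ => (wt b ε ξ : ℂ) * fourier (s k) ξ)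
          + fun ξ => (wt b ε ξ : ℂ) * (F ξ - fourier (s k) ξ) := by
        funext ξ; simp only [Pi.add_apply]; ring
      rw [e]
      refine (lpNorm_add_le hA (by norm_num)).trans (add_le_add ?_ ?_)
      · refine (hW _ (hsN k) ε hε).trans ?_
        have : lpNorm (s k : Rn n → ℂ) p volume
            ≤ lpNorm f p volume + lpNorm (fun x => s k x - f x) p volume := by
          have := lpNorm_add_le (g := fun x => s k x - f x) hf hp1
          refine le_trans (le_of_eq ?_) this
          congr 1
          funext x
          simp
        gcongr
      · have h1 := lpNorm_mono_real (p := 2) (f := fun ξ => (wt b ε ξ : ℂ) * (F ξ - fourier (s k) ξ))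
          (g := fun ξ => ε ^ (-b) * ‖(wt b 1 ξ : ℂ) * (F ξ - fourier (s k) ξ)‖)
          (((hdiff k).norm).const_mul _) fun ξ => by
            rw [norm_wt_mul b hε, norm_wt_mul b one_pos, ← mul_assoc]
            gcongr
            exact wt_le_wt_one hb0 hε hε1 ξ
        refine h1.trans (le_of_eq ?_)
        have h2 := lpNorm_const_smul (𝕜 := ℝ) (p := 2) (ε ^ (-b))
          (fun ξ => ‖(wt b 1 ξ : ℂ) * (F ξ - fourier (s k) ξ)‖) (volume : Measure (Rn n))
        rw [lpNorm_norm (hdiff k).1] at h2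
        refine h2.trans (congrArg (· * _) ?_)
        exact Real.norm_of_nonneg (by positivity)
    have hlim : Tendsto (fun k => C * ((lpNorm f p volume + lpNorm (fun x => s k x - f x) p volume)
            + ε ^ ((1 - 2 * b) / 2) * traceNorm (s k))
          + ε ^ (-b) * lpNorm (fun ξ => (wt b 1 ξ : ℂ) * (F ξ - fourier (s k) ξ)) 2 volume) atTop
        (𝓝 (C * ((lpNorm f p volume + 0) + ε ^ ((1 - 2 * b) / 2) * 0) + ε ^ (-b) * 0)) :=
      (((hs.const_add _).add (hT.const_mul _)).const_mul _).add (hconv.const_mul _)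
    refine (ge_of_tendsto' hlim hk).trans (le_of_eq ?_)
    ring
  have hfat : eLpNorm (fun ξ => (wtSing b ξ : ℂ) * F ξ) 2 volume
      ≤ ENNReal.ofReal (C * lpNorm f p volume) := by
    have hpos : ∀ k : ℕ, 0 < 1 / ((k : ℝ) + 1) := fun k => by positivity
    have hle : ∀ k : ℕ, 1 / ((k : ℝ) + 1) ≤ 1 := fun k => by
      rw [div_le_one (by positivity)]; linarith [Nat.cast_nonneg (α := ℝ) k]
    have := Lp.eLpNorm_lim_le_liminf_eLpNorm (p := 2) (μ := (volume : Measure (Rn n)))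
      (f := fun (k : ℕ) ξ => (wt b (1 / ((k : ℝ) + 1)) ξ : ℂ) * F ξ)
      (fun k => (hεm _ (hpos k) (hle k)).1) (fun ξ => (wtSing b ξ : ℂ) * F ξ) (by
        filter_upwards [ae_norm_sq_ne_one] with ξ hξ
        exact ((Complex.continuous_ofReal.tendsto _).comp (tendsto_wt_zero b hξ)).mul_const _)
    refine this.trans (liminf_le_of_le (by isBoundedDefault) fun x hx => ?_)
    obtain ⟨k, hk⟩ := hx.exists
    refine hk.trans ?_
    rw [← ofReal_lpNorm (hεm _ (hpos k) (hle k))]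
    exact ENNReal.ofReal_le_ofReal (hεb _ (hpos k) (hle k))
  have hSm : MemLp (fun ξ => (wtSing b ξ : ℂ) * F ξ) 2 volume := by
    refine ⟨?_, hfat.trans_lt ENNReal.ofReal_lt_top⟩
    have : Measurable (wtSing b : Rn n → ℝ) := by unfold wtSing; fun_prop
    exact (Complex.measurable_ofReal.comp this).aestronglyMeasurable.mul hFm
  refine ⟨F, ⟨hf, hs, hT, hWFm, hconv, hSm, ?_⟩⟩
  rw [← toReal_eLpNorm hSm.1]
  have hfn : 0 ≤ lpNorm f p volume := lpNorm_nonneg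
  exact ENNReal.toReal_le_of_le_ofReal (by positivity) hfat

end WeightedLimit

end HelmholtzBR

namespace HelmholtzBR

variable {n : ℕ}

/-! ### The weighted limit is the distributional Fourier transform -/

section Consequences

lemma fourier_fourier_neg (φ : 𝓢(Rn n, ℂ)) (ξ : Rn n) :
    fourier (fourier φ) (-ξ) = ((2 * Real.pi) ^ n : ℝ) * φ ξ := by
  have hpi : (2 * Real.pi)⁻¹ ≠ 0 := two_pi_inv_ne_zero
  have h1 : 𝓕⁻ (𝓕 φ : 𝓢(Rn n, ℂ)) = φ := FourierTransform.fourierInv_fourier_eq φ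
  have h2 : φ ξ = ∫ y, Complex.exp (((2 * Real.pi * inner ℝ y ξ : ℝ) : ℂ) * Complex.I) • 𝓕 (φ : Rn n → ℂ) y := by
    nth_rw 1 [← h1]
    rw [SchwartzMap.fourierInv_coe, Real.fourierInv_eq', SchwartzMap.fourier_coe]
  have h3 := Measure.integral_comp_smul (volume : Measure (Rn n))
    (fun y => Complex.exp (((2 * Real.pi * inner ℝ y ξ : ℝ) : ℂ) * Complex.I) • 𝓕 (φ : Rn n → ℂ) y)
    (2 * Real.pi)⁻¹
  rw [← h2, finrank_euclideanSpace, Fintype.card_fin, ← inv_pow, inv_inv, abs_of_pos (by positivity)] at h3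
  rw [← Complex.real_smul, ← h3, fourier]
  refine integral_congr_ae (ae_of_all _ fun x => ?_)
  simp only [smul_eq_mul, fourier_eq_scaled, inner_smul_left, inner_neg_left, real_inner_comm x ξ]
  congr 2
  have : (Real.pi : ℂ) ≠ 0 := by exact_mod_cast Real.pi_ne_zero
  push_cast
  simp
  field_simp

variable {b C : ℝ} {f F : Rn n → ℂ} {s : ℕ → 𝓢(Rn n, ℂ)}

lemma wt_ofReal_ne_zero (b : ℝ) (ξ : Rn n) : (wt b 1 ξ : ℂ) ≠ 0 :=
  Complex.ofReal_ne_zero.2 (wt_pos b one_pos ξ).ne'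

lemma continuous_wt_ofReal (b : ℝ) : Continuous fun ξ : Rn n => (wt b 1 ξ : ℂ) :=
  Complex.continuous_ofReal.comp (continuous_wt b one_pos)

lemma continuous_wt_inv (b : ℝ) : Continuous fun ξ : Rn n => ((wt b 1 ξ)⁻¹ : ℂ) :=
  (continuous_wt_ofReal b).inv₀ (wt_ofReal_ne_zero b)

lemma WeightedLimit.aestronglyMeasurable (h : WeightedLimit b C f F s) :
    AEStronglyMeasurable F volume := by
  have h2 := (continuous_wt_inv (n := n) b).aestronglyMeasurable (μ := volume) |>.mul h.memLp_wt.1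
  refine h2.congr (ae_of_all _ fun ξ => ?_)
  exact inv_mul_cancel_left₀ (wt_ofReal_ne_zero b ξ) _

lemma WeightedLimit.memLp_wt_sub (h : WeightedLimit b C f F s) (hb : 0 ≤ b) (k : ℕ) :
    MemLp (fun ξ => (wt b 1 ξ : ℂ) * (F ξ - fourier (s k) ξ)) 2 volume := by
  have h2 := h.memLp_wt.sub ((SchwartzMap_nice (s k)).memLp_wt_fourier hb one_pos)
  refine h2.ae_eq (ae_of_all _ fun ξ => ?_)
  simp only [Pi.sub_apply, mul_sub]

/-- Convergence of pairings against functions that are square integrable for the dual weight. -/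
lemma WeightedLimit.tendsto_integral (h : WeightedLimit b C f F s) (hb : 0 ≤ b) {ψ : Rn n → ℂ}
    (hψ : MemLp (fun ξ => ((wt b 1 ξ)⁻¹ : ℂ) * ψ ξ) 2 volume) :
    Integrable (fun ξ => F ξ * ψ ξ) ∧ (∀ k, Integrable fun ξ => fourier (s k) ξ * ψ ξ) ∧
    Tendsto (fun k => ∫ ξ, ‖(F ξ - fourier (s k) ξ) * ψ ξ‖) atTop (𝓝 0) ∧
    Tendsto (fun k => ∫ ξ, fourier (s k) ξ * ψ ξ) atTop (𝓝 (∫ ξ, F ξ * ψ ξ)) := by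
  have e : ∀ (G : Rn n → ℂ) ξ, (wt b 1 ξ : ℂ) * G ξ * (((wt b 1 ξ)⁻¹ : ℂ) * ψ ξ) = G ξ * ψ ξ := by
    intro G ξ
    have := wt_ofReal_ne_zero b ξ
    field_simp
  have i1 : Integrable (fun ξ => F ξ * ψ ξ) :=
    (integrable_mul_of_memLp_two h.memLp_wt hψ).congr (ae_of_all _ fun ξ => e F ξ)
  have i2 : ∀ k, Integrable fun ξ => fourier (s k) ξ * ψ ξ := fun k =>
    (integrable_mul_of_memLp_two ((SchwartzMap_nice (s k)).memLp_wt_fourier hb one_pos) hψ).congr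
      (ae_of_all _ fun ξ => e _ ξ)
  have t1 : Tendsto (fun k => ∫ ξ, ‖(F ξ - fourier (s k) ξ) * ψ ξ‖) atTop (𝓝 0) := by
    have hlim := h.tendsto_wt.mul_const (lpNorm (fun ξ => ((wt b 1 ξ)⁻¹ : ℂ) * ψ ξ) 2 volume)
    rw [zero_mul] at hlim
    refine squeeze_zero (fun k => integral_nonneg fun _ => norm_nonneg _) (fun k => ?_) hlim
    have := integral_norm_mul_le_lpNorm (h.memLp_wt_sub hb k) hψ
    refine le_trans (le_of_eq (integral_congr_ae (ae_of_all _ fun ξ => ?_))) this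
    exact congrArg norm (e (fun ξ => F ξ - fourier (s k) ξ) ξ).symm
  refine ⟨i1, i2, t1, ?_⟩
  rw [tendsto_iff_norm_sub_tendsto_zero]
  refine squeeze_zero (fun k => norm_nonneg _) (fun k => ?_) t1
  rw [norm_sub_rev, ← integral_sub i1 (i2 k)]
  refine (norm_integral_le_integral_norm _).trans (le_of_eq ?_)
  simp_rw [sub_mul]

/-- The multiplication formula for `s k` passes to the limit: on the left by weighted convergence,
since b ≤ 2 makes φ over the weight square integrable; on the right by Hölder. -/
lemma WeightedLimit.isFourierTransform (h : WeightedLimit b C f F s) (hb : 0 ≤ b) (hb' : b ≤ 2)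
    (hbn : b ≤ ((n : ℝ) + 1) / 4) : IsFourierTransform f F := by
  have hp1 : 1 ≤ ENNReal.ofReal (pExp n b) := by
    rw [ENNReal.one_le_ofReal]; exact one_le_pExp hb hbn
  have hpq := ENNReal.HolderConjugate.conjExponent hp1
  refine ⟨?_, fun φ => ?_⟩
  · have h1 : LocallyIntegrable (fun ξ => (wt b 1 ξ : ℂ) * F ξ) volume :=
      h.memLp_wt.locallyIntegrable (by norm_num)
    rw [← locallyIntegrableOn_univ] at h1 ⊢
    have h2 := h1.continuousOn_mul (continuous_wt_inv (n := n) b).continuousOn isOpen_univ.isLocallyClosed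
    refine (locallyIntegrableOn_congr (ae_of_all _ fun ξ => ?_)).1 h2
    exact inv_mul_cancel_left₀ (wt_ofReal_ne_zero b ξ) _
  · obtain ⟨i1, i2, -, t2⟩ := h.tendsto_integral hb (memLp_wt_inv_mul hb' φ)
    refine ⟨i1, tendsto_nhds_unique t2 ?_⟩
    have hφ : MemLp (fourier φ) (ENNReal.conjExponent (ENNReal.ofReal (pExp n b))) volume := by
      rw [← coe_schwartzFourier]
      exact (schwartzFourier φ).memLp _
    have hlim := h.tendsto_lpNorm.mul_const
      (lpNorm (fourier φ) (ENNReal.conjExponent (ENNReal.ofReal (pExp n b))) volume)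
    rw [zero_mul] at hlim
    rw [tendsto_iff_norm_sub_tendsto_zero]
    refine squeeze_zero (fun k => norm_nonneg _) (fun k => ?_) hlim
    have hsk : MemLp (s k : Rn n → ℂ) (ENNReal.ofReal (pExp n b)) volume := (s k).memLp _
    rw [integral_fourier_mul_eq (SchwartzMap_nice (s k)).integrable (SchwartzMap_nice φ).integrable,
      ← integral_sub (integrable_mul_of_memLp hsk hφ) (integrable_mul_of_memLp h.memLp hφ)]
    refine (norm_integral_le_integral_norm _).trans ?_
    have := integral_norm_mul_le_lpNorm_mul (hsk.sub h.memLp) hφ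
    refine le_trans (le_of_eq ?_) this
    simp only [Pi.sub_apply, sub_mul]

end Consequences

/-! ### The case α ≤ 1 -/

section MildSingularity

lemma measurable_wtSing (b : ℝ) : Measurable (wtSing b : Rn n → ℝ) := by unfold wtSing; fun_prop

lemma wtSing_nonneg (b : ℝ) (ξ : Rn n) : 0 ≤ wtSing b ξ := Real.rpow_nonneg (abs_nonneg _) _

/-- The argument of the power is at most 2γ · π/2 = πγ ≤ π/2 in modulus. Below the threshold γ = 1/2
the real part therefore controls the modulus, and no trace term arises. -/
lemma cos_mul_le_re_sym {γ ε : ℝ} (hγ : 0 ≤ γ) (hγ' : γ ≤ 1 / 2) (hε : 0 < ε) (s : ℝ) :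
    Real.cos (Real.pi * γ) * (s ^ 2 + ε ^ 2) ^ (-γ) ≤ (sym ((2 * γ : ℝ) : ℂ) (ε : ℂ) s).re := by
  have hp := Real.pi_pos
  rw [sym, ← Complex.ofReal_neg, Complex.cpow_ofReal]
  simp only [Complex.add_re, Complex.ofReal_re, Complex.mul_re, Complex.I_re,
    Complex.ofReal_im, Complex.I_im, mul_zero, mul_one, sub_self, add_zero, zero_mul, sub_zero]
  rw [norm_base_ofReal, Real.sqrt_eq_rpow, ← Real.rpow_mul (by positivity), mul_comm]
  have e : 1 / 2 * -(2 * γ) = -γ := by ring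
  rw [e]
  refine mul_le_mul_of_nonneg_left ?_ (by positivity)
  have harg : |Complex.arg ((ε : ℂ) + s * Complex.I)| < Real.pi / 2 := by
    rw [Complex.abs_arg_lt_pi_div_two_iff]
    left
    simpa using hε
  rw [← Real.cos_abs (_ * -(2 * γ)), abs_mul, abs_neg, abs_of_nonneg (by positivity : 0 ≤ 2 * γ)]
  refine Real.cos_le_cos_of_nonneg_of_le_pi (by positivity) (by nlinarith) ?_
  nlinarith

/-- The weighted `L²` bound below the trace threshold. -/
theorem exists_lpNorm_wtSing_fourier_le {γ : ℝ} (hγ : 0 ≤ γ) (hγ' : γ < 1 / 2)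
    (hγn : γ ≤ ((n : ℝ) + 1) / 4) :
    ∃ C : ℝ, 0 < C ∧ ∀ g : Rn n → ℂ, Nice g →
      MemLp (fun ξ => (wtSing γ ξ : ℂ) * fourier g ξ) 2 volume ∧
      lpNorm (fun ξ => (wtSing γ ξ : ℂ) * fourier g ξ) 2 volume
        ≤ C * lpNorm g (ENNReal.ofReal (pExp n γ)) volume := by
  have hp := Real.pi_pos
  have hc : 0 < Real.cos (Real.pi * γ) :=
    Real.cos_pos_of_mem_Ioo ⟨by nlinarith, by nlinarith⟩
  set c := Real.cos (Real.pi * γ)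
  have hP := powConst_pos (n := n) hγ
  refine ⟨√(powConst n γ / c), Real.sqrt_pos.2 (by positivity), fun g hg => ?_⟩
  set N := lpNorm g (ENNReal.ofReal (pExp n γ)) volume
  have hN : 0 ≤ N := lpNorm_nonneg
  have hb : ∀ ε : ℝ, 0 < ε →
      lpNorm (fun ξ => (wt γ ε ξ : ℂ) * fourier g ξ) 2 volume ≤ √(powConst n γ / c) * N := by
    intro ε hε
    have h1 := norm_integral_sym_sq_le hγ hγn (goodParam_ofReal hε) hg
    have h2 := lpNorm_two_sq (hg.memLp_wt_fourier hγ hε)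
    have e : ∀ ξ, ‖(wt γ ε ξ : ℂ) * fourier g ξ‖ ^ 2
        = ((‖ξ‖ ^ 2 - 1) ^ 2 + ε ^ 2) ^ (-γ) * ‖fourier g ξ‖ ^ 2 := by
      intro ξ
      rw [norm_wt_mul γ hε, mul_pow, wt_sq hε]
    simp_rw [e] at h2
    have hi : Integrable fun ξ : Rn n =>
        sym ((2 * γ : ℝ) : ℂ) ε (‖ξ‖ ^ 2 - 1) * ((‖fourier g ξ‖ ^ 2 : ℝ) : ℂ) :=
      integrable_sym_mul (by simpa using hγ) (by simpa using hε) (by fun_prop) hg.integrable_sq_fourier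
    have h3 : c * ∫ ξ : Rn n, ((‖ξ‖ ^ 2 - 1) ^ 2 + ε ^ 2) ^ (-γ) * ‖fourier g ξ‖ ^ 2
        ≤ powConst n γ * N ^ 2 := by
      refine le_trans ?_ h1
      refine le_trans ?_ (Complex.re_le_norm _)
      have h4 : (∫ ξ : Rn n, sym ((2 * γ : ℝ) : ℂ) ε (‖ξ‖ ^ 2 - 1) * ((‖fourier g ξ‖ ^ 2 : ℝ) : ℂ)).re
          = ∫ ξ : Rn n, (sym ((2 * γ : ℝ) : ℂ) ε (‖ξ‖ ^ 2 - 1) * ((‖fourier g ξ‖ ^ 2 : ℝ) : ℂ)).re :=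
        (integral_re hi).symm
      rw [h4, ← integral_const_mul]
      have hi2 : Integrable fun ξ : Rn n => ((‖ξ‖ ^ 2 - 1) ^ 2 + ε ^ 2) ^ (-γ) * ‖fourier g ξ‖ ^ 2 := by
        refine ((hg.memLp_wt_fourier hγ hε).integrable_norm_pow (by norm_num)).congr
          (ae_of_all _ fun ξ => ?_)
        exact e ξ
      refine integral_mono (hi2.const_mul _) hi.re fun ξ => ?_
      simp only [Complex.re_mul_ofReal]
      rw [← mul_assoc]
      exact mul_le_mul_of_nonneg_right (cos_mul_le_re_sym hγ hγ'.le hε _) (by positivity)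
    rw [← h2] at h3
    refine abs_le_of_sq_le_sq' ?_ (by positivity) |>.2
    rw [mul_pow, Real.sq_sqrt (by positivity), div_mul_eq_mul_div, le_div_iff₀ hc]
    linarith
  have hfat : eLpNorm (fun ξ => (wtSing γ ξ : ℂ) * fourier g ξ) 2 volume
      ≤ ENNReal.ofReal (√(powConst n γ / c) * N) := by
    have hpos : ∀ k : ℕ, 0 < 1 / ((k : ℝ) + 1) := fun k => by positivity
    have := Lp.eLpNorm_lim_le_liminf_eLpNorm (p := 2) (μ := (volume : Measure (Rn n)))
      (f := fun (k : ℕ) ξ => (wt γ (1 / ((k : ℝ) + 1)) ξ : ℂ) * fourier g ξ)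
      (fun k => (hg.memLp_wt_fourier hγ (hpos k)).1) (fun ξ => (wtSing γ ξ : ℂ) * fourier g ξ) (by
        filter_upwards [ae_norm_sq_ne_one] with ξ hξ
        exact ((Complex.continuous_ofReal.tendsto _).comp (tendsto_wt_zero γ hξ)).mul_const _)
    refine this.trans (liminf_le_of_le (by isBoundedDefault) fun x hx => ?_)
    obtain ⟨k, hk⟩ := hx.exists
    refine hk.trans ?_
    rw [← ofReal_lpNorm (hg.memLp_wt_fourier hγ (hpos k))]
    exact ENNReal.ofReal_le_ofReal (hb _ (hpos k))
  have hSm : MemLp (fun ξ => (wtSing γ ξ : ℂ) * fourier g ξ) 2 volume :=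
    ⟨(Complex.measurable_ofReal.comp (measurable_wtSing γ)).aestronglyMeasurable.mul
      (continuous_fourier hg.integrable).aestronglyMeasurable, hfat.trans_lt ENNReal.ofReal_lt_top⟩
  refine ⟨hSm, ?_⟩
  rw [← toReal_eLpNorm hSm.1]
  exact ENNReal.toReal_le_of_le_ofReal (by positivity) hfat

lemma abs_brSymbol_le (a : ℝ) (ξ : Rn n) : |brSymbol (-a) ξ| ≤ wtSing a ξ := by
  unfold brSymbol wtSing
  split_ifs with h
  · have h1 : 0 < 1 - ‖ξ‖ ^ 2 := by nlinarith [norm_nonneg ξ]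
    rw [abs_of_pos (Real.rpow_pos_of_pos h1 _), abs_sub_comm, abs_of_pos h1]
  · rw [abs_zero]
    exact Real.rpow_nonneg (abs_nonneg _) _

lemma measurable_brSymbol (a : ℝ) : Measurable (brSymbol a : Rn n → ℝ) := by
  unfold brSymbol
  exact Measurable.ite (measurableSet_lt measurable_norm measurable_const) (by fun_prop) measurable_const

lemma tendsto_setIntegral_ball {G : Rn n → ℂ} (hG : Integrable G) :
    Tendsto (fun ρ : ℝ => ∫ ξ in Metric.ball (0 : Rn n) ρ, G ξ) (𝓝[<] 1)
      (𝓝 (∫ ξ in Metric.ball (0 : Rn n) 1, G ξ)) := by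
  simp_rw [← integral_indicator measurableSet_ball]
  refine tendsto_integral_filter_of_dominated_convergence (fun ξ => ‖G ξ‖) ?_ ?_ hG.norm ?_
  · exact .of_forall fun ρ => hG.aestronglyMeasurable.indicator measurableSet_ball
  · exact .of_forall fun ρ => ae_of_all _ fun ξ => norm_indicator_le_norm_self _ _
  · refine ae_of_all _ fun ξ => tendsto_const_nhds.congr' ?_
    by_cases hξ : ‖ξ‖ < 1
    · filter_upwards [nhdsWithin_le_nhds (Ioi_mem_nhds hξ)] with ρ hρ
      rw [Set.indicator_of_mem (by simpa using hξ), Set.indicator_of_mem (by simpa using hρ)]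
    · filter_upwards [self_mem_nhdsWithin] with ρ hρ
      have hρ : ρ < 1 := hρ
      rw [Set.indicator_of_notMem (by simpa using hξ), Set.indicator_of_notMem]
      simp only [mem_ball_zero_iff, not_lt]
      linarith [not_lt.1 hξ]

/-- The Bochner-Riesz pairing when the singularity splits into two mild ones. -/
theorem exists_bochnerRiesz_bound_of_le_one {α b C : ℝ} (hb : 1 / 2 < b)
    (hbα : b ≤ α) (hα2 : α ≤ 2 * b) (hα : α ≤ 1) (hbn : b ≤ ((n : ℝ) + 1) / 4) (hC : 0 < C) :
    ∃ K : ℝ, 0 < K ∧ ∀ (f F : Rn n → ℂ) (s : ℕ → 𝓢(Rn n, ℂ)), WeightedLimit b C f F s →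
      ∀ g φ : 𝓢(Rn n, ℂ), (∀ ξ, fourier g (-ξ) = φ ξ) → ∃ l : ℂ,
        Tendsto (fun ρ : ℝ => ∫ ξ in Metric.ball (0 : Rn n) ρ, (brSymbol (-α) ξ : ℂ) * F ξ * φ ξ)
          (𝓝[<] 1) (𝓝 l) ∧
        ‖l‖ ≤ K * lpNorm f (ENNReal.ofReal (pExp n b)) volume
          * lpNorm g (ENNReal.ofReal (pExp n (α - b))) volume := by
  -- α ≤ 1 and b > 1/2 put α - b below the trace threshold, so ĝ need not vanish on the sphere. The
  -- weight |s|^{-α} splits as |s|^{-b}|s|^{-(α-b)}, and Cauchy–Schwarz applies.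
  obtain ⟨C', hC', hg⟩ := exists_lpNorm_wtSing_fourier_le (n := n) (γ := α - b) (by linarith)
    (by linarith) (by linarith)
  refine ⟨C * C', by positivity, fun f F s h g φ hφ => ?_⟩
  obtain ⟨m1, m2⟩ := hg g (SchwartzMap_nice g)
  have hm : MeasurePreserving (fun ξ : Rn n => -ξ) volume volume :=
    Measure.measurePreserving_neg _
  have e1 : (fun ξ => (wtSing (α - b) ξ : ℂ) * φ ξ)
      = fun ξ => (fun ξ => (wtSing (α - b) ξ : ℂ) * fourier g ξ) (-ξ) := by
    funext ξ
    simp only [hφ, wtSing, norm_neg]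
  have mφ : MemLp (fun ξ => (wtSing (α - b) ξ : ℂ) * φ ξ) 2 volume := by
    rw [e1]; exact m1.comp_measurePreserving hm
  have nφ : lpNorm (fun ξ => (wtSing (α - b) ξ : ℂ) * φ ξ) 2 volume
      ≤ C' * lpNorm g (ENNReal.ofReal (pExp n (α - b))) volume := by
    rw [e1, lpNorm_comp_neg m1.1]; exact m2
  have hprod := integrable_mul_of_memLp_two h.memLp_sing mφ
  have hle : ∀ᵐ ξ : Rn n, ‖(brSymbol (-α) ξ : ℂ) * F ξ * φ ξ‖
      ≤ ‖(wtSing b ξ : ℂ) * F ξ * ((wtSing (α - b) ξ : ℂ) * φ ξ)‖ := by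
    filter_upwards [ae_norm_sq_ne_one] with ξ hξ
    have hs : wtSing α ξ = wtSing b ξ * wtSing (α - b) ξ := by
      unfold wtSing
      rw [← Real.rpow_add (abs_pos.2 hξ)]
      congr 1; ring
    have := abs_brSymbol_le α ξ
    simp only [norm_mul, Complex.norm_real, Real.norm_eq_abs, abs_of_nonneg (wtSing_nonneg _ ξ)]
    calc |brSymbol (-α) ξ| * ‖F ξ‖ * ‖φ ξ‖ ≤ wtSing α ξ * ‖F ξ‖ * ‖φ ξ‖ := by gcongr
      _ = _ := by rw [hs]; ring
  have hmeas : AEStronglyMeasurable (fun ξ : Rn n => (brSymbol (-α) ξ : ℂ) * F ξ * φ ξ) volume :=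
    ((Complex.measurable_ofReal.comp (measurable_brSymbol _)).aestronglyMeasurable.mul
      h.aestronglyMeasurable).mul φ.continuous.aestronglyMeasurable
  have hint := hprod.norm.mono' hmeas hle
  refine ⟨_, tendsto_setIntegral_ball hint, ?_⟩
  have hf : 0 ≤ lpNorm f (ENNReal.ofReal (pExp n b)) volume := lpNorm_nonneg
  calc _ ≤ ∫ ξ in Metric.ball (0 : Rn n) 1, ‖(brSymbol (-α) ξ : ℂ) * F ξ * φ ξ‖ :=
        norm_integral_le_integral_norm _
    _ ≤ ∫ ξ, ‖(brSymbol (-α) ξ : ℂ) * F ξ * φ ξ‖ :=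
        setIntegral_le_integral hint.norm (ae_of_all _ fun _ => norm_nonneg _)
    _ ≤ ∫ ξ, ‖(wtSing b ξ : ℂ) * F ξ * ((wtSing (α - b) ξ : ℂ) * φ ξ)‖ :=
        integral_mono_ae hint.norm hprod.norm hle
    _ ≤ _ := integral_norm_mul_le_lpNorm h.memLp_sing mφ
    _ ≤ (C * lpNorm f (ENNReal.ofReal (pExp n b)) volume)
        * (C' * lpNorm g (ENNReal.ofReal (pExp n (α - b))) volume) :=
        mul_le_mul h.lpNorm_sing_le nφ lpNorm_nonneg (by positivity)
    _ = _ := by ring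

end MildSingularity

end HelmholtzBR

namespace HelmholtzBR

variable {n : ℕ}

/-! ### Functionals bounded in L^r, 1 ≤ r ≤ 2, are integrals against functions -/

section Duality

/-- A rapidly decreasing weight with polynomially growing inverse. -/
noncomputable def decay (n : ℕ) (x : Rn n) : ℝ := ((1 + ‖x‖ ^ 2) ^ n)⁻¹

lemma decay_pos (x : Rn n) : 0 < decay n x := by unfold decay; positivity

lemma decay_le_one (x : Rn n) : decay n x ≤ 1 := by
  unfold decay
  exact inv_le_one_of_one_le₀ (one_le_pow₀ (by nlinarith [sq_nonneg ‖x‖]))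

lemma continuous_decay : Continuous (decay n) := by
  unfold decay
  exact Continuous.inv₀ (by fun_prop) fun x => by positivity

lemma integrable_decay (hn : 2 ≤ n) : Integrable (decay n) := by
  have hn' : (2 : ℝ) ≤ n := by exact_mod_cast hn
  have := integrable_rpow_neg_one_add_norm_sq (E := Rn n) (μ := volume) (r := 2 * n)
    (by rw [finrank_euclideanSpace, Fintype.card_fin]; linarith)
  refine this.congr (ae_of_all _ fun x => ?_)
  simp only [decay]
  rw [← Real.rpow_natCast (1 + ‖x‖ ^ 2) n, ← Real.rpow_neg (by positivity)]
  congr 1; ring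

lemma memLp_decay (hn : 2 ≤ n) {t : ℝ≥0∞} (ht : 1 ≤ t) :
    MemLp (fun x => (decay n x : ℂ)) t volume := by
  have hc : Continuous fun x => (decay n x : ℂ) := Complex.continuous_ofReal.comp continuous_decay
  have hb : ∀ x, ‖(decay n x : ℂ)‖ ≤ 1 := fun x => by
    rw [Complex.norm_real, Real.norm_of_nonneg (decay_pos x).le]; exact decay_le_one x
  rcases eq_or_ne t ∞ with rfl | ht'
  · exact memLp_top_of_bound hc.aestronglyMeasurable 1 (ae_of_all _ hb)
  · have ht0 : t ≠ 0 := (zero_lt_one.trans_le ht).ne'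
    have ht1 : 1 ≤ t.toReal := by
      have := ENNReal.toReal_mono ht' ht
      simpa using this
    rw [← integrable_norm_rpow_iff hc.aestronglyMeasurable ht0 ht']
    refine (integrable_decay hn).mono' (hc.norm.rpow_const fun x => Or.inr
      (by linarith)).aestronglyMeasurable (ae_of_all _ fun x => ?_)
    rw [Real.norm_of_nonneg (by positivity)]
    calc ‖(decay n x : ℂ)‖ ^ t.toReal ≤ ‖(decay n x : ℂ)‖ ^ (1 : ℝ) :=
          Real.rpow_le_rpow_of_exponent_ge' (norm_nonneg _) (hb x) zero_le_one ht1
      _ = decay n x := by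
          rw [Real.rpow_one, Complex.norm_real, Real.norm_of_nonneg (decay_pos x).le]


lemma decay_hasTemperateGrowth : (fun x : Rn n => (decay n x : ℂ)).HasTemperateGrowth := by
  have := Function.Complex.hasTemperateGrowth_ofReal.comp
    (Function.hasTemperateGrowth_one_add_norm_sq_rpow (Rn n) (-(n : ℝ)))
  refine (funext fun x => ?_ : (fun x : Rn n => (decay n x : ℂ)) = _) ▸ this
  rw [decay, Function.comp_apply, Real.rpow_neg (by positivity), Real.rpow_natCast]

lemma decay_inv_hasTemperateGrowth : (fun x : Rn n => (decay n x : ℂ)⁻¹).HasTemperateGrowth := by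
  have := Function.Complex.hasTemperateGrowth_ofReal.comp
    (Function.hasTemperateGrowth_one_add_norm_sq_rpow (Rn n) (n : ℝ))
  refine (funext fun x => ?_ : (fun x : Rn n => (decay n x : ℂ)⁻¹) = _) ▸ this
  rw [decay, Function.comp_apply, ← Complex.ofReal_inv, inv_inv, Real.rpow_natCast]

/-- Multiplying by the decaying weight maps `L²` into `L^r` for `r ≤ 2`. -/
lemma exists_lpNorm_decay_mul_le (hn : 2 ≤ n) {r : ℝ≥0∞} (hr1 : 1 ≤ r) (hr2 : r ≤ 2) :
    ∃ A : ℝ, 0 ≤ A ∧ ∀ χ : Rn n → ℂ, MemLp χ 2 volume →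
      MemLp (fun x => (decay n x : ℂ) * χ x) r volume ∧
      lpNorm (fun x => (decay n x : ℂ) * χ x) r volume ≤ A * lpNorm χ 2 volume := by
  -- Hölder with 1/t = 1/r - 1/2: t = ∞ when r = 2, and t ≥ 1 because r ≥ 1.
  set t : ℝ≥0∞ := (r⁻¹ - 2⁻¹)⁻¹ with ht
  have hle : (2 : ℝ≥0∞)⁻¹ ≤ r⁻¹ := ENNReal.inv_le_inv.2 hr2
  have hT : ENNReal.HolderTriple t 2 r := ⟨by rw [ht, inv_inv, tsub_add_cancel_of_le hle]⟩
  have ht1 : 1 ≤ t := by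
    rw [ht, ENNReal.one_le_inv]
    exact tsub_le_self.trans (ENNReal.inv_le_one.2 hr1)
  have hG := memLp_decay hn ht1
  refine ⟨lpNorm (fun x => (decay n x : ℂ)) t volume, lpNorm_nonneg, fun χ hχ => ?_⟩
  have hm : MemLp (fun x => (decay n x : ℂ) * χ x) r volume := hχ.mul hG
  refine ⟨hm, ?_⟩
  have h := eLpNorm_smul_le_mul_eLpNorm (p := t) (q := 2) (r := r) hχ.1 hG.1
  rw [← toReal_eLpNorm hm.1, ← toReal_eLpNorm hG.1, ← toReal_eLpNorm hχ.1, ← ENNReal.toReal_mul]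
  exact ENNReal.toReal_mono (ENNReal.mul_ne_top hG.2.ne hχ.2.ne) h

/-- As r ≤ 2, Λ composed with the decaying weight is bounded on L², where Riesz representation gives
v. The last clause carries the L^r bound over to all of L² by density, so that v can be tested
against functions that are not smooth. -/
lemma exists_weighted_riesz (hn : 2 ≤ n) {r : ℝ≥0∞} (hr1 : 1 ≤ r) (hr2 : r ≤ 2)
    (Λ : 𝓢(Rn n, ℂ) →ₗ[ℂ] ℂ) {K : ℝ} (hK : 0 ≤ K)
    (hΛ : ∀ ψ : 𝓢(Rn n, ℂ), ‖Λ ψ‖ ≤ K * lpNorm ψ r volume) :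
    ∃ v : Rn n → ℂ, StronglyMeasurable v ∧ MemLp v 2 volume ∧
      (∀ χ : 𝓢(Rn n, ℂ), Λ (SchwartzMap.smulLeftCLM ℂ (fun x => (decay n x : ℂ)) χ) = ∫ x, v x * χ x) ∧
      ∀ χ : Rn n → ℂ, MemLp χ 2 volume →
        ‖∫ x, v x * χ x‖ ≤ K * lpNorm (fun x => (decay n x : ℂ) * χ x) r volume := by
  obtain ⟨A, hA, hG⟩ := exists_lpNorm_decay_mul_le hn hr1 hr2
  set e : 𝓢(Rn n, ℂ) →ₗ[ℂ] Lp ℂ 2 (volume : Measure (Rn n)) :=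
    (SchwartzMap.toLpCLM ℂ ℂ 2 volume).toLinearMap
  set T : 𝓢(Rn n, ℂ) →ₗ[ℂ] ℂ := Λ ∘ₗ (SchwartzMap.smulLeftCLM ℂ (fun x => (decay n x : ℂ))).toLinearMap
  have hdense : DenseRange e := SchwartzMap.denseRange_toLpCLM (by norm_num)
  have hcoe : ∀ χ : 𝓢(Rn n, ℂ), (SchwartzMap.smulLeftCLM ℂ (fun x => (decay n x : ℂ)) χ : Rn n → ℂ)
      = fun x => (decay n x : ℂ) * χ x := by
    intro χ
    funext x
    rw [SchwartzMap.smulLeftCLM_apply_apply decay_hasTemperateGrowth, smul_eq_mul]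
  have hnorm : ∀ χ, ‖e χ‖ = lpNorm χ 2 volume := by
    intro χ
    rw [← toReal_eLpNorm (χ.memLp 2 volume).1]
    exact SchwartzMap.norm_toLp
  have hT1 : ∀ χ, ‖T χ‖ ≤ K * lpNorm (fun x => (decay n x : ℂ) * χ x) r volume := by
    intro χ
    rw [← hcoe]
    exact hΛ _
  have hTb : ∀ χ, ‖T χ‖ ≤ (K * A) * ‖e χ‖ := by
    intro χ
    refine (hT1 χ).trans ?_
    rw [hnorm, mul_assoc]
    exact mul_le_mul_of_nonneg_left (hG χ (χ.memLp 2 volume)).2 hK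
  set Φ := T.extendOfNorm e
  set v₀ : Lp ℂ 2 (volume : Measure (Rn n)) := (InnerProductSpace.toDual ℂ _).symm Φ
  set v : Rn n → ℂ := fun x => conj (v₀ x)
  have hvm : MemLp v 2 volume := (Lp.memLp v₀).star
  have hint : ∀ χ : Rn n → ℂ, ∀ hχ : MemLp χ 2 volume, Φ (hχ.toLp χ) = ∫ x, v x * χ x := by
    intro χ hχ
    rw [← InnerProductSpace.toDual_symm_apply, L2.inner_def]
    refine integral_congr_ae ?_
    filter_upwards [hχ.coeFn_toLp] with x hx
    rw [hx, RCLike.inner_apply, mul_comm]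
  have hS : ∀ χ : 𝓢(Rn n, ℂ), T χ = ∫ x, v x * χ x := by
    intro χ
    rw [← hint χ (χ.memLp 2 volume)]
    exact (LinearMap.extendOfNorm_eq hdense ⟨_, hTb⟩ χ).symm
  refine ⟨v, (Lp.stronglyMeasurable v₀).star, hvm, hS, fun χ hχ => ?_⟩
  have hV : 0 ≤ lpNorm v 2 volume := lpNorm_nonneg
  refine le_of_forall_pos_le_add fun δ hδ => ?_
  -- The approximation error enters through ‖v‖₂ in the pairing and through K · A in the bound; the
  -- 1 keeps the divisor positive.
  set δ' := δ / (lpNorm v 2 volume + K * A + 1)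
  have hδ' : 0 < δ' := by positivity
  obtain ⟨η, hη⟩ := Metric.denseRange_iff.1 hdense (hχ.toLp χ) δ' hδ'
  have hηm : MemLp (η : Rn n → ℂ) 2 volume := η.memLp 2 volume
  have hd : lpNorm (fun x => χ x - η x) 2 volume ≤ δ' := by
    have : dist (hχ.toLp χ) (e η) = lpNorm (fun x => χ x - η x) 2 volume := by
      have h1 : e η = hηm.toLp η := rfl
      rw [h1, dist_eq_norm, ← MemLp.toLp_sub, Lp.norm_toLp, toReal_eLpNorm (hχ.sub hηm).1]
      rfl
    rw [← this]
    exact hη.le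
  have hsub : MemLp (fun x => χ x - η x) 2 volume := hχ.sub hηm
  have b1 : ‖∫ x, v x * χ x‖ ≤ ‖∫ x, v x * η x‖ + lpNorm v 2 volume * δ' := by
    have h1 : ∫ x, v x * χ x = (∫ x, v x * η x) + ∫ x, v x * (χ x - η x) := by
      rw [← integral_add (integrable_mul_of_memLp_two hvm hηm)
        (integrable_mul_of_memLp_two hvm hsub)]
      refine integral_congr_ae (ae_of_all _ fun x => ?_)
      simp only
      ring
    rw [h1]
    refine (norm_add_le _ _).trans (add_le_add le_rfl ?_)
    refine (norm_integral_le_integral_norm _).trans ?_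
    refine (integral_norm_mul_le_lpNorm hvm hsub).trans ?_
    exact mul_le_mul_of_nonneg_left hd hV
  have b2 : lpNorm (fun x => (decay n x : ℂ) * η x) r volume
      ≤ lpNorm (fun x => (decay n x : ℂ) * χ x) r volume + A * δ' := by
    have h1 := lpNorm_sub_le (g := fun x => (decay n x : ℂ) * (χ x - η x)) (hG χ hχ).1 hr1
    have h3 : (fun x => (decay n x : ℂ) * χ x) - (fun x => (decay n x : ℂ) * (χ x - η x))
        = fun x => (decay n x : ℂ) * η x := by
      funext x; simp only [Pi.sub_apply]; ring
    rw [h3] at h1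
    refine h1.trans (add_le_add le_rfl ((hG _ hsub).2.trans ?_))
    exact mul_le_mul_of_nonneg_left hd hA
  have b3 := hT1 η
  rw [hS] at b3
  have b4 : (lpNorm v 2 volume + K * A) * δ' ≤ δ := by
    simp only [δ']
    rw [mul_div_assoc', div_le_iff₀ (by positivity)]
    nlinarith [mul_nonneg hK hA]
  have b5 := mul_le_mul_of_nonneg_left b2 hK
  linarith

/-- The set where a function and its argument are bounded by `N`. -/
def levelSet (u : Rn n → ℂ) (N : ℕ) : Set (Rn n) := {x | ‖x‖ ≤ N ∧ ‖u x‖ ≤ N}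

lemma measurableSet_levelSet {u : Rn n → ℂ} (hu : StronglyMeasurable u) (N : ℕ) :
    MeasurableSet (levelSet u N) :=
  (measurableSet_le measurable_norm measurable_const).inter
    (measurableSet_le hu.measurable.norm measurable_const)

lemma volume_levelSet_lt_top (u : Rn n → ℂ) (N : ℕ) : volume (levelSet u N) < ∞ := by
  refine (measure_mono (t := Metric.closedBall (0 : Rn n) N) fun x hx => ?_).trans_lt
    measure_closedBall_lt_top
  simpa using hx.1

lemma memLp_indicator_of_bound {B : Set (Rn n)} (hB : MeasurableSet B) (hB' : volume B < ∞)
    {h : Rn n → ℂ} (hm : StronglyMeasurable h) {M : ℝ} (hM : ∀ x ∈ B, ‖h x‖ ≤ M) (p : ℝ≥0∞) :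
    MemLp (B.indicator h) p volume := by
  rw [memLp_indicator_iff_restrict hB]
  have : IsFiniteMeasure (volume.restrict B) := ⟨by simpa using hB'⟩
  refine MemLp.of_bound hm.aestronglyMeasurable M ?_
  filter_upwards [ae_restrict_mem hB] with x hx using hM x hx

/-- Testing against ū|u|^{r'-2} on a level set, where everything is finite, gives I ≤ K · I^{1/r}
for I the integral of |u|^{r'} there. Divide, and exhaust by level sets with Fatou. -/
lemma eLpNorm_le_of_testing {r r' : ℝ} (hr2 : r ≤ 2) (hr' : r.HolderConjugate r')
    {u : Rn n → ℂ} (hu : StronglyMeasurable u) {K : ℝ} (hK : 0 ≤ K)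
    (htest : ∀ (B : Set (Rn n)) (N : ℕ) (h : Rn n → ℂ) (M : ℝ), MeasurableSet B → B ⊆ levelSet u N →
      StronglyMeasurable h → (∀ x ∈ B, ‖h x‖ ≤ M) →
      ‖∫ x, u x * B.indicator h x‖ ≤ K * lpNorm (B.indicator h) (ENNReal.ofReal r) volume) :
    eLpNorm u (ENNReal.ofReal r') volume ≤ ENNReal.ofReal K := by
  have hr'0 : 0 < r' := hr'.symm.pos
  have hr0 : 0 < r := hr'.pos
  have hr'2 : 2 ≤ r' := by
    have h1 := hr'.inv_add_inv_eq_one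
    have h2 : (1 : ℝ) / 2 ≤ r⁻¹ := by rw [one_div]; exact inv_anti₀ hr0 hr2
    have h3 : r'⁻¹ ≤ 2⁻¹ := by rw [one_div] at h2; linarith
    exact (inv_le_inv₀ hr'0 two_pos).1 h3
  have hcut : ∀ N : ℕ, eLpNorm ((levelSet u N).indicator u) (ENNReal.ofReal r') volume
      ≤ ENNReal.ofReal K := by
    intro N
    have hB := measurableSet_levelSet hu N
    have hB' := volume_levelSet_lt_top u N
    set B := levelSet u N
    have hum := memLp_indicator_of_bound hB hB' hu (M := N) (fun x hx => hx.2) (ENNReal.ofReal r')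
    set h : Rn n → ℂ := fun x => conj (u x) * ((‖u x‖ ^ (r' - 2) : ℝ) : ℂ)
    have hn0 : ∀ x, ‖h x‖ = ‖u x‖ ^ (r' - 1) := by
      intro x
      simp only [h]
      rw [norm_mul, RCLike.norm_conj, Complex.norm_real, Real.norm_of_nonneg (by positivity)]
      rcases (norm_nonneg (u x)).eq_or_lt with h0 | h0
      · rw [← h0, zero_mul, Real.zero_rpow (by linarith)]
      · rw [← Real.rpow_one_add' h0.le (by linarith)]; congr 1; ring
    have hhm : StronglyMeasurable h := by
      refine Measurable.stronglyMeasurable ?_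
      have := hu.measurable
      fun_prop
    have hM : ∀ x ∈ B, ‖h x‖ ≤ (N : ℝ) ^ (r' - 1) := by
      intro x hx
      rw [hn0]
      exact Real.rpow_le_rpow (norm_nonneg _) hx.2 (by linarith)
    have ht := htest B N h _ hB le_rfl hhm hM
    have hhLp := memLp_indicator_of_bound hB hB' hhm hM (ENNReal.ofReal r)
    set I := ∫ x in B, ‖u x‖ ^ r'
    have hI : 0 ≤ I := integral_nonneg fun x => by positivity
    have e1 : ∫ x, u x * B.indicator h x = (I : ℂ) := by
      rw [← integral_complex_ofReal, ← integral_indicator hB]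
      refine integral_congr_ae (ae_of_all _ fun x => ?_)
      by_cases hx : x ∈ B <;>
        simp only [hx, Set.indicator_of_mem, Set.indicator_of_notMem, not_false_eq_true]
      · simp only [h]
        rw [← mul_assoc, Complex.mul_conj, Complex.normSq_eq_norm_sq, ← Complex.ofReal_mul]
        congr 1
        rcases (norm_nonneg (u x)).eq_or_lt with h0 | h0
        · rw [← h0, Real.zero_rpow hr'0.ne']; simp
        · rw [← Real.rpow_natCast, ← Real.rpow_add h0]; congr 1; push_cast; ring
      · simp
    have e2 : lpNorm (B.indicator h) (ENNReal.ofReal r) volume = I ^ (r⁻¹) := by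
      rw [lpNorm_eq_integral_norm_rpow_toReal (by simpa using hr0) ENNReal.ofReal_ne_top hhLp.1,
        ENNReal.toReal_ofReal hr0.le]
      congr 1
      simp only [I]
      rw [← integral_indicator hB]
      refine integral_congr_ae (ae_of_all _ fun x => ?_)
      by_cases hx : x ∈ B <;>
        simp only [hx, Set.indicator_of_mem, Set.indicator_of_notMem, not_false_eq_true]
      · rw [hn0, ← Real.rpow_mul (norm_nonneg _)]
        congr 1
        have := hr'.sub_one_mul_conj
        have h5 := hr'.symm.sub_one_mul_conj
        linarith
      · simp [Real.zero_rpow hr0.ne']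
    have e3 : lpNorm (B.indicator u) (ENNReal.ofReal r') volume = I ^ (r'⁻¹) := by
      rw [lpNorm_eq_integral_norm_rpow_toReal (by simpa using hr'0) ENNReal.ofReal_ne_top hum.1,
        ENNReal.toReal_ofReal hr'0.le]
      congr 1
      simp only [I]
      rw [← integral_indicator hB]
      refine integral_congr_ae (ae_of_all _ fun x => ?_)
      by_cases hx : x ∈ B <;>
        simp only [hx, Set.indicator_of_mem, Set.indicator_of_notMem, not_false_eq_true]
      simp [Real.zero_rpow hr'0.ne']
    rw [e1, e2, Complex.norm_real, Real.norm_of_nonneg hI] at ht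
    rw [← ofReal_lpNorm hum, e3]
    refine ENNReal.ofReal_le_ofReal ?_
    rcases hI.eq_or_lt with h0 | h0
    · rw [← h0, Real.zero_rpow (by positivity)]; exact hK
    · have h6 : I = I ^ (r'⁻¹) * I ^ (r⁻¹) := by
        rw [← Real.rpow_add h0, add_comm, hr'.inv_add_inv_eq_one, Real.rpow_one]
      have h7 : 0 < I ^ (r⁻¹) := by positivity
      exact le_of_mul_le_mul_right (h6.symm.le.trans ht) h7
  refine (Lp.eLpNorm_lim_le_liminf_eLpNorm
    (f := fun (N : ℕ) => (levelSet u N).indicator u)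
    (fun N => (hu.indicator (measurableSet_levelSet hu N)).aestronglyMeasurable) u
    (ae_of_all _ fun x => ?_)).trans
    (liminf_le_of_le (by isBoundedDefault) fun y hy => ?_)
  · refine tendsto_const_nhds.congr' ?_
    obtain ⟨N, hN⟩ := exists_nat_ge (max ‖x‖ ‖u x‖)
    filter_upwards [eventually_ge_atTop N] with k hk
    have hk' : (N : ℝ) ≤ k := by exact_mod_cast hk
    rw [Set.indicator_of_mem]
    exact ⟨(le_max_left _ _).trans (hN.trans hk'), (le_max_right _ _).trans (hN.trans hk')⟩
  · obtain ⟨k, hk⟩ := hy.exists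
    exact hk.trans (hcut k)

/-- Testing against the conjugate phase of u on the part of {|u| > K} in a level set shows that the
integral of |u| - K there is not positive; the integrand is, so that part is null. -/
lemma eLpNorm_top_le_of_testing {u : Rn n → ℂ} (hu : StronglyMeasurable u) {K : ℝ} (hK : 0 ≤ K)
    (htest : ∀ (B : Set (Rn n)) (N : ℕ) (h : Rn n → ℂ) (M : ℝ), MeasurableSet B → B ⊆ levelSet u N →
      StronglyMeasurable h → (∀ x ∈ B, ‖h x‖ ≤ M) →
      ‖∫ x, u x * B.indicator h x‖ ≤ K * lpNorm (B.indicator h) 1 volume) :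
    eLpNorm u ∞ volume ≤ ENNReal.ofReal K := by
  have hnull : ∀ N : ℕ, volume (levelSet u N ∩ {x | K < ‖u x‖}) = 0 := by
    intro N
    have hB : MeasurableSet (levelSet u N ∩ {x | K < ‖u x‖}) :=
      (measurableSet_levelSet hu N).inter (measurableSet_lt measurable_const hu.measurable.norm)
    have hB' : volume (levelSet u N ∩ {x | K < ‖u x‖}) < ∞ :=
      (measure_mono Set.inter_subset_left).trans_lt (volume_levelSet_lt_top u N)
    set B := levelSet u N ∩ {x | K < ‖u x‖}
    set h : Rn n → ℂ := fun x => conj (u x) * ((‖u x‖⁻¹ : ℝ) : ℂ)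
    have hhm : StronglyMeasurable h := by
      refine Measurable.stronglyMeasurable ?_
      have := hu.measurable
      fun_prop
    have hpos : ∀ x ∈ B, 0 < ‖u x‖ := fun x hx => hK.trans_lt hx.2
    have hn1 : ∀ x ∈ B, ‖h x‖ = 1 := by
      intro x hx
      simp only [h]
      rw [norm_mul, RCLike.norm_conj, Complex.norm_real, norm_inv, norm_norm,
        mul_inv_cancel₀ (hpos x hx).ne']
    have ht := htest B N h 1 hB Set.inter_subset_left hhm fun x hx => (hn1 x hx).le
    have hhLp := memLp_indicator_of_bound hB hB' hhm (fun x hx => (hn1 x hx).le) 1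
    have hum := memLp_indicator_of_bound hB hB' hu (M := N) (fun x hx => hx.1.2) 1
    have hui : IntegrableOn u B := by
      rw [← integrable_indicator_iff hB]; exact memLp_one_iff_integrable.1 hum
    have hKi : IntegrableOn (fun _ => K) B := integrableOn_const hB'.ne
    have e1 : ∫ x, u x * B.indicator h x = ((∫ x in B, ‖u x‖ : ℝ) : ℂ) := by
      rw [← integral_complex_ofReal, ← integral_indicator hB]
      refine integral_congr_ae (ae_of_all _ fun x => ?_)
      by_cases hx : x ∈ B <;>
        simp only [hx, Set.indicator_of_mem, Set.indicator_of_notMem, not_false_eq_true]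
      · simp only [h]
        rw [← mul_assoc, Complex.mul_conj, Complex.normSq_eq_norm_sq, ← Complex.ofReal_mul]
        congr 1
        have := (hpos x hx).ne'
        field_simp
      · simp
    have e2 : lpNorm (B.indicator h) 1 volume = ∫ x in B, (1 : ℝ) := by
      rw [lpNorm_one_eq_integral_norm hhLp.1, ← integral_indicator hB]
      refine integral_congr_ae (ae_of_all _ fun x => ?_)
      by_cases hx : x ∈ B <;>
        simp only [hx, Set.indicator_of_mem, Set.indicator_of_notMem, not_false_eq_true]
      · exact hn1 x hx
      · simp
    rw [e1, e2, Complex.norm_real, Real.norm_of_nonneg (integral_nonneg fun _ => norm_nonneg _),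
      ← integral_const_mul, mul_one] at ht
    have h0 : ∫ x in B, (‖u x‖ - K) = 0 := by
      refine le_antisymm ?_ ?_
      · rw [integral_sub hui.norm hKi]; linarith
      · exact setIntegral_nonneg hB fun x hx => sub_nonneg.2 hx.2.le
    have h1 := (setIntegral_eq_zero_iff_of_nonneg_ae
      ((ae_restrict_iff' hB).2 (ae_of_all _ fun x hx => sub_nonneg.2 hx.2.le))
      (hui.norm.sub hKi)).1 h0
    rw [Filter.EventuallyEq, ae_restrict_iff' hB] at h1
    rw [measure_eq_zero_iff_ae_notMem]
    filter_upwards [h1] with x hx hxB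
    have := hx hxB
    have h2 : K < ‖u x‖ := hxB.2
    simp only [Pi.zero_apply] at this
    linarith
  rw [eLpNorm_exponent_top]
  refine eLpNormEssSup_le_of_ae_bound ?_
  have h3 : ∀ᵐ x, ∀ N : ℕ, x ∉ levelSet u N ∩ {x | K < ‖u x‖} :=
    ae_all_iff.2 fun N => measure_eq_zero_iff_ae_notMem.1 (hnull N)
  filter_upwards [h3] with x hx
  by_contra hcon
  obtain ⟨N, hN⟩ := exists_nat_ge (max ‖x‖ ‖u x‖)
  exact hx N ⟨⟨(le_max_left _ _).trans hN, (le_max_right _ _).trans hN⟩, not_le.1 hcon⟩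

/-- Functionals on Schwartz functions bounded in `L^r`, `1 ≤ r ≤ 2`, are given by functions in
the dual Lebesgue space. -/
theorem exists_eq_integral_of_bound (hn : 2 ≤ n) {r : ℝ} (hr1 : 1 ≤ r) (hr2 : r ≤ 2) {q : ℝ≥0∞}
    (hq : (ENNReal.ofReal r).HolderConjugate q) (Λ : 𝓢(Rn n, ℂ) →ₗ[ℂ] ℂ) {K : ℝ} (hK : 0 ≤ K)
    (hΛ : ∀ ψ : 𝓢(Rn n, ℂ), ‖Λ ψ‖ ≤ K * lpNorm ψ (ENNReal.ofReal r) volume) :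
    ∃ u : Rn n → ℂ, MemLp u q volume ∧ eLpNorm u q volume ≤ ENNReal.ofReal K ∧
      ∀ ψ : 𝓢(Rn n, ℂ), Λ ψ = ∫ x, u x * ψ x := by
  obtain ⟨v, hvs, hvm, hvS, hvb⟩ := exists_weighted_riesz hn (ENNReal.one_le_ofReal.2 hr1)
    (by rw [← ENNReal.ofReal_ofNat]; exact ENNReal.ofReal_le_ofReal hr2) Λ hK hΛ
  have hd0 : ∀ x : Rn n, (decay n x : ℂ) ≠ 0 := fun x => Complex.ofReal_ne_zero.2 (decay_pos x).ne'
  have hdc : Continuous fun x : Rn n => (decay n x : ℂ) :=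
    Complex.continuous_ofReal.comp continuous_decay
  have hdi : Continuous fun x : Rn n => ((decay n x : ℂ))⁻¹ := hdc.inv₀ hd0
  -- Undoing the weight may leave L², but the inverse weight is bounded on level sets, which is all
  -- the testing lemmas ask for.
  set u : Rn n → ℂ := fun x => (decay n x : ℂ)⁻¹ * v x
  have hu : StronglyMeasurable u := hdi.stronglyMeasurable.mul hvs
  have htest : ∀ (B : Set (Rn n)) (N : ℕ) (h : Rn n → ℂ) (M : ℝ), MeasurableSet B →
      B ⊆ levelSet u N → StronglyMeasurable h → (∀ x ∈ B, ‖h x‖ ≤ M) →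
      ‖∫ x, u x * B.indicator h x‖ ≤ K * lpNorm (B.indicator h) (ENNReal.ofReal r) volume := by
    intro B N h M hB hBN hh hM
    have hb : ∀ x ∈ B, ‖(decay n x : ℂ)⁻¹ * h x‖ ≤ (1 + (N : ℝ) ^ 2) ^ n * M := by
      intro x hx
      have h1 : ‖x‖ ≤ N := (hBN hx).1
      rw [norm_mul, norm_inv, Complex.norm_real, Real.norm_of_nonneg (decay_pos x).le, decay, inv_inv]
      gcongr
      exact hM x hx
    have hχ := memLp_indicator_of_bound hB
      ((measure_mono hBN).trans_lt (volume_levelSet_lt_top u N)) (hdi.stronglyMeasurable.mul hh) hb 2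
    have := hvb _ hχ
    have e1 : ∀ x, (decay n x : ℂ) * B.indicator (fun x => (decay n x : ℂ)⁻¹ * h x) x
        = B.indicator h x := by
      intro x
      by_cases hx : x ∈ B <;>
        simp only [hx, Set.indicator_of_mem, Set.indicator_of_notMem, not_false_eq_true]
      · rw [mul_inv_cancel_left₀ (hd0 x)]
      · simp
    have e2 : ∀ x, v x * B.indicator (fun x => (decay n x : ℂ)⁻¹ * h x) x = u x * B.indicator h x := by
      intro x
      rw [← e1]
      simp only [u]
      have := hd0 x
      field_simp
    calc _ = ‖∫ x, v x * B.indicator (fun x => (decay n x : ℂ)⁻¹ * h x) x‖ := by simp_rw [e2]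
      _ ≤ _ := this
      _ = _ := by
          congr 2
          funext x
          exact e1 x
  have hle : eLpNorm u q volume ≤ ENNReal.ofReal K := by
    rcases hr1.eq_or_lt with h1 | h1
    · have hq' : q = ∞ := by
        rw [← h1, ENNReal.ofReal_one] at hq
        have := hq.inv_add_inv_eq_inv
        simpa using this
      subst hq'
      refine eLpNorm_top_le_of_testing hu hK ?_
      simpa only [← h1, ENNReal.ofReal_one] using htest
    · have hc := Real.HolderConjugate.conjExponent h1
      have hq' : q = ENNReal.ofReal (Real.conjExponent r) := by
        have := hc.ennrealOfReal
        exact ENNReal.HolderConjugate.unique (ENNReal.ofReal r) q _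
      rw [hq']
      exact eLpNorm_le_of_testing hr2 hc hu hK htest
  refine ⟨u, ⟨hu.aestronglyMeasurable, hle.trans_lt ENNReal.ofReal_lt_top⟩, hle, fun ψ => ?_⟩
  have h1 := hvS (SchwartzMap.smulLeftCLM ℂ (fun x => (decay n x : ℂ)⁻¹) ψ)
  have h2 : SchwartzMap.smulLeftCLM ℂ (fun x => (decay n x : ℂ))
      (SchwartzMap.smulLeftCLM ℂ (fun x => (decay n x : ℂ)⁻¹) ψ) = ψ := by
    ext x
    rw [SchwartzMap.smulLeftCLM_apply_apply decay_hasTemperateGrowth,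
      SchwartzMap.smulLeftCLM_apply_apply decay_inv_hasTemperateGrowth, smul_smul,
      mul_inv_cancel₀ (hd0 x), one_smul]
  rw [h2] at h1
  rw [h1]
  refine integral_congr_ae (ae_of_all _ fun x => ?_)
  simp only [u]
  rw [SchwartzMap.smulLeftCLM_apply_apply decay_inv_hasTemperateGrowth, smul_eq_mul]
  ring

end Duality

end HelmholtzBR

namespace HelmholtzBR

variable {n : ℕ}

/-! ### Forms of both signs and their interpolation against the limit function -/

section SignedForm

/-- The form `∫ (w + iσ(|ξ|² - 1))^{-z} F(ξ) ĝ(-ξ) dξ`. -/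
noncomputable def signForm (σ : ℝ) (z w : ℂ) (F g : Rn n → ℂ) : ℂ :=
  ∫ ξ, sym z w (σ * (‖ξ‖ ^ 2 - 1)) * (F ξ * fourier g (-ξ))

lemma goodParam_conj {w : ℂ} (hw : goodParam w) : goodParam (conj w) := by
  simpa [goodParam] using hw

lemma signForm_one (z w : ℂ) (f g : Rn n → ℂ) : signForm 1 z w (fourier f) g = resForm z w f g := by
  simp only [signForm, one_mul, resForm]

/-- Reflecting ξ and conjugating reverses the sign of s, so estimates for σ = -1 follow from those
for σ = 1 with conjugated data. -/
lemma signForm_neg_one (z : ℂ) {w : ℂ} (hw : 0 < w.re) (f g : Rn n → ℂ) :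
    signForm (-1) z w (fourier f) g
      = conj (resForm (conj z) (conj w) (fun x => conj (f x)) fun x => conj (g x)) := by
  rw [resForm, ← integral_conj, ← integral_neg_eq_self, signForm]
  refine integral_congr_ae (ae_of_all _ fun ξ => ?_)
  simp only [map_mul, conj_sym _ (show 0 < (conj w).re by simpa using hw), Complex.conj_conj,
    fourier_conj, neg_neg, neg_one_mul, norm_neg]

/-- The two-sided resolvent bound. -/
lemma norm_Gamma_mul_signForm_le {b : ℝ} (hb : 0 ≤ b) (hbn : b ≤ ((n : ℝ) + 1) / 4) {σ : ℝ}
    (hσ : σ = 1 ∨ σ = -1) {z w : ℂ} (hz : z.re = 2 * b) (hw : goodParam w) {f g : Rn n → ℂ}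
    (hf : Nice f) (hg : Nice g) :
    ‖Complex.Gamma (z + 1) * signForm σ z w (fourier f) g‖ ≤ resConst n * Real.exp (2 * |z.im|)
      * (lpNorm f (ENNReal.ofReal (pExp n b)) volume
        * lpNorm g (ENNReal.ofReal (pExp n b)) volume) := by
  rcases hσ with rfl | rfl
  · rw [signForm_one]
    exact norm_Gamma_mul_resForm_le_lpNorm hb hbn hz hw hf hg
  · have := norm_Gamma_mul_resForm_le_lpNorm hb hbn (z := conj z) (by simpa using hz)
      (goodParam_conj hw) hf.conj hg.conj
    have e : Complex.Gamma (conj z + 1) = conj (Complex.Gamma (z + 1)) := by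
      rw [← Complex.Gamma_conj, map_add, map_one]
    rw [lpNorm_conj_fun, lpNorm_conj_fun, e, norm_mul, RCLike.norm_conj, Complex.conj_im, abs_neg]
      at this
    rwa [signForm_neg_one z hw.1, norm_mul, RCLike.norm_conj]

lemma norm_Gamma_add_one_le {z : ℂ} (hz : 0 ≤ z.re) : ‖Complex.Gamma (z + 1)‖ ≤ Real.Gamma (z.re + 1) := by
  have := norm_Gamma_le (z := z + 1) (by simp; linarith)
  simpa using this

lemma Gamma_ofReal_add_one (a : ℝ) : Complex.Gamma ((a : ℂ) + 1) = (Real.Gamma (a + 1) : ℂ) := by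
  rw [← Complex.Gamma_ofReal]; push_cast; rfl

/-- Interpolation with the trivial bound: control of the forms of intermediate order, uniformly in
the parameter. -/
lemma exists_norm_signForm_le {b α : ℝ} (hb : 0 < b) (hbn : b ≤ ((n : ℝ) + 1) / 4) (hα : 0 ≤ α)
    (hα2 : α ≤ 2 * b) :
    ∃ K : ℝ, 0 ≤ K ∧ ∀ σ : ℝ, σ = 1 ∨ σ = -1 → ∀ w, goodParam w → ∀ f g : Rn n → ℂ, Nice f → Nice g →
      ‖signForm σ α w (fourier f) g‖ ≤ K * ((∫ ξ, ‖fourier f ξ * fourier g (-ξ)‖)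
        + lpNorm f (ENNReal.ofReal (pExp n b)) volume
          * lpNorm g (ENNReal.ofReal (pExp n b)) volume) := by
  have hR := resConst_pos n
  have hG : 0 < Real.Gamma (α + 1) := Real.Gamma_pos_of_pos (by linarith)
  refine ⟨(Real.Gamma (α + 1))⁻¹ * ((1 + resConst n) * Real.exp ((2 * b - 0) ^ 2 + 2 ^ 2 / 4)),
    by positivity, fun σ hσ w hw f g hf hg => ?_⟩
  set I := ∫ ξ, ‖fourier f ξ * fourier g (-ξ)‖
  have hI : 0 ≤ I := integral_nonneg fun _ => norm_nonneg _
  set P := lpNorm f (ENNReal.ofReal (pExp n b)) volume * lpNorm g (ENNReal.ofReal (pExp n b)) volume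
  have hP : 0 ≤ P := mul_nonneg lpNorm_nonneg lpNorm_nonneg
  have hi := hf.integrable_fourier_mul hg
  have hstrip : StripFun 0 (2 * b) 2 fun z => Complex.Gamma (z + 1) * signForm σ z w (fourier f) g := by
    have := (stripFun_Gamma_add_one (b := 2 * b) le_rfl).mul
      (stripFun_integral_sym (b := 2 * b) hw.1 (s := fun ξ : Rn n => σ * (‖ξ‖ ^ 2 - 1)) (by fun_prop) hi)
    rwa [zero_add] at this
  -- f and g stay fixed: on Re z = 0 the symbol is at most e^{2|Im z|} and the form is bounded
  -- through I, on Re z = 2b through P.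
  have key := three_lines (A := (1 + resConst n) * (I + P)) (by norm_num) (by linarith) hstrip
    (by positivity) ?_ ?_ (z₀ := (α : ℂ)) (by simpa using hα) (by simpa using hα2)
  · rw [Gamma_ofReal_add_one, norm_mul, Complex.norm_real, Real.norm_of_nonneg hG.le] at key
    simp only [Complex.ofReal_im, abs_zero, mul_zero, Real.exp_zero, mul_one] at key
    rw [mul_assoc, ← div_eq_inv_mul, le_div_iff₀ hG]
    linarith
  · intro z hz
    have h1 := norm_Gamma_add_one_le (z := z) hz.ge
    rw [hz, zero_add, Real.Gamma_one] at h1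
    have h2 : ‖signForm σ z w (fourier f) g‖ ≤ Real.exp (2 * |z.im|) * I := by
      refine (norm_integral_le_of_norm_le (hi.norm.const_mul (Real.exp (2 * |z.im|)))
        (ae_of_all _ fun ξ => ?_)).trans (integral_const_mul _ _).le
      rw [norm_mul]
      gcongr
      have := norm_sym_le_of_re_nonneg (s := σ * (‖ξ‖ ^ 2 - 1)) hw.1 hz.ge
      rwa [hz, neg_zero, Real.rpow_zero, one_mul] at this
    rw [norm_mul]
    have hE := Real.exp_pos (2 * |z.im|)
    calc _ ≤ 1 * (Real.exp (2 * |z.im|) * I) := mul_le_mul h1 h2 (norm_nonneg _) zero_le_one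
      _ = I * Real.exp (2 * |z.im|) := by ring
      _ ≤ _ := by
        gcongr
        nlinarith [mul_nonneg hR.le (add_nonneg hI hP)]
  · intro z hz
    refine (norm_Gamma_mul_signForm_le hb.le hbn hσ hz hw hf hg).trans ?_
    rw [mul_right_comm]
    gcongr
    · linarith
    · exact le_add_of_nonneg_left hI

lemma StripFun.comp_sub {c k : ℝ} {Ψ : ℂ → ℂ} (b : ℝ) (hΨ : StripFun 0 c k Ψ) :
    StripFun b (b + c) k fun z => Ψ (z - b) := by
  obtain ⟨M, hM⟩ := hΨ.growth
  refine ⟨hΨ.diff.comp (g := fun z : ℂ => z - b) ?_ fun z hz => ?_, M, fun z h1 h2 => ?_⟩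
  · exact (differentiable_id.sub_const _).diffContOnCl
  · have h1 := hz.1
    have h2 := hz.2
    constructor
    · simpa using h1
    · simp only [Complex.sub_re, Complex.ofReal_re]; linarith
  · have := hM (z - b) (by simpa using h1) (by simpa using (by linarith : z.re ≤ c + b))
    simpa using this

/-- Splitting off the order b lets the weighted L² bound absorb that factor together with F; only
the order z - b is left to a pointwise estimate. -/
lemma sym_split (z : ℂ) (b : ℝ) {w : ℂ} (hw : 0 < w.re) (s : ℝ) :
    sym z w s = sym (z - b) w s * sym b w s := by
  rw [sym, sym, sym, ← Complex.cpow_add _ _ (base_ne_zero hw)]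
  congr 1; ring

lemma norm_sym_eq_wt (b ε : ℝ) {σ : ℝ} (hσ : σ = 1 ∨ σ = -1) (ξ : Rn n) :
    ‖sym b ε (σ * (‖ξ‖ ^ 2 - 1))‖ = wt b ε ξ := by
  rw [norm_sym_ofReal, norm_base_ofReal, Real.sqrt_eq_rpow, ← Real.rpow_mul (by positivity), wt]
  have : (σ * (‖ξ‖ ^ 2 - 1)) ^ 2 = (‖ξ‖ ^ 2 - 1) ^ 2 := by rcases hσ with rfl | rfl <;> ring
  rw [this]
  congr 1; ring

variable {b C : ℝ} {f F : Rn n → ℂ} {s : ℕ → 𝓢(Rn n, ℂ)}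

lemma WeightedLimit.memLp_sym_mul (h : WeightedLimit b C f F s) (hb : 0 ≤ b) {ε σ : ℝ} (hε : 0 < ε)
    (hε1 : ε ≤ 1) (hσ : σ = 1 ∨ σ = -1) :
    MemLp (fun ξ => sym b ε (σ * (‖ξ‖ ^ 2 - 1)) * F ξ) 2 volume := by
  refine h.memLp_wt.of_le_mul (c := ε ^ (-b)) (((continuous_sym _ (by simpa using hε)).comp
    (by fun_prop)).aestronglyMeasurable.mul h.aestronglyMeasurable) (ae_of_all _ fun ξ => ?_)
  rw [norm_mul, norm_sym_eq_wt b ε hσ, norm_wt_mul b one_pos, ← mul_assoc]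
  gcongr
  exact wt_le_wt_one hb hε hε1 ξ

/-- The bound does not depend on ε because |ε ± is|^{-b} ≤ |s|^{-b}. -/
lemma WeightedLimit.lpNorm_sym_mul_le (h : WeightedLimit b C f F s) (hb : 0 ≤ b) {ε σ : ℝ}
    (hε : 0 < ε) (hε1 : ε ≤ 1) (hσ : σ = 1 ∨ σ = -1) :
    lpNorm (fun ξ => sym b ε (σ * (‖ξ‖ ^ 2 - 1)) * F ξ) 2 volume
      ≤ C * lpNorm f (ENNReal.ofReal (pExp n b)) volume := by
  refine le_trans ?_ h.lpNorm_sing_le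
  rw [← toReal_eLpNorm (h.memLp_sym_mul hb hε hε1 hσ).1, ← toReal_eLpNorm h.memLp_sing.1]
  refine ENNReal.toReal_mono h.memLp_sing.2.ne (eLpNorm_mono_ae ?_)
  filter_upwards [ae_norm_sq_ne_one] with ξ hξ
  rw [norm_mul, norm_mul, norm_sym_eq_wt b ε hσ, Complex.norm_real,
    Real.norm_of_nonneg (wtSing_nonneg b ξ)]
  gcongr
  have h1 : wtSing b ξ = ((‖ξ‖ ^ 2 - 1) ^ 2) ^ (-b / 2) := by
    rw [wtSing, ← sq_abs (‖ξ‖ ^ 2 - 1), ← Real.rpow_natCast |‖ξ‖ ^ 2 - 1| 2,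
      ← Real.rpow_mul (abs_nonneg _)]
    congr 1; push_cast; ring
  rw [h1, wt]
  exact Real.rpow_le_rpow_of_nonpos (by positivity) (by nlinarith) (by linarith)

/-- The factored integrand of the form against the limit function. -/
lemma signForm_eq_factored {σ ε : ℝ} (hε : 0 < ε) (z : ℂ) (F g : Rn n → ℂ) :
    signForm σ z ε F g = ∫ ξ, sym (z - b) ε (σ * (‖ξ‖ ^ 2 - 1))
      * (sym b ε (σ * (‖ξ‖ ^ 2 - 1)) * F ξ * fourier g (-ξ)) := by
  refine integral_congr_ae (ae_of_all _ fun ξ => ?_)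
  simp only
  rw [sym_split z b (by simpa using hε)]
  ring

lemma WeightedLimit.integrable_factored (h : WeightedLimit b C f F s) (hb : 0 ≤ b) {ε σ : ℝ}
    (hε : 0 < ε) (hε1 : ε ≤ 1) (hσ : σ = 1 ∨ σ = -1) {g : Rn n → ℂ} (hg : Nice g) :
    Integrable fun ξ => sym b ε (σ * (‖ξ‖ ^ 2 - 1)) * F ξ * fourier g (-ξ) :=
  integrable_mul_of_memLp_two (h.memLp_sym_mul hb hε hε1 hσ) hg.memLp_fourier_neg

lemma WeightedLimit.integrable_signForm (h : WeightedLimit b C f F s) (hb : 0 ≤ b) {ε σ : ℝ}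
    (hε : 0 < ε) (hε1 : ε ≤ 1) (hσ : σ = 1 ∨ σ = -1) {g : Rn n → ℂ} (hg : Nice g) {z : ℂ}
    (hz : b ≤ z.re) :
    Integrable fun ξ => sym z ε (σ * (‖ξ‖ ^ 2 - 1)) * (F ξ * fourier g (-ξ)) := by
  have hε' : 0 < (ε : ℂ).re := by simpa using hε
  have := integrable_sym_mul (z := z - b) (w := ε) (s := fun ξ : Rn n => σ * (‖ξ‖ ^ 2 - 1))
    (by simpa using hz) hε' (by fun_prop) (h.integrable_factored hb hε hε1 hσ hg)
  refine this.congr (ae_of_all _ fun ξ => ?_)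
  simp only
  rw [sym_split z b hε']
  ring

lemma WeightedLimit.norm_signForm_le_two (h : WeightedLimit b C f F s) (hb : 0 ≤ b) {ε σ : ℝ}
    (hε : 0 < ε) (hε1 : ε ≤ 1) (hσ : σ = 1 ∨ σ = -1) {g : Rn n → ℂ} (hg : Nice g) {z : ℂ}
    (hz : b ≤ z.re) :
    ‖signForm σ z ε F g‖ ≤ ε ^ (-(z.re - b)) * Real.exp (2 * |z.im|)
      * (C * lpNorm f (ENNReal.ofReal (pExp n b)) volume * (planch n * lpNorm g 2 volume)) := by
  have hε' : 0 < (ε : ℂ).re := by simpa using hε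
  rw [signForm_eq_factored (b := b) hε]
  refine (norm_integral_mul_le_of_bound (A := ε ^ (-(z.re - b)) * Real.exp (2 * |z.im|)) (by positivity)
    (fun ξ => ?_) (h.memLp_sym_mul hb hε hε1 hσ) hg.memLp_fourier_neg).trans ?_
  · have := norm_sym_le_of_re_nonneg (s := σ * (‖ξ‖ ^ 2 - 1)) (z := z - b) hε' (by simpa using hz)
    simpa using this
  · rw [hg.lpNorm_fourier_neg]
    have := planch_pos n
    have h2 : 0 ≤ lpNorm g 2 volume := lpNorm_nonneg
    gcongr
    exact h.lpNorm_sym_mul_le hb hε hε1 hσ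

/-- For fixed ε a symbol of order at least b is dominated by the weight at scale 1, so the form is
continuous along the approximation. Resolvent bounds for Schwartz functions thereby pass to F. -/
lemma WeightedLimit.tendsto_signForm (h : WeightedLimit b C f F s) (hb : 0 ≤ b) {ε σ : ℝ}
    (hε : 0 < ε) (hε1 : ε ≤ 1) (hσ : σ = 1 ∨ σ = -1) {g : Rn n → ℂ} (hg : Nice g) {z : ℂ}
    (hz : b ≤ z.re) :
    Tendsto (fun k => signForm σ z ε (fourier (s k)) g) atTop (𝓝 (signForm σ z ε F g)) := by
  have hε' : 0 < (ε : ℂ).re := by simpa using hε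
  have hψ : MemLp (fun ξ => ((wt b 1 ξ)⁻¹ : ℂ)
      * (sym z ε (σ * (‖ξ‖ ^ 2 - 1)) * fourier g (-ξ))) 2 volume := by
    have hm : Continuous fun ξ : Rn n => sym z ε (σ * (‖ξ‖ ^ 2 - 1)) * fourier g (-ξ) :=
      ((continuous_sym z hε').comp (by fun_prop)).mul
        ((continuous_fourier hg.integrable).comp continuous_neg)
    refine hg.memLp_fourier_neg.of_le_mul (c := ε ^ (-(z.re - b)) * Real.exp (2 * |z.im|) * ε ^ (-b))
      ((continuous_wt_inv b).mul hm).aestronglyMeasurable (ae_of_all _ fun ξ => ?_)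
    have hw := wt_pos b one_pos ξ
    have h1 := norm_sym_le_of_re_nonneg (s := σ * (‖ξ‖ ^ 2 - 1)) (z := z - b) hε' (by simpa using hz)
    simp only [Complex.sub_re, Complex.ofReal_re, Complex.sub_im, Complex.ofReal_im, sub_zero] at h1
    rw [norm_mul, norm_mul, norm_inv, Complex.norm_real, Real.norm_of_nonneg hw.le, sym_split z b hε',
      norm_mul, norm_sym_eq_wt b ε hσ, ← mul_assoc, inv_mul_eq_div]
    gcongr
    rw [div_le_iff₀ hw]
    have h2 := wt_le_wt_one hb hε hε1 ξ
    calc _ ≤ ε ^ (-(z.re - b)) * Real.exp (2 * |z.im|) * (ε ^ (-b) * wt b 1 ξ) :=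
          mul_le_mul h1 h2 (wt_pos b hε ξ).le (by positivity)
      _ = _ := by ring
  have := (h.tendsto_integral hb hψ).2.2.2
  have e : ∀ G : Rn n → ℂ, signForm σ z ε G g
      = ∫ ξ, G ξ * (sym z ε (σ * (‖ξ‖ ^ 2 - 1)) * fourier g (-ξ)) := fun G =>
    integral_congr_ae (ae_of_all _ fun ξ => by simp only; ring)
  simpa only [e] using this

/-- Stein interpolation between the weighted `L²` bound and the resolvent bound. -/
theorem exists_norm_signForm_limit_le {α : ℝ} (hb : 0 < b) (hbn : b ≤ ((n : ℝ) + 1) / 4)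
    (hbα : b ≤ α) (hα2 : α ≤ 2 * b) (hC : 0 < C) :
    ∃ K : ℝ, 0 < K ∧ ∀ (f F : Rn n → ℂ) (s : ℕ → 𝓢(Rn n, ℂ)), WeightedLimit b C f F s →
      ∀ g, Nice g → ∀ σ : ℝ, σ = 1 ∨ σ = -1 → ∀ ε : ℝ, 0 < ε → ε ≤ 1 →
      ‖signForm σ α ε F g‖ ≤ K * lpNorm f (ENNReal.ofReal (pExp n b)) volume
        * lpNorm g (ENNReal.ofReal (pExp n (α - b))) volume := by
  have hR := resConst_pos n
  have hpl := planch_pos n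
  have hG : 0 < Real.Gamma (α + 1) := Real.Gamma_pos_of_pos (by linarith)
  have hGb : 0 < Real.Gamma (b + 1) := Real.Gamma_pos_of_pos (by linarith)
  set K₀ := Real.Gamma (b + 1) * (C * planch n) + resConst n
  refine ⟨(Real.Gamma (α + 1))⁻¹ * (K₀ * Real.exp ((2 * b - b) ^ 2 + 2 ^ 2 / 4)), by positivity,
    fun f F s h g hg σ hσ ε hε hε1 => ?_⟩
  have hε' : 0 < (ε : ℂ).re := by simpa using hε
  set Nf := lpNorm f (ENNReal.ofReal (pExp n b)) volume
  have hNf : 0 ≤ Nf := lpNorm_nonneg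
  -- F is fixed and only g is interpolated: L² on Re z = b, from the weighted bound, and L^{p_b} on
  -- Re z = 2b, from the resolvent bound. Order α then falls on L^{p_{α-b}}.
  have key := stein_interpolation (n := n) (a := b) (b := 2 * b) (k := 2) (r₀ := 2) (r₁ := pExp n b)
    (r := pExp n (α - b)) (K := K₀ * Nf)
    (M := ‖Complex.Gamma ((α : ℂ) + 1)‖ * (ε ^ (-(α - b)) * (C * Nf * planch n)))
    (by norm_num) (by linarith) (by norm_num) (lt_of_lt_of_le one_pos (one_le_pExp hb.le hbn))
    (one_le_pExp (by linarith) (by linarith)) (pExp_le_two (by linarith)) (by positivity)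
    (L := fun z g => Complex.Gamma (z + 1) * signForm σ z ε F g) ?_ ?_ (z₀ := (α : ℂ))
    (by simpa using hbα) (by simpa using hα2) ?_ ?_ ?_ ?_ hg
  · rw [Gamma_ofReal_add_one, norm_mul, Complex.norm_real, Real.norm_of_nonneg hG.le] at key
    simp only [Complex.ofReal_im, abs_zero, mul_zero, Real.exp_zero, mul_one] at key
    rw [mul_assoc, mul_assoc, ← div_eq_inv_mul, le_div_iff₀ hG]
    linarith
  · intro z hz _
    refine NiceLinear.smul ⟨fun g₁ g₂ h₁ h₂ => ?_, fun c g₁ h₁ => ?_⟩ _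
    · simp only [signForm]
      rw [← integral_add (h.integrable_signForm hb.le hε hε1 hσ h₁ hz)
        (h.integrable_signForm hb.le hε hε1 hσ h₂ hz)]
      simp only [fourier_add h₁.integrable h₂.integrable]
      exact integral_congr_ae (ae_of_all _ fun ξ => by ring)
    · simp only [signForm]
      rw [← integral_const_mul]
      simp only [fourier_const_mul]
      exact integral_congr_ae (ae_of_all _ fun ξ => by ring)
  · intro g₁ h₁
    have s1 := (stripFun_integral_sym (b := b) hε' (s := fun ξ : Rn n => σ * (‖ξ‖ ^ 2 - 1))
      (by fun_prop) (h.integrable_factored hb.le hε hε1 hσ h₁)).comp_sub b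
    rw [← two_mul] at s1
    have s2 := (stripFun_Gamma_add_one (b := 2 * b) hb.le).mul s1
    rw [zero_add] at s2
    refine s2.congr fun z _ _ => ?_
    rw [signForm_eq_factored (b := b) hε]
  · intro g₁ h₁
    rw [norm_mul]
    have h2 := h.norm_signForm_le_two hb.le hε hε1 hσ h₁ (z := α) (by simpa using hbα)
    simp only [Complex.ofReal_re, Complex.ofReal_im, abs_zero, mul_zero, Real.exp_zero, mul_one] at h2
    have h1 : 0 ≤ lpNorm g₁ 1 volume := lpNorm_nonneg
    refine (mul_le_mul_of_nonneg_left h2 (norm_nonneg _)).trans ?_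
    have hX : 0 ≤ ‖Complex.Gamma ((α : ℂ) + 1)‖ * (ε ^ (-(α - b)) * (C * Nf * planch n)) := by positivity
    nlinarith [mul_nonneg hX h1]
  · simp only [Complex.ofReal_re, pExp]
    have h3 : (n : ℝ) + 1 + 4 * b ≠ 0 := by positivity
    have h4 : (n : ℝ) + 1 + 4 * (α - b) ≠ 0 := by
      have : (0 : ℝ) ≤ n := Nat.cast_nonneg n
      have : 0 < (n : ℝ) + 1 + 4 * (α - b) := by linarith
      exact this.ne'
    have h5 : 2 * b - b ≠ 0 := by linarith
    field_simp
    ring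
  · intro z hz g₁ h₁
    have h1 := norm_Gamma_add_one_le (z := z) (by linarith)
    have h2 := h.norm_signForm_le_two hb.le hε hε1 hσ h₁ hz.ge
    rw [hz, sub_self, neg_zero, Real.rpow_zero, one_mul] at h2
    rw [hz] at h1
    rw [norm_mul, ENNReal.ofReal_ofNat]
    have hg2 : 0 ≤ lpNorm g₁ 2 volume := lpNorm_nonneg
    calc _ ≤ Real.Gamma (b + 1) * (Real.exp (2 * |z.im|) * (C * Nf * (planch n * lpNorm g₁ 2 volume))) :=
          mul_le_mul h1 h2 (norm_nonneg _) hGb.le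
      _ = Real.Gamma (b + 1) * (C * planch n) * Nf * Real.exp (2 * |z.im|) * lpNorm g₁ 2 volume := by ring
      _ ≤ _ := by
        gcongr
        simp only [K₀]
        linarith
  · intro z hz g₁ h₁
    have hlim := ((h.tendsto_signForm hb.le hε hε1 hσ h₁ (z := z) (by linarith)).const_mul
      (Complex.Gamma (z + 1))).norm
    have hp1 : 1 ≤ ENNReal.ofReal (pExp n b) := by
      rw [ENNReal.one_le_ofReal]; exact one_le_pExp hb.le hbn
    have hb1 : ∀ k, ‖Complex.Gamma (z + 1) * signForm σ z ε (fourier (s k)) g₁‖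
        ≤ resConst n * Real.exp (2 * |z.im|)
          * ((Nf + lpNorm (fun x => s k x - f x) (ENNReal.ofReal (pExp n b)) volume)
            * lpNorm g₁ (ENNReal.ofReal (pExp n b)) volume) := by
      intro k
      refine (norm_Gamma_mul_signForm_le hb.le hbn hσ hz (goodParam_ofReal hε)
        (SchwartzMap_nice (s k)) h₁).trans ?_
      have hg1 : 0 ≤ lpNorm g₁ (ENNReal.ofReal (pExp n b)) volume := lpNorm_nonneg
      gcongr
      have := lpNorm_add_le (g := fun x => s k x - f x) h.memLp hp1
      refine le_trans (le_of_eq ?_) this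
      congr 1
      funext x
      simp
    have hlim2 := (((h.tendsto_lpNorm.const_add Nf).mul_const
      (lpNorm g₁ (ENNReal.ofReal (pExp n b)) volume)).const_mul (resConst n * Real.exp (2 * |z.im|)))
    refine (le_of_tendsto_of_tendsto' hlim hlim2 hb1).trans ?_
    have hg1 : 0 ≤ lpNorm g₁ (ENNReal.ofReal (pExp n b)) volume := lpNorm_nonneg
    calc _ = resConst n * Nf * Real.exp (2 * |z.im|) * lpNorm g₁ (ENNReal.ofReal (pExp n b)) volume := by
          ring
      _ ≤ _ := by
        gcongr
        simp only [K₀]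
        have : 0 ≤ Real.Gamma (b + 1) * (C * planch n) := by positivity
        linarith

end SignedForm

end HelmholtzBR

namespace HelmholtzBR

variable {n : ℕ}

/-! ### Densities near the unit sphere -/

section ShellRegularity

lemma norm_shell_le (h : Rn n → ℂ) {s : ℝ} (hs : -1 < s) :
    ‖shell h s‖ ≤ (shell (fun ξ => (‖h ξ‖ : ℂ)) s).re := by
  have h0 : 0 ≤ 1 / 2 * (1 + s) ^ (((n : ℝ) - 2) / 2) := by
    have : 0 ≤ (1 + s) ^ (((n : ℝ) - 2) / 2) := Real.rpow_nonneg (by linarith) _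
    positivity
  have e : sphInt (fun ξ : Rn n => (‖h ξ‖ : ℂ)) (√(1 + s))
      = ((∫ ω : Metric.sphere (0 : Rn n) 1, ‖h (√(1 + s) • (ω : Rn n))‖ ∂sphereMeasure n : ℝ) : ℂ) :=
    integral_ofReal
  rw [shell, shell, e, ← Complex.ofReal_mul, Complex.ofReal_re, norm_mul, Complex.norm_real,
    Real.norm_of_nonneg h0]
  gcongr
  exact norm_integral_le_integral_norm _

lemma integral_norm_shell_le (hn : 2 ≤ n) {h : Rn n → ℂ} (hh : Integrable h) :
    ∫ s in Set.Ioi (-1 : ℝ), ‖shell h s‖ ≤ ∫ ξ, ‖h ξ‖ := by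
  obtain ⟨i1, -⟩ := integral_eq_integral_shell hn hh
  obtain ⟨i2, e2⟩ := integral_eq_integral_shell hn hh.norm.ofReal (F := fun ξ => (‖h ξ‖ : ℂ))
  have e3 : ∫ ξ, ‖h ξ‖ = ∫ s in Set.Ioi (-1 : ℝ), (shell (fun ξ => (‖h ξ‖ : ℂ)) s).re := by
    have h5 : ∫ s in Set.Ioi (-1 : ℝ), (shell (fun ξ => (‖h ξ‖ : ℂ)) s).re
        = (∫ s in Set.Ioi (-1 : ℝ), shell (fun ξ => (‖h ξ‖ : ℂ)) s).re := integral_re i2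
    rw [h5, ← e2, integral_complex_ofReal, Complex.ofReal_re]
  rw [e3]
  exact setIntegral_mono_on i1.norm i2.re measurableSet_Ioi fun s hs => norm_shell_le h hs

/-- At s = 0 the density is half an integral over the unit sphere, so Cauchy–Schwarz there sees only
the trace. This is why the coefficient of the divergent term disappears in the limit. -/
lemma norm_shell_zero_le {f : Rn n → ℂ} (hf : Nice f) (φ : 𝓢(Rn n, ℂ)) :
    ‖shell (fun ξ => fourier f ξ * φ ξ) 0‖ ≤ traceNorm f
      * lpNorm (fun ω : Metric.sphere (0 : Rn n) 1 => φ (ω : Rn n)) 2 (sphereMeasure n) := by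
  have hφ : MemLp (fun ω : Metric.sphere (0 : Rn n) 1 => φ (ω : Rn n)) 2 (sphereMeasure n) :=
    MemLp.of_bound (φ.continuous.comp continuous_subtype_val).aestronglyMeasurable
      ‖φ.toBoundedContinuousFunction‖ (ae_of_all _ fun ω => φ.toBoundedContinuousFunction.norm_coe_le_norm _)
  have h1 := integral_norm_mul_le_lpNorm hf.memLp_trace hφ
  have h2 := norm_integral_le_integral_norm (μ := sphereMeasure n)
    fun ω : Metric.sphere (0 : Rn n) 1 => fourier f ω * φ ω
  rw [shell_zero, norm_mul]
  have h3 : ‖(1 / 2 : ℂ)‖ = 1 / 2 := by simp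
  rw [h3]
  have h4 := norm_nonneg (∫ ω : Metric.sphere (0 : Rn n) 1, fourier f ω * φ ω ∂sphereMeasure n)
  exact (by linarith : _ ≤ _).trans (h2.trans h1)

lemma exists_norm_sub_le_schwartz (φ : 𝓢(Rn n, ℂ)) : ∃ L : ℝ, 0 ≤ L ∧ ∀ x y, ‖φ x - φ y‖ ≤ L * ‖x - y‖ := by
  refine ⟨‖(SchwartzMap.fderivCLM ℂ (Rn n) ℂ φ).toBoundedContinuousFunction‖, norm_nonneg _, fun x y => ?_⟩
  refine Convex.norm_image_sub_le_of_norm_fderiv_le (𝕜 := ℝ) (fun z _ => φ.differentiableAt)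
    (fun z _ => ?_) convex_univ (Set.mem_univ y) (Set.mem_univ x)
  exact (SchwartzMap.fderivCLM ℂ (Rn n) ℂ φ).toBoundedContinuousFunction.norm_coe_le_norm z

/-- The radius √(1+s) and the factor (1+s)^{(n-2)/2} are smooth near s = 0, and a Schwartz function
is globally Lipschitz. -/
lemma exists_norm_shell_sub_le (φ : 𝓢(Rn n, ℂ)) :
    ∃ L : ℝ, 0 ≤ L ∧ ∀ s : ℝ, |s| ≤ 1 / 4 → ‖shell φ s - shell φ 0‖ ≤ L * |s| := by
  obtain ⟨L₁, hL₁, h₁⟩ := exists_norm_sub_le_schwartz φ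
  set σ := (sphereMeasure n).real Set.univ
  have hc : ∀ r : ℝ, Integrable (fun ω : Metric.sphere (0 : Rn n) 1 => φ (r • (ω : Rn n)))
      (sphereMeasure n) := fun r => by
    refine (MemLp.of_bound (p := 1) (C := ‖φ.toBoundedContinuousFunction‖) ?_
      (ae_of_all _ fun ω => φ.toBoundedContinuousFunction.norm_coe_le_norm _)).integrable le_rfl
    exact (φ.continuous.comp (by fun_prop)).aestronglyMeasurable
  have hS : ∀ s : ℝ, |s| ≤ 1 / 4 → ‖sphInt φ √(1 + s) - sphInt φ 1‖ ≤ L₁ * |s| * σ := by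
    intro s hs
    have hs' := abs_le.1 hs
    rw [sphInt, sphInt, ← integral_sub (hc _) (hc _)]
    refine norm_integral_le_of_norm_le_const (ae_of_all _ fun ω => ?_)
    refine (h₁ _ _).trans ?_
    gcongr
    rw [← sub_smul, norm_smul, norm_eq_of_mem_sphere, mul_one, Real.norm_eq_abs]
    have h3 : (√(1 + s) - 1) * (√(1 + s) + 1) = s := by
      have := Real.sq_sqrt (show 0 ≤ 1 + s by linarith)
      linarith
    have h4 := Real.sqrt_nonneg (1 + s)
    calc |√(1 + s) - 1| ≤ |√(1 + s) - 1| * |√(1 + s) + 1| :=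
          le_mul_of_one_le_right (abs_nonneg _) (by rw [abs_of_nonneg (by linarith)]; linarith)
      _ = |s| := by rw [← abs_mul, h3]
  set m : ℝ := ((n : ℝ) - 2) / 2
  have hd : ∀ s ∈ Set.Icc (-(1 / 4) : ℝ) (1 / 4),
      HasDerivAt (fun s : ℝ => (1 + s) ^ m) (m * (1 + s) ^ (m - 1)) s := by
    intro s hs
    have h1 : HasDerivAt (fun s : ℝ => 1 + s) 1 s := (hasDerivAt_id s).const_add 1
    have := h1.rpow_const (p := m) (Or.inl (by linarith [hs.1]))
    convert this using 1
    ring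
  have hcd : ContinuousOn (fun s : ℝ => m * (1 + s) ^ (m - 1)) (Set.Icc (-(1 / 4) : ℝ) (1 / 4)) := by
    refine continuousOn_const.mul (ContinuousOn.rpow_const (by fun_prop) fun s hs => Or.inl ?_)
    linarith [hs.1]
  obtain ⟨B, hB⟩ := isCompact_Icc.exists_bound_of_continuousOn hcd
  have hB0 : 0 ≤ B := (norm_nonneg _).trans (hB 0 (by norm_num))
  have hP : ∀ s : ℝ, |s| ≤ 1 / 4 → |(1 + s) ^ m - 1| ≤ B * |s| := by
    intro s hs
    have := Convex.norm_image_sub_le_of_norm_hasDerivWithin_le (f := fun s : ℝ => (1 + s) ^ m)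
      (fun x hx => (hd x hx).hasDerivWithinAt) hB (convex_Icc _ _)
      (show (0 : ℝ) ∈ Set.Icc (-(1 / 4) : ℝ) (1 / 4) by norm_num) (y := s) (by
        have := abs_le.1 hs
        exact ⟨by linarith, this.2⟩)
    simpa using this
  have hσ : 0 ≤ σ := measureReal_nonneg
  refine ⟨(1 + B) * (L₁ * σ) + B * ‖sphInt φ 1‖, by positivity, fun s hs => ?_⟩
  have e : shell φ s - shell φ 0 = (((1 / 2 * (1 + s) ^ m : ℝ)) : ℂ) * (sphInt φ √(1 + s) - sphInt φ 1)
      + ((1 / 2 * ((1 + s) ^ m - 1) : ℝ) : ℂ) * sphInt φ 1 := by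
    simp only [shell, add_zero, Real.sqrt_one, Real.one_rpow, m]
    push_cast
    ring
  have h5 := hP s hs
  have h6 : |(1 + s) ^ m| ≤ 1 + B := by
    have := abs_add_le ((1 + s) ^ m - 1) 1
    rw [sub_add_cancel, abs_one] at this
    nlinarith
  rw [e]
  refine (norm_add_le _ _).trans ?_
  rw [norm_mul, norm_mul, Complex.norm_real, Complex.norm_real, Real.norm_eq_abs, Real.norm_eq_abs,
    abs_mul, abs_mul, abs_of_pos (by norm_num : (0 : ℝ) < 1 / 2)]
  have h7 := mul_le_mul h6 (hS s hs) (norm_nonneg _) (by positivity)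
  have h8 := mul_le_mul_of_nonneg_right h5 (norm_nonneg (sphInt φ 1))
  have h9 : 0 ≤ |(1 + s) ^ m| * ‖sphInt φ √(1 + s) - sphInt φ 1‖ := by positivity
  have h10 : 0 ≤ |(1 + s) ^ m - 1| * ‖sphInt φ 1‖ := by positivity
  nlinarith

/-- The shell densities of products of a Fourier transform of a Schwartz function with a Schwartz
function are Lipschitz near the unit sphere. -/
lemma exists_norm_shell_mul_sub_le (f φ : 𝓢(Rn n, ℂ)) :
    ∃ L : ℝ, 0 ≤ L ∧ ∀ s : ℝ, |s| ≤ 1 / 4 →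
      ‖shell (fun ξ => fourier f ξ * φ ξ) s - shell (fun ξ => fourier f ξ * φ ξ) 0‖ ≤ L * |s| := by
  have h := exists_norm_shell_sub_le
    (SchwartzMap.smulLeftCLM ℂ (schwartzFourier f : Rn n → ℂ) φ)
  have e : ⇑(SchwartzMap.smulLeftCLM ℂ (schwartzFourier f : Rn n → ℂ) φ)
      = fun ξ => fourier f ξ * φ ξ := by
    funext ξ
    rw [SchwartzMap.smulLeftCLM_apply_apply (schwartzFourier f).hasTemperateGrowth, coe_schwartzFourier,
      smul_eq_mul]
  rwa [e] at h

end ShellRegularity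

/-! ### Interchange of limits -/

section Limits

/-- `E k` converges as δ → 0 for each k and approaches `D` uniformly in δ, so `D` converges. Since
`R k` merges with `E k` as δ → 0 and approaches `T` uniformly, the limit of `D` inherits the bound
on `T`. -/
lemma exists_tendsto_of_uniform {E R : ℕ → ℝ → ℂ} {D T : ℝ → ℂ} {N : ℕ → ℝ} {K : ℝ}
    (hN : Tendsto N atTop (𝓝 0))
    (hE : ∀ k δ, 0 < δ → δ ≤ 1 → ‖E k δ - D δ‖ ≤ N k)
    (hR : ∀ k δ, 0 < δ → δ ≤ 1 → ‖R k δ - T δ‖ ≤ N k)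
    (hl : ∀ k, ∃ l, Tendsto (E k) (𝓝[>] 0) (𝓝 l))
    (hER : ∀ k, Tendsto (fun δ => E k δ - R k δ) (𝓝[>] 0) (𝓝 0))
    (hT : ∀ δ, 0 < δ → δ ≤ 1 → ‖T δ‖ ≤ K) :
    ∃ l, Tendsto D (𝓝[>] 0) (𝓝 l) ∧ ‖l‖ ≤ K := by
  have hev : ∀ᶠ δ : ℝ in 𝓝[>] 0, 0 < δ ∧ δ ≤ 1 := by
    filter_upwards [Ioc_mem_nhdsGT (one_pos : (0 : ℝ) < 1)] with δ hδ using hδ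
  choose l hl using hl
  have hlim : ∃ l, Tendsto D (𝓝[>] 0) (𝓝 l) := by
    refine cauchy_map_iff_exists_tendsto.1 ?_
    rw [Metric.cauchy_iff]
    refine ⟨by infer_instance, fun ε hε => ?_⟩
    obtain ⟨k, hk⟩ := (hN.eventually_lt_const (show 0 < ε / 4 by positivity)).exists
    have h2 := (hl k).eventually (Metric.ball_mem_nhds _ (show 0 < ε / 4 by positivity))
    refine ⟨D '' {δ | (0 < δ ∧ δ ≤ 1) ∧ E k δ ∈ Metric.ball (l k) (ε / 4)},
      image_mem_map (hev.and h2), ?_⟩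
    rintro _ ⟨x, ⟨hx, hx2⟩, rfl⟩ _ ⟨y, ⟨hy, hy2⟩, rfl⟩
    have a1 := hE k x hx.1 hx.2
    have a2 := hE k y hy.1 hy.2
    rw [← dist_eq_norm] at a1 a2
    rw [Metric.mem_ball] at hx2 hy2
    have t1 := dist_triangle4 (D x) (E k x) (E k y) (D y)
    have t2 := dist_triangle_right (E k x) (E k y) (l k)
    rw [dist_comm (D x) (E k x)] at t1
    linarith
  obtain ⟨d, hd⟩ := hlim
  refine ⟨d, hd, le_of_forall_pos_le_add fun ε hε => ?_⟩
  obtain ⟨k, hk⟩ := (hN.eventually_lt_const (show 0 < ε / 4 by positivity)).exists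
  have h1 := (hER k).eventually (Metric.ball_mem_nhds _ (show 0 < ε / 4 by positivity))
  have h2 := hd.eventually (Metric.ball_mem_nhds _ (show 0 < ε / 4 by positivity))
  obtain ⟨δ, ⟨hδ, b1⟩, b2⟩ := ((hev.and h1).and h2).exists
  rw [dist_eq_norm] at b2
  rw [dist_zero_right] at b1
  have b3 := hE k δ hδ.1 hδ.2
  have b4 := hR k δ hδ.1 hδ.2
  have b5 := hT δ hδ.1 hδ.2
  have e : d = T δ + (R k δ - T δ) + (E k δ - R k δ) - (E k δ - D δ) - (D δ - d) := by ring
  rw [e]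
  have c1 := norm_sub_le (T δ + (R k δ - T δ) + (E k δ - R k δ) - (E k δ - D δ)) (D δ - d)
  have c2 := norm_sub_le (T δ + (R k δ - T δ) + (E k δ - R k δ)) (E k δ - D δ)
  have c3 := norm_add_le (T δ + (R k δ - T δ)) (E k δ - R k δ)
  have c4 := norm_add_le (T δ) (R k δ - T δ)
  linarith

/-- A bounded functional, extended along an approximating sequence, keeps its modulus of
continuity. -/
lemma WeightedLimit.norm_sub_le_of_bound {b C : ℝ} {f F : Rn n → ℂ} {s : ℕ → 𝓢(Rn n, ℂ)}
    (h : WeightedLimit b C f F s) (hb : 0 ≤ b) (hbn : b ≤ ((n : ℝ) + 1) / 4) {T : (Rn n → ℂ) → ℂ}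
    {t : ℂ} {A : ℝ} (hA : 0 ≤ A)
    (hsub : ∀ u v, Nice u → Nice v → T (fun x => u x - v x) = T u - T v)
    (hT : ∀ u, Nice u → ‖T u‖ ≤ A * (lpNorm u (ENNReal.ofReal (pExp n b)) volume + traceNorm u))
    (ht : Tendsto (fun k => T (s k)) atTop (𝓝 t)) (k : ℕ) :
    ‖T (s k) - t‖ ≤ A * (lpNorm (fun x => s k x - f x) (ENNReal.ofReal (pExp n b)) volume
      + traceNorm (s k)) := by
  have hp1 : 1 ≤ ENNReal.ofReal (pExp n b) := by
    rw [ENNReal.one_le_ofReal]; exact one_le_pExp hb hbn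
  have hsN : ∀ k, Nice (s k : Rn n → ℂ) := fun k => SchwartzMap_nice (s k)
  have h1 : ∀ l, ‖T (s k) - T (s l)‖ ≤ A * ((lpNorm (fun x => s k x - f x) (ENNReal.ofReal (pExp n b)) volume
      + lpNorm (fun x => s l x - f x) (ENNReal.ofReal (pExp n b)) volume)
      + (traceNorm (s k) + traceNorm (s l))) := by
    intro l
    rw [← hsub _ _ (hsN k) (hsN l)]
    refine (hT _ ((hsN k).sub (hsN l))).trans ?_
    have t1 := lpNorm_sub_le (g := fun x => s l x - f x)
      (((s k).memLp (ENNReal.ofReal (pExp n b))).sub h.memLp) hp1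
    have e : ((s k : Rn n → ℂ) - f) - (fun x => s l x - f x) = fun x => s k x - s l x := by
      funext x; simp
    rw [e] at t1
    gcongr
    · exact t1
    · exact (hsN k).traceNorm_sub_le (hsN l)
  have h2 := ((ht.const_sub (T (s k))).norm)
  have h3 := ((h.tendsto_lpNorm.const_add (lpNorm (fun x => s k x - f x)
    (ENNReal.ofReal (pExp n b)) volume)).add (h.tendsto_trace.const_add (traceNorm (s k)))).const_mul A
  simp only [add_zero] at h3
  exact le_of_tendsto_of_tendsto' h2 h3 h1

end Limits

end HelmholtzBR

namespace HelmholtzBR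

variable {n : ℕ}

/-! ### The case 1 < α < 2 -/

section StrongSingularity

/-- The pairing of `(1 - |ξ|²)_+^{-a}`, truncated at `|ξ|² = 1 - δ`. -/
noncomputable def truncPair (a δ : ℝ) (F φ : Rn n → ℂ) : ℂ :=
  ∫ ξ, (dKer a δ (‖ξ‖ ^ 2 - 1) : ℂ) * (F ξ * φ ξ)

/-- The pairing of the regularisation `mReg` of `(1 - |ξ|²)_+^{-a}`. -/
noncomputable def regForm (a δ : ℝ) (F g : Rn n → ℂ) : ℂ :=
  (Complex.exp (Complex.I * (Real.pi * a / 2 : ℝ)) * signForm 1 a δ F g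
    - Complex.exp (-(Complex.I * (Real.pi * a / 2 : ℝ))) * signForm (-1) a δ F g)
      / (2 * Complex.I * (Real.sin (Real.pi * a) : ℝ))

lemma norm_regForm_le (a δ : ℝ) (F g : Rn n → ℂ) {M : ℝ}
    (h : ∀ σ : ℝ, σ = 1 ∨ σ = -1 → ‖signForm σ a δ F g‖ ≤ M) :
    ‖regForm a δ F g‖ ≤ |Real.sin (Real.pi * a)|⁻¹ * M := by
  have h1 := h 1 (Or.inl rfl)
  have h2 := h (-1) (Or.inr rfl)
  have e : |Real.sin (Real.pi * a)|⁻¹ * M = (M + M) / (2 * |Real.sin (Real.pi * a)|) := by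
    rw [← two_mul, mul_div_mul_left _ _ two_ne_zero, inv_mul_eq_div]
  rw [regForm, norm_div, norm_xKer_denominator, e]
  gcongr
  refine (norm_sub_le _ _).trans ?_
  rw [norm_mul, norm_mul, norm_exp_I_mul, norm_exp_neg_I_mul, one_mul, one_mul]
  exact add_le_add h1 h2

section Smooth

variable {a : ℝ} {f : Rn n → ℂ} {g φ : 𝓢(Rn n, ℂ)}

lemma Nice.integrable_fourier_mul_schwartz (hf : Nice f) (φ : 𝓢(Rn n, ℂ)) :
    Integrable fun ξ => fourier f ξ * φ ξ :=
  integrable_mul_of_memLp_two hf.memLp_fourier (φ.memLp 2)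

lemma Nice.integrableOn_shell (hf : Nice f) (hn : 2 ≤ n) (φ : 𝓢(Rn n, ℂ)) :
    IntegrableOn (shell fun ξ => fourier f ξ * φ ξ) (Set.Ioi (-1)) :=
  (integral_eq_integral_shell hn (hf.integrable_fourier_mul_schwartz φ)).1

/-- The symbol depends on ξ through s alone, so the form is a one-dimensional average. This carries
the resolvent bounds into the Hölder and finite part arguments. -/
lemma Nice.symAvg_shell (hf : Nice f) (hn : 2 ≤ n) (hφ : ∀ ξ, fourier g (-ξ) = φ ξ) (ha : 0 ≤ a)
    (σ : ℝ) {w : ℂ} (hw : 0 < w.re) :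
    symAvg a σ w (shell fun ξ => fourier f ξ * φ ξ) = signForm σ a w (fourier f) g := by
  have hi : Integrable fun ξ : Rn n => sym a w (σ * (‖ξ‖ ^ 2 - 1 : ℝ)) * (fourier f ξ * φ ξ) := by
    have := integrable_sym_mul (z := a) (s := fun ξ : Rn n => σ * (‖ξ‖ ^ 2 - 1)) (by simpa using ha) hw
      (by fun_prop) (hf.integrable_fourier_mul_schwartz φ)
    exact this
  have := (integral_radial_mul hn (k := fun s => sym a w (σ * s)) hi).2
  rw [symAvg, ← this, signForm]
  simp only [hφ]

lemma Nice.finPart_shell (hf : Nice f) (hn : 2 ≤ n) (φ : 𝓢(Rn n, ℂ)) (ha : 0 ≤ a) {δ : ℝ}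
    (hδ : 0 < δ) :
    finPart a δ (shell fun ξ => fourier f ξ * φ ξ) = truncPair a δ (fourier f) φ
      - shell (fun ξ => fourier f ξ * φ ξ) 0 * ((δ ^ (1 - a) / (a - 1) : ℝ) : ℂ) := by
  have hi : Integrable fun ξ : Rn n => (dKer a δ (‖ξ‖ ^ 2 - 1) : ℂ) * (fourier f ξ * φ ξ) := by
    refine (hf.integrable_fourier_mul_schwartz φ).bdd_mul (c := δ ^ (-a))
      (Complex.measurable_ofReal.comp ((measurable_dKer a δ).comp (by fun_prop))).aestronglyMeasurable
      (ae_of_all _ fun ξ => ?_)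
    rw [Complex.norm_real]
    exact abs_dKer_le ha hδ _
  have := (integral_radial_mul hn (k := fun s => (dKer a δ s : ℂ)) hi).2
  rw [finPart, ← this, truncPair]

lemma Nice.integral_mReg_shell (hf : Nice f) (hn : 2 ≤ n) (hφ : ∀ ξ, fourier g (-ξ) = φ ξ)
    (ha : 0 ≤ a) {δ : ℝ} (hδ : 0 < δ) :
    ∫ s in Set.Ioi (-1), mReg a δ s * shell (fun ξ => fourier f ξ * φ ξ) s
      = regForm a δ (fourier f) g := by
  have hδ' : 0 < (δ : ℂ).re := by simpa using hδ
  rw [integral_mReg_mul ha hδ (hf.integrableOn_shell hn φ), hf.symAvg_shell hn hφ ha 1 hδ',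
    hf.symAvg_shell hn hφ ha (-1) hδ', regForm]

lemma finPart_shell_sub {u v : Rn n → ℂ} (hu : Nice u) (hv : Nice v) (hn : 2 ≤ n)
    (φ : 𝓢(Rn n, ℂ)) (ha : 0 ≤ a) {δ : ℝ} (hδ : 0 < δ) :
    finPart a δ (shell fun ξ => fourier (fun x => u x - v x) ξ * φ ξ)
      = finPart a δ (shell fun ξ => fourier u ξ * φ ξ) - finPart a δ (shell fun ξ => fourier v ξ * φ ξ) := by
  have e : ∀ s ∈ Set.Ioi (-1 : ℝ), shell (fun ξ => fourier (fun x => u x - v x) ξ * φ ξ) s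
      = shell (fun ξ => fourier u ξ * φ ξ) s - shell (fun ξ => fourier v ξ * φ ξ) s := by
    intro s _
    have hc : ∀ w : Rn n → ℂ, Nice w → Integrable (fun ω : Metric.sphere (0 : Rn n) 1 =>
        fourier w (√(1 + s) • (ω : Rn n)) * φ (√(1 + s) • (ω : Rn n))) (sphereMeasure n) := fun w hw =>
      Continuous.integrable_of_hasCompactSupport
        (((continuous_fourier hw.integrable).comp (by fun_prop)).mul (φ.continuous.comp (by fun_prop)))
        (HasCompactSupport.of_compactSpace _)
    simp only [shell, sphInt]
    rw [← mul_sub, ← integral_sub (hc u hu) (hc v hv), fourier_sub hu.integrable hv.integrable]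
    simp only [sub_mul]
  have i1 := integrableOn_dKer_mul ha hδ (hu.integrableOn_shell hn φ)
  have i2 := integrableOn_dKer_mul ha hδ (hv.integrableOn_shell hn φ)
  have e0 := e 0 (by norm_num)
  rw [finPart, finPart, finPart, e0, setIntegral_congr_fun measurableSet_Ioi
    (g := fun s => (dKer a δ s : ℂ) * shell (fun ξ => fourier u ξ * φ ξ) s
      - (dKer a δ s : ℂ) * shell (fun ξ => fourier v ξ * φ ξ) s) (fun s hs => by
        simp only [e s hs, mul_sub]), integral_sub i1 i2]
  ring

lemma signForm_sub {u v : Rn n → ℂ} (hu : Nice u) (hv : Nice v) {g : Rn n → ℂ} (hg : Nice g)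
    {σ : ℝ} {z w : ℂ} (hz : 0 ≤ z.re) (hw : 0 < w.re) :
    signForm σ z w (fourier fun x => u x - v x) g
      = signForm σ z w (fourier u) g - signForm σ z w (fourier v) g := by
  have hi : ∀ u : Rn n → ℂ, Nice u → Integrable fun ξ : Rn n =>
      sym z w (σ * (‖ξ‖ ^ 2 - 1)) * (fourier u ξ * fourier g (-ξ)) := fun u hu => by
    have := integrable_sym_mul (z := z) (s := fun ξ : Rn n => σ * (‖ξ‖ ^ 2 - 1)) hz hw
      (by fun_prop) (hu.integrable_fourier_mul hg)
    simpa using this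
  rw [signForm, signForm, signForm, ← integral_sub (hi u hu) (hi v hv),
    fourier_sub hu.integrable hv.integrable]
  refine integral_congr_ae (ae_of_all _ fun ξ => ?_)
  simp only
  ring

lemma regForm_sub {u v : Rn n → ℂ} (hu : Nice u) (hv : Nice v) {g : Rn n → ℂ} (hg : Nice g)
    (ha : 0 ≤ a) {δ : ℝ} (hδ : 0 < δ) :
    regForm a δ (fourier fun x => u x - v x) g
      = regForm a δ (fourier u) g - regForm a δ (fourier v) g := by
  have hz : 0 ≤ (a : ℂ).re := by simpa using ha
  have hδ' : 0 < (δ : ℂ).re := by simpa using hδ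
  rw [regForm, regForm, regForm, signForm_sub hu hv hg hz hδ', signForm_sub hu hv hg hz hδ']
  ring

/-- Uniform bounds for the finite parts and for the regularised forms. -/
lemma exists_norm_finPart_shell_le (hn : 2 ≤ n) {b C : ℝ} (hb : 0 < b) (hb2 : b ≤ 2)
    (hbn : b ≤ ((n : ℝ) + 1) / 4)
    (ha : 1 < a) (ha2 : a < 2) (hab : a ≤ 2 * b) (hC : 0 ≤ C)
    (hW : ∀ f : Rn n → ℂ, Nice f → lpNorm (fun ξ => (wt b 1 ξ : ℂ) * fourier f ξ) 2 volume
        ≤ C * (lpNorm f (ENNReal.ofReal (pExp n b)) volume + traceNorm f))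
    (hφ : ∀ ξ, fourier g (-ξ) = φ ξ) :
    ∃ A : ℝ, 0 ≤ A ∧ ∀ f : Rn n → ℂ, Nice f → ∀ δ : ℝ, 0 < δ → δ ≤ 1 →
      ‖finPart a δ (shell fun ξ => fourier f ξ * φ ξ)‖
          ≤ A * (lpNorm f (ENNReal.ofReal (pExp n b)) volume + traceNorm f) ∧
      ‖regForm a δ (fourier f) g‖
          ≤ A * (lpNorm f (ENNReal.ofReal (pExp n b)) volume + traceNorm f) := by
  have ha0 : 0 ≤ a := by linarith
  have hg := SchwartzMap_nice g
  obtain ⟨K, hK, h1⟩ := exists_norm_signForm_le (n := n) hb hbn ha0 hab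
  obtain ⟨C₁, hC₁, h2⟩ := exists_norm_finPart_le ha ha2
  set W := lpNorm (fun ξ => ((wt b 1 ξ)⁻¹ : ℂ) * φ ξ) 2 volume
  set G := lpNorm g (ENNReal.ofReal (pExp n b)) volume
  set S := lpNorm (fun ω : Metric.sphere (0 : Rn n) 1 => φ (ω : Rn n)) 2 (sphereMeasure n)
  have hWn : 0 ≤ W := lpNorm_nonneg
  have hGn : 0 ≤ G := lpNorm_nonneg
  have hSn : 0 ≤ S := lpNorm_nonneg
  set B := K * (C * W + G)
  have hB : 0 ≤ B := by positivity
  set s := |Real.sin (Real.pi * a)|⁻¹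
  have hs : 0 ≤ s := by positivity
  -- Two inputs, both linear in ‖f‖_p plus the trace norm: the L¹ norm of f̂φ, from the weighted
  -- bound at ε = 1, and the forms of order a over all of `goodParam`, which the Hölder argument
  -- consumes.
  have key : ∀ f : Rn n → ℂ, Nice f →
      (∫ ξ, ‖fourier f ξ * φ ξ‖) ≤ C * W * (lpNorm f (ENNReal.ofReal (pExp n b)) volume + traceNorm f) ∧
      ∀ σ : ℝ, σ = 1 ∨ σ = -1 → ∀ w, goodParam w → ‖signForm σ a w (fourier f) g‖
        ≤ B * (lpNorm f (ENNReal.ofReal (pExp n b)) volume + traceNorm f) := by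
    intro f hf
    set N := lpNorm f (ENNReal.ofReal (pExp n b)) volume + traceNorm f
    have hI : (∫ ξ, ‖fourier f ξ * φ ξ‖) ≤ C * W * N := by
      have h3 := integral_norm_mul_le_lpNorm (hf.memLp_wt_fourier hb.le one_pos) (memLp_wt_inv_mul hb2 φ)
      have e : ∀ ξ, (wt b 1 ξ : ℂ) * fourier f ξ * (((wt b 1 ξ)⁻¹ : ℂ) * φ ξ) = fourier f ξ * φ ξ := by
        intro ξ
        have := wt_ofReal_ne_zero b ξ
        field_simp
      simp only [e] at h3
      refine h3.trans ((mul_le_mul_of_nonneg_right (hW f hf) hWn).trans (le_of_eq ?_))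
      ring
    refine ⟨hI, fun σ hσ w hw => (h1 σ hσ w hw f g hf hg).trans ?_⟩
    simp only [hφ]
    have hl : lpNorm f (ENNReal.ofReal (pExp n b)) volume ≤ N := le_add_of_nonneg_right (traceNorm_nonneg f)
    calc _ ≤ K * (C * W * N + N * G) := by gcongr
      _ = B * N := by ring
  refine ⟨C₁ * (B + C * W + S) + s * B, by positivity, fun f hf δ hδ hδ1 => ?_⟩
  obtain ⟨k1, k2⟩ := key f hf
  have ht := traceNorm_nonneg f
  have hl : 0 ≤ lpNorm f (ENNReal.ofReal (pExp n b)) volume := lpNorm_nonneg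
  set N := lpNorm f (ENNReal.ofReal (pExp n b)) volume + traceNorm f
  have hN : 0 ≤ N := add_nonneg hl ht
  constructor
  · have hcont : Continuous fun ξ => fourier f ξ * φ ξ :=
      (continuous_fourier hf.integrable).mul φ.continuous
    refine (h2 _ (B * N) (by positivity) (hf.integrableOn_shell hn φ) (continuousOn_shell hcont)
      (fun σ hσ w hw => ?_) δ hδ hδ1).trans ?_
    · rw [hf.symAvg_shell hn hφ ha0 σ hw.1]
      exact k2 σ hσ w hw
    · have j1 := (integral_norm_shell_le hn (hf.integrable_fourier_mul_schwartz φ)).trans k1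
      have j2 : ‖shell (fun ξ => fourier f ξ * φ ξ) 0‖ ≤ N * S :=
        (norm_shell_zero_le hf φ).trans (mul_le_mul_of_nonneg_right (le_add_of_nonneg_left hl) hSn)
      calc _ ≤ C₁ * (B * N + C * W * N + N * S) := by gcongr
        _ ≤ C₁ * (B * N + C * W * N + N * S) + s * B * N := le_add_of_nonneg_right (by positivity)
        _ = _ := by ring
  · refine (norm_regForm_le a δ _ g fun σ hσ => k2 σ hσ δ (goodParam_ofReal hδ)).trans ?_
    calc s * (B * N) ≤ C₁ * (B + C * W + S) * N + s * (B * N) := le_add_of_nonneg_left (by positivity)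
      _ = _ := by ring

end Smooth

/-- |ξ| < ρ amounts to |ξ|² - 1 < -(1-ρ²), so truncating to the ball is cutting the kernel at δ = 1
- ρ². -/
lemma setIntegral_ball_brSymbol (a : ℝ) (F φ : Rn n → ℂ) {ρ : ℝ} (hρ : 0 < ρ) (hρ1 : ρ < 1) :
    ∫ ξ in Metric.ball (0 : Rn n) ρ, (brSymbol (-a) ξ : ℂ) * F ξ * φ ξ
      = truncPair a (1 - ρ ^ 2) F φ := by
  rw [← integral_indicator measurableSet_ball, truncPair]
  refine integral_congr_ae (ae_of_all _ fun ξ => ?_)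
  have h0 := norm_nonneg ξ
  by_cases h : ‖ξ‖ < ρ
  · have h1 : ‖ξ‖ ^ 2 - 1 < -(1 - ρ ^ 2) := by nlinarith
    simp only
    rw [Set.indicator_of_mem (by simpa using h), dKer, if_pos h1, brSymbol, if_pos (h.trans hρ1), neg_sub,
      mul_assoc]
  · have h1 : ¬ ‖ξ‖ ^ 2 - 1 < -(1 - ρ ^ 2) := by nlinarith [not_lt.1 h]
    simp only
    rw [Set.indicator_of_notMem (by simpa using h), dKer, if_neg h1]
    simp

/-- The Bochner-Riesz pairing for a strong singularity, through finite parts. -/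
theorem exists_bochnerRiesz_bound_of_one_lt (hn : 2 ≤ n) {α b C : ℝ} (hb : 0 < b) (hb2 : b ≤ 2)
    (hbα : b ≤ α) (hα2 : α ≤ 2 * b) (hα : 1 < α) (hα' : α < 2) (hbn : b ≤ ((n : ℝ) + 1) / 4)
    (hC : 0 < C)
    (hW : ∀ f : Rn n → ℂ, Nice f → lpNorm (fun ξ => (wt b 1 ξ : ℂ) * fourier f ξ) 2 volume
        ≤ C * (lpNorm f (ENNReal.ofReal (pExp n b)) volume + traceNorm f)) :
    ∃ K : ℝ, 0 < K ∧ ∀ (f F : Rn n → ℂ) (s : ℕ → 𝓢(Rn n, ℂ)), WeightedLimit b C f F s →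
      ∀ g φ : 𝓢(Rn n, ℂ), (∀ ξ, fourier g (-ξ) = φ ξ) → ∃ l : ℂ,
        Tendsto (fun ρ : ℝ => ∫ ξ in Metric.ball (0 : Rn n) ρ, (brSymbol (-α) ξ : ℂ) * F ξ * φ ξ)
          (𝓝[<] 1) (𝓝 l) ∧
        ‖l‖ ≤ K * lpNorm f (ENNReal.ofReal (pExp n b)) volume
          * lpNorm g (ENNReal.ofReal (pExp n (α - b))) volume := by
  have hα0 : 0 ≤ α := by linarith
  obtain ⟨K, hK, hKb⟩ := exists_norm_signForm_limit_le (n := n) hb hbn hbα hα2 hC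
  have hs := abs_pos.2 (sin_pi_mul_ne_zero hα hα')
  refine ⟨|Real.sin (Real.pi * α)|⁻¹ * K, by positivity, fun f F s h g φ hφ => ?_⟩
  have hg := SchwartzMap_nice g
  have hsN : ∀ k, Nice (s k : Rn n → ℂ) := fun k => SchwartzMap_nice (s k)
  obtain ⟨A, hA, hAb⟩ := exists_norm_finPart_shell_le hn hb hb2 hbn hα hα' hα2 hC.le hW hφ
  have hN := (h.tendsto_lpNorm.add h.tendsto_trace).const_mul A
  rw [add_zero, mul_zero] at hN
  -- The subtracted term carries the density at s = 0, which vanishing traces force to 0. For F the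
  -- finite part is thus the plain truncated pairing.
  have hlimD : ∀ δ : ℝ, 0 < δ → Tendsto (fun k => finPart α δ (shell fun ξ => fourier (s k) ξ * φ ξ)) atTop
      (𝓝 (truncPair α δ F φ)) := by
    intro δ hδ
    have hψ : MemLp (fun ξ => ((wt b 1 ξ)⁻¹ : ℂ) * ((dKer α δ (‖ξ‖ ^ 2 - 1) : ℂ) * φ ξ)) 2 volume := by
      refine (memLp_wt_inv_mul hb2 φ).of_le_mul (c := δ ^ (-α)) ?_ (ae_of_all _ fun ξ => ?_)
      · exact (continuous_wt_inv b).aestronglyMeasurable.mul ((Complex.measurable_ofReal.comp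
          ((measurable_dKer α δ).comp (by fun_prop))).aestronglyMeasurable.mul
            φ.continuous.aestronglyMeasurable)
      · rw [mul_left_comm, norm_mul, Complex.norm_real]
        gcongr
        exact abs_dKer_le hα0 hδ _
    have t1 := (h.tendsto_integral hb.le hψ).2.2.2
    have e : ∀ G : Rn n → ℂ, ∫ ξ, G ξ * ((dKer α δ (‖ξ‖ ^ 2 - 1) : ℂ) * φ ξ) = truncPair α δ G φ := fun G =>
      integral_congr_ae (ae_of_all _ fun ξ => by simp only; ring)
    simp only [e] at t1
    have t2 : Tendsto (fun k => shell (fun ξ => fourier (s k) ξ * φ ξ) 0) atTop (𝓝 0) := by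
      have := h.tendsto_trace.mul_const
        (lpNorm (fun ω : Metric.sphere (0 : Rn n) 1 => φ (ω : Rn n)) 2 (sphereMeasure n))
      rw [zero_mul] at this
      exact squeeze_zero_norm (fun k => norm_shell_zero_le (hsN k) φ) this
    have t3 := t1.sub (t2.mul_const ((δ ^ (1 - α) / (α - 1) : ℝ) : ℂ))
    rw [zero_mul, sub_zero] at t3
    refine t3.congr fun k => ?_
    rw [(hsN k).finPart_shell hn φ hα0 hδ]
  -- `E` and `R` are the finite parts and regularised forms of the approximants, `D` and `T` the
  -- truncated pairing and regularised form of F. The uniform closeness may depend on g in any way;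
  -- the final constant comes from `T` alone.
  obtain ⟨l, hl, hlb⟩ := exists_tendsto_of_uniform
    (E := fun k δ => finPart α δ (shell fun ξ => fourier (s k) ξ * φ ξ))
    (R := fun k δ => regForm α δ (fourier (s k)) g) (D := fun δ => truncPair α δ F φ)
    (T := fun δ => regForm α δ F g)
    (K := |Real.sin (Real.pi * α)|⁻¹ * (K * lpNorm f (ENNReal.ofReal (pExp n b)) volume
      * lpNorm g (ENNReal.ofReal (pExp n (α - b))) volume)) hN
    (fun k δ hδ hδ1 => h.norm_sub_le_of_bound hb.le hbn
      (T := fun u => finPart α δ (shell fun ξ => fourier u ξ * φ ξ)) hA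
      (fun u v hu hv => finPart_shell_sub hu hv hn φ hα0 hδ) (fun u hu => (hAb u hu δ hδ hδ1).1)
      (hlimD δ hδ) k)
    (fun k δ hδ hδ1 => h.norm_sub_le_of_bound hb.le hbn
      (T := fun u => regForm α δ (fourier u) g) hA
      (fun u v hu hv => regForm_sub hu hv hg hα0 hδ) (fun u hu => (hAb u hu δ hδ hδ1).2)
      ((((h.tendsto_signForm hb.le hδ hδ1 (Or.inl rfl) hg (by simpa using hbα)).const_mul _).sub
        ((h.tendsto_signForm hb.le hδ hδ1 (Or.inr rfl) hg (by simpa using hbα)).const_mul _)).div_const _) k)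
    (fun k => by
      obtain ⟨L, hL0, hL⟩ := exists_norm_shell_mul_sub_le (s k) φ
      exact exists_tendsto_finPart hα hα' ((hsN k).integrableOn_shell hn φ) hL0 hL)
    (fun k => by
      obtain ⟨L, hL0, hL⟩ := exists_norm_shell_mul_sub_le (s k) φ
      refine (tendsto_finPart_sub hα hα' ((hsN k).integrableOn_shell hn φ) hL0 hL).congr' ?_
      filter_upwards [self_mem_nhdsWithin] with δ hδ
      rw [(hsN k).integral_mReg_shell hn hφ hα0 hδ])
    (fun δ hδ hδ1 => norm_regForm_le α δ F g fun σ hσ => hKb f F s h g hg σ hσ δ hδ hδ1)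
  refine ⟨l, ?_, hlb.trans (le_of_eq (by ring))⟩
  have hρ : Tendsto (fun ρ : ℝ => 1 - ρ ^ 2) (𝓝[<] 1) (𝓝[>] 0) := by
    refine tendsto_nhdsWithin_iff.2 ⟨?_, ?_⟩
    · have : ContinuousAt (fun ρ : ℝ => 1 - ρ ^ 2) 1 := by fun_prop
      have h2 := this.tendsto
      norm_num at h2
      exact h2.mono_left nhdsWithin_le_nhds
    · filter_upwards [Ioo_mem_nhdsLT (zero_lt_one (α := ℝ))] with ρ hρ
      have := hρ.1
      have := hρ.2
      simp only [Set.mem_Ioi]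
      nlinarith
  refine (hl.comp hρ).congr' ?_
  filter_upwards [Ioo_mem_nhdsLT (zero_lt_one (α := ℝ))] with ρ hρ
  exact (setIntegral_ball_brSymbol α F φ hρ.1 hρ.2).symm

end StrongSingularity

end HelmholtzBR

namespace HelmholtzBR

variable {n : ℕ}

/-! ### From bounds on pairings to the Bochner–Riesz operator -/

section Conclusion

lemma exists_schwartz_eq_fourier_neg (ψ : 𝓢(Rn n, ℂ)) :
    ∃ φ : 𝓢(Rn n, ℂ), ∀ ξ, fourier ψ (-ξ) = φ ξ :=
  ⟨SchwartzMap.compCLMOfContinuousLinearEquiv ℂ (ContinuousLinearEquiv.neg ℝ) (schwartzFourier ψ),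
    fun ξ => by rw [← schwartzFourier_apply]; simp⟩

lemma integrable_truncated {a δ : ℝ} (ha : 0 ≤ a) (hδ : 0 < δ) {F φ : Rn n → ℂ}
    (h : Integrable fun ξ => F ξ * φ ξ) :
    Integrable fun ξ : Rn n => (dKer a δ (‖ξ‖ ^ 2 - 1) : ℂ) * (F ξ * φ ξ) := by
  refine h.bdd_mul (c := δ ^ (-a)) (Complex.measurable_ofReal.comp
    ((measurable_dKer a δ).comp (by fun_prop))).aestronglyMeasurable (ae_of_all _ fun ξ => ?_)
  rw [Complex.norm_real]
  exact abs_dKer_le ha hδ _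

/-- A bound for the Bochner-Riesz pairings yields the Bochner-Riesz mean. -/
lemma exists_isBochnerRiesz_of_bound (hn : 2 ≤ n) {a r K : ℝ} {q : ℝ≥0∞} (ha : 0 ≤ a) (hr1 : 1 ≤ r)
    (hr2 : r ≤ 2) (hq : (ENNReal.ofReal r).HolderConjugate q) (hK : 0 ≤ K) {f F : Rn n → ℂ}
    (hF : IsFourierTransform f F)
    (h : ∀ g φ : 𝓢(Rn n, ℂ), (∀ ξ, fourier g (-ξ) = φ ξ) → ∃ l : ℂ,
      Tendsto (fun ρ : ℝ => ∫ ξ in Metric.ball (0 : Rn n) ρ, (brSymbol (-a) ξ : ℂ) * F ξ * φ ξ)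
        (𝓝[<] 1) (𝓝 l) ∧ ‖l‖ ≤ K * lpNorm g (ENNReal.ofReal r) volume) :
    ∃ u : Rn n → ℂ, MemLp u q volume ∧ IsBochnerRiesz (-a) f u ∧
      eLpNorm u q volume ≤ ENNReal.ofReal (((2 * Real.pi) ^ n)⁻¹ * K) := by
  choose Φ hΦ using exists_schwartz_eq_fourier_neg (n := n)
  choose l hl hlK using fun ψ => h ψ (Φ ψ) (hΦ ψ)
  have hev : ∀ᶠ ρ : ℝ in 𝓝[<] 1, 0 < ρ ∧ ρ < 1 := Ioo_mem_nhdsLT zero_lt_one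
  have hint : ∀ ψ {ρ : ℝ}, 0 < ρ → ρ < 1 →
      Integrable fun ξ : Rn n => (dKer a (1 - ρ ^ 2) (‖ξ‖ ^ 2 - 1) : ℂ) * (F ξ * Φ ψ ξ) :=
    fun ψ ρ h0 h1 => integrable_truncated ha (by nlinarith) (hF.2 (Φ ψ)).1
  have hadd : ∀ ψ₁ ψ₂, l (ψ₁ + ψ₂) = l ψ₁ + l ψ₂ := by
    intro ψ₁ ψ₂
    refine tendsto_nhds_unique (hl (ψ₁ + ψ₂)) (((hl ψ₁).add (hl ψ₂)).congr' ?_)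
    filter_upwards [hev] with ρ hρ
    rw [setIntegral_ball_brSymbol _ _ _ hρ.1 hρ.2, setIntegral_ball_brSymbol _ _ _ hρ.1 hρ.2,
      setIntegral_ball_brSymbol _ _ _ hρ.1 hρ.2, truncPair, truncPair, truncPair,
      ← integral_add (hint ψ₁ hρ.1 hρ.2) (hint ψ₂ hρ.1 hρ.2)]
    refine integral_congr_ae (ae_of_all _ fun ξ => ?_)
    have e : Φ (ψ₁ + ψ₂) ξ = Φ ψ₁ ξ + Φ ψ₂ ξ := by
      rw [← hΦ, ← hΦ, ← hΦ, ← congrFun (fourier_add ψ₁.integrable ψ₂.integrable) (-ξ)]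
      rfl
    simp only [e]
    ring
  have hsmul : ∀ (c : ℂ) ψ, l (c • ψ) = c • l ψ := by
    intro c ψ
    refine tendsto_nhds_unique (hl (c • ψ)) (((hl ψ).const_smul c).congr fun ρ => ?_)
    rw [smul_eq_mul, ← integral_const_mul]
    refine integral_congr_ae (ae_of_all _ fun ξ => ?_)
    have e : Φ (c • ψ) ξ = c * Φ ψ ξ := by
      rw [← hΦ, ← hΦ, ← congrFun (fourier_const_mul c ψ) (-ξ)]
      rfl
    simp only [e]
    ring
  obtain ⟨u, hu, hub, hul⟩ := exists_eq_integral_of_bound hn hr1 hr2 hq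
    { toFun := l, map_add' := hadd, map_smul' := hsmul } hK hlK
  have hπ : (0 : ℝ) < (2 * Real.pi) ^ n := by positivity
  refine ⟨fun x => ((((2 * Real.pi) ^ n)⁻¹ : ℝ) : ℂ) • u x, hu.const_smul ((((2 * Real.pi) ^ n)⁻¹ : ℝ) : ℂ), ⟨F, hF, fun φ => ?_⟩, ?_⟩
  -- The test function φ is reached from its own transform, since transforming twice and reflecting
  -- multiplies by (2π)^n; this is the source of the factor (2π)^{-n}.
  · have h1 := (hl (schwartzFourier φ)).const_mul ((((2 * Real.pi) ^ n)⁻¹ : ℝ) : ℂ)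
    have h2 : l (schwartzFourier φ) = ∫ x, u x * fourier φ x := by
      rw [← coe_schwartzFourier]; exact hul (schwartzFourier φ)
    rw [h2, ← integral_const_mul] at h1
    simp only [smul_eq_mul, mul_assoc]
    refine h1.congr fun ρ => ?_
    rw [← integral_const_mul]
    refine integral_congr_ae (ae_of_all _ fun ξ => ?_)
    simp only
    rw [← hΦ, coe_schwartzFourier, fourier_fourier_neg]
    have : (((2 * Real.pi) ^ n : ℝ) : ℂ) ≠ 0 := Complex.ofReal_ne_zero.2 hπ.ne'
    rw [Complex.ofReal_inv]
    field_simp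
  · have e : (fun x => ((((2 * Real.pi) ^ n)⁻¹ : ℝ) : ℂ) • u x) = ((((2 * Real.pi) ^ n)⁻¹ : ℝ) : ℂ) • u := rfl
    rw [e, eLpNorm_const_smul, ENNReal.ofReal_mul (by positivity)]
    gcongr
    rw [← ofReal_norm, Complex.norm_real, Real.norm_of_nonneg (by positivity)]

/-- The reciprocals add up to ((n+1+4γ) + (n+1-4γ))/(2n+2) = 1. At γ = (n+1)/4 the first exponent is
1, and division by 0 in `ℝ≥0∞` yields its conjugate ∞. -/
lemma holderConjugate_pExp {γ : ℝ} (hγ : 0 ≤ γ) (hγn : γ ≤ ((n : ℝ) + 1) / 4) :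
    (ENNReal.ofReal (pExp n γ)).HolderConjugate
      (ENNReal.ofReal (2 * (n : ℝ) + 2) / ENNReal.ofReal ((n : ℝ) + 1 - 4 * γ)) := by
  have h1 : (0 : ℝ) < 2 * (n : ℝ) + 2 := by positivity
  have h2 : (0 : ℝ) < (n : ℝ) + 1 + 4 * γ := by positivity
  rw [ENNReal.holderConjugate_iff, pExp, ENNReal.ofReal_div_of_pos h2,
    ENNReal.inv_div (Or.inl ENNReal.ofReal_ne_top) (Or.inl (by simpa using h2)),
    ENNReal.inv_div (Or.inr ENNReal.ofReal_ne_top) (Or.inr (by simpa using h1)),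
    ← ENNReal.ofReal_div_of_pos h1, ← ENNReal.ofReal_div_of_pos h1,
    ← ENNReal.ofReal_add (by positivity) (div_nonneg (by linarith) h1.le), ← add_div]
  have e : (n : ℝ) + 1 + 4 * γ + ((n : ℝ) + 1 - 4 * γ) = 2 * (n : ℝ) + 2 := by ring
  rw [e, div_self h1.ne', ENNReal.ofReal_one]

lemma tendsto_lpNorm_zero {X : Type*} [MeasurableSpace X] {μ : Measure X} {p : ℝ≥0∞} {f : ℕ → X → ℂ}
    (hf : ∀ k, AEStronglyMeasurable (f k) μ) (h : Tendsto (fun k => eLpNorm (f k) p μ) atTop (𝓝 0)) :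
    Tendsto (fun k => lpNorm (f k) p μ) atTop (𝓝 0) := by
  have := (ENNReal.tendsto_toReal ENNReal.zero_ne_top).comp h
  rw [ENNReal.toReal_zero] at this
  exact this.congr fun k => toReal_eLpNorm (hf k)

theorem exists_bochnerRiesz_bound (hn : 2 ≤ n) {α β : ℝ} (hβ_lower : 1 / 2 < β) (hβ_upper : β < 3 / 2)
    (hβn : β ≤ ((n : ℝ) + 1) / 4) (hβα : β ≤ α) (hα2β : α ≤ 2 * β) (hα : α < 2) :
    ∃ C : ℝ, 0 < C ∧ ∀ f : Rn n → ℂ, MemLp f (ENNReal.ofReal (pExp n β)) volume →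
      HasFourierSphereTrace (ENNReal.ofReal (pExp n β)) f 0 → ∃ u : Rn n → ℂ,
        MemLp u (ENNReal.ofReal (2 * (n : ℝ) + 2) / ENNReal.ofReal ((n : ℝ) + 1 - 4 * (α - β))) volume ∧
        IsBochnerRiesz (-α) f u ∧
        eLpNorm u (ENNReal.ofReal (2 * (n : ℝ) + 2) / ENNReal.ofReal ((n : ℝ) + 1 - 4 * (α - β))) volume
          ≤ ENNReal.ofReal C * eLpNorm f (ENNReal.ofReal (pExp n β)) volume := by
  obtain ⟨C, hC, hW, hlim⟩ := exists_weightedLimit hn hβ_lower hβ_upper hβn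
  have hK : ∃ K : ℝ, 0 < K ∧ ∀ (f F : Rn n → ℂ) (s : ℕ → 𝓢(Rn n, ℂ)), WeightedLimit β C f F s →
      ∀ g φ : 𝓢(Rn n, ℂ), (∀ ξ, fourier g (-ξ) = φ ξ) → ∃ l : ℂ,
        Tendsto (fun ρ : ℝ => ∫ ξ in Metric.ball (0 : Rn n) ρ, (brSymbol (-α) ξ : ℂ) * F ξ * φ ξ)
          (𝓝[<] 1) (𝓝 l) ∧
        ‖l‖ ≤ K * lpNorm f (ENNReal.ofReal (pExp n β)) volume
          * lpNorm g (ENNReal.ofReal (pExp n (α - β))) volume := by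
    -- For α ≤ 1 the pairing converges absolutely. For α > 1 the order α - β may reach 1/2, where
    -- the dual weight is no longer controlled, and finite parts take over.
    rcases le_or_gt α 1 with h1 | h1
    · exact exists_bochnerRiesz_bound_of_le_one hβ_lower hβα hα2β h1 hβn hC
    · exact exists_bochnerRiesz_bound_of_one_lt hn (by linarith) (by linarith) hβα hα2β h1 hα hβn hC hW
  obtain ⟨K, hK, hb⟩ := hK
  refine ⟨((2 * Real.pi) ^ n)⁻¹ * K, by positivity, fun f hf ⟨s, hs, ht⟩ => ?_⟩
  have hsf := tendsto_lpNorm_zero (fun k => (s k).continuous.aestronglyMeasurable.sub hf.1) hs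
  have htr : Tendsto (fun k => traceNorm (s k)) atTop (𝓝 0) := by
    simp only [Pi.zero_apply, sub_zero] at ht
    exact tendsto_lpNorm_zero (fun k => (SchwartzMap_nice (s k)).memLp_trace.1) ht
  obtain ⟨F, hF⟩ := hlim f s hf hsf htr
  have hN : 0 ≤ lpNorm f (ENNReal.ofReal (pExp n β)) volume := lpNorm_nonneg
  obtain ⟨u, hu, hBR, hun⟩ := exists_isBochnerRiesz_of_bound hn (a := α) (by linarith)
    (one_le_pExp (n := n) (b := α - β) (by linarith) (by linarith)) (pExp_le_two (by linarith))
    (holderConjugate_pExp (by linarith) (by linarith)) (mul_nonneg hK.le hN)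
    (hF.isFourierTransform (by linarith) (by linarith) hβn) (hb f F s hF)
  refine ⟨u, hu, hBR, hun.trans (le_of_eq ?_)⟩
  rw [← mul_assoc, ENNReal.ofReal_mul (by positivity), ofReal_lpNorm hf]

end Conclusion

end HelmholtzBR

theorem mainTheorem4 (n : ℕ) (hn : 2 ≤ n) (α β : ℝ)
    (hβ_lower : 1 / 2 < β) (hβ_upper : β < 3 / 2) (hβn : β ≤ ((n : ℝ) + 1) / 4)
    (hβα : β ≤ α) (hα2β : α ≤ 2 * β) (hα : α < 2)
    (p q : ℝ≥0∞)
    (hp : p = ENNReal.ofReal (2 * (n : ℝ) + 2) / ENNReal.ofReal ((n : ℝ) + 1 + 4 * β))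
    -- the quotient is `∞` when its denominator vanishes
    (hq : q = ENNReal.ofReal (2 * (n : ℝ) + 2) / ENNReal.ofReal ((n : ℝ) + 1 - 4 * (α - β))) :
    ∃ C : ℝ, 0 < C ∧
      ∀ f : EuclideanSpace ℝ (Fin n) → ℂ, MemLp f p volume →
        HelmholtzBR.HasFourierSphereTrace p f 0 →
          ∃ u : EuclideanSpace ℝ (Fin n) → ℂ,
            MemLp u q volume ∧ HelmholtzBR.IsBochnerRiesz (-α) f u ∧
              eLpNorm u q volume ≤ ENNReal.ofReal C * eLpNorm f p volume := by
  have hp' : p = ENNReal.ofReal (HelmholtzBR.pExp n β) := by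
    rw [hp, HelmholtzBR.pExp, ENNReal.ofReal_div_of_pos (by positivity)]
  rw [hp', hq]
  exact HelmholtzBR.exists_bochnerRiesz_bound hn hβ_lower hβ_upper hβn hβα hα2β hα
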